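/- Conventions. Let $\mathbb C\mathfrak t^{\mathbb R}$ be the set of formal elements $c\,\mathfrak t^x$ ($c\in\mathbb C$, $x\in\mathbb R$), with $c_1\mathfrak t^x\cdot c_2\mathfrak t^y=c_1c_2\mathfrak t^{x+y}$ and with $c_1\mathfrak t^x+c_2\mathfrak t^y$ equal to the term with the smaller exponent, or to $(c_1+c_2)\mathfrak t^x$ if $x=y$; $\mathbb C^*\mathfrak t^{\mathbb R}$ is its group of elements with $c\neq0$. For $x\ge 0$ put $\lceil c\,\mathfrak t^x\rceil=c$ if $x=0$ and $0$ if $x>0$. An *abstract exploded space* is a topological space with a sheaf $\mathcal E^\times$ of abelian groups of $\mathbb C^*\mathfrak t^{\mathbb R}$-valued functions (under pointwise multiplication) containing the constants; a *morphism* (or *map*) is a continuous map pulling sections of $\mathcal E^\times$ back to sections of $\mathcal E^\times$. An *integral affine polytope* $P\subset\mathbb R^m$ is a set with nonempty interior defined by finitely many inequalities $a+x\cdot\alpha\ge0$ or $a+x\cdot\alpha>0$ with $a\in\mathbb R$, $\alpha\in\mathbb Z^m$. The space $\mathbb R^n\times\mathbf T^m_P$ consists of the $(x,\tilde z)$ with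 $x\in\mathbb R^n$ and $\tilde z=(c_1\mathfrak t^{x_1},\dots,c_m\mathfrak t^{x_m})\in(\mathbb C^*\mathfrak t^{\mathbb R})^m$ such that $(x_1,\dots,x_m)\in P$. Its smooth monomials are the functions $\zeta=\lceil \mathfrak t^a\tilde z^\alpha\rceil$ with $a\in\mathbb R$, $\alpha\in\mathbb Z^m$ and $a+y\cdot\alpha\ge0$ for all $y\in P$; it has the coarsest topology making $x$ and all smooth monomials continuous, and its sections of $\mathcal E^\times$ are locally the functions $h(x,\zeta_1,\dots,\zeta_N)\,\mathfrak t^a\tilde z^\alpha$ with $h$ a smooth $\mathbb C^*$-valued function, $\zeta_i$ smooth monomials, $a\in\mathbb R$ and $\alpha\in\mathbb Z^m$. A (smooth) *exploded manifold* is an abstract exploded space locally isomorphic to such spaces. Its *smooth part* $\lceil\mathbf B\rceil$ is the quotient of $\mathbf B$ identifying topologically indistinguishable points. A *tangent vector* at $p\in\mathbf B$ is a pair of maps, from germs at $p$ of smooth functions (morphisms to $\mathbb R$, where $\mathcal E^\times$ on $\mathbb R$ consists of the functions locally of the form $h\,\mathfrak t^a$ with $h$ smooth and $\mathbb C^*$-valued)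 to $\mathbb R$, and from germs at $p$ of finite sums of sections of $\mathcal E^\times$ to $\mathbb C\mathfrak t^{\mathbb R}$, both written $v$, satisfying $v(f+g)=v(f)+v(g)$, $v(fg)=v(f)g(p)+f(p)v(g)$, $v(c\,\mathfrak t^yf)=c\,\mathfrak t^y v(f)$ and $v(\iota f)=\iota v(f)$, where $\iota(c)=c\,\mathfrak t^0$. The set of these is $T_p\mathbf B$, and $df:T_p\mathbf B\to T_{f(p)}\mathbf C$ is $df(v)(g)=v(g\circ f)$. Two maps $f:\mathbf A\to\mathbf B$ and $g:\mathbf C\to\mathbf B$ are *transverse* if $df(T_a\mathbf A)+dg(T_c\mathbf C)=T_{f(a)}\mathbf B$ whenever $f(a)=g(c)$. Fiber products are those of the category of smooth exploded manifolds, defined by the usual universal property. A *refinement* of an exploded manifold $\mathbf B$ is an exploded manifold $\mathbf B'$ with a map $f:\mathbf B'\to\mathbf B$ such that (1) $f$ is proper, i.e. the induced map $\lceil\mathbf B'\rceil\to\lceil\mathbf B\rceil$ is proper; (2) $f$ is a bijection on points; (3) $df:T_p\mathbf B'\to T_{f(p)}\mathbf B$ is surjective for every $p\in\mathbf B'$.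 **Lemma.** Let $f:\mathbf B'\to\mathbf B$ be a refinement of an exploded manifold $\mathbf B$, and let $g:\mathbf C\to\mathbf B$ be any map of exploded manifolds. Then $f$ and $g$ are transverse, the fiber product $\mathbf C'=\mathbf B'\times_{\mathbf B}\mathbf C$ exists as an exploded manifold, and its projection $\mathbf C'\to\mathbf C$ is a refinement of $\mathbf C$. (Moreover, if Hausdorffness of smooth parts is made part of the definition of an exploded manifold, the result remains true: $\lceil\mathbf C'\rceil$ is Hausdorff if $\lceil\mathbf B'\rceil$ and $\lceil\mathbf C\rceil$ are.) -/

import Mathlib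

open Filter Topology TopologicalSpace
open scoped ContDiff

universe u u₁ u₂ u₃

noncomputable section

namespace Exploded

/-! ### The exploded semiring and the group `ℂ^* 𝔱^ℝ` -/

/-- Elements `c 𝔱^x` of the exploded semiring `ℂ𝔱^ℝ`, with `c` complex and `x` real. -/
@[ext] structure ExplodedC : Type where
  coeff : ℂ
  order : ℝ

namespace ExplodedC

/-- `c₁ 𝔱^x · c₂ 𝔱^y = c₁ c₂ 𝔱^(x+y)`. -/
instance : Mul ExplodedC := ⟨fun a b => ⟨a.coeff * b.coeff, a.order + b.order⟩⟩

/-- `c₁ 𝔱^x + c₂ 𝔱^y` keeps the term with the smaller exponent and adds the coefficients when the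
exponents agree. -/
instance : Add ExplodedC :=
  ⟨fun a b => if a.order < b.order then a else if b.order < a.order then b
    else ⟨a.coeff + b.coeff, a.order⟩⟩

/-- The inclusion `ι : ℝ → ℂ𝔱^ℝ`, `ι c = c 𝔱^0`. -/
def ofReal (r : ℝ) : ExplodedC := ⟨(r : ℂ), 0⟩

end ExplodedC

/-- The multiplicative group `ℂ^* 𝔱^ℝ`, with elements `c 𝔱^x` written as pairs `(c, x)`. -/
abbrev CStarT : Type := ℂˣ × Multiplicative ℝ

namespace CStarT

/-- The element `c 𝔱^x`. -/
def mk (c : ℂˣ) (x : ℝ) : CStarT := (c, Multiplicative.ofAdd x)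

/-- The exponent `x` of `c 𝔱^x` (its tropical part is `𝔱^x`). -/
def trop (z : CStarT) : ℝ := Multiplicative.toAdd z.2

/-- The inclusion of `ℂ^* 𝔱^ℝ` in `ℂ𝔱^ℝ`. -/
def toExplodedC (z : CStarT) : ExplodedC := ⟨(z.1 : ℂ), z.trop⟩

open Classical in
/-- The smooth part of `c 𝔱^x` (used for `x ≥ 0`): it is `c` if `x = 0`, and `0` if `x > 0`. -/
def smoothPart (z : CStarT) : ℂ := if z.trop = 0 then (z.1 : ℂ) else 0

end CStarT

theorem CStarT.mk_mul_zero (a b : ℂˣ) : CStarT.mk (a * b) 0 = CStarT.mk a 0 * CStarT.mk b 0 := by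
  simp [CStarT.mk]

theorem CStarT.mk_inv_zero (a : ℂˣ) : CStarT.mk a⁻¹ 0 = (CStarT.mk a 0)⁻¹ := by
  simp [CStarT.mk]

/-! ### Abstract exploded spaces and their morphisms -/

/-- An abstract exploded space: a topological space with a sheaf of abelian groups of functions to
`ℂ^* 𝔱^ℝ` (with pointwise multiplication and restriction of functions) containing the constants. -/
structure AbstractExplodedSpace : Type (u + 1) where
  carrier : Type u
  [top : TopologicalSpace carrier]
  /-- The exploded functions on an open set. -/
  sections : (U : Opens carrier) → Subgroup (U → CStarT)
  const_mem : ∀ (U : Opens carrier) (c : CStarT), (fun _ => c) ∈ sections U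
  restrict_mem : ∀ {U V : Opens carrier} (h : V ≤ U) {F : U → CStarT}, F ∈ sections U →
    (fun x : V => F ⟨x, h x.2⟩) ∈ sections V
  glue : ∀ {U : Opens carrier} {F : U → CStarT},
    (∀ x : U, ∃ V : Opens carrier, (x : carrier) ∈ V ∧ ∃ h : V ≤ U,
      (fun y : V => F ⟨y, h y.2⟩) ∈ sections V) → F ∈ sections U

instance : CoeSort AbstractExplodedSpace.{u} (Type u) := ⟨AbstractExplodedSpace.carrier⟩

instance (X : AbstractExplodedSpace.{u}) : TopologicalSpace X := X.top

/-- A morphism of abstract exploded spaces: a continuous map which pulls exploded functions back to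
exploded functions. -/
@[ext] structure Hom (X : AbstractExplodedSpace.{u₁}) (Y : AbstractExplodedSpace.{u₂}) where
  toFun : X → Y
  continuous' : Continuous toFun
  pullback_mem : ∀ (U : Opens Y) (F : U → CStarT), F ∈ Y.sections U →
    (fun x : Opens.comap ⟨toFun, continuous'⟩ U => F ⟨toFun x, x.2⟩) ∈
      X.sections (Opens.comap ⟨toFun, continuous'⟩ U)

instance (X : AbstractExplodedSpace.{u₁}) (Y : AbstractExplodedSpace.{u₂}) :
    CoeFun (Hom X Y) (fun _ => X → Y) := ⟨Hom.toFun⟩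

/-- The identity morphism. -/
def Hom.id (X : AbstractExplodedSpace.{u}) : Hom X X where
  toFun x := x
  continuous' := continuous_id
  pullback_mem _ _ hF := hF

/-- `f.comp g` is the morphism `x ↦ f (g x)`. -/
def Hom.comp {X : AbstractExplodedSpace.{u₁}} {Y : AbstractExplodedSpace.{u₂}}
    {Z : AbstractExplodedSpace.{u₃}} (f : Hom Y Z) (g : Hom X Y) : Hom X Z where
  toFun x := f (g x)
  continuous' := f.continuous'.comp g.continuous'
  pullback_mem U F hF := g.pullback_mem _ _ (f.pullback_mem U F hF)

/-- Two abstract exploded spaces are isomorphic. -/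
def IsIsomorphic (X : AbstractExplodedSpace.{u₁}) (Y : AbstractExplodedSpace.{u₂}) : Prop :=
  ∃ (f : Hom X Y) (g : Hom Y X), g.comp f = Hom.id X ∧ f.comp g = Hom.id Y

namespace AbstractExplodedSpace

/-- The image in `X` of an open subset of the open subset `U` of `X`. -/
def imageOpen {X : Type u} [TopologicalSpace X] (U : Opens X) (W : Opens U) : Opens X :=
  ⟨Subtype.val '' (W : Set U), U.isOpen.isOpenMap_subtype_val _ W.isOpen⟩

theorem mem_of_mem_imageOpen {X : Type u} [TopologicalSpace X] {U : Opens X} {W : Opens U} {x : X}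
    (hx : x ∈ imageOpen U W) : x ∈ U := by
  obtain ⟨y, _, rfl⟩ := hx
  exact y.2

theorem mk_mem_of_mem_imageOpen {X : Type u} [TopologicalSpace X] {U : Opens X} {W : Opens U} {x : X}
    (hx : x ∈ imageOpen U W) : (⟨x, mem_of_mem_imageOpen hx⟩ : U) ∈ W := by
  obtain ⟨y, hy, rfl⟩ := hx
  exact hy

/-- An open subset of an abstract exploded space, with the restricted sheaf. -/
def restrict (X : AbstractExplodedSpace.{u}) (U : Opens X) : AbstractExplodedSpace.{u} where
  carrier := U
  sections W :=
    { carrier := {F | (fun x : imageOpen U W =>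
          F ⟨⟨x, mem_of_mem_imageOpen x.2⟩, mk_mem_of_mem_imageOpen x.2⟩) ∈
            X.sections (imageOpen U W)}
      mul_mem' := fun ha hb => (X.sections (imageOpen U W)).mul_mem ha hb
      one_mem' := (X.sections (imageOpen U W)).one_mem
      inv_mem' := fun ha => (X.sections (imageOpen U W)).inv_mem ha }
  const_mem W c := X.const_mem (imageOpen U W) c
  restrict_mem {W W'} h F hF :=
    X.restrict_mem (U := imageOpen U W) (V := imageOpen U W') (Set.image_mono h) hF
  glue {W F} hF := by
    refine X.glue ?_
    rintro ⟨x, hx⟩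
    obtain ⟨V, hxV, hVW, hV⟩ := hF ⟨⟨x, mem_of_mem_imageOpen hx⟩, mk_mem_of_mem_imageOpen hx⟩
    exact ⟨imageOpen U V, ⟨_, hxV, rfl⟩, Set.image_mono hVW, hV⟩

/-- The abstract exploded space on `X` whose exploded functions are the functions that locally agree
with members of a given group `K` of functions containing the constants. -/
def ofSubgroup (X : Type u) [TopologicalSpace X] (K : Subgroup (X → CStarT))
    (hK : ∀ c : CStarT, (fun _ => c) ∈ K) : AbstractExplodedSpace.{u} where
  carrier := X
  sections U :=
    { carrier := {F | ∀ x : U, ∃ V : Opens X, (x : X) ∈ V ∧ ∃ k ∈ K,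
          ∀ y : U, (y : X) ∈ V → F y = k y}
      mul_mem' := by
        intro F G hF hG x
        obtain ⟨V, hxV, k, hk, hFk⟩ := hF x
        obtain ⟨W, hxW, l, hl, hGl⟩ := hG x
        refine ⟨V ⊓ W, ⟨hxV, hxW⟩, k * l, K.mul_mem hk hl, fun y hy => ?_⟩
        simp [hFk y hy.1, hGl y hy.2]
      one_mem' := fun _ => ⟨⊤, trivial, 1, K.one_mem, fun _ _ => rfl⟩
      inv_mem' := by
        intro F hF x
        obtain ⟨V, hxV, k, hk, hFk⟩ := hF x
        refine ⟨V, hxV, k⁻¹, K.inv_mem hk, fun y hy => ?_⟩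
        simp [hFk y hy] }
  const_mem _ c _ := ⟨⊤, trivial, fun _ => c, hK c, fun _ _ => rfl⟩
  restrict_mem {U V} h F hF x := by
    obtain ⟨W, hxW, k, hk, hFk⟩ := hF ⟨x, h x.2⟩
    exact ⟨W, hxW, k, hk, fun y hy => hFk _ hy⟩
  glue {U F} hF x := by
    obtain ⟨V, hxV, hVU, hV⟩ := hF x
    obtain ⟨W, hxW, k, hk, hFk⟩ := hV ⟨x, hxV⟩
    exact ⟨V ⊓ W, ⟨hxV, hxW⟩, k, hk, fun y hy => hFk ⟨y, hy.1⟩ hy.2⟩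

end AbstractExplodedSpace

/-! ### The smooth manifold `ℝ` -/

/-- `ℝ` as an abstract exploded space: the exploded functions are the functions `h 𝔱^a` with `h`
smooth and `ℂ^*`-valued and `a` real and locally constant. -/
def realLine : AbstractExplodedSpace.{0} :=
  AbstractExplodedSpace.ofSubgroup ℝ
    { carrier := {F | ∃ (h : ℝ → ℂˣ) (a : ℝ), ContDiff ℝ ∞ (fun y => (h y : ℂ)) ∧
          ∀ y, F y = CStarT.mk (h y) a}
      mul_mem' := by
        rintro F G ⟨h, a, hh, hF⟩ ⟨k, b, hk, hG⟩
        refine ⟨h * k, a + b, ?_, fun y => ?_⟩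
        · simpa using hh.mul hk
        · simp [hF, hG, CStarT.mk]
      one_mem' := ⟨1, 0, by simpa using contDiff_const, fun y => rfl⟩
      inv_mem' := by
        rintro F ⟨h, a, hh, hF⟩
        refine ⟨h⁻¹, -a, ?_, fun y => ?_⟩
        · simp only [Pi.inv_apply, Units.val_inv_eq_inv_val]
          exact hh.inv (fun y => (h y).ne_zero)
        · simp [hF, CStarT.mk] }
    (fun c => ⟨fun _ => c.1, Multiplicative.toAdd c.2, contDiff_const, fun _ => rfl⟩)

/-! ### Integral affine polytopes and the coordinate charts `ℝⁿ × 𝐓ᵐ_P` -/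

/-- An integral affine function `x ↦ a + ∑ xᵢ αᵢ` on `ℝᵐ` (with `a` real and `α` integral), given as
the pair `(a, α)`. -/
abbrev IntAffine (m : ℕ) : Type := ℝ × (Fin m → ℤ)

/-- The value of an integral affine function. -/
def IntAffine.eval {m : ℕ} (q : IntAffine m) (x : Fin m → ℝ) : ℝ := q.1 + ∑ i, x i * (q.2 i : ℝ)

/-- Integral affine polytopes: subsets of `ℝᵐ` with nonempty interior that are defined by finitely
many weak and strict inequalities between integral affine functions and `0`.  (Since `𝔱^x ≤ 𝔱^0`
means `x ≥ 0`, the inequalities read `0 ≤ a + x·α` and `0 < a + x·α`.) -/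
def IsIntegralAffinePolytope {m : ℕ} (P : Set (Fin m → ℝ)) : Prop :=
  (interior P).Nonempty ∧ ∃ weak strict : Finset (IntAffine m),
    P = {x | (∀ q ∈ weak, 0 ≤ q.eval x) ∧ ∀ q ∈ strict, 0 < q.eval x}

/-- The points of `ℝⁿ × 𝐓ᵐ_P`: tuples `(x, z₁, …, z_m)` with `x ∈ ℝⁿ`, `zᵢ ∈ ℂ^* 𝔱^ℝ`, and the
tropical part of `z` in `P`. -/
def ModelPoint (n : ℕ) {m : ℕ} (P : Set (Fin m → ℝ)) : Type :=
  (Fin n → ℝ) × {z : Fin m → CStarT // (fun i => (z i).trop) ∈ P}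

/-- The monomial `𝔱^a z^α`. -/
def monomial {m : ℕ} (q : IntAffine m) (z : Fin m → CStarT) : CStarT :=
  CStarT.mk 1 q.1 * ∏ i, z i ^ q.2 i

theorem monomial_zero {m : ℕ} (z : Fin m → CStarT) : monomial 0 z = 1 := by
  simp [monomial, CStarT.mk]

theorem monomial_add {m : ℕ} (q r : IntAffine m) (z : Fin m → CStarT) :
    monomial (q + r) z = monomial q z * monomial r z := by
  have e : CStarT.mk 1 (q.1 + r.1) = CStarT.mk 1 q.1 * CStarT.mk 1 r.1 := by simp [CStarT.mk]
  simp only [monomial, Prod.fst_add, Prod.snd_add, Pi.add_apply, zpow_add,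
    Finset.prod_mul_distrib]
  rw [e, mul_mul_mul_comm]

theorem monomial_neg {m : ℕ} (q : IntAffine m) (z : Fin m → CStarT) :
    monomial (-q) z = (monomial q z)⁻¹ := by
  rw [eq_inv_iff_mul_eq_one, ← monomial_add, neg_add_cancel, monomial_zero]

/-- The monomials `ζ̃ = 𝔱^a z^α` whose tropical part is `≤ 𝔱^0` on `P`. -/
abbrev NonnegMonomial {m : ℕ} (P : Set (Fin m → ℝ)) : Type :=
  {q : IntAffine m // ∀ x ∈ P, 0 ≤ q.eval x}

/-- The smooth monomial `ζ`, the smooth part of `ζ̃ = 𝔱^a z^α`. -/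
def smoothMonomial {n m : ℕ} {P : Set (Fin m → ℝ)} (q : NonnegMonomial P) (p : ModelPoint n P) : ℂ :=
  (monomial q.1 p.2.1).smoothPart

/-- The topology of `ℝⁿ × 𝐓ᵐ_P`: the coarsest one for which the coordinates of `ℝⁿ` and all the
smooth monomials are continuous.  This is the pullback of the usual topology under the map
`(x, ζ₁, …, ζ_N)` for any finite basis of the smooth monomials, since every smooth monomial is a
constant times a product of nonnegative powers of those of a basis. -/
instance {n m : ℕ} {P : Set (Fin m → ℝ)} : TopologicalSpace (ModelPoint n P) :=
  TopologicalSpace.induced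
    (fun p => (p.1, fun q : NonnegMonomial P => smoothMonomial q p)) inferInstance

/-- The abstract exploded space `ℝⁿ × 𝐓ᵐ_P`: the exploded functions are (locally) the functions
`h(x, ζ₁, …, ζ_N) 𝔱^a z^α` with `h` smooth and `ℂ^*`-valued and the `ζᵢ` finitely many smooth
monomials. -/
def model (n : ℕ) {m : ℕ} (P : Set (Fin m → ℝ)) : AbstractExplodedSpace.{0} :=
  AbstractExplodedSpace.ofSubgroup (ModelPoint n P)
    { carrier := {F | ∃ (s : Finset (NonnegMonomial P)) (h : (Fin n → ℝ) × (s → ℂ) → ℂˣ)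
          (q : IntAffine m), ContDiff ℝ ∞ (fun y => (h y : ℂ)) ∧
          ∀ p, F p = CStarT.mk (h (p.1, fun i => smoothMonomial i.1 p)) 0 * monomial q p.2.1}
      mul_mem' := by
        classical
        rintro F G ⟨s, h, q, hh, hF⟩ ⟨t, k, r, hk, hG⟩
        refine ⟨s ∪ t,
          fun y => h (y.1, fun i => y.2 ⟨i, Finset.mem_union_left _ i.2⟩) *
            k (y.1, fun i => y.2 ⟨i, Finset.mem_union_right _ i.2⟩), q + r, ?_, fun p => ?_⟩
        · simp only [Units.val_mul]
          refine (hh.comp (f := fun y : (Fin n → ℝ) × ((s ∪ t : Finset _) → ℂ) =>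
            (y.1, fun i : s => y.2 ⟨i, Finset.mem_union_left _ i.2⟩)) (by fun_prop)).mul
            (hk.comp (f := fun y : (Fin n → ℝ) × ((s ∪ t : Finset _) → ℂ) =>
            (y.1, fun i : t => y.2 ⟨i, Finset.mem_union_right _ i.2⟩)) (by fun_prop))
        · rw [Pi.mul_apply, hF, hG, monomial_add, CStarT.mk_mul_zero, mul_mul_mul_comm]
      one_mem' := ⟨∅, fun _ => 1, 0, contDiff_const, fun p => by
        rw [monomial_zero, mul_one]; rfl⟩
      inv_mem' := by
        rintro F ⟨s, h, q, hh, hF⟩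
        refine ⟨s, fun y => (h y)⁻¹, -q, ?_, fun p => ?_⟩
        · simp only [Units.val_inv_eq_inv_val]
          exact hh.inv (fun y => (h y).ne_zero)
        · rw [Pi.inv_apply, hF, monomial_neg, CStarT.mk_inv_zero, mul_inv] }
    (fun c => ⟨∅, fun _ => c.1, (Multiplicative.toAdd c.2, 0), contDiff_const, fun p => by
      simp [monomial, CStarT.mk]⟩)

/-! ### Exploded manifolds, smooth parts -/

/-- A (smooth) exploded manifold is an abstract exploded space in which every point has an open
neighbourhood isomorphic to some `ℝⁿ × 𝐓ᵐ_P`, with `P` an integral affine polytope. -/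
def IsExplodedManifold (X : AbstractExplodedSpace.{u}) : Prop :=
  ∀ p : X, ∃ U : Opens X, p ∈ U ∧ ∃ (n m : ℕ) (P : Set (Fin m → ℝ)),
    IsIntegralAffinePolytope P ∧ IsIsomorphic (X.restrict U) (model n P)

/-- The smooth part: the quotient by the relation which identifies topologically
indistinguishable points. -/
abbrev SmoothPart (X : AbstractExplodedSpace.{u}) : Type u := SeparationQuotient X

/-- The map of smooth parts induced by a morphism. -/
def Hom.smoothPartMap {X Y : AbstractExplodedSpace.{u}} (f : Hom X Y) :
    SmoothPart X → SmoothPart Y :=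
  SeparationQuotient.lift (fun x => SeparationQuotient.mk (f x))
    (fun _ _ h => SeparationQuotient.mk_eq_mk.2 (h.map f.continuous'))

/-- A morphism is proper if the induced map of smooth parts is proper. -/
def Hom.IsProper {X Y : AbstractExplodedSpace.{u}} (f : Hom X Y) : Prop :=
  IsProperMap f.smoothPartMap

/-! ### Tangent vectors -/

section Tangent

variable {X Y : AbstractExplodedSpace.{u}}

/-- Germs at `p` of smooth functions, i.e. of morphisms to `ℝ` from open neighbourhoods of `p`. -/
def IsSmoothGerm (p : X) (g : Germ (𝓝 p) ℝ) : Prop :=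
  ∃ φ : X → ℝ, (φ : Germ (𝓝 p) ℝ) = g ∧ ∃ U : Opens X, p ∈ U ∧
    ∃ h : Hom (X.restrict U) realLine, ∀ x : U, h.toFun x = φ x

/-- Germs at `p` of exploded functions, regarded as germs of functions to `ℂ𝔱^ℝ`. -/
def IsExplodedGerm (p : X) (g : Germ (𝓝 p) ExplodedC) : Prop :=
  ∃ φ : X → ExplodedC, (φ : Germ (𝓝 p) ExplodedC) = g ∧ ∃ U : Opens X, p ∈ U ∧
    ∃ F ∈ X.sections U, ∀ x : U, φ x = (F x).toExplodedC

/-- Germs at `p` of exploded tropical functions, i.e. finite (nonempty) sums of germs of exploded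
functions. -/
def IsTropicalGerm (p : X) (g : Germ (𝓝 p) ExplodedC) : Prop :=
  g ∈ AddSubsemigroup.closure {g : Germ (𝓝 p) ExplodedC | IsExplodedGerm p g}

/-- A tangent vector at `p`: a derivation at `p` acting on germs of smooth functions and on germs of
exploded tropical functions, compatibly with the inclusion `ι`.  The conditions `hfg`, `hcg`, `hg`
hold automatically on exploded manifolds, where sums and products of smooth functions are smooth,
products of exploded tropical functions are exploded tropical functions, and `ι f` is an exploded
tropical function when `f` is smooth. -/
@[ext] structure TangentVector (p : X) where
  onSmooth : {g : Germ (𝓝 p) ℝ // IsSmoothGerm p g} → ℝ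
  onTrop : {g : Germ (𝓝 p) ExplodedC // IsTropicalGerm p g} → ExplodedC
  smooth_add : ∀ f g (hfg : IsSmoothGerm p (f.1 + g.1)),
    onSmooth ⟨f.1 + g.1, hfg⟩ = onSmooth f + onSmooth g
  trop_add : ∀ f g (hfg : IsTropicalGerm p (f.1 + g.1)),
    onTrop ⟨f.1 + g.1, hfg⟩ = onTrop f + onTrop g
  smooth_mul : ∀ f g (hfg : IsSmoothGerm p (f.1 * g.1)),
    onSmooth ⟨f.1 * g.1, hfg⟩ = onSmooth f * g.1.value + f.1.value * onSmooth g
  trop_mul : ∀ f g (hfg : IsTropicalGerm p (f.1 * g.1)),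
    onTrop ⟨f.1 * g.1, hfg⟩ = onTrop f * g.1.value + f.1.value * onTrop g
  trop_const_mul : ∀ (c : ExplodedC) g
    (hcg : IsTropicalGerm p ((c : Germ (𝓝 p) ExplodedC) * g.1)),
    onTrop ⟨(c : Germ (𝓝 p) ExplodedC) * g.1, hcg⟩ = c * onTrop g
  compat : ∀ g (hg : IsTropicalGerm p (g.1.map ExplodedC.ofReal)),
    onTrop ⟨g.1.map ExplodedC.ofReal, hg⟩ = ExplodedC.ofReal (onSmooth g)

/-- The pullback `g ∘ f` of a germ by a morphism. -/
def Hom.pullGerm (f : Hom X Y) (p : X) {β : Type*} (g : Germ (𝓝 (f p)) β) : Germ (𝓝 p) β :=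
  g.compTendsto f f.continuous'.continuousAt

theorem Hom.value_pullGerm (f : Hom X Y) (p : X) {β : Type*} (g : Germ (𝓝 (f p)) β) :
    (f.pullGerm p g).value = g.value := by
  induction g using Germ.inductionOn with | _ φ => rfl

/-- The restriction of a morphism to the preimage of an open set. -/
def Hom.restrict (f : Hom X Y) (U : Opens Y) :
    Hom (X.restrict (Opens.comap ⟨f.toFun, f.continuous'⟩ U)) (Y.restrict U) where
  toFun x := ⟨f x.1, x.2⟩
  continuous' := Continuous.subtype_mk (f.continuous'.comp continuous_subtype_val) _
  pullback_mem W F hF := by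
    have h := f.pullback_mem _ _ hF
    refine X.restrict_mem ?_ h
    rintro _ ⟨x, hx, rfl⟩
    exact ⟨_, hx, rfl⟩

theorem IsSmoothGerm.pull (f : Hom X Y) {p : X} {g : Germ (𝓝 (f p)) ℝ} (hg : IsSmoothGerm (f p) g) :
    IsSmoothGerm p (f.pullGerm p g) := by
  obtain ⟨φ, rfl, U, hU, h, hφ⟩ := hg
  exact ⟨fun x => φ (f x), rfl, _, hU, h.comp (f.restrict U), fun x => hφ ⟨f x.1, x.2⟩⟩

theorem IsTropicalGerm.pull (f : Hom X Y) {p : X} {g : Germ (𝓝 (f p)) ExplodedC}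
    (hg : IsTropicalGerm (f p) g) : IsTropicalGerm p (f.pullGerm p g) := by
  refine AddSubsemigroup.closure_induction
    (p := fun g _ => IsTropicalGerm p (f.pullGerm p g)) ?_ ?_ hg
  · rintro _ ⟨φ, rfl, U, hU, F, hF, hφ⟩
    exact AddSubsemigroup.subset_closure
      ⟨fun x => φ (f x), rfl, _, hU, _, f.pullback_mem U F hF, fun x => hφ ⟨f x.1, x.2⟩⟩
  · intro a b _ _ ha hb
    have : f.pullGerm p (a + b) = f.pullGerm p a + f.pullGerm p b := by
      induction a using Germ.inductionOn with | _ a => ?_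
      induction b using Germ.inductionOn with | _ b => rfl
    rw [this]
    exact AddMemClass.add_mem ha hb

/-- The derivative `df : T_p X → T_{f(p)} Y`, `(df v)(g) = v(g ∘ f)`. -/
def Hom.deriv (f : Hom X Y) (p : X) (v : TangentVector p) : TangentVector (f p) where
  onSmooth g := v.onSmooth ⟨f.pullGerm p g.1, g.2.pull f⟩
  onTrop g := v.onTrop ⟨f.pullGerm p g.1, g.2.pull f⟩
  smooth_add := by
    rintro ⟨a, ha⟩ ⟨b, hb⟩ hab
    induction a using Germ.inductionOn with | _ a => ?_
    induction b using Germ.inductionOn with | _ b => ?_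
    exact v.smooth_add ⟨_, ha.pull f⟩ ⟨_, hb.pull f⟩ (hab.pull f)
  trop_add := by
    rintro ⟨a, ha⟩ ⟨b, hb⟩ hab
    induction a using Germ.inductionOn with | _ a => ?_
    induction b using Germ.inductionOn with | _ b => ?_
    exact v.trop_add ⟨_, ha.pull f⟩ ⟨_, hb.pull f⟩ (hab.pull f)
  smooth_mul := by
    rintro ⟨a, ha⟩ ⟨b, hb⟩ hab
    induction a using Germ.inductionOn with | _ a => ?_
    induction b using Germ.inductionOn with | _ b => ?_
    exact v.smooth_mul ⟨_, ha.pull f⟩ ⟨_, hb.pull f⟩ (hab.pull f)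
  trop_mul := by
    rintro ⟨a, ha⟩ ⟨b, hb⟩ hab
    induction a using Germ.inductionOn with | _ a => ?_
    induction b using Germ.inductionOn with | _ b => ?_
    exact v.trop_mul ⟨_, ha.pull f⟩ ⟨_, hb.pull f⟩ (hab.pull f)
  trop_const_mul := by
    rintro c ⟨a, ha⟩ hca
    induction a using Germ.inductionOn with | _ a => ?_
    exact v.trop_const_mul c ⟨_, ha.pull f⟩ (hca.pull f)
  compat := by
    rintro ⟨a, ha⟩ h
    induction a using Germ.inductionOn with | _ a => ?_
    exact v.compat ⟨_, ha.pull f⟩ (h.pull f)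

end Tangent

/-! ### Transversality, fiber products, refinements -/

/-- `f : A → B` and `g : C → B` are transverse: whenever `f a = g c`, every tangent vector of `B` at
that point is the sum of one in the image of `df` and one in the image of `dg`. -/
def IsTransverse {A B C : AbstractExplodedSpace.{u}} (f : Hom A B) (g : Hom C B) : Prop :=
  ∀ (a : A) (c : C) (h : g c = f a) (w : TangentVector (f a)),
    ∃ (v₁ : TangentVector a) (v₂ : TangentVector c),
      (∀ φ, w.onSmooth φ =
        (f.deriv a v₁).onSmooth φ + (h ▸ g.deriv c v₂ : TangentVector (f a)).onSmooth φ) ∧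
      (∀ φ, w.onTrop φ =
        (f.deriv a v₁).onTrop φ + (h ▸ g.deriv c v₂ : TangentVector (f a)).onTrop φ)

/-- `D` with the maps `π₁ : D → A` and `π₂ : D → C` is the fiber product of `f : A → B` and
`g : C → B` in the category of exploded manifolds. -/
structure IsFiberProduct {A B C D : AbstractExplodedSpace.{u}} (f : Hom A B) (g : Hom C B)
    (π₁ : Hom D A) (π₂ : Hom D C) : Prop where
  isExplodedManifold : IsExplodedManifold D
  comm : f.comp π₁ = g.comp π₂
  existsUnique_lift : ∀ (E : AbstractExplodedSpace.{u}), IsExplodedManifold E →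
    ∀ (h₁ : Hom E A) (h₂ : Hom E C), f.comp h₁ = g.comp h₂ →
      ∃! l : Hom E D, π₁.comp l = h₁ ∧ π₂.comp l = h₂

/-- `f : B' → B` is a refinement of `B`: `B'` is an exploded manifold, and `f` is proper, bijective
on points, and has surjective derivative at each point. -/
structure IsRefinement {B' B : AbstractExplodedSpace.{u}} (f : Hom B' B) : Prop where
  isExplodedManifold : IsExplodedManifold B'
  isProper : f.IsProper
  bijective : Function.Bijective f
  deriv_surjective : ∀ p : B', Function.Surjective (f.deriv p)

end Exploded

end

/-! Transversality is formal. Since `df` is onto at every point, a tangent vector at a common image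
point is `df v` plus the image of a zero vector; the only thing to check is that adding this image
changes nothing, which holds because the exponent of `v(g)` is forced to be that of `g`
(`TangentVector.order_onTrop`, `isTransverse_of_surjective`).

The rest depends on a local normal form: in suitable charts a refinement is the inclusion of `ℝⁿ ×
𝐓ᵐ_{P₂}` in `ℝⁿ × 𝐓ᵐ_{P₁}` for polytopes `P₂ ⊆ P₁`, with the same coordinates on both sides
(`exists_subpolytope_charts`). Take charts in which the exponent of the point is interior to the
polytope. Exploded functions there are smooth units times monomials, and `f` induces a map from the
lattice of monomials of the target to that of the source. This map is onto: otherwise a nontrivial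
torus element moves a point without moving its image, against injectivity
(`exists_adapted_coordinates`). Splitting it divides the exploded coordinates of the target into
those that pull back to a unit times a source coordinate and those that pull back to a unit of
exponent zero. Setting the vanishing smooth monomials to zero leaves an ordinary smooth map,
injective with surjective derivative, hence a local diffeomorphism. Together with the inverse
function theorem in the coordinates `(x, ζ)`, this gives the normal form
(`exists_locIso_of_adapted`).

Consequently, over a chart of `C` with polytope `Q` in which `g` acts on exponents by an integral
affine map `A`, the fiber product is the model of `Q ∩ A⁻¹(P₂)` (`ChartData.exists_chart`). This set
may have empty interior, but its model is still an exploded manifold: near a point it equals the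
model of a face, and the coordinates with constant exponent become ordinary `ℂ^*` coordinates with
local logarithms (`locIso_face`, `goodPt_model`). Charts must fill whole models, so small
neighbourhoods are stretched to the full model (`exists_openIso_of_mem_nhds`).

Globally, the fiber product is the set-theoretic one with the finest structure for which all plots,
the maps from models with componentwise morphisms, are morphisms. Its universal property is then
immediate once the charts above are known (`isFiberProduct_pullback`).

The projection to `C` is bijective by base change. Its derivative is onto because it is an inclusion
of models in charts, every coordinate velocity is realised by a path, and a tangent vector is
determined by its values on coordinates (`TangentVector.ext_of_chart`, which uses Hadamard's lemma).
For properness, an ultrafilter whose projection to `C` converges also has a limit in `B'`, by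
properness of `f`; hence the absolute values of the monomials defining `Q ∩ A⁻¹(P₂)` converge, and
by Farkas' lemma this suffices for convergence in the model (`exists_le_nhds_of_bounded`,
`isProper_pullbackSnd`). Hausdorffness of smooth parts is the `R1Space` property upstairs, checked
on the same charts. -/

noncomputable section
namespace Exploded

/-! ### Germs of exploded functions and morphisms at a point -/

section Germs

variable {X : AbstractExplodedSpace.{u₁}} {Y : AbstractExplodedSpace.{u₂}}
  {Z : AbstractExplodedSpace.{u₃}}

/-- `F` is an exploded function on a neighbourhood of `p`. -/
def SecAt (X : AbstractExplodedSpace.{u₁}) (F : X → CStarT) (p : X) : Prop :=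
  ∃ U : Opens X, p ∈ U ∧ (fun x : U => F x) ∈ X.sections U

theorem SecAt.congr {F G : X → CStarT} {p : X} (hF : SecAt X F p) (h : F =ᶠ[𝓝 p] G) :
    SecAt X G p := by
  obtain ⟨U, hU, hF⟩ := hF
  obtain ⟨V, hV, hVo, hpV⟩ := eventually_nhds_iff.1 h
  refine ⟨U ⊓ ⟨V, hVo⟩, ⟨hU, hpV⟩, ?_⟩
  have := X.restrict_mem (U := U) (V := U ⊓ ⟨V, hVo⟩) inf_le_left hF
  convert this using 1
  funext x
  exact (hV x.1 x.2.2).symm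

theorem SecAt.eventually {F : X → CStarT} {p : X} (hF : SecAt X F p) :
    ∀ᶠ p' in 𝓝 p, SecAt X F p' := by
  obtain ⟨U, hU, hF⟩ := hF
  filter_upwards [U.isOpen.mem_nhds hU] with x hx
  exact ⟨U, hx, hF⟩

theorem secAt_const (c : CStarT) (p : X) : SecAt X (fun _ => c) p :=
  ⟨⊤, trivial, X.const_mem ⊤ c⟩

theorem SecAt.mul {F G : X → CStarT} {p : X} (hF : SecAt X F p) (hG : SecAt X G p) :
    SecAt X (fun x => F x * G x) p := by
  obtain ⟨U, hU, hF⟩ := hF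
  obtain ⟨V, hV, hG⟩ := hG
  exact ⟨U ⊓ V, ⟨hU, hV⟩, (X.sections (U ⊓ V)).mul_mem
    (X.restrict_mem (V := U ⊓ V) inf_le_left hF) (X.restrict_mem (V := U ⊓ V) inf_le_right hG)⟩

theorem SecAt.inv {F : X → CStarT} {p : X} (hF : SecAt X F p) :
    SecAt X (fun x => (F x)⁻¹) p := by
  obtain ⟨U, hU, hF⟩ := hF
  exact ⟨U, hU, (X.sections U).inv_mem hF⟩

/-- The group of functions which are exploded near `p`. -/
def secGroup (p : X) : Subgroup (X → CStarT) where
  carrier := {F | SecAt X F p}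
  mul_mem' := SecAt.mul
  one_mem' := secAt_const 1 p
  inv_mem' := SecAt.inv

theorem SecAt.zpow {F : X → CStarT} {p : X} (hF : SecAt X F p) (k : ℤ) :
    SecAt X (fun x => F x ^ k) p :=
  (secGroup p).zpow_mem (x := F) hF k

theorem SecAt.prod {ι : Type*} (t : Finset ι) {F : ι → X → CStarT} {p : X}
    (hF : ∀ i ∈ t, SecAt X (F i) p) : SecAt X (fun x => ∏ i ∈ t, F i x) p := by
  have := (secGroup p).prod_mem (f := F) (t := t) hF
  have h : (∏ i ∈ t, F i) = fun x => ∏ i ∈ t, F i x := by funext x; simp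
  rwa [h] at this

theorem SecAt.monomial {m : ℕ} (q : IntAffine m) {z : X → Fin m → CStarT} {p : X}
    (hz : ∀ i, SecAt X (fun x => z x i) p) : SecAt X (fun x => Exploded.monomial q (z x)) p :=
  (secAt_const _ p).mul (SecAt.prod _ fun i _ => (hz i).zpow _)

/-- The sheaf axiom makes being a section a condition on germs. It allows sections over open sets to
be replaced by total functions satisfying `SecAt`, so that restriction maps disappear. -/
theorem mem_sections_iff {U : Opens X} {G : X → CStarT} :
    (fun x : U => G x) ∈ X.sections U ↔ ∀ p ∈ U, SecAt X G p := by
  refine ⟨fun h p hp => ⟨U, hp, h⟩, fun h => X.glue ?_⟩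
  rintro ⟨x, hx⟩
  obtain ⟨V, hV, hG⟩ := h x hx
  exact ⟨U ⊓ V, ⟨hx, hV⟩, inf_le_left, X.restrict_mem (V := U ⊓ V) inf_le_right hG⟩

open Classical in
/-- Extension of a function on an open set by `1`. -/
def extendOne {S : Type*} {T : Set S} (F : T → CStarT) (x : S) : CStarT :=
  if h : x ∈ T then F ⟨x, h⟩ else 1

theorem extendOne_coe {S : Type*} {T : Set S} (F : T → CStarT) (x : T) :
    extendOne F (x : S) = F x := by simp [extendOne]

theorem mem_sections_iff' {U : Opens X} {F : U → CStarT} :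
    F ∈ X.sections U ↔ ∀ p ∈ U, SecAt X (extendOne (T := (U : Set X)) F) p := by
  rw [← mem_sections_iff]
  have : (fun x : U => extendOne (T := (U : Set X)) F x) = F := by
    funext x; exact extendOne_coe (T := (U : Set X)) F x
  rw [this]

/-- `f` is a morphism near `p`, at the level of germs at `p`. -/
def MorAt (X : AbstractExplodedSpace.{u₁}) (Y : AbstractExplodedSpace.{u₂}) (f : X → Y) (p : X) :
    Prop :=
  ContinuousAt f p ∧ ∀ F : Y → CStarT, SecAt Y F (f p) → SecAt X (fun x => F (f x)) p

theorem MorAt.congr {f g : X → Y} {p : X} (hf : MorAt X Y f p) (h : f =ᶠ[𝓝 p] g) :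
    MorAt X Y g p := by
  refine ⟨hf.1.congr h, fun F hF => ?_⟩
  rw [← h.eq_of_nhds] at hF
  exact (hf.2 F hF).congr (h.fun_comp F)

theorem MorAt.comp {g : Y → Z} {f : X → Y} {p : X} (hg : MorAt Y Z g (f p)) (hf : MorAt X Y f p) :
    MorAt X Z (fun x => g (f x)) p :=
  ⟨hg.1.comp hf.1, fun F hF => hf.2 _ (hg.2 F hF)⟩

theorem Hom.morAt (f : Hom X Y) (p : X) : MorAt X Y f p := by
  refine ⟨f.continuous'.continuousAt, fun F hF => ?_⟩
  obtain ⟨U, hU, hF⟩ := hF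
  exact ⟨_, hU, f.pullback_mem U _ hF⟩

/-- A map which is a morphism at all points is a morphism. -/
def Hom.ofMorAt (f : X → Y) (hf : ∀ p, MorAt X Y f p) : Hom X Y where
  toFun := f
  continuous' := continuous_iff_continuousAt.2 fun p => (hf p).1
  pullback_mem U F hF := by
    have h : ∀ p : X, f p ∈ U → SecAt X (fun x => extendOne (T := (U : Set Y)) F (f x)) p :=
      fun p hp => (hf p).2 _ (mem_sections_iff'.1 hF _ hp)
    have h2 := (mem_sections_iff (U := Opens.comap ⟨f, continuous_iff_continuousAt.2
      fun p => (hf p).1⟩ U) (G := fun x => extendOne (T := (U : Set Y)) F (f x))).2 h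
    convert h2 using 1
    funext x
    exact (extendOne_coe (T := (U : Set Y)) F ⟨f x, x.2⟩).symm

theorem secAt_restrict {U : Opens X} {G : X → CStarT} {p : X} (hp : p ∈ U) :
    SecAt (X.restrict U) (fun x : U => G x) (⟨p, hp⟩ : U) ↔ SecAt X G p := by
  constructor
  · rintro ⟨V, hV, hG⟩
    exact ⟨AbstractExplodedSpace.imageOpen U V, ⟨_, hV, rfl⟩, hG⟩
  · rintro ⟨V, hV, hG⟩
    refine ⟨Opens.comap ⟨Subtype.val, continuous_subtype_val⟩ V, hV, ?_⟩
    refine X.restrict_mem (U := V)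
      (V := AbstractExplodedSpace.imageOpen U (Opens.comap ⟨Subtype.val, continuous_subtype_val⟩ V))
      ?_ hG
    rintro _ ⟨x, hx, rfl⟩
    exact hx

theorem secAt_restrict' {U : Opens X} {G : U → CStarT} {p : X} (hp : p ∈ U) :
    SecAt (X.restrict U) G (⟨p, hp⟩ : U) ↔ SecAt X (extendOne (T := (U : Set X)) G) p := by
  rw [← secAt_restrict hp]
  have : (fun x : U => extendOne (T := (U : Set X)) G x) = G := by
    funext x; exact extendOne_coe (T := (U : Set X)) G x
  rw [this]

theorem morAt_val (U : Opens X) (p : U) : MorAt (X.restrict U) X (Subtype.val : U → X) p :=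
  ⟨continuous_subtype_val.continuousAt, fun _ hF => (secAt_restrict p.2).2 hF⟩

theorem morAt_restrict_iff {U : Opens X} {f : X → Y} {p : X} (hp : p ∈ U) :
    MorAt (X.restrict U) Y (fun x : U => f x) (⟨p, hp⟩ : U) ↔ MorAt X Y f p := by
  refine ⟨fun h => ⟨?_, fun F hF => ?_⟩, fun h => MorAt.comp (Y := X) h (morAt_val U ⟨p, hp⟩)⟩
  · have := h.1
    exact (U.isOpen.isOpenEmbedding_subtypeVal.continuousAt_iff (x := ⟨p, hp⟩)).1 this
  · exact (secAt_restrict (G := fun x => F (f x)) hp).1 (h.2 F hF)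

theorem morAt_to_restrict {V : Opens Y} {f : X → V} {p : X}
    (hf : MorAt X Y (fun x => (f x : Y)) p) : MorAt X (Y.restrict V) f p := by
  refine ⟨IsInducing.subtypeVal.continuousAt_iff.2 hf.1, fun F hF => ?_⟩
  have := hf.2 _ ((secAt_restrict' (f p).2).1 hF)
  refine this.congr (Eventually.of_forall fun x => ?_)
  exact extendOne_coe (T := (V : Set Y)) F (f x)

/-- `φ` is an isomorphism of the open set `U` onto `Y`, with inverse `ψ`. -/
structure OpenIso (X : AbstractExplodedSpace.{u₁}) (Y : AbstractExplodedSpace.{u₂}) (U : Set X)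
    (φ : X → Y) (ψ : Y → X) : Prop where
  isOpen : IsOpen U
  morAt : ∀ x ∈ U, MorAt X Y φ x
  morAt_symm : ∀ y, MorAt Y X ψ y
  mem : ∀ y, ψ y ∈ U
  left_inv : ∀ x ∈ U, ψ (φ x) = x
  right_inv : ∀ y, φ (ψ y) = y

/-- Total maps `φ`, `ψ` carry the same information as an isomorphism of an open subspace and compose
without subtypes. Off `U` the value of `φ` is irrelevant; it is set to the image of `p`. -/
theorem exists_isIsomorphic_iff {p : X} :
    (∃ U : Opens X, p ∈ U ∧ IsIsomorphic (X.restrict U) Y) ↔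
      ∃ (U : Set X) (φ : X → Y) (ψ : Y → X), p ∈ U ∧ OpenIso X Y U φ ψ := by
  classical
  constructor
  · rintro ⟨U, hp, f, g, hgf, hfg⟩
    have hgf' : ∀ x : U, g (f x) = x := fun x => congrArg (fun h => h.toFun x) hgf
    have hfg' : ∀ y, f (g y) = y := fun x => congrArg (fun h => h.toFun x) hfg
    refine ⟨U, fun x => if h : x ∈ U then f ⟨x, h⟩ else f ⟨p, hp⟩, fun y => (g y : U).1, hp,
      U.isOpen, fun x hx => ?_, fun y => ?_, fun y => (g y : U).2, fun x hx => ?_, fun y => ?_⟩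
    · rw [← morAt_restrict_iff (U := U) hx]
      refine (f.morAt ⟨x, hx⟩).congr (Eventually.of_forall fun (y : U) => ?_)
      have hy : y.1 ∈ U := y.2
      simp only [hy, dif_pos]
    · exact MorAt.comp (morAt_val U (g y)) (g.morAt y)
    · have hx' : x ∈ U := hx
      simp only [hx', dif_pos]
      exact congrArg Subtype.val (hgf' ⟨x, hx⟩)
    · have hx' : (g y : U).1 ∈ U := (g y : U).2
      simp only [hx', dif_pos]
      exact hfg' y
  · rintro ⟨U, φ, ψ, hp, h⟩
    refine ⟨⟨U, h.isOpen⟩, hp, Hom.ofMorAt (X := X.restrict ⟨U, h.isOpen⟩) (fun x : U => φ x) ?_,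
      Hom.ofMorAt (Y := X.restrict ⟨U, h.isOpen⟩) (fun y => (⟨ψ y, h.mem y⟩ : U)) ?_, ?_, ?_⟩
    · rintro ⟨x, hx⟩
      exact (morAt_restrict_iff (U := ⟨U, h.isOpen⟩) hx).2 (h.morAt x hx)
    · intro y
      exact morAt_to_restrict (V := ⟨U, h.isOpen⟩) (h.morAt_symm y)
    · ext x
      exact Subtype.ext (h.left_inv _ (Subtype.property (p := (· ∈ U)) x))
    · ext y
      exact h.right_inv y

/-- `φ` and `ψ` are mutually inverse morphisms between neighbourhoods of `x` and `y`. -/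
structure LocIso (X : AbstractExplodedSpace.{u₁}) (Y : AbstractExplodedSpace.{u₂})
    (φ : X → Y) (ψ : Y → X) (x : X) (y : Y) : Prop where
  map : φ x = y
  map_symm : ψ y = x
  morAt : ∀ᶠ x' in 𝓝 x, MorAt X Y φ x'
  morAt_symm : ∀ᶠ y' in 𝓝 y, MorAt Y X ψ y'
  left_inv : ∀ᶠ x' in 𝓝 x, ψ (φ x') = x'
  right_inv : ∀ᶠ y' in 𝓝 y, φ (ψ y') = y'

theorem LocIso.symm {φ : X → Y} {ψ : Y → X} {x : X} {y : Y} (h : LocIso X Y φ ψ x y) :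
    LocIso Y X ψ φ y x :=
  ⟨h.map_symm, h.map, h.morAt_symm, h.morAt, h.right_inv, h.left_inv⟩

theorem LocIso.tendsto {φ : X → Y} {ψ : Y → X} {x : X} {y : Y} (h : LocIso X Y φ ψ x y) :
    Tendsto φ (𝓝 x) (𝓝 y) := by
  have := h.morAt.self_of_nhds.1
  rwa [ContinuousAt, h.map] at this

theorem LocIso.trans {φ : X → Y} {ψ : Y → X} {φ' : Y → Z} {ψ' : Z → Y} {x : X} {y : Y} {z : Z}
    (h : LocIso X Y φ ψ x y) (h' : LocIso Y Z φ' ψ' y z) :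
    LocIso X Z (fun a => φ' (φ a)) (fun c => ψ (ψ' c)) x z where
  map := by rw [h.map, h'.map]
  map_symm := by rw [h'.map_symm, h.map_symm]
  morAt := by
    filter_upwards [h.morAt, h.tendsto.eventually h'.morAt] with a h1 h2 using h2.comp h1
  morAt_symm := by
    filter_upwards [h'.morAt_symm, h'.symm.tendsto.eventually h.morAt_symm] with a h1 h2
      using h2.comp h1
  left_inv := by
    filter_upwards [h.left_inv, h.tendsto.eventually h'.left_inv] with a h1 h2
    rw [h2, h1]
  right_inv := by
    filter_upwards [h'.right_inv, h'.symm.tendsto.eventually h.right_inv] with a h1 h2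
    rw [h2, h1]

theorem OpenIso.locIso {U : Set X} {φ : X → Y} {ψ : Y → X} (h : OpenIso X Y U φ ψ) {x : X}
    (hx : x ∈ U) : LocIso X Y φ ψ x (φ x) where
  map := rfl
  map_symm := h.left_inv x hx
  morAt := mem_of_superset (h.isOpen.mem_nhds hx) h.morAt
  morAt_symm := Eventually.of_forall h.morAt_symm
  left_inv := mem_of_superset (h.isOpen.mem_nhds hx) h.left_inv
  right_inv := Eventually.of_forall h.right_inv

end Germs

/-! ### Smoothness near a point -/

section SmoothNear

variable {E F G : Type*} [NormedAddCommGroup E] [NormedSpace ℝ E] [NormedAddCommGroup F]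
  [NormedSpace ℝ F] [NormedAddCommGroup G] [NormedSpace ℝ G]

/-- `h` is smooth on a neighbourhood of `x`. -/
def SmoothNear (h : E → F) (x : E) : Prop := ∀ᶠ y in 𝓝 x, ContDiffAt ℝ ∞ h y

theorem SmoothNear.contDiffAt {h : E → F} {x : E} (hh : SmoothNear h x) : ContDiffAt ℝ ∞ h x :=
  hh.self_of_nhds

theorem SmoothNear.continuousAt {h : E → F} {x : E} (hh : SmoothNear h x) : ContinuousAt h x :=
  hh.contDiffAt.continuousAt

theorem SmoothNear.eventually {h : E → F} {x : E} (hh : SmoothNear h x) :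
    ∀ᶠ y in 𝓝 x, SmoothNear h y :=
  eventually_eventually_nhds.2 hh

theorem _root_.ContDiff.smoothNear {h : E → F} (hh : ContDiff ℝ ∞ h) (x : E) : SmoothNear h x :=
  Eventually.of_forall fun _ => hh.contDiffAt

theorem SmoothNear.comp {g : F → G} {f : E → F} {x : E} (hg : SmoothNear g (f x))
    (hf : SmoothNear f x) : SmoothNear (fun y => g (f y)) x := by
  filter_upwards [hf, hf.continuousAt.eventually hg] with y h1 h2
  exact ContDiffAt.comp y h2 h1

theorem SmoothNear.prodMk {f : E → F} {g : E → G} {x : E} (hf : SmoothNear f x)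
    (hg : SmoothNear g x) : SmoothNear (fun y => (f y, g y)) x := by
  filter_upwards [hf, hg] with y h1 h2 using h1.prodMk h2

theorem SmoothNear.pi {ι : Type*} [Fintype ι] {f : E → ι → F} {x : E}
    (hf : ∀ i, SmoothNear (fun y => f y i) x) : SmoothNear f x := by
  filter_upwards [eventually_all.2 hf] with y h using contDiffAt_pi.2 h

/-- The sheaf of a model is built from globally smooth `ℂ^*`-valued functions, so germs have to be
extended. Near `x` the values of `h` lie in the disc of radius `‖h x‖` about `h x`, which misses
zero and is star-shaped about its centre; a bump function contracts `h` to the constant `h x` inside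
this disc. -/
theorem exists_contDiff_extension [FiniteDimensional ℝ E] {h : E → ℂ} {x : E}
    (hh : SmoothNear h x) (h0 : h x ≠ 0) :
    ∃ k : E → ℂˣ, ContDiff ℝ ∞ (fun y => (k y : ℂ)) ∧ ∀ᶠ y in 𝓝 x, (k y : ℂ) = h y := by
  have hU : ∀ᶠ y in 𝓝 x, ContDiffAt ℝ ∞ h y ∧ ‖h y - h x‖ < ‖h x‖ := by
    refine hh.and ?_
    have : Tendsto (fun y => ‖h y - h x‖) (𝓝 x) (𝓝 0) := by
      have := (hh.continuousAt.sub (continuousAt_const (y := h x))).norm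
      simpa [ContinuousAt] using this
    exact this.eventually (gt_mem_nhds (norm_pos_iff.2 h0))
  obtain ⟨ε, hε, hball⟩ := Metric.eventually_nhds_iff_ball.1 hU
  let χ : ContDiffBump x := ⟨ε / 4, ε / 2, by positivity, by linarith⟩
  have hsm : ContDiff ℝ ∞ (fun y => (χ y : ℂ) * (h y - h x)) := by
    refine contDiff_iff_contDiffAt.2 fun y => ?_
    by_cases hy' : y ∈ Metric.ball x ε
    swap
    · have hc : Metric.closedBall x (ε / 2) ⊆ Metric.ball x ε :=
        Metric.closedBall_subset_ball (by linarith)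
      have h1 : (fun y => (χ y : ℂ) * (h y - h x)) =ᶠ[𝓝 y] fun _ => 0 := by
        filter_upwards [Metric.isClosed_closedBall.isOpen_compl.mem_nhds fun h => hy' (hc h)]
          with z hz
        have : χ z = 0 := χ.zero_of_le_dist (by
          simp only [Set.mem_compl_iff, Metric.mem_closedBall, not_le] at hz
          exact hz.le)
        simp [this]
      exact contDiffAt_const.congr_of_eventuallyEq h1
    have h2 : ContDiffAt ℝ ∞ (fun y => (χ y : ℂ)) y :=
      Complex.ofRealCLM.contDiff.contDiffAt.comp y χ.contDiff.contDiffAt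
    exact h2.mul ((hball y hy').1.sub contDiffAt_const)
  have hne : ∀ y, h x + (χ y : ℂ) * (h y - h x) ≠ 0 := by
    intro y hy
    by_cases hyb : y ∈ Metric.ball x ε
    · have h1 : ‖(χ y : ℂ) * (h y - h x)‖ = ‖h x‖ := by
        rw [show (χ y : ℂ) * (h y - h x) = - h x by linear_combination hy, norm_neg]
      rw [norm_mul, Complex.norm_real, Real.norm_of_nonneg χ.nonneg] at h1
      have h2 := (hball y hyb).2
      have h3 : χ y * ‖h y - h x‖ ≤ 1 * ‖h y - h x‖ :=
        mul_le_mul_of_nonneg_right χ.le_one (norm_nonneg _)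
      linarith
    · have : χ y = 0 := χ.zero_of_le_dist (by
        simp only [Metric.mem_ball, not_lt] at hyb; simp only [χ]; linarith)
      simp [this] at hy
      exact h0 hy
  refine ⟨fun y => Units.mk0 _ (hne y), contDiff_const.add hsm, ?_⟩
  filter_upwards [χ.eventuallyEq_one] with y hy
  simp [hy]

end SmoothNear

/-! ### Monomials and integral affine maps -/

open Classical in
/-- A complex number regarded as a unit (with `1` in place of `0`). -/
def toUnit (c : ℂ) : ℂˣ := if h : c = 0 then 1 else Units.mk0 c h

theorem coe_toUnit {c : ℂ} (h : c ≠ 0) : (toUnit c : ℂ) = c := by simp [toUnit, h]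

@[simp] theorem toUnit_coe (c : ℂˣ) : toUnit (c : ℂ) = c := Units.ext (coe_toUnit c.ne_zero)

theorem toUnit_mul {a b : ℂ} (ha : a ≠ 0) (hb : b ≠ 0) : toUnit (a * b) = toUnit a * toUnit b :=
  Units.ext (by simp [coe_toUnit, ha, hb])

namespace CStarT

@[simp] theorem trop_mul (a b : CStarT) : (a * b).trop = a.trop + b.trop := rfl
@[simp] theorem trop_inv (a : CStarT) : (a⁻¹).trop = -a.trop := rfl
@[simp] theorem trop_one : (1 : CStarT).trop = 0 := rfl
@[simp] theorem trop_mk (c : ℂˣ) (x : ℝ) : (mk c x).trop = x := rfl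
@[simp] theorem mk_fst (c : ℂˣ) (x : ℝ) : (mk c x).1 = c := rfl
@[simp] theorem trop_zpow (a : CStarT) (k : ℤ) : (a ^ k).trop = k * a.trop := by
  simp [trop, toAdd_zpow]
@[simp] theorem trop_pow (a : CStarT) (k : ℕ) : (a ^ k).trop = k * a.trop := by
  simp [trop, toAdd_pow]

theorem trop_prod {ι : Type*} (t : Finset ι) (f : ι → CStarT) :
    (∏ i ∈ t, f i).trop = ∑ i ∈ t, (f i).trop := by
  classical
  induction t using Finset.induction_on with
  | empty => simp
  | insert a t ha ih => simp [Finset.prod_insert ha, Finset.sum_insert ha, ih]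

theorem ext' {a b : CStarT} (h1 : a.1 = b.1) (h2 : a.trop = b.trop) : a = b := Prod.ext h1 h2

theorem smoothPart_of_eq {z : CStarT} (h : z.trop = 0) : z.smoothPart = z.1 := by
  simp [smoothPart, h]

theorem smoothPart_of_pos {z : CStarT} (h : 0 < z.trop) : z.smoothPart = 0 := by
  simp [smoothPart, h.ne']

theorem smoothPart_mul {a b : CStarT} (ha : 0 ≤ a.trop) (hb : 0 ≤ b.trop) :
    (a * b).smoothPart = a.smoothPart * b.smoothPart := by
  by_cases h1 : a.trop = 0 <;> by_cases h2 : b.trop = 0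
  · simp [smoothPart, h1, h2]
  · simp [smoothPart, h1, h2]
  · simp [smoothPart, h1, h2]
  · have : a.trop + b.trop ≠ 0 := by
      have := lt_of_le_of_ne ha (Ne.symm h1); positivity
    simp [smoothPart, h1, this]

theorem smoothPart_mk_mul (c : ℂˣ) (a : CStarT) :
    (mk c 0 * a).smoothPart = c * a.smoothPart := by
  by_cases h1 : a.trop = 0 <;> simp [smoothPart, h1]

theorem smoothPart_ne_zero_iff {z : CStarT} : z.smoothPart ≠ 0 ↔ z.trop = 0 := by
  by_cases h : z.trop = 0 <;> simp [smoothPart, h]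

end CStarT

section Monomials

variable {m m₁ m₂ m₃ : ℕ}

theorem trop_monomial (q : IntAffine m) (z : Fin m → CStarT) :
    (monomial q z).trop = q.eval (fun i => (z i).trop) := by
  simp [monomial, CStarT.trop_prod, IntAffine.eval, mul_comm]

theorem monomial_fst (q : IntAffine m) (z : Fin m → CStarT) :
    (monomial q z).1 = ∏ i, (z i).1 ^ q.2 i := by
  simp [monomial, Prod.fst_prod]

theorem monomial_sum {ι : Type*} (t : Finset ι) (f : ι → IntAffine m) (z : Fin m → CStarT) :
    monomial (∑ i ∈ t, f i) z = ∏ i ∈ t, monomial (f i) z := by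
  classical
  induction t using Finset.induction_on with
  | empty => simp [monomial_zero]
  | insert a t ha ih => simp [Finset.prod_insert ha, Finset.sum_insert ha, ih, monomial_add]

theorem monomial_nsmul (k : ℕ) (q : IntAffine m) (z : Fin m → CStarT) :
    monomial (k • q) z = monomial q z ^ k := by
  induction k with
  | zero => simp [monomial_zero]
  | succ k ih => rw [succ_nsmul, monomial_add, ih, pow_succ]

theorem monomial_zsmul (k : ℤ) (q : IntAffine m) (z : Fin m → CStarT) :
    monomial (k • q) z = monomial q z ^ k := by
  cases k with
  | ofNat k => simpa using monomial_nsmul k q z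
  | negSucc k => rw [negSucc_zsmul, monomial_neg, monomial_nsmul, zpow_negSucc]

theorem monomial_mul (q : IntAffine m) (z w : Fin m → CStarT) :
    monomial q (fun i => z i * w i) = monomial q z * ∏ i, w i ^ q.2 i := by
  simp [monomial, mul_zpow, Finset.prod_mul_distrib, mul_assoc]

theorem monomial_const (a : ℝ) (z : Fin m → CStarT) :
    monomial ((a, 0) : IntAffine m) z = CStarT.mk 1 a := by
  simp [monomial]

/-- The coordinate function `zᵢ` as a monomial. -/
def IntAffine.coord (i : Fin m) : IntAffine m := (0, Pi.single i 1)

theorem monomial_coord (i : Fin m) (z : Fin m → CStarT) : monomial (IntAffine.coord i) z = z i := by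
  classical
  simp only [monomial, IntAffine.coord]
  rw [Finset.prod_eq_single i]
  · simp [CStarT.mk]
  · intro j _ hj; simp [Pi.single_eq_of_ne hj]
  · simp

namespace IntAffine

@[simp] theorem eval_add (q r : IntAffine m) (x : Fin m → ℝ) : (q + r).eval x = q.eval x + r.eval x := by
  simp [eval, mul_add, Finset.sum_add_distrib]; ring

@[simp] theorem eval_zero (x : Fin m → ℝ) : (0 : IntAffine m).eval x = 0 := by simp [eval]

@[simp] theorem eval_neg (q : IntAffine m) (x : Fin m → ℝ) : (-q).eval x = -q.eval x := by
  simp [eval]; ring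

@[simp] theorem eval_nsmul (k : ℕ) (q : IntAffine m) (x : Fin m → ℝ) : (k • q).eval x = k * q.eval x := by
  simp [eval, mul_add, Finset.mul_sum]; refine Finset.sum_congr rfl fun i _ => by ring

@[simp] theorem eval_zsmul (k : ℤ) (q : IntAffine m) (x : Fin m → ℝ) : (k • q).eval x = k * q.eval x := by
  simp [eval, mul_add, Finset.mul_sum]; refine Finset.sum_congr rfl fun i _ => by ring

theorem eval_sum {ι : Type*} (t : Finset ι) (f : ι → IntAffine m) (x : Fin m → ℝ) :
    (∑ i ∈ t, f i).eval x = ∑ i ∈ t, (f i).eval x := by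
  classical
  induction t using Finset.induction_on with
  | empty => simp
  | insert a t ha ih => simp [Finset.sum_insert ha, ih]

@[simp] theorem eval_const (a : ℝ) (x : Fin m → ℝ) : IntAffine.eval ((a, 0) : IntAffine m) x = a := by
  simp [eval]

@[simp] theorem eval_coord (i : Fin m) (x : Fin m → ℝ) : (coord i).eval x = x i := by
  classical
  simp [eval, coord, Pi.single_apply]

theorem continuous_eval (q : IntAffine m) : Continuous q.eval := by
  unfold eval; fun_prop

/-- The linear part of an integral affine function. -/
def lin (q : IntAffine m) (x : Fin m → ℝ) : ℝ := ∑ i, x i * (q.2 i : ℝ)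

theorem eval_add_vec (q : IntAffine m) (x y : Fin m → ℝ) : q.eval (x + y) = q.eval x + q.lin y := by
  simp [eval, lin, add_mul, Finset.sum_add_distrib]; ring

theorem lin_smul (q : IntAffine m) (c : ℝ) (y : Fin m → ℝ) : q.lin (c • y) = c * q.lin y := by
  simp [lin, Finset.mul_sum, mul_assoc]

theorem lin_add (q : IntAffine m) (x y : Fin m → ℝ) : q.lin (x + y) = q.lin x + q.lin y := by
  simp [lin, add_mul, Finset.sum_add_distrib]

theorem lin_sub (q : IntAffine m) (x y : Fin m → ℝ) : q.lin (x - y) = q.eval x - q.eval y := by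
  simp [lin, eval, sub_mul, Finset.sum_sub_distrib]

/-- The composition of an integral affine function with an integral affine map. -/
def comp (q : IntAffine m₂) (M : Fin m₂ → IntAffine m₁) : IntAffine m₁ :=
  ((q.1, 0) : IntAffine m₁) + ∑ j, q.2 j • M j

/-- The affine map given by a family of integral affine functions. -/
def aff (M : Fin m₂ → IntAffine m₁) (x : Fin m₁ → ℝ) : Fin m₂ → ℝ := fun j => (M j).eval x

theorem eval_comp (q : IntAffine m₂) (M : Fin m₂ → IntAffine m₁) (x : Fin m₁ → ℝ) :
    (q.comp M).eval x = q.eval (aff M x) := by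
  rw [comp, eval_add, eval_const, eval_sum]
  simp only [eval_zsmul]
  simp [eval, aff, mul_comm]

theorem continuous_aff (M : Fin m₂ → IntAffine m₁) : Continuous (aff M) :=
  continuous_pi fun _ => continuous_eval _

end IntAffine

/-- The monomial map given by a family of monomials. -/
def monMap (M : Fin m₂ → IntAffine m₁) (z : Fin m₁ → CStarT) : Fin m₂ → CStarT :=
  fun j => monomial (M j) z

theorem monomial_comp (q : IntAffine m₂) (M : Fin m₂ → IntAffine m₁) (z : Fin m₁ → CStarT) :
    monomial (q.comp M) z = monomial q (monMap M z) := by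
  rw [IntAffine.comp, monomial_add, monomial_const, monomial_sum]
  simp only [monomial_zsmul]
  rfl

/-- The tuple of exponents. -/
def tropv (z : Fin m → CStarT) : Fin m → ℝ := fun i => (z i).trop

theorem tropv_monMap (M : Fin m₂ → IntAffine m₁) (z : Fin m₁ → CStarT) :
    tropv (monMap M z) = IntAffine.aff M (tropv z) := by
  funext j; exact trop_monomial _ _

end Monomials

/-! ### Coordinates and smooth germs on the models -/

section Model

variable {n m : ℕ} {P : Set (Fin m → ℝ)}

/-- The coordinates in `ℝⁿ`. -/
def xc (p : model n P) : Fin n → ℝ := p.1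

/-- The coordinates in `(ℂ^*𝔱^ℝ)ᵐ`. -/
def zc (p : model n P) : Fin m → CStarT := p.2.1

/-- The exponents of the coordinates. -/
def tc (p : model n P) : Fin m → ℝ := tropv (zc p)

theorem tc_mem (p : model n P) : tc p ∈ P := p.2.2

/-- The point with given coordinates. -/
def mkPt (x : Fin n → ℝ) (z : Fin m → CStarT) (h : tropv z ∈ P) : model n P := (x, ⟨z, h⟩)

@[simp] theorem xc_mkPt (x : Fin n → ℝ) (z : Fin m → CStarT) (h : tropv z ∈ P) :
    xc (mkPt x z h) = x := rfl

@[simp] theorem zc_mkPt (x : Fin n → ℝ) (z : Fin m → CStarT) (h : tropv z ∈ P) :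
    zc (mkPt x z h) = z := rfl

@[simp] theorem tc_mkPt (x : Fin n → ℝ) (z : Fin m → CStarT) (h : tropv z ∈ P) :
    tc (mkPt x z h) = tropv z := rfl

theorem model_ext {p p' : model n P} (h1 : xc p = xc p') (h2 : zc p = zc p') : p = p' :=
  Prod.ext h1 (Subtype.ext h2)

/-- The smooth monomials. -/
def smon (q : NonnegMonomial P) (p : model n P) : ℂ := (monomial q.1 (zc p)).smoothPart

theorem trop_monomial_zc (q : IntAffine m) (p : model n P) :
    (monomial q (zc p)).trop = q.eval (tc p) := trop_monomial _ _

/-- The coordinates together with finitely many smooth monomials. -/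
def coords (s : Finset (NonnegMonomial P)) (p : model n P) : (Fin n → ℝ) × (s → ℂ) :=
  (xc p, fun i => smon i.1 p)

theorem continuous_xc_smon :
    Continuous (fun p : model n P => (xc p, fun q : NonnegMonomial P => smon q p)) :=
  continuous_induced_dom

theorem nhds_model (p : model n P) :
    𝓝 p = (𝓝 (xc p, fun q : NonnegMonomial P => smon q p)).comap
      (fun p => (xc p, fun q : NonnegMonomial P => smon q p)) := nhds_induced _ _

theorem continuous_xc : Continuous (xc : model n P → _) := continuous_xc_smon.fst

theorem continuous_smon (q : NonnegMonomial P) : Continuous (smon q : model n P → ℂ) :=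
  (continuous_apply q).comp continuous_xc_smon.snd

theorem continuous_coords (s : Finset (NonnegMonomial P)) :
    Continuous (coords s : model n P → _) :=
  continuous_xc.prodMk (continuous_pi fun _ => continuous_smon _)

theorem tendsto_model_iff {ι : Type*} {l : Filter ι} {f : ι → model n P} {p : model n P} :
    Tendsto f l (𝓝 p) ↔ Tendsto (fun i => xc (f i)) l (𝓝 (xc p)) ∧
      ∀ q : NonnegMonomial P, Tendsto (fun i => smon q (f i)) l (𝓝 (smon q p)) := by
  rw [nhds_model, tendsto_comap_iff, nhds_prod_eq, tendsto_prod_iff']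
  exact and_congr Iff.rfl tendsto_pi_nhds

/-- The topology is induced from an infinite product, so a neighbourhood constrains only finitely
many smooth monomials. -/
theorem exists_coords_nhds {p : model n P} {W : Set (model n P)} (hW : W ∈ 𝓝 p) :
    ∃ (s : Finset (NonnegMonomial P)) (ε : ℝ), 0 < ε ∧ ∀ e : model n P,
      (∀ i, |xc e i - xc p i| < ε) → (∀ q ∈ s, ‖smon q e - smon q p‖ < ε) → e ∈ W := by
  rw [nhds_model, mem_comap] at hW
  obtain ⟨V, hV, hVW⟩ := hW
  rw [nhds_prod_eq, mem_prod_iff] at hV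
  obtain ⟨A, hA, B, hB, hAB⟩ := hV
  rw [nhds_pi, mem_pi'] at hB
  obtain ⟨s, t, ht, hB⟩ := hB
  obtain ⟨ε₁, h₁, hA⟩ := Metric.mem_nhds_iff.1 hA
  have hε : ∀ s' : Finset (NonnegMonomial P), ∃ ε : ℝ, 0 < ε ∧
      ∀ q ∈ s', Metric.ball (smon q p) ε ⊆ t q := by
    classical
    intro s'
    induction s' using Finset.induction_on with
    | empty => exact ⟨1, one_pos, by simp⟩
    | insert a s' _ ih =>
      obtain ⟨ε, hε, h⟩ := ih
      obtain ⟨δ, hδ, h'⟩ := Metric.mem_nhds_iff.1 (ht a)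
      refine ⟨min ε δ, lt_min hε hδ, fun q hq => ?_⟩
      rcases Finset.mem_insert.1 hq with rfl | hq
      · exact (Metric.ball_subset_ball (min_le_right _ _)).trans h'
      · exact (Metric.ball_subset_ball (min_le_left _ _)).trans (h q hq)
  obtain ⟨ε₂, h₂, hε⟩ := hε s
  refine ⟨s, min ε₁ ε₂, lt_min h₁ h₂, fun e hx hz => hVW (hAB ⟨hA ?_, hB ?_⟩)⟩
  · rw [Metric.mem_ball, dist_pi_lt_iff h₁]
    exact fun i => (hx i).trans_le (min_le_left _ _)
  · intro q hq
    refine hε q hq ?_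
    rw [Metric.mem_ball, dist_eq_norm]
    exact (hz q hq).trans_le (min_le_right _ _)

variable {V W : Type*} [NormedAddCommGroup V] [NormedSpace ℝ V] [NormedAddCommGroup W]
  [NormedSpace ℝ W]

/-- `f` is near `p` a smooth function of the coordinates and finitely many smooth monomials. -/
def SmM (f : model n P → V) (p : model n P) : Prop :=
  ∃ (s : Finset (NonnegMonomial P)) (h : (Fin n → ℝ) × (s → ℂ) → V),
    SmoothNear h (coords s p) ∧ f =ᶠ[𝓝 p] fun e => h (coords s e)

theorem SmM.congr {f g : model n P → V} {p : model n P} (hf : SmM f p) (h : f =ᶠ[𝓝 p] g) :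
    SmM g p := by
  obtain ⟨s, k, hk, hf⟩ := hf
  exact ⟨s, k, hk, h.symm.trans hf⟩

theorem SmM.continuousAt {f : model n P → V} {p : model n P} (hf : SmM f p) :
    ContinuousAt f p := by
  obtain ⟨s, h, hh, hf⟩ := hf
  exact ContinuousAt.congr (ContinuousAt.comp (g := h) hh.continuousAt
    (continuous_coords s).continuousAt) hf.symm

theorem SmM.comp {g : V → W} {f : model n P → V} {p : model n P} (hg : SmoothNear g (f p))
    (hf : SmM f p) : SmM (fun e => g (f e)) p := by
  obtain ⟨s, h, hh, hf⟩ := hf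
  rw [hf.eq_of_nhds] at hg
  exact ⟨s, fun y => g (h y), hg.comp hh, hf.fun_comp g⟩

theorem smM_const (c : V) (p : model n P) : SmM (fun _ => c) p :=
  ⟨∅, fun _ => c, contDiff_const.smoothNear _, EventuallyEq.rfl⟩

theorem smM_coords (s : Finset (NonnegMonomial P)) (p : model n P) : SmM (coords s) p :=
  ⟨s, fun y => y, contDiff_id.smoothNear _, EventuallyEq.rfl⟩

theorem smM_xc (p : model n P) : SmM (xc : model n P → _) p :=
  ⟨∅, Prod.fst, contDiff_fst.smoothNear _, EventuallyEq.rfl⟩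

theorem smM_smon (q : NonnegMonomial P) (p : model n P) : SmM (smon q) p := by
  classical
  exact ⟨{q}, fun y => y.2 ⟨q, by simp⟩, ContDiff.smoothNear (by fun_prop) _, EventuallyEq.rfl⟩

theorem SmM.pi {ι : Type*} [Fintype ι] {f : model n P → ι → V} {p : model n P}
    (hf : ∀ i, SmM (fun e => f e i) p) : SmM f p := by
  classical
  choose s h hh hf using hf
  let t := Finset.univ.biUnion s
  have ht : ∀ i, ∀ j : s i, j.1 ∈ t := fun i j =>
    Finset.mem_biUnion.2 ⟨i, Finset.mem_univ _, j.2⟩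
  refine ⟨t, fun y i => h i (y.1, fun j => y.2 ⟨j.1, ht i j⟩), ?_, ?_⟩
  · refine SmoothNear.pi fun i => ?_
    refine SmoothNear.comp (g := h i) (hh i) (ContDiff.smoothNear (by fun_prop) _)
  · filter_upwards [eventually_all.2 hf] with e he
    funext i
    exact he i

theorem SmM.prodMk {f : model n P → V} {g : model n P → W} {p : model n P}
    (hf : SmM f p) (hg : SmM g p) : SmM (fun e => (f e, g e)) p := by
  classical
  obtain ⟨s, h, hh, hf⟩ := hf
  obtain ⟨t, k, hk, hg⟩ := hg
  refine ⟨s ∪ t, fun y => (h (y.1, fun j => y.2 ⟨j.1, Finset.mem_union_left _ j.2⟩),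
    k (y.1, fun j => y.2 ⟨j.1, Finset.mem_union_right _ j.2⟩)), ?_, ?_⟩
  · exact SmoothNear.prodMk
      (SmoothNear.comp (g := h) hh (ContDiff.smoothNear (by fun_prop) _))
      (SmoothNear.comp (g := k) hk (ContDiff.smoothNear (by fun_prop) _))
  · filter_upwards [hf, hg] with e h1 h2
    rw [h1, h2]
    rfl

theorem SmM.mul {f g : model n P → ℂ} {p : model n P} (hf : SmM f p) (hg : SmM g p) :
    SmM (fun e => f e * g e) p :=
  SmM.comp (g := fun y : ℂ × ℂ => y.1 * y.2) (ContDiff.smoothNear (by fun_prop) _) (hf.prodMk hg)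

theorem SmM.inv {f : model n P → ℂ} {p : model n P} (hf : SmM f p) (h0 : f p ≠ 0) :
    SmM (fun e => (f e)⁻¹) p := by
  refine SmM.comp (g := fun y : ℂ => y⁻¹) ?_ hf
  filter_upwards [isOpen_ne.mem_nhds h0] with y hy
  exact contDiffAt_inv ℝ hy

theorem SmM.prod {ι : Type*} (t : Finset ι) {f : ι → model n P → ℂ} {p : model n P}
    (hf : ∀ i ∈ t, SmM (f i) p) : SmM (fun e => ∏ i ∈ t, f i e) p := by
  classical
  induction t using Finset.induction_on with
  | empty => simpa using smM_const 1 p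
  | insert a t ha ih =>
    simp only [Finset.prod_insert ha]
    exact (hf a (by simp)).mul (ih fun i hi => hf i (by simp [hi]))

theorem SmM.pow {f : model n P → ℂ} {p : model n P} (hf : SmM f p) (k : ℕ) :
    SmM (fun e => f e ^ k) p :=
  SmM.comp (g := fun y : ℂ => y ^ k) (ContDiff.smoothNear (by fun_prop) _) hf

theorem SmM.zpow {f : model n P → ℂ} {p : model n P} (hf : SmM f p) (h0 : f p ≠ 0) (k : ℤ) :
    SmM (fun e => f e ^ k) p := by
  cases k with
  | ofNat k => simpa using hf.pow k
  | negSucc k => simpa using ((hf.pow (k + 1)).inv (pow_ne_zero _ h0))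

theorem secAt_ofSubgroup {X : Type*} [TopologicalSpace X] {K : Subgroup (X → CStarT)} {hK}
    {F : X → CStarT} {p : X} :
    SecAt (AbstractExplodedSpace.ofSubgroup X K hK) F p ↔ ∃ k ∈ K, F =ᶠ[𝓝 p] k := by
  constructor
  · rintro ⟨U, hU, hF⟩
    obtain ⟨V, hV, k, hk, h⟩ := hF ⟨p, hU⟩
    refine ⟨k, hk, ?_⟩
    filter_upwards [U.isOpen.mem_nhds hU, V.isOpen.mem_nhds hV] with x h1 h2
    exact h ⟨x, h1⟩ h2
  · rintro ⟨k, hk, h⟩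
    obtain ⟨V, hV, hVo, hpV⟩ := eventually_nhds_iff.1 h
    exact ⟨⟨V, hVo⟩, hpV, fun x => ⟨⟨V, hVo⟩, x.2, k, hk, fun y hy => hV _ hy⟩⟩

/-- Working with a complex-valued `H` that is nonzero at `p`, and with `toUnit`, keeps all calculus
in normed spaces. Passing back to a globally defined unit is `exists_contDiff_extension`. -/
theorem secAt_model_iff {F : model n P → CStarT} {p : model n P} :
    SecAt (model n P) F p ↔ ∃ (H : model n P → ℂ) (q : IntAffine m), SmM H p ∧ H p ≠ 0 ∧
      ∀ᶠ e in 𝓝 p, F e = CStarT.mk (toUnit (H e)) 0 * monomial q (zc e) := by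
  refine secAt_ofSubgroup.trans ⟨?_, ?_⟩
  · rintro ⟨_, ⟨s, h, q, hh, hF'⟩, hF⟩
    refine ⟨fun e => (h (coords s e) : ℂ), q, ⟨s, _, hh.smoothNear _, EventuallyEq.rfl⟩,
      (h _).ne_zero, ?_⟩
    filter_upwards [hF] with e he
    exact he.trans ((hF' e).trans (by rw [toUnit_coe]; rfl))
  · rintro ⟨H, q, ⟨s, h, hh, hH⟩, h0, hF⟩
    rw [hH.eq_of_nhds] at h0
    obtain ⟨k, hk, hkh⟩ := exists_contDiff_extension hh h0
    refine ⟨_, ⟨s, k, q, hk, fun p => rfl⟩, ?_⟩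
    filter_upwards [hF, hH, (continuous_coords s).continuousAt.eventually hkh] with e h1 h2 h3
    rw [h1, h2, ← h3, toUnit_coe]
    rfl

theorem secAt_unit {H : model n P → ℂ} {p : model n P} (hH : SmM H p) (h0 : H p ≠ 0) :
    SecAt (model n P) (fun e => CStarT.mk (toUnit (H e)) 0) p :=
  secAt_model_iff.2 ⟨H, 0, hH, h0, Eventually.of_forall fun e => by
    rw [monomial_zero, mul_one]⟩

theorem secAt_monomial (q : IntAffine m) (p : model n P) :
    SecAt (model n P) (fun e => monomial q (zc e)) p :=
  secAt_model_iff.2 ⟨fun _ => 1, q, smM_const 1 p, one_ne_zero, Eventually.of_forall fun e => by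
    rw [show (1 : ℂ) = ((1 : ℂˣ) : ℂ) from rfl, toUnit_coe]
    exact (one_mul _).symm⟩

theorem secAt_zc (i : Fin m) (p : model n P) : SecAt (model n P) (fun e => zc e i) p := by
  simpa only [monomial_coord] using secAt_monomial (n := n) (P := P) (IntAffine.coord i) p

/-- A criterion for a map to a model to be a morphism at a point. -/
theorem morAt_model {X : AbstractExplodedSpace.{u}} {Φ : X → model n P} {e : X}
    (hx : ContinuousAt (fun x => xc (Φ x)) e)
    (hs : ∀ q : NonnegMonomial P, ContinuousAt (fun x => smon q (Φ x)) e)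
    (hu : ∀ (s : Finset (NonnegMonomial P)) (h : (Fin n → ℝ) × (s → ℂ) → ℂ),
      SmoothNear h (coords s (Φ e)) → h (coords s (Φ e)) ≠ 0 →
        SecAt X (fun x => CStarT.mk (toUnit (h (coords s (Φ x)))) 0) e)
    (hz : ∀ i, SecAt X (fun x => zc (Φ x) i) e) : MorAt X (model n P) Φ e := by
  have hc : ContinuousAt Φ e := tendsto_model_iff.2 ⟨hx, hs⟩
  refine ⟨hc, fun F hF => ?_⟩
  obtain ⟨H, q, ⟨s, h, hh, hH⟩, h0, hF⟩ := secAt_model_iff.1 hF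
  rw [hH.eq_of_nhds] at h0
  refine ((hu s h hh h0).mul (SecAt.monomial q hz)).congr ?_
  filter_upwards [hc.eventually hF, hc.eventually hH] with x h1 h2
  rw [h1, h2]

end Model

/-! ### Morphisms between models. -/

section ModelMaps

variable {n₁ m₁ n₂ m₂ : ℕ} {P₁ : Set (Fin m₁ → ℝ)} {P₂ : Set (Fin m₂ → ℝ)}

theorem morAt_model_model {Φ : model n₁ P₁ → model n₂ P₂} {e : model n₁ P₁}
    (hx : SmM (fun x => xc (Φ x)) e)
    (hs : ∀ q : NonnegMonomial P₂, SmM (fun x => smon q (Φ x)) e)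
    (hz : ∀ i, SecAt (model n₁ P₁) (fun x => zc (Φ x) i) e) :
    MorAt (model n₁ P₁) (model n₂ P₂) Φ e := by
  refine morAt_model hx.continuousAt (fun q => (hs q).continuousAt) (fun s h hh h0 => ?_) hz
  have hc : SmM (fun x => coords s (Φ x)) e := hx.prodMk (SmM.pi fun i => hs i.1)
  exact secAt_unit (SmM.comp (g := h) hh hc) h0

/-- The maps `(x, z) ↦ (X(x, ζ), U(x, ζ) zᴹ)` are morphisms. -/
theorem morAt_explicit {Φ : model n₁ P₁ → model n₂ P₂} {e : model n₁ P₁}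
    {U : Fin m₂ → model n₁ P₁ → ℂ} {M : Fin m₂ → IntAffine m₁}
    (hx : SmM (fun x => xc (Φ x)) e) (hU : ∀ j, SmM (U j) e) (hU0 : ∀ j, U j e ≠ 0)
    (hz : ∀ᶠ x in 𝓝 e, ∀ j,
      zc (Φ x) j = CStarT.mk (toUnit (U j x)) 0 * monomial (M j) (zc x))
    (hM : Set.MapsTo (IntAffine.aff M) P₁ P₂) :
    MorAt (model n₁ P₁) (model n₂ P₂) Φ e := by
  have hne : ∀ᶠ x in 𝓝 e, ∀ j, U j x ≠ 0 :=
    eventually_all.2 fun j => (hU j).continuousAt.eventually (isOpen_ne.mem_nhds (hU0 j))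
  refine morAt_model_model hx (fun q => ?_) fun i =>
    secAt_model_iff.2 ⟨U i, M i, hU i, hU0 i, hz.mono fun x h => h i⟩
  -- A smooth monomial `q` pulls back to a unit times `q ∘ M`, which is again a smooth monomial
  -- because `M` maps `P₁` into `P₂`.
  let r : NonnegMonomial P₁ := ⟨q.1.comp M, fun y hy => by
    rw [IntAffine.eval_comp]; exact q.2 _ (hM hy)⟩
  have : SmM (fun x => (∏ j, U j x ^ q.1.2 j) * smon r x) e :=
    (SmM.prod _ fun j _ => (hU j).zpow (hU0 j) _).mul (smM_smon r e)
  refine this.congr ?_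
  filter_upwards [hz, hne] with x h1 h2
  have h3 : zc (Φ x) = fun j => monMap M (zc x) j * CStarT.mk (toUnit (U j x)) 0 := by
    funext j; rw [h1 j, mul_comm]; rfl
  have h4 : ∏ i, CStarT.mk (toUnit (U i x)) 0 ^ q.1.2 i =
      CStarT.mk (∏ i, toUnit (U i x) ^ q.1.2 i) 0 := by
    refine CStarT.ext' ?_ ?_
    · simp [Prod.fst_prod]
    · simp [CStarT.trop_prod]
  rw [smon, smon, h3, monomial_mul, h4, mul_comm (monomial _ _), CStarT.smoothPart_mk_mul, monomial_comp]
  congr 1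
  simp only [Units.coe_prod, Units.val_zpow_eq_zpow_val]
  exact Finset.prod_congr rfl fun j _ => by rw [coe_toUnit (h2 j)]

end ModelMaps

/-! ### Real and complex smooth germs, described by exploded functions -/

section Smooth

variable {X : AbstractExplodedSpace.{u₁}} {Y : AbstractExplodedSpace.{u₂}}

/-- The exponential of a real function is an exploded function near `p`. -/
def RSm (X : AbstractExplodedSpace.{u₁}) (φ : X → ℝ) (p : X) : Prop :=
  SecAt X (fun x => CStarT.mk (toUnit (Real.exp (φ x) : ℂ)) 0) p

/-- A complex function with smooth real and imaginary part near `p`. -/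
def CSm (X : AbstractExplodedSpace.{u₁}) (f : X → ℂ) (p : X) : Prop :=
  RSm X (fun x => (f x).re) p ∧ RSm X (fun x => (f x).im) p

theorem RSm.congr {φ φ' : X → ℝ} {p : X} (h : RSm X φ p) (he : φ =ᶠ[𝓝 p] φ') : RSm X φ' p :=
  SecAt.congr h (he.fun_comp fun t : ℝ => CStarT.mk (toUnit (Real.exp t : ℂ)) 0)

theorem CSm.congr {φ φ' : X → ℂ} {p : X} (h : CSm X φ p) (he : φ =ᶠ[𝓝 p] φ') : CSm X φ' p :=
  ⟨h.1.congr (he.fun_comp Complex.re), h.2.congr (he.fun_comp Complex.im)⟩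

theorem RSm.pull {f : X → Y} {p : X} (hf : MorAt X Y f p) {φ : Y → ℝ} (h : RSm Y φ (f p)) :
    RSm X (fun x => φ (f x)) p := hf.2 _ h

theorem CSm.pull {f : X → Y} {p : X} (hf : MorAt X Y f p) {φ : Y → ℂ} (h : CSm Y φ (f p)) :
    CSm X (fun x => φ (f x)) p := ⟨h.1.pull hf, h.2.pull hf⟩

theorem RSm.eventually {φ : X → ℝ} {p : X} (h : RSm X φ p) : ∀ᶠ x in 𝓝 p, RSm X φ x :=
  SecAt.eventually h

/-- The properties of points of exploded manifolds that make smooth functions behave well. -/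
structure Nice (X : AbstractExplodedSpace.{u₁}) (e : X) : Prop where
  comp : ∀ {n : ℕ} {ι : Type} [Fintype ι] (φ : X → Fin n → ℝ) (ψ : X → ι → ℂ)
    (H : (Fin n → ℝ) × (ι → ℂ) → ℂ), (∀ i, RSm X (fun x => φ x i) e) →
    (∀ i, CSm X (fun x => ψ x i) e) → SmoothNear H (φ e, ψ e) → H (φ e, ψ e) ≠ 0 →
    SecAt X (fun x => CStarT.mk (toUnit (H (φ x, ψ x))) 0) e
  smooth : ∀ {w : X → CStarT}, SecAt X w e → (∀ᶠ x in 𝓝 e, 0 ≤ (w x).trop) →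
    CSm X (fun x => (w x).smoothPart) e
  continuousAt : ∀ {φ : X → ℝ}, RSm X φ e → ContinuousAt φ e

theorem Nice.continuousAt_complex {e : X} (h : Nice X e) {f : X → ℂ} (hf : CSm X f e) :
    ContinuousAt f e := by
  have h1 := h.continuousAt hf.1
  have h2 := h.continuousAt hf.2
  have h3 : ContinuousAt (fun x => ((f x).re : ℂ) + ((f x).im : ℂ) * Complex.I) e :=
    (Complex.continuous_ofReal.continuousAt.comp h1).add
      ((Complex.continuous_ofReal.continuousAt.comp h2).mul continuousAt_const)
  simpa only [Complex.re_add_im] using h3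

theorem LocIso.nice {φ : X → Y} {ψ : Y → X} {x : X} {y : Y} (h : LocIso X Y φ ψ x y)
    (hY : Nice Y y) : Nice X x := by
  obtain ⟨hxy, hyx, hφ, hψ, hl, -⟩ := h
  have hψy := hψ.self_of_nhds
  have hφx := hφ.self_of_nhds
  subst hxy
  have hle : ∀ {Z : Type} (f : X → Z), (fun a => f (ψ (φ a))) =ᶠ[𝓝 x] f := fun f =>
    hl.mono fun a ha => congrArg f ha
  refine ⟨fun {n ι _} f g H hf hg hH h0 => ?_, fun {w} hw hpos => ?_, fun {f} hf => ?_⟩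
  · have key := hY.comp (fun y => f (ψ y)) (fun y => g (ψ y)) H
      (fun i => RSm.pull (φ := fun x => f x i) hψy (by rw [hyx]; exact hf i))
      (fun i => CSm.pull (φ := fun x => g x i) hψy (by rw [hyx]; exact hg i))
      (by rw [hyx]; exact hH) (by rw [hyx]; exact h0)
    exact (hφx.2 _ key).congr (hle fun a => CStarT.mk (toUnit (H (f a, g a))) 0)
  · have hw' : SecAt Y (fun y => w (ψ y)) (φ x) := hψy.2 _ (by rw [hyx]; exact hw)
    have hc := hψy.1
    rw [ContinuousAt, hyx] at hc
    have key := hY.smooth hw' (hc.eventually hpos)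
    exact (CSm.pull hφx key).congr (hle fun a => (w a).smoothPart)
  · have key := hY.continuousAt (RSm.pull (φ := f) hψy (by rw [hyx]; exact hf))
    exact (ContinuousAt.comp (g := fun y => f (ψ y)) key hφx.1).congr (hle f)

variable {n m : ℕ} {P : Set (Fin m → ℝ)}

theorem smoothNear_exp (t : ℝ) : SmoothNear (fun t : ℝ => (Real.exp t : ℂ)) t :=
  ContDiff.smoothNear (Complex.ofRealCLM.contDiff.comp Real.contDiff_exp) t

theorem SmM.rSm {φ : model n P → ℝ} {p : model n P} (h : SmM φ p) : RSm (model n P) φ p :=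
  secAt_unit (H := fun x => (Real.exp (φ x) : ℂ)) (SmM.comp (g := fun t : ℝ => (Real.exp t : ℂ)) (smoothNear_exp _) h)
    (by simp)

theorem smM_xc_apply (i : Fin n) (p : model n P) : SmM (fun e : model n P => xc e i) p :=
  SmM.comp (g := fun x : Fin n → ℝ => x i) (ContDiff.smoothNear (by fun_prop) _) (smM_xc p)

theorem rSm_xc (i : Fin n) (p : model n P) : RSm (model n P) (fun e => xc e i) p :=
  (smM_xc_apply i p).rSm

/-- Maps to models given by smooth functions and exploded functions are morphisms. -/
theorem Nice.morAt {e : X} (h : Nice X e) {Φ : X → model n P}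
    (hx : ∀ i, RSm X (fun x => xc (Φ x) i) e) (hz : ∀ i, SecAt X (fun x => zc (Φ x) i) e) :
    MorAt X (model n P) Φ e := by
  have hs : ∀ q : NonnegMonomial P, CSm X (fun x => smon q (Φ x)) e := fun q =>
    h.smooth (SecAt.monomial q.1 hz) (Eventually.of_forall fun x => by
      rw [trop_monomial_zc]; exact q.2 _ (tc_mem _))
  refine morAt_model (continuousAt_pi.2 fun i => h.continuousAt (hx i))
    (fun q => h.continuousAt_complex (hs q)) (fun s k hk h0 => ?_) hz
  exact h.comp (fun x => xc (Φ x)) (fun x (i : s) => smon i.1 (Φ x)) k hx (fun i => hs i.1) hk h0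

/-! ### Relative interior points -/

/-- `y` lies in no proper face of `P`. -/
def RelInt {m : ℕ} (P : Set (Fin m → ℝ)) (y : Fin m → ℝ) : Prop :=
  ∀ q : IntAffine m, (∀ x ∈ P, 0 ≤ q.eval x) → q.eval y = 0 → ∀ x ∈ P, q.eval x = 0

/-- Multiplication of the coordinates by positive real numbers, with change of exponents. -/
def scalePt (c : Fin m → ℝ) (y : Fin m → ℝ) (z : Fin m → CStarT) : Fin m → CStarT :=
  fun i => CStarT.mk (toUnit (Real.exp (c i) : ℂ) * (z i).1) (y i)

theorem monomial_scalePt_fst (q : IntAffine m) (c y : Fin m → ℝ) (z : Fin m → CStarT) :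
    ((monomial q (scalePt c y z)).1 : ℂ) = Real.exp (q.lin c) * (monomial q z).1 := by
  rw [monomial_fst, monomial_fst]
  simp only [scalePt, CStarT.mk_fst, mul_zpow, Finset.prod_mul_distrib, Units.val_mul,
    Units.coe_prod, Units.val_zpow_eq_zpow_val]
  congr 1
  rw [IntAffine.lin, Real.exp_sum, Complex.ofReal_prod]
  refine Finset.prod_congr rfl fun i _ => ?_
  rw [coe_toUnit (by simp), mul_comm, Complex.ofReal_exp, Complex.ofReal_exp, Complex.ofReal_mul,
    Complex.ofReal_intCast, Complex.exp_int_mul]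

/-- Near a point with exponent in the relative interior of `P` there are points with any exponent in
`P`. -/
theorem exists_near_of_relInt {p : model n P} (hp : RelInt P (tc p)) {W : Set (model n P)}
    (hW : W ∈ 𝓝 p) {y : Fin m → ℝ} (hy : y ∈ P) : ∃ e ∈ W, tc e = y ∧ xc e = xc p := by
  -- All points of this curve have exponent `y`, and the coefficients are scaled by `exp (T (y - tc
  -- p))`. A monomial vanishing at `tc p` vanishes on `P` and is unchanged by the scaling. A
  -- monomial `q` with `q(tc p) > 0` and `q(y) = 0` is scaled by `exp (-T q(tc p))`, so it tends to
  -- zero as it should.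
  let γ : ℝ → model n P := fun T => mkPt (xc p) (scalePt (T • (y - tc p)) y (zc p)) hy
  have hγz : ∀ T, zc (γ T) = scalePt (T • (y - tc p)) y (zc p) := fun _ => rfl
  have hγ : Tendsto γ atTop (𝓝 p) := by
    refine tendsto_model_iff.2 ⟨tendsto_const_nhds, fun q => ?_⟩
    by_cases h0 : q.1.eval (tc p) = 0
    · have hz := hp q.1 q.2 h0
      have : (fun T => smon q (γ T)) = fun _ => smon q p := by
        funext T
        have h1 : (monomial q.1 (zc (γ T))).trop = 0 := by rw [trop_monomial_zc]; exact hz _ hy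
        have h2 : (monomial q.1 (zc p)).trop = 0 := by rw [trop_monomial_zc]; exact h0
        rw [smon, smon, CStarT.smoothPart_of_eq h1, CStarT.smoothPart_of_eq h2]
        rw [hγz, monomial_scalePt_fst, IntAffine.lin_smul, IntAffine.lin_sub, h0, hz y hy]
        simp
      rw [this]
      exact tendsto_const_nhds
    · have hpos : 0 < q.1.eval (tc p) := lt_of_le_of_ne (q.2 _ (tc_mem p)) (Ne.symm h0)
      have h2 : smon q p = 0 := CStarT.smoothPart_of_pos (by rw [trop_monomial_zc]; exact hpos)
      rw [h2]
      by_cases hy0 : q.1.eval y = 0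
      · rw [tendsto_zero_iff_norm_tendsto_zero]
        have : (fun T => ‖smon q (γ T)‖) = fun T =>
            Real.exp (-(q.1.eval (tc p) * T)) * ‖((monomial q.1 (zc p)).1 : ℂ)‖ := by
          funext T
          have h1 : (monomial q.1 (zc (γ T))).trop = 0 := by rw [trop_monomial_zc]; exact hy0
          rw [smon, CStarT.smoothPart_of_eq h1]
          rw [hγz, monomial_scalePt_fst, norm_mul, Complex.norm_real, Real.norm_eq_abs, Real.abs_exp,
            IntAffine.lin_smul, IntAffine.lin_sub, hy0]
          congr 2
          ring
        rw [this]
        have h3 : Tendsto (fun T : ℝ => Real.exp (-(q.1.eval (tc p) * T))) atTop (𝓝 0) :=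
          Real.tendsto_exp_neg_atTop_nhds_zero.comp (tendsto_id.const_mul_atTop hpos)
        simpa using h3.mul_const _
      · have : (fun T => smon q (γ T)) = fun _ => 0 := by
          funext T
          refine CStarT.smoothPart_of_pos ?_
          rw [trop_monomial_zc]
          exact lt_of_le_of_ne (q.2 _ hy) (Ne.symm hy0)
        rw [this]
        exact tendsto_const_nhds
  obtain ⟨T, hT⟩ := (hγ.eventually hW).exists
  exact ⟨γ T, hT, rfl, rfl⟩

theorem smon_eq_coeff {q : NonnegMonomial P} (hq : ∀ x ∈ P, q.1.eval x = 0) (e : model n P) :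
    smon q e = (monomial q.1 (zc e)).1 :=
  CStarT.smoothPart_of_eq (by rw [trop_monomial_zc]; exact hq _ (tc_mem e))

theorem smoothNear_log_norm {c : ℂ} (hc : c ≠ 0) : SmoothNear (fun c : ℂ => Real.log ‖c‖) c := by
  filter_upwards [isOpen_ne.mem_nhds hc] with y hy
  exact (contDiffAt_norm ℝ hy).log (by simpa using hy)

/-- Near `p` write `exp φ` as a unit `H` times a monomial `q`. The left side has exponent zero,
while points near `p` take every exponent in `P`; so `q` vanishes on `P`, its smooth part never
vanishes, and `φ = log |H ζ_q|` is smooth. -/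
theorem RSm.smM {φ : model n P → ℝ} {p : model n P} (hp : RelInt P (tc p))
    (h : RSm (model n P) φ p) : SmM φ p := by
  obtain ⟨H, q, hH, h0, hF⟩ := secAt_model_iff.1 h
  have hq : ∀ y ∈ P, q.eval y = 0 := by
    intro y hy
    obtain ⟨e, he, hey, -⟩ := exists_near_of_relInt hp hF hy
    have := congrArg CStarT.trop he
    simpa [trop_monomial_zc, hey] using this.symm
  let r : NonnegMonomial P := ⟨q, fun y hy => (hq y hy).ge⟩
  have hne : H p * smon r p ≠ 0 := mul_ne_zero h0 (by rw [smon_eq_coeff hq]; exact Units.ne_zero _)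
  have := SmM.comp (g := fun c : ℂ => Real.log ‖c‖) (smoothNear_log_norm hne)
    (hH.mul (smM_smon r p))
  refine this.congr ?_
  filter_upwards [hF, hH.continuousAt.eventually (isOpen_ne.mem_nhds h0)] with e he hHe
  have h1 := congrArg (fun a : CStarT => (a.1 : ℂ)) he
  simp only [CStarT.mk_fst, Prod.fst_mul, Units.val_mul] at h1
  rw [coe_toUnit (by simp), coe_toUnit hHe] at h1
  rw [smon_eq_coeff hq, ← h1, Complex.norm_real, Real.norm_eq_abs, Real.abs_exp, Real.log_exp]

theorem CSm.smM {f : model n P → ℂ} {p : model n P} (hp : RelInt P (tc p))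
    (h : CSm (model n P) f p) : SmM f p := by
  have := SmM.comp (g := fun y : ℝ × ℝ => (y.1 : ℂ) + y.2 * Complex.I)
    (ContDiff.smoothNear ((Complex.ofRealCLM.contDiff.comp contDiff_fst).add
      ((Complex.ofRealCLM.contDiff.comp contDiff_snd).mul contDiff_const)) _)
    ((h.1.smM hp).prodMk (h.2.smM hp))
  simpa only [Complex.re_add_im] using this

theorem SmM.cSm {f : model n P → ℂ} {p : model n P} (h : SmM f p) : CSm (model n P) f p :=
  ⟨(SmM.comp (g := Complex.re) (ContDiff.smoothNear Complex.reCLM.contDiff _) h).rSm,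
    (SmM.comp (g := Complex.im) (ContDiff.smoothNear Complex.imCLM.contDiff _) h).rSm⟩

/-- The form of exploded functions with nonnegative exponents near relative interior points. -/
theorem smM_smoothPart {w : model n P → CStarT} {p : model n P} (hp : RelInt P (tc p))
    (hw : SecAt (model n P) w p) (h : ∀ᶠ x in 𝓝 p, 0 ≤ (w x).trop) :
    SmM (fun x => (w x).smoothPart) p := by
  obtain ⟨H, q, hH, h0, hF⟩ := secAt_model_iff.1 hw
  -- Points near `p` take every exponent in `P`, so nonnegativity near `p` makes `q` nonnegative on
  -- the whole polytope.
  have hq : ∀ y ∈ P, 0 ≤ q.eval y := by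
    intro y hy
    obtain ⟨e, ⟨he, hpos⟩, hey, -⟩ := exists_near_of_relInt hp (hF.and h) hy
    simpa [he, trop_monomial_zc, hey] using hpos
  refine (hH.mul (smM_smon ⟨q, hq⟩ p)).congr ?_
  filter_upwards [hF, hH.continuousAt.eventually (isOpen_ne.mem_nhds h0)] with e he hHe
  rw [he, CStarT.smoothPart_mk_mul, coe_toUnit hHe, smon]

theorem nice_model {p : model n P} (hp : RelInt P (tc p)) : Nice (model n P) p where
  comp φ ψ H hφ hψ hH h0 := by
    have h1 : SmM φ p := SmM.pi fun i => (hφ i).smM hp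
    have h2 : SmM ψ p := SmM.pi fun i => (hψ i).smM hp
    exact secAt_unit (H := fun x => H (φ x, ψ x)) (SmM.comp hH (h1.prodMk h2)) h0
  smooth hw h := (smM_smoothPart hp hw h).cSm
  continuousAt h := (h.smM hp).continuousAt

/-- An affine function that is nonnegative near `y` and zero at `y` has zero linear part: test it at
`y ± t v`. -/
theorem relInt_of_mem_interior {y : Fin m → ℝ} (hy : y ∈ interior P) :
    RelInt P y := by
  intro q hq h0 x hx
  have hlin : ∀ v : Fin m → ℝ, q.lin v = 0 := by
    intro v
    by_contra hv
    have hc : Tendsto (fun t : ℝ => y + t • v) (𝓝 0) (𝓝 (y + (0 : ℝ) • v)) :=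
      (continuous_const.add (continuous_id.smul continuous_const)).tendsto _
    rw [zero_smul, add_zero] at hc
    have h1 := hc.eventually (mem_interior_iff_mem_nhds.1 hy)
    obtain ⟨ε, hε, hball⟩ := Metric.eventually_nhds_iff.1 h1
    have key : ∀ t : ℝ, |t| < ε → 0 ≤ t * q.lin v := by
      intro t ht
      have h2 := hq _ (hball (y := t) (by simpa using ht))
      rwa [IntAffine.eval_add_vec, h0, zero_add, IntAffine.lin_smul] at h2
    have h2 := key (ε / 2) (by rw [abs_of_pos (by positivity)]; linarith)
    have h3 := key (-(ε / 2)) (by rw [abs_neg, abs_of_pos (by positivity)]; linarith)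
    have h4 : (ε / 2) * q.lin v = 0 := by linarith
    rcases mul_eq_zero.1 h4 with h5 | h5
    · linarith
    · exact hv h5
  have := IntAffine.lin_sub q x y
  rw [hlin, h0] at this
  linarith

end Smooth

/-! ### Charts at interior points -/

/-- `X` is near `x` isomorphic to a neighbourhood of a point of a model whose exponent is in the
interior of the polytope. -/
def GoodPt (X : AbstractExplodedSpace.{u}) (x : X) : Prop :=
  ∃ (n m : ℕ) (P : Set (Fin m → ℝ)) (p : model n P) (φ : X → model n P) (ψ : model n P → X),
    IsIntegralAffinePolytope P ∧ tc p ∈ interior P ∧ LocIso X (model n P) φ ψ x p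

theorem GoodPt.nice {X : AbstractExplodedSpace.{u}} {x : X} (h : GoodPt X x) : Nice X x := by
  obtain ⟨n, m, P, p, φ, ψ, -, hp, h⟩ := h
  exact h.nice (nice_model (relInt_of_mem_interior hp))

theorem GoodPt.of_locIso {X : AbstractExplodedSpace.{u₁}} {Y : AbstractExplodedSpace.{u₂}}
    {φ : X → Y} {ψ : Y → X} {x : X} {y : Y} (h : LocIso X Y φ ψ x y) (hy : GoodPt Y y) :
    GoodPt X x := by
  obtain ⟨n, m, P, p, φ', ψ', hP, hp, h'⟩ := hy
  exact ⟨n, m, P, p, _, _, hP, hp, h.trans h'⟩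

/-! ### The real line -/

theorem secAt_realLine_iff {F : realLine → CStarT} {t : ℝ} :
    SecAt realLine F t ↔ ∃ (h : ℝ → ℂ) (a : ℝ), SmoothNear h t ∧ h t ≠ 0 ∧
      ∀ᶠ s in 𝓝 t, F s = CStarT.mk (toUnit (h s)) a := by
  refine secAt_ofSubgroup.trans ⟨?_, ?_⟩
  · rintro ⟨k, ⟨h, a, hh, hk⟩, hF⟩
    refine ⟨fun s => h s, a, hh.smoothNear t, (h t).ne_zero, ?_⟩
    filter_upwards [hF] with s hs
    exact hs.trans ((hk s).trans (by rw [toUnit_coe]))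
  · rintro ⟨h, a, hh, h0, hF⟩
    obtain ⟨k, hk, hkh⟩ := exists_contDiff_extension hh h0
    refine ⟨_, ⟨k, a, hk, fun s => rfl⟩, ?_⟩
    filter_upwards [hF, hkh] with s h1 h2
    rw [h1, ← h2, toUnit_coe]

/-- With no exploded coordinates the model is `ℝ` itself, so the general results on good points
apply to functions along paths. -/
theorem goodPt_realLine (t : ℝ) : GoodPt realLine t := by
  let P : Set (Fin 0 → ℝ) := Set.univ
  let φ : ℝ → model 1 P := fun s => mkPt (fun _ => s) (fun _ => 1) trivial
  let ψ : model 1 P → ℝ := fun p => xc p 0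
  have hψφ : ∀ s, ψ (φ s) = s := fun s => rfl
  have hφψ : ∀ p, φ (ψ p) = p := fun p => model_ext
    (by funext i; rw [Subsingleton.elim i 0]; rfl) (by funext i; exact i.elim0)
  have hψm : ∀ p, MorAt (model 1 P) realLine ψ p := by
    intro p
    refine ⟨(smM_xc_apply 0 p).continuousAt, fun F hF => ?_⟩
    obtain ⟨h, a, hh, h0, hF⟩ := secAt_realLine_iff.1 hF
    refine secAt_model_iff.2 ⟨fun p => h (ψ p), (a, 0), SmM.comp hh (smM_xc_apply 0 p), h0, ?_⟩
    have hc : ContinuousAt ψ p := (smM_xc_apply 0 p).continuousAt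
    filter_upwards [hc.eventually hF] with e he
    rw [he, monomial_const]
    exact CStarT.ext' (by simp) (by simp)
  have hφm : ∀ s : ℝ, MorAt realLine (model 1 P) φ s := by
    intro s
    have hx : Continuous (fun s => xc (φ s)) := continuous_pi fun _ => continuous_id
    refine morAt_model (Continuous.continuousAt hx) (fun q => ?_) (fun r k hk h0 => ?_)
      fun i => i.elim0
    · exact (continuous_const : Continuous fun _ : ℝ => smon q (φ 0)).continuousAt
    · have hc : ContDiff ℝ ∞ (fun s : ℝ => coords r (φ s)) :=
        (contDiff_pi.2 fun _ => contDiff_id).prodMk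
          (contDiff_const : ContDiff ℝ ∞ fun _ : ℝ => fun i : r => smon i.1 (φ 0))
      exact secAt_realLine_iff.2 ⟨fun s => k (coords r (φ s)), 0,
        SmoothNear.comp hk (hc.smoothNear _), h0, Eventually.of_forall fun _ => rfl⟩
  exact ⟨1, 0, P, φ t, φ, ψ, ⟨by simp [P], ∅, ∅, by simp [P]⟩, by simp [P],
    ⟨rfl, hψφ t, Eventually.of_forall hφm, Eventually.of_forall hψm, Eventually.of_forall hψφ,
      Eventually.of_forall hφψ⟩⟩

/-! ### The inverse function theorem, and local isomorphisms of models -/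

/-- The point of this form is that the inverse is smooth on a neighbourhood and not only at the
image point: invertibility of the derivative is an open condition, so the inverse function theorem
applies at all nearby points. -/
theorem exists_smooth_local_inverse {E F : Type*} [NormedAddCommGroup E] [NormedSpace ℝ E]
    [CompleteSpace E] [NormedAddCommGroup F] [NormedSpace ℝ F] {G : E → F} {y₀ : E}
    (hG : SmoothNear G y₀) {G' : E ≃L[ℝ] F} (hG' : HasFDerivAt G (G' : E →L[ℝ] F) y₀) :
    ∃ L : F → E, SmoothNear L (G y₀) ∧ L (G y₀) = y₀ ∧ (∀ᶠ y in 𝓝 y₀, L (G y) = y) ∧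
      ∀ᶠ w in 𝓝 (G y₀), G (L w) = w := by
  have h0 : (∞ : ℕ∞ω) ≠ 0 := by simp
  let T := hG.contDiffAt.toOpenPartialHomeomorph G hG' h0
  have hTG : ∀ y, T y = G y := fun y => by
    simp only [T, ContDiffAt.toOpenPartialHomeomorph_coe]
  have hy : y₀ ∈ T.source := hG.contDiffAt.mem_toOpenPartialHomeomorph_source hG' h0
  have hGy : G y₀ ∈ T.target := by rw [← hTG]; exact T.map_source hy
  have hLy : T.symm (G y₀) = y₀ := by rw [← hTG]; exact T.left_inv hy
  have hcont : ContinuousAt T.symm (G y₀) := T.continuousAt_symm hGy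
  refine ⟨T.symm, ?_, hLy, ?_, ?_⟩
  · have hc : ContinuousAt (fderiv ℝ G) y₀ :=
      (hG.contDiffAt.fderiv_right (m := 0) (by simp)).continuousAt
    have hinv : ∀ᶠ y in 𝓝 y₀, fderiv ℝ G y ∈ Set.range ((↑) : (E ≃L[ℝ] F) → E →L[ℝ] F) := by
      refine hc.eventually ?_
      rw [hG'.fderiv]
      exact ContinuousLinearEquiv.nhds G'
    have h1 : ∀ᶠ y in 𝓝 y₀, ContDiffAt ℝ ∞ G y ∧
      fderiv ℝ G y ∈ Set.range ((↑) : (E ≃L[ℝ] F) → E →L[ℝ] F) := hG.and hinv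
    rw [ContinuousAt, hLy] at hcont
    filter_upwards [hcont.eventually h1, T.open_target.mem_nhds hGy] with w hw hwt
    obtain ⟨hw1, A, hA⟩ := hw
    have hd : HasFDerivAt T (A : E →L[ℝ] F) (T.symm w) := by
      rw [hA]
      have : (T : E → F) = G := funext hTG
      rw [this]
      exact (hw1.differentiableAt h0).hasFDerivAt
    refine T.contDiffAt_symm hwt hd ?_
    have : (T : E → F) = G := funext hTG
    rw [this]
    exact hw1
  · filter_upwards [T.open_source.mem_nhds hy] with y h
    rw [← hTG]; exact T.left_inv h
  · filter_upwards [T.open_target.mem_nhds hGy] with w h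
    rw [← hTG]; exact T.right_inv h

theorem smoothPart_monomial_unit_mul {m : ℕ} (q : IntAffine m) (u : Fin m → ℂ)
    (hu : ∀ l, u l ≠ 0) (z : Fin m → CStarT) :
    (monomial q (fun l => CStarT.mk (toUnit (u l)) 0 * z l)).smoothPart =
      (∏ l, u l ^ q.2 l) * (monomial q z).smoothPart := by
  have h3 : (fun l => CStarT.mk (toUnit (u l)) 0 * z l) =
      fun l => z l * CStarT.mk (toUnit (u l)) 0 := funext fun l => mul_comm _ _
  have h4 : ∏ i, CStarT.mk (toUnit (u i)) 0 ^ q.2 i =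
      CStarT.mk (∏ i, toUnit (u i) ^ q.2 i) 0 := by
    refine CStarT.ext' ?_ ?_
    · simp [Prod.fst_prod]
    · simp [CStarT.trop_prod]
  rw [h3, monomial_mul, h4, mul_comm (monomial _ _), CStarT.smoothPart_mk_mul]
  congr 1
  simp only [Units.coe_prod, Units.val_zpow_eq_zpow_val]
  exact Finset.prod_congr rfl fun j _ => by rw [coe_toUnit (hu j)]

section LocalIso

variable {n₁ m₁ n₂ m₂ d : ℕ} {P₁ : Set (Fin m₁ → ℝ)} {P₂ : Set (Fin m₂ → ℝ)}

/-- The coordinate expression of the map `(x, z) ↦ (X, (h z, k))` between models. -/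
def coordMap {s : Finset (NonnegMonomial P₁)} (X : (Fin n₁ → ℝ) × (s → ℂ) → Fin n₂ → ℝ)
    (h : (Fin n₁ → ℝ) × (s → ℂ) → Fin m₁ → ℂ) (k : (Fin n₁ → ℝ) × (s → ℂ) → Fin d → ℂ)
    (y : (Fin n₁ → ℝ) × (s → ℂ)) : (Fin n₂ → ℝ) × ((Fin d → ℂ) × (s → ℂ)) :=
  (X y, k y, fun i => y.2 i * ∏ l, h y l ^ i.1.1.2 l)

theorem smoothNear_coordMap {s : Finset (NonnegMonomial P₁)}
    {X : (Fin n₁ → ℝ) × (s → ℂ) → Fin n₂ → ℝ} {h : (Fin n₁ → ℝ) × (s → ℂ) → Fin m₁ → ℂ}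
    {k : (Fin n₁ → ℝ) × (s → ℂ) → Fin d → ℂ} {y₀ : (Fin n₁ → ℝ) × (s → ℂ)}
    (hX : SmoothNear X y₀) (hh : SmoothNear h y₀) (hk : SmoothNear k y₀)
    (h0 : ∀ l, h y₀ l ≠ 0) : SmoothNear (coordMap X h k) y₀ := by
  refine hX.prodMk (hk.prodMk (SmoothNear.pi fun i => ?_))
  have hne : ∀ᶠ y in 𝓝 y₀, ∀ l, h y l ≠ 0 := eventually_all.2 fun l =>
    ((continuous_apply l).continuousAt.comp hh.continuousAt).eventually
      (isOpen_ne.mem_nhds (h0 l))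
  filter_upwards [hh, hne] with y h1 h2
  refine ContDiffAt.mul (ContDiff.contDiffAt (by fun_prop)) (contDiffAt_prod fun l _ => ?_)
  have h3 : ContDiffAt ℝ ∞ (fun y => h y l) y := contDiffAt_pi.1 h1 l
  cases i.1.1.2 l with
  | ofNat a => simpa using h3.pow a
  | negSucc a =>
    simp only [zpow_negSucc]
    exact (h3.pow (a + 1)).inv (pow_ne_zero _ (h2 l))

/-- A map `(x, z) ↦ (X, (h z, k))` between models with invertible derivative is a local
isomorphism. -/
theorem exists_locIso_of_coordMap {e : Fin m₁ ⊕ Fin d ≃ Fin m₂}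
    (hP₂ : ∀ y, y ∈ P₂ ↔ (fun i => y (e (Sum.inl i))) ∈ P₁ ∧ ∀ j, y (e (Sum.inr j)) = 0)
    {p : model n₁ P₁} {s : Finset (NonnegMonomial P₁)}
    {X : (Fin n₁ → ℝ) × (s → ℂ) → Fin n₂ → ℝ} {h : (Fin n₁ → ℝ) × (s → ℂ) → Fin m₁ → ℂ}
    {k : (Fin n₁ → ℝ) × (s → ℂ) → Fin d → ℂ}
    (hX : SmoothNear X (coords s p)) (hh : SmoothNear h (coords s p))
    (hk : SmoothNear k (coords s p)) (h0 : ∀ l, h (coords s p) l ≠ 0)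
    (k0 : ∀ j, k (coords s p) j ≠ 0)
    {G' : ((Fin n₁ → ℝ) × (s → ℂ)) ≃L[ℝ] ((Fin n₂ → ℝ) × ((Fin d → ℂ) × (s → ℂ)))}
    (hG' : HasFDerivAt (coordMap X h k) (G' : _ →L[ℝ] _) (coords s p))
    {Φ : model n₁ P₁ → model n₂ P₂}
    (hΦ : ∀ᶠ a in 𝓝 p, xc (Φ a) = X (coords s a) ∧
      (∀ l, zc (Φ a) (e (Sum.inl l)) = CStarT.mk (toUnit (h (coords s a) l)) 0 * zc a l) ∧
      ∀ j, zc (Φ a) (e (Sum.inr j)) = CStarT.mk (toUnit (k (coords s a) j)) 0) :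
    ∃ Θ : model n₂ P₂ → model n₁ P₁, LocIso (model n₁ P₁) (model n₂ P₂) Φ Θ p (Φ p) := by
  set y₀ := coords s p with hy₀
  have hhne : ∀ᶠ y in 𝓝 y₀, ∀ l, h y l ≠ 0 := eventually_all.2 fun l =>
    ((continuous_apply l).continuousAt.comp hh.continuousAt).eventually
      (isOpen_ne.mem_nhds (h0 l))
  have hkne : ∀ᶠ y in 𝓝 y₀, ∀ l, k y l ≠ 0 := eventually_all.2 fun l =>
    ((continuous_apply l).continuousAt.comp hk.continuousAt).eventually
      (isOpen_ne.mem_nhds (k0 l))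
  obtain ⟨L, hL, hLy, hLG, hGL⟩ :=
    exists_smooth_local_inverse (smoothNear_coordMap hX hh hk h0) hG'
  have hcp : Tendsto (coords s) (𝓝 p) (𝓝 y₀) := (continuous_coords s).continuousAt
  -- the coordinates on the target
  let κ : Fin d → NonnegMonomial P₂ := fun j => ⟨IntAffine.coord (e (Sum.inr j)), fun y hy => by
    rw [IntAffine.eval_coord, ((hP₂ y).1 hy).2]⟩
  let ι : Fin m₁ → IntAffine m₂ := fun l => IntAffine.coord (e (Sum.inl l))
  let σ : s → NonnegMonomial P₂ := fun i => ⟨i.1.1.comp ι, fun y hy => by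
    rw [IntAffine.eval_comp]
    refine i.1.2 _ ?_
    have : IntAffine.aff ι y = fun l => y (e (Sum.inl l)) := funext fun l => IntAffine.eval_coord _ _
    rw [this]
    exact ((hP₂ y).1 hy).1⟩
  -- Read through `coords s` on the source and `w` on the target, `Φ` becomes `coordMap`. Its local
  -- inverse `L` therefore dictates the smooth coordinates of the inverse of `Φ`, and the exploded
  -- coordinates are those of `b` divided by `h`.
  let w : model n₂ P₂ → (Fin n₂ → ℝ) × ((Fin d → ℂ) × (s → ℂ)) := fun b =>
    (xc b, fun j => smon (κ j) b, fun i => smon (σ i) b)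
  have hw : ∀ b, SmM w b := fun b =>
    (smM_xc b).prodMk ((SmM.pi fun j => smM_smon _ b).prodMk (SmM.pi fun i => smM_smon _ b))
  have hκ : ∀ (b : model n₂ P₂) j, smon (κ j) b = (zc b (e (Sum.inr j))).1 := by
    intro b j
    have h1 : monomial (κ j).1 (zc b) = zc b (e (Sum.inr j)) := monomial_coord _ _
    rw [smon, CStarT.smoothPart_of_eq, h1]
    rw [h1]
    exact ((hP₂ _).1 (tc_mem b)).2 j
  have hσ : ∀ (b : model n₂ P₂) i, smon (σ i) b =
      (monomial i.1.1 fun l => zc b (e (Sum.inl l))).smoothPart := by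
    intro b i
    have : monMap ι (zc b) = fun l => zc b (e (Sum.inl l)) := funext fun l => monomial_coord _ _
    rw [smon, show (σ i).1 = i.1.1.comp ι from rfl, monomial_comp, this]
  have hwΦ : ∀ᶠ a in 𝓝 p, w (Φ a) = coordMap X h k (coords s a) := by
    filter_upwards [hΦ, hcp.eventually hhne, hcp.eventually hkne] with a ha h1 h2
    obtain ⟨ha1, ha2, ha3⟩ := ha
    refine Prod.ext ha1 (Prod.ext ?_ ?_)
    · funext j
      simp only [w, coordMap]
      rw [hκ, ha3, CStarT.mk_fst, coe_toUnit (h2 j)]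
    · funext i
      simp only [w, coordMap]
      rw [hσ, show (fun l => zc (Φ a) (e (Sum.inl l))) = _ from funext ha2,
        smoothPart_monomial_unit_mul _ _ h1, mul_comm]
      rfl
  have hmem : ∀ b : model n₂ P₂, tropv (fun l => CStarT.mk (toUnit ((h (L (w b)) l)⁻¹)) 0 *
      zc b (e (Sum.inl l))) ∈ P₁ := by
    intro b
    have h1 : tropv (fun l => CStarT.mk (toUnit ((h (L (w b)) l)⁻¹)) 0 * zc b (e (Sum.inl l))) =
        fun l => tc b (e (Sum.inl l)) := by
      funext l; simp [tropv, tc]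
    rw [h1]
    exact ((hP₂ _).1 (tc_mem b)).1
  let Θ : model n₂ P₂ → model n₁ P₁ := fun b => mkPt (L (w b)).1 _ (hmem b)
  have hΘx : ∀ b, xc (Θ b) = (L (w b)).1 := fun _ => rfl
  have hΘz : ∀ b l, zc (Θ b) l = CStarT.mk (toUnit ((h (L (w b)) l)⁻¹)) 0 *
      zc b (e (Sum.inl l)) := fun _ _ => rfl
  have hwp : w (Φ p) = coordMap X h k y₀ := hwΦ.self_of_nhds
  have hLw : ∀ᶠ b in 𝓝 (Φ p), SmoothNear L (w b) ∧ coordMap X h k (L (w b)) = w b :=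
    (hw (Φ p)).continuousAt.eventually (by rw [hwp]; exact hL.eventually.and hGL)
  have hLc : Tendsto (fun b => L (w b)) (𝓝 (Φ p)) (𝓝 y₀) := by
    have := ContinuousAt.comp (g := L) (by rw [hwp]; exact hL.continuousAt)
      (hw (Φ p)).continuousAt
    simpa only [ContinuousAt, Function.comp_def, hwp, hLy] using this
  have hleft : ∀ᶠ a in 𝓝 p, Θ (Φ a) = a := by
    filter_upwards [hwΦ, hΦ, hcp.eventually hLG, hcp.eventually hhne] with a h1 h2 h3 h4
    rw [← h1] at h3
    refine model_ext ?_ (funext fun l => ?_)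
    · rw [hΘx, h3]; rfl
    · rw [hΘz, h3, h2.2.1, ← mul_assoc, ← CStarT.mk_mul_zero,
        ← toUnit_mul (inv_ne_zero (h4 l)) (h4 l), inv_mul_cancel₀ (h4 l)]
      exact CStarT.ext' (by simp [toUnit]) (by simp)
  have hΘm : ∀ᶠ b in 𝓝 (Φ p), MorAt (model n₂ P₂) (model n₁ P₁) Θ b := by
    filter_upwards [hLw, hLc.eventually (hh.eventually.and hhne)] with b h1 h2
    have h3 : SmM (fun b => L (w b)) b := SmM.comp h1.1 (hw b)
    refine morAt_explicit (U := fun l b => (h (L (w b)) l)⁻¹) (M := ι)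
      (SmM.comp (g := fun y : (Fin n₁ → ℝ) × (s → ℂ) => y.1) (contDiff_fst.smoothNear _) h3)
      (fun l => SmM.inv (f := fun b => h (L (w b)) l) ?_ (h2.2 l)) (fun l => inv_ne_zero (h2.2 l))
      (Eventually.of_forall fun a l => ?_) fun y hy => ?_
    · exact SmM.comp (g := fun y => h y l)
        (SmoothNear.comp (g := fun v : Fin m₁ → ℂ => v l) (ContDiff.smoothNear (by fun_prop) _)
          h2.1) h3
    · rw [hΘz, monomial_coord]
    · have : IntAffine.aff ι y = fun l => y (e (Sum.inl l)) :=
        funext fun l => IntAffine.eval_coord _ _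
      rw [this]
      exact ((hP₂ y).1 hy).1
  have hΘp : Θ (Φ p) = p := hleft.self_of_nhds
  have hΘt : Tendsto Θ (𝓝 (Φ p)) (𝓝 p) := by
    have := hΘm.self_of_nhds.1
    rwa [ContinuousAt, hΘp] at this
  refine ⟨Θ, rfl, hΘp, ?_, hΘm, hleft, ?_⟩
  · let M : Fin m₂ → IntAffine m₁ := fun j =>
      Sum.elim (fun l => IntAffine.coord l) (fun _ => 0) (e.symm j)
    let U : Fin m₂ → model n₁ P₁ → ℂ := fun j a =>
      Sum.elim (fun l => h (coords s a) l) (fun i => k (coords s a) i) (e.symm j)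
    filter_upwards [eventually_eventually_nhds.2 hΦ, hcp.eventually (hX.eventually.and
      (hh.eventually.and (hk.eventually.and (hhne.and hkne))))] with a h1 h2
    obtain ⟨hXa, hha, hka, hhn, hkn⟩ := h2
    have hcs := smM_coords s a
    have hha' : ∀ l, SmM (fun a => h (coords s a) l) a := fun l =>
      SmM.comp (g := fun y => h y l) (SmoothNear.comp (g := fun v : Fin m₁ → ℂ => v l)
        (ContDiff.smoothNear (by fun_prop) _) hha) hcs
    have hka' : ∀ l, SmM (fun a => k (coords s a) l) a := fun l =>
      SmM.comp (g := fun y => k y l) (SmoothNear.comp (g := fun v : Fin d → ℂ => v l)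
        (ContDiff.smoothNear (by fun_prop) _) hka) hcs
    refine morAt_explicit (U := U) (M := M)
      ((SmM.comp hXa hcs).congr (h1.mono fun b hb => hb.1.symm)) (fun j => ?_) (fun j => ?_)
      (h1.mono fun b hb j => ?_) fun y hy => ?_
    · simp only [U]
      cases e.symm j with
      | inl l => exact hha' l
      | inr i => exact hka' i
    · simp only [U]
      cases e.symm j with
      | inl l => exact hhn l
      | inr i => exact hkn i
    · obtain ⟨j, rfl⟩ := e.surjective j
      simp only [U, M, Equiv.symm_apply_apply]
      cases j with
      | inl l => rw [hb.2.1]; simp [monomial_coord]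
      | inr i => rw [hb.2.2]; simp [monomial_zero]
    · rw [hP₂]
      refine ⟨?_, fun j => by simp [IntAffine.aff, M]⟩
      have : (fun i => IntAffine.aff M y (e (Sum.inl i))) = y := by
        funext i; simp [IntAffine.aff, M]
      rwa [this]
  · filter_upwards [hLw, hLc.eventually (hhne.and hkne), hΘt.eventually hΦ] with b h1 h2 h3
    have hG : coordMap X h k (L (w b)) = w b := h1.2
    have hinv : ∀ l, (h (L (w b)) l)⁻¹ ≠ 0 := fun l => inv_ne_zero (h2.1 l)
    -- Dividing the exploded coordinates by `h` divides the monomial `σ i` by exactly the product by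
    -- which `coordMap` multiplies it.
    have hcΘ : coords s (Θ b) = L (w b) := by
      refine Prod.ext rfl (funext fun i => ?_)
      have h4 : smon i.1 (Θ b) = (∏ l, (h (L (w b)) l)⁻¹ ^ i.1.1.2 l) * smon (σ i) b := by
        rw [hσ]
        exact smoothPart_monomial_unit_mul _ _ hinv _
      have h5 : (L (w b)).2 i * ∏ l, h (L (w b)) l ^ i.1.1.2 l = smon (σ i) b :=
        congrFun (congrArg (fun y => y.2.2) hG) i
      change smon i.1 (Θ b) = _
      rw [h4, ← h5, mul_left_comm, ← Finset.prod_mul_distrib]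
      simp only [inv_zpow]
      rw [Finset.prod_eq_one, mul_one]
      exact fun l _ => inv_mul_cancel₀ (zpow_ne_zero _ (h2.1 l))
    rw [hcΘ] at h3
    refine model_ext (h3.1.trans (congrArg Prod.fst hG)) (funext fun j => ?_)
    obtain ⟨j, rfl⟩ := e.surjective j
    cases j with
    | inl l =>
      rw [h3.2.1, hΘz, ← mul_assoc, ← CStarT.mk_mul_zero, ← toUnit_mul (h2.1 l) (hinv l),
        mul_inv_cancel₀ (h2.1 l)]
      exact CStarT.ext' (by simp [toUnit]) (by simp)
    | inr i =>
      rw [h3.2.2, show k (L (w b)) i = smon (κ i) b from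
        congrFun (congrArg (fun y => y.2.1) hG) i, hκ]
      refine CStarT.ext' (by simp) ?_
      rw [CStarT.trop_mk]
      exact (((hP₂ _).1 (tc_mem b)).2 i).symm

end LocalIso

/-! ### Unimodular changes of coordinates -/

section Unimodular

variable {n m₁ m₂ : ℕ}

/-- `M` and `N` are mutually inverse integral affine maps. -/
def UniPair (M : Fin m₂ → IntAffine m₁) (N : Fin m₁ → IntAffine m₂) : Prop :=
  (∀ i, (N i).comp M = IntAffine.coord i) ∧ ∀ j, (M j).comp N = IntAffine.coord j

theorem UniPair.symm {M : Fin m₂ → IntAffine m₁} {N : Fin m₁ → IntAffine m₂} (h : UniPair M N) :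
    UniPair N M := ⟨h.2, h.1⟩

theorem UniPair.monMap_monMap {M : Fin m₂ → IntAffine m₁} {N : Fin m₁ → IntAffine m₂}
    (h : UniPair M N) (z : Fin m₁ → CStarT) : monMap N (monMap M z) = z := by
  funext i
  rw [monMap, ← monomial_comp, h.1, monomial_coord]

theorem UniPair.aff_aff {M : Fin m₂ → IntAffine m₁} {N : Fin m₁ → IntAffine m₂}
    (h : UniPair M N) (x : Fin m₁ → ℝ) : IntAffine.aff N (IntAffine.aff M x) = x := by
  funext i
  rw [IntAffine.aff, ← IntAffine.eval_comp, h.1, IntAffine.eval_coord]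

/-- The linear part of the inverse consists of the coordinates of the standard vectors in the basis
`b`; its constant part undoes the translation by `τ`. -/
theorem exists_uniPair {m : ℕ} (b : Module.Basis (Fin m) ℤ (Fin m → ℤ)) (τ : Fin m → ℝ) :
    ∃ N : Fin m → IntAffine m, UniPair (fun j => (τ j, b j)) N := by
  classical
  let c : Fin m → Fin m → ℤ := fun i j => b.repr (Pi.single i 1) j
  refine ⟨fun i => (-∑ j, c i j * τ j, c i), fun i => ?_, fun j => ?_⟩
  · refine Prod.ext ?_ ?_
    · simp [IntAffine.comp, IntAffine.coord, Prod.fst_sum]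
    · have := b.sum_repr (Pi.single i 1)
      simp only [IntAffine.comp, IntAffine.coord, Prod.snd_add, Prod.snd_sum, Prod.smul_snd,
        zero_add]
      exact this
  · have h1 : ∀ k, ∑ i, b j i * c i k = if j = k then 1 else 0 := by
      intro k
      have h2 : b j = ∑ i, b j i • (Pi.single i 1 : Fin m → ℤ) := by
        funext l; simp [Finset.sum_apply, Pi.single_apply]
      have h3 := congrArg (fun v => b.repr v k) h2
      simp only [map_sum, map_smul, Finsupp.coe_finsetSum, Finset.sum_apply, Finsupp.smul_apply,
        Module.Basis.repr_self, Finsupp.single_apply, smul_eq_mul] at h3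
      exact h3.symm
    refine Prod.ext ?_ ?_
    · simp only [IntAffine.comp, IntAffine.coord, Prod.fst_add, Prod.fst_sum, Prod.smul_fst]
      simp only [zsmul_eq_mul, mul_neg, Finset.sum_neg_distrib]
      have h4 : ∑ i, (b j i : ℝ) * ∑ k, (c i k : ℝ) * τ k = τ j := by
        simp only [Finset.mul_sum]
        rw [Finset.sum_comm]
        have h5 : ∀ k, ∑ i, (b j i : ℝ) * ((c i k : ℝ) * τ k) =
            ((∑ i, b j i * c i k : ℤ) : ℝ) * τ k := by
          intro k; push_cast; rw [Finset.sum_mul]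
          exact Finset.sum_congr rfl fun i _ => by ring
        simp only [h5, h1]
        simp
      rw [h4]; simp
    · funext k
      simp only [IntAffine.comp, IntAffine.coord, Prod.snd_add, Prod.snd_sum, Prod.smul_snd,
        zero_add, Finset.sum_apply, Pi.smul_apply, smul_eq_mul]
      rw [h1 k, Pi.single_apply]
      simp [eq_comm]

/-- The map of models induced by an integral affine map. -/
def affMap {P₁ : Set (Fin m₁ → ℝ)} {P₂ : Set (Fin m₂ → ℝ)} (M : Fin m₂ → IntAffine m₁)
    (h : Set.MapsTo (IntAffine.aff M) P₁ P₂) (p : model n P₁) : model n P₂ :=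
  mkPt (xc p) (monMap M (zc p)) (by rw [tropv_monMap]; exact h (tc_mem p))

theorem morAt_affMap {P₁ : Set (Fin m₁ → ℝ)} {P₂ : Set (Fin m₂ → ℝ)} (M : Fin m₂ → IntAffine m₁)
    (h : Set.MapsTo (IntAffine.aff M) P₁ P₂) (p : model n P₁) :
    MorAt (model n P₁) (model n P₂) (affMap M h) p := by
  refine morAt_explicit (U := fun _ _ => 1) (M := M) (smM_xc p) (fun _ => smM_const 1 p)
    (fun _ => one_ne_zero) (Eventually.of_forall fun x j => ?_) h
  exact CStarT.ext' (by simp [affMap, monMap, toUnit]) (by simp [affMap, monMap])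

theorem tc_affMap {P₁ : Set (Fin m₁ → ℝ)} {P₂ : Set (Fin m₂ → ℝ)} (M : Fin m₂ → IntAffine m₁)
    (h : Set.MapsTo (IntAffine.aff M) P₁ P₂) (p : model n P₁) :
    tc (affMap M h p) = IntAffine.aff M (tc p) := tropv_monMap _ _

theorem UniPair.mapsTo {M : Fin m₂ → IntAffine m₁} {N : Fin m₁ → IntAffine m₂} (h : UniPair M N)
    (P : Set (Fin m₁ → ℝ)) : Set.MapsTo (IntAffine.aff M) P (IntAffine.aff N ⁻¹' P) := by
  intro x hx
  rwa [Set.mem_preimage, h.aff_aff]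

theorem UniPair.locIso {M : Fin m₂ → IntAffine m₁} {N : Fin m₁ → IntAffine m₂} (h : UniPair M N)
    {P : Set (Fin m₁ → ℝ)} (p : model n P) :
    LocIso (model n P) (model n (IntAffine.aff N ⁻¹' P)) (affMap M (h.mapsTo P))
      (affMap N (Set.mapsTo_preimage _ _)) p (affMap M (h.mapsTo P) p) := by
  have h1 : ∀ p : model n P, affMap N (Set.mapsTo_preimage _ _) (affMap M (h.mapsTo P) p) = p :=
    fun p => model_ext rfl (h.monMap_monMap _)
  exact ⟨rfl, h1 p, Eventually.of_forall fun _ => morAt_affMap _ _ _,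
    Eventually.of_forall fun _ => morAt_affMap _ _ _, Eventually.of_forall h1,
    Eventually.of_forall fun p => model_ext rfl (h.symm.monMap_monMap _)⟩

end Unimodular

/-! ### Local isomorphisms from injectivity of the derivative. -/

section LocalIso

variable {n₁ m₁ n₂ m₂ d : ℕ} {P₁ : Set (Fin m₁ → ℝ)} {P₂ : Set (Fin m₂ → ℝ)}

/-- The form of `exists_locIso_of_coordMap` in which the invertibility of the derivative is given by
its injectivity and the equality of dimensions. -/
theorem exists_locIso_of_injective {e : Fin m₁ ⊕ Fin d ≃ Fin m₂}
    (hP₂ : ∀ y, y ∈ P₂ ↔ (fun i => y (e (Sum.inl i))) ∈ P₁ ∧ ∀ j, y (e (Sum.inr j)) = 0)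
    {p : model n₁ P₁} {s : Finset (NonnegMonomial P₁)}
    {X : (Fin n₁ → ℝ) × (s → ℂ) → Fin n₂ → ℝ} {h : (Fin n₁ → ℝ) × (s → ℂ) → Fin m₁ → ℂ}
    {k : (Fin n₁ → ℝ) × (s → ℂ) → Fin d → ℂ}
    (hX : SmoothNear X (coords s p)) (hh : SmoothNear h (coords s p))
    (hk : SmoothNear k (coords s p)) (h0 : ∀ l, h (coords s p) l ≠ 0)
    (k0 : ∀ j, k (coords s p) j ≠ 0) (hn : n₁ = n₂ + 2 * d)
    (hinj : ∀ v, fderiv ℝ X (coords s p) v = 0 → fderiv ℝ k (coords s p) v = 0 →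
      (∀ i : s, fderiv ℝ (fun y : (Fin n₁ → ℝ) × (s → ℂ) => y.2 i * ∏ l, h y l ^ i.1.1.2 l)
        (coords s p) v = 0) → v = 0)
    {Φ : model n₁ P₁ → model n₂ P₂}
    (hΦ : ∀ᶠ a in 𝓝 p, xc (Φ a) = X (coords s a) ∧
      (∀ l, zc (Φ a) (e (Sum.inl l)) = CStarT.mk (toUnit (h (coords s a) l)) 0 * zc a l) ∧
      ∀ j, zc (Φ a) (e (Sum.inr j)) = CStarT.mk (toUnit (k (coords s a) j)) 0) :
    ∃ Θ : model n₂ P₂ → model n₁ P₁, LocIso (model n₁ P₁) (model n₂ P₂) Φ Θ p (Φ p) := by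
  have h1 : (∞ : ℕ∞ω) ≠ 0 := by simp
  have hG := smoothNear_coordMap hX hh hk h0
  have hdX := (hX.contDiffAt.differentiableAt h1).hasFDerivAt
  have hdk := (hk.contDiffAt.differentiableAt h1).hasFDerivAt
  have hd3 : ∀ i : s, HasFDerivAt
      (fun y : (Fin n₁ → ℝ) × (s → ℂ) => y.2 i * ∏ l, h y l ^ i.1.1.2 l) _ (coords s p) := fun i =>
    (((contDiffAt_pi.1 hG.contDiffAt.snd.snd) i).differentiableAt h1).hasFDerivAt
  have hd : HasFDerivAt (coordMap X h k) _ (coords s p) :=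
    hdX.prodMk (hdk.prodMk (hasFDerivAt_pi.2 hd3))
  set A := (fderiv ℝ X (coords s p)).prod ((fderiv ℝ k (coords s p)).prod
    (ContinuousLinearMap.pi fun i : s => fderiv ℝ
      (fun y : (Fin n₁ → ℝ) × (s → ℂ) => y.2 i * ∏ l, h y l ^ i.1.1.2 l) (coords s p))) with hA
  have hAinj : Function.Injective A.toLinearMap := by
    refine (injective_iff_map_eq_zero _).2 fun v hv => ?_
    have hv' : A v = 0 := hv
    refine hinj v (congrArg Prod.fst hv') (congrArg (fun y => y.2.1) hv') fun i => ?_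
    exact congrFun (congrArg (fun y => y.2.2) hv') i
  -- The factors `s → ℂ` cancel, and each of the `d` coordinates of exponent zero has two real
  -- dimensions; this is the `2 * d` in `hn`.
  have hfin : Module.finrank ℝ ((Fin n₁ → ℝ) × (s → ℂ)) =
      Module.finrank ℝ ((Fin n₂ → ℝ) × ((Fin d → ℂ) × (s → ℂ))) := by
    simp only [Module.finrank_prod, Module.finrank_pi_fintype, Complex.finrank_real_complex,
      Module.finrank_self, Finset.sum_const, Finset.card_univ, Fintype.card_fin, smul_eq_mul]
    omega
  let G' := (A.toLinearMap.linearEquivOfInjective hAinj hfin).toContinuousLinearEquiv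
  refine exists_locIso_of_coordMap hP₂ hX hh hk h0 k0 (G' := G') ?_ hΦ
  have : G'.toContinuousLinearMap = A := ContinuousLinearMap.ext fun v => rfl
  rw [this]
  exact hd

end LocalIso

/-! ### Farkas' lemma and faces of polytopes -/

/-- Induction on the number of inequalities. If the inequality for `j` is needed, there is `x₀`
satisfying the other ones with `b x₀ < 0` and `a j x₀ = -1`. Projecting along `x₀` to the kernel of
`a j` eliminates `j`, and undoing the projection gives `a j` a nonnegative coefficient. -/
theorem farkas {V ι : Type*} [AddCommGroup V] [Module ℝ V] (t : Finset ι) (a : ι → V →ₗ[ℝ] ℝ)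
    (b : V →ₗ[ℝ] ℝ) (h : ∀ x, (∀ i ∈ t, 0 ≤ a i x) → 0 ≤ b x) :
    ∃ c : ι → ℝ, (∀ i, 0 ≤ c i) ∧ ∀ x, b x = ∑ i ∈ t, c i * a i x := by
  classical
  induction t using Finset.induction_on generalizing a b with
  | empty =>
    refine ⟨0, fun _ => le_rfl, fun x => ?_⟩
    have h1 := h x (by simp)
    have h2 := h (-x) (by simp)
    rw [map_neg] at h2
    simp only [Finset.sum_empty]
    linarith
  | insert j t hj ih =>
    by_cases hb : ∀ x, (∀ i ∈ t, 0 ≤ a i x) → 0 ≤ b x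
    · obtain ⟨c, hc, hbc⟩ := ih a b hb
      refine ⟨fun i => if i = j then 0 else c i, fun i => ?_, fun x => ?_⟩
      · dsimp only; split_ifs <;> simp [hc i]
      · dsimp only
        rw [hbc, Finset.sum_insert hj, if_pos rfl, zero_mul, zero_add]
        refine Finset.sum_congr rfl fun i hi => ?_
        rw [if_neg]
        rintro rfl
        exact hj hi
    · push Not at hb
      obtain ⟨x₁, hx₁, hbx₁⟩ := hb
      have hjx₁ : a j x₁ < 0 := by
        by_contra hcon
        push Not at hcon
        refine absurd (h x₁ fun i hi => ?_) (not_le.2 hbx₁)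
        rcases Finset.mem_insert.1 hi with rfl | hi
        · exact hcon
        · exact hx₁ i hi
      obtain ⟨x₀, hx₀, hbx₀, hjx₀⟩ : ∃ x₀, (∀ i ∈ t, 0 ≤ a i x₀) ∧ b x₀ < 0 ∧ a j x₀ = -1 := by
        refine ⟨(-(a j x₁))⁻¹ • x₁, fun i hi => ?_, ?_, ?_⟩
        · rw [map_smul, smul_eq_mul]
          exact mul_nonneg (inv_nonneg.2 (by linarith)) (hx₁ i hi)
        · rw [map_smul, smul_eq_mul]
          exact mul_neg_of_pos_of_neg (inv_pos.2 (by linarith)) hbx₁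
        · rw [map_smul, smul_eq_mul]
          rw [inv_neg, neg_mul, inv_mul_cancel₀ hjx₁.ne]
      -- The projection is `x ↦ x + a j x • x₀`; the functionals given to the induction hypothesis
      -- are the compositions with it.
      obtain ⟨c, hc, hbc⟩ := ih (fun i => a i + a i x₀ • a j) (b + b x₀ • a j) fun x hx => by
        have := h (x + a j x • x₀) fun i hi => by
          rcases Finset.mem_insert.1 hi with rfl | hi
          · simp [hjx₀]
          · have := hx i hi
            simp only [LinearMap.add_apply, LinearMap.smul_apply, smul_eq_mul] at this
            simp only [map_add, map_smul, smul_eq_mul]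
            linarith
        simp only [LinearMap.add_apply, LinearMap.smul_apply, smul_eq_mul]
        simp only [map_add, map_smul, smul_eq_mul] at this
        linarith
      refine ⟨fun i => if i = j then ∑ i ∈ t, c i * a i x₀ - b x₀ else c i, fun i => ?_,
        fun x => ?_⟩
      · dsimp only
        split_ifs
        · have : 0 ≤ ∑ i ∈ t, c i * a i x₀ := Finset.sum_nonneg fun i hi =>
            mul_nonneg (hc i) (hx₀ i hi)
          linarith
        · exact hc i
      · have h1 := hbc x
        simp only [LinearMap.add_apply, LinearMap.smul_apply, smul_eq_mul, mul_add,
          Finset.sum_add_distrib] at h1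
        dsimp only
        rw [Finset.sum_insert hj, if_pos rfl]
        have h2 : ∑ i ∈ t, (if i = j then ∑ i ∈ t, c i * a i x₀ - b x₀ else c i) * a i x =
            ∑ i ∈ t, c i * a i x := by
          refine Finset.sum_congr rfl fun i hi => ?_
          rw [if_neg]
          rintro rfl
          exact hj hi
        have h3 : ∑ i ∈ t, c i * (a i x₀ * a j x) = (∑ i ∈ t, c i * a i x₀) * a j x := by
          rw [Finset.sum_mul]
          exact Finset.sum_congr rfl fun i _ => by ring
        rw [h2, sub_mul]
        linarith

/-- Sets defined by finitely many weak and strict integral affine inequalities. -/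
def IsPoly {m : ℕ} (P : Set (Fin m → ℝ)) : Prop :=
  ∃ weak strict : Finset (IntAffine m),
    P = {x | (∀ q ∈ weak, 0 ≤ q.eval x) ∧ ∀ q ∈ strict, 0 < q.eval x}

/-- The homogenization of an integral affine function. -/
def IntAffine.homog {m : ℕ} (q : IntAffine m) : (ℝ × (Fin m → ℝ)) →ₗ[ℝ] ℝ where
  toFun v := q.1 * v.1 + q.lin v.2
  map_add' v w := by simp [IntAffine.lin_add]; ring
  map_smul' c v := by simp [IntAffine.lin_smul]; ring

theorem IntAffine.homog_apply {m : ℕ} (q : IntAffine m) (t : ℝ) (y : Fin m → ℝ) :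
    q.homog (t, y) = q.1 * t + q.lin y := rfl

theorem IntAffine.homog_of_pos {m : ℕ} (q : IntAffine m) {t : ℝ} (ht : 0 < t) (y : Fin m → ℝ) :
    q.homog (t, y) = t * q.eval (t⁻¹ • y) := by
  have h1 : q.eval (t⁻¹ • y) = q.1 + q.lin (t⁻¹ • y) := rfl
  rw [h1, lin_smul, homog_apply]
  field_simp

/-- Farkas' lemma for integral affine functions on a face of a polytope. -/
theorem exists_nonneg_combination {m : ℕ} {weak strict I : Finset (IntAffine m)} {y₀ : Fin m → ℝ}
    (hy₀ : (∀ q ∈ weak, 0 ≤ q.eval y₀) ∧ ∀ q ∈ strict, 0 < q.eval y₀) (hI : I ⊆ weak)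
    (hI₀ : ∀ q ∈ I, q.eval y₀ = 0) (r : IntAffine m)
    (hr : ∀ y, (∀ q ∈ weak, 0 ≤ q.eval y) → (∀ q ∈ strict, 0 < q.eval y) →
      (∀ q ∈ I, q.eval y = 0) → 0 ≤ r.eval y) :
    ∃ (c c' : IntAffine m → ℝ) (c₀ : ℝ), (∀ q, 0 ≤ c q) ∧ (∀ q, 0 ≤ c' q) ∧ 0 ≤ c₀ ∧
      ∀ y, r.eval y = ∑ q ∈ weak ∪ strict, c q * q.eval y - ∑ q ∈ I, c' q * q.eval y + c₀ := by
  classical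
  let t : Finset (IntAffine m ⊕ (IntAffine m ⊕ Unit)) := (weak ∪ strict).disjSum (I.disjSum {()})
  let a : IntAffine m ⊕ (IntAffine m ⊕ Unit) → (ℝ × (Fin m → ℝ)) →ₗ[ℝ] ℝ :=
    Sum.elim (fun q => q.homog) (Sum.elim (fun q => -q.homog) fun _ => LinearMap.fst ℝ ℝ _)
  obtain ⟨c, hc, hrc⟩ := farkas t a r.homog (by
    rintro ⟨τ, y⟩ hx
    have h1 : ∀ q ∈ weak ∪ strict, 0 ≤ q.homog (τ, y) := fun q hq => hx (Sum.inl q) (by simpa [t] using hq)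
    have h2 : ∀ q ∈ I, q.homog (τ, y) ≤ 0 := fun q hq => by
      have := hx (Sum.inr (Sum.inl q)) (by simpa [t] using hq)
      simpa [a] using this
    have h3 : 0 ≤ τ := hx (Sum.inr (Sum.inr ())) (by simp [t])
    -- The pair `(τ, y)` satisfies only homogeneous weak inequalities. Adding `ε • (1, y₀)` makes
    -- the first entry positive and the strict inequalities strict, so dividing by that entry gives
    -- a point of the face, where `hr` applies. Letting `ε` tend to zero then gives the claim.
    have key : ∀ ε : ℝ, 0 < ε → 0 ≤ r.homog ((τ, y) + ε • ((1 : ℝ), y₀)) := by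
      intro ε hε
      have hpos : 0 < τ + ε * 1 := by linarith
      have hv : ((τ, y) + ε • ((1 : ℝ), y₀) : ℝ × (Fin m → ℝ)) = (τ + ε * 1, y + ε • y₀) := rfl
      have hq1 : ∀ q : IntAffine m, (τ + ε * 1) * q.eval ((τ + ε * 1)⁻¹ • (y + ε • y₀)) =
          q.homog (τ, y) + ε * q.eval y₀ := by
        intro q
        rw [← q.homog_of_pos hpos, ← hv, map_add, map_smul, smul_eq_mul,
          q.homog_of_pos one_pos, inv_one, one_smul, one_mul]
      rw [hv, r.homog_of_pos hpos]
      refine mul_nonneg hpos.le (hr _ (fun q hq => ?_) (fun q hq => ?_) fun q hq => ?_)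
      · refine nonneg_of_mul_nonneg_right (b := q.eval _) ?_ hpos
        rw [hq1]
        exact add_nonneg (h1 q (Finset.mem_union_left _ hq)) (mul_nonneg hε.le (hy₀.1 q hq))
      · refine pos_of_mul_pos_right (a := τ + ε * 1) (b := q.eval _) ?_ hpos.le
        rw [hq1]
        exact add_pos_of_nonneg_of_pos (h1 q (Finset.mem_union_right _ hq))
          (mul_pos hε (hy₀.2 q hq))
      · have h4 : q.homog (τ, y) = 0 := le_antisymm (h2 q hq) (h1 q (Finset.mem_union_left _ (hI hq)))
        have h5 := hq1 q
        rw [h4, hI₀ q hq, mul_zero, add_zero] at h5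
        exact (mul_eq_zero.1 h5).resolve_left hpos.ne'
    have h5 : ∀ ε : ℝ, 0 < ε → 0 ≤ r.homog (τ, y) + ε * r.homog (1, y₀) := fun ε hε => by
      have := key ε hε
      rwa [map_add, map_smul, smul_eq_mul] at this
    by_contra hneg
    push Not at hneg
    rcases le_or_gt (r.homog (1, y₀)) 0 with h6 | h6
    · have := h5 1 one_pos
      linarith
    · have := h5 (-(r.homog (τ, y)) / (2 * r.homog (1, y₀))) (div_pos (by linarith) (by linarith))
      have h7 : -(r.homog (τ, y)) / (2 * r.homog (1, y₀)) * r.homog (1, y₀) =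
          -(r.homog (τ, y)) / 2 := by field_simp
      linarith)
  refine ⟨fun q => c (Sum.inl q), fun q => c (Sum.inr (Sum.inl q)), c (Sum.inr (Sum.inr ())),
    fun _ => hc _, fun _ => hc _, hc _, fun y => ?_⟩
  have h1 : ∀ q : IntAffine m, q.homog (1, y) = q.eval y := fun q => by
    rw [q.homog_of_pos one_pos, inv_one, one_smul, one_mul]
  have h2 := hrc (1, y)
  simp only [t, a, Finset.sum_disjSum, Finset.sum_singleton, Sum.elim_inl, Sum.elim_inr,
    LinearMap.neg_apply, LinearMap.fst_apply, h1, mul_one, mul_neg, Finset.sum_neg_distrib] at h2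
  rw [h2]
  ring

/-- An integral affine function which is nonnegative on a face becomes nonnegative on the polytope
after adding a multiple of the functions defining the face. -/
theorem exists_nonneg_add_nsmul {m : ℕ} {weak strict I : Finset (IntAffine m)} {y₀ : Fin m → ℝ}
    (hy₀ : (∀ q ∈ weak, 0 ≤ q.eval y₀) ∧ ∀ q ∈ strict, 0 < q.eval y₀) (hI : I ⊆ weak)
    (hI₀ : ∀ q ∈ I, q.eval y₀ = 0) (r : IntAffine m)
    (hr : ∀ y, (∀ q ∈ weak, 0 ≤ q.eval y) → (∀ q ∈ strict, 0 < q.eval y) →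
      (∀ q ∈ I, q.eval y = 0) → 0 ≤ r.eval y) :
    ∃ N : ℕ, ∀ y, (∀ q ∈ weak, 0 ≤ q.eval y) → (∀ q ∈ strict, 0 < q.eval y) →
      0 ≤ (r + N • ∑ q ∈ I, q).eval y := by
  classical
  obtain ⟨c, c', c₀, hc, hc', hc₀, h⟩ := exists_nonneg_combination hy₀ hI hI₀ r hr
  -- Negative coefficients in the combination come only from `I`, and `N` dominates all of them.
  obtain ⟨N, hN⟩ : ∃ N : ℕ, ∀ q ∈ I, c' q ≤ N := by
    obtain ⟨N, hN⟩ := exists_nat_ge (∑ q ∈ I, c' q)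
    exact ⟨N, fun q hq => (Finset.single_le_sum (fun i _ => hc' i) hq).trans hN⟩
  refine ⟨N, fun y hw hs => ?_⟩
  rw [IntAffine.eval_add, IntAffine.eval_nsmul, IntAffine.eval_sum, h, Finset.mul_sum]
  have h3 : 0 ≤ ∑ q ∈ weak ∪ strict, c q * q.eval y := Finset.sum_nonneg fun q hq =>
    mul_nonneg (hc _) (by
      rcases Finset.mem_union.1 hq with h | h
      · exact hw q h
      · exact (hs q h).le)
  have h4 : ∑ q ∈ I, c' q * q.eval y ≤ ∑ q ∈ I, N * q.eval y := Finset.sum_le_sum fun q hq =>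
    mul_le_mul_of_nonneg_right (hN q hq) (hw q (hI hq))
  linarith

theorem IsPoly.preimage {m₁ m₂ : ℕ} {P : Set (Fin m₂ → ℝ)} (hP : IsPoly P)
    (M : Fin m₂ → IntAffine m₁) : IsPoly (IntAffine.aff M ⁻¹' P) := by
  classical
  obtain ⟨weak, strict, rfl⟩ := hP
  refine ⟨weak.image (·.comp M), strict.image (·.comp M), ?_⟩
  ext x
  simp only [Set.mem_preimage, Set.mem_ofPred_eq, Finset.forall_mem_image, IntAffine.eval_comp]

theorem IsPoly.inter {m : ℕ} {P Q : Set (Fin m → ℝ)} (hP : IsPoly P) (hQ : IsPoly Q) :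
    IsPoly (P ∩ Q) := by
  classical
  obtain ⟨weak, strict, rfl⟩ := hP
  obtain ⟨weak', strict', rfl⟩ := hQ
  refine ⟨weak ∪ weak', strict ∪ strict', ?_⟩
  ext x
  simp only [Set.mem_inter_iff, Set.mem_ofPred_eq, Finset.mem_union]
  grind

/-! ### Models of faces, and of polytopes with empty interior. -/

section Face

variable {n m : ℕ}

theorem exists_map_model {S : Type*} {P : Set (Fin m → ℝ)} (x : S → Fin n → ℝ)
    (z : S → Fin m → CStarT) (h : ∀ a, tropv (z a) ∈ P) :
    ∃ Φ : S → model n P, (∀ a, xc (Φ a) = x a) ∧ ∀ a, zc (Φ a) = z a :=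
  ⟨fun a => mkPt (x a) (z a) (h a), fun _ => rfl, fun _ => rfl⟩

theorem exists_pt_model {P : Set (Fin m → ℝ)} (x : Fin n → ℝ) (z : Fin m → CStarT)
    (h : tropv z ∈ P) : ∃ p : model n P, xc p = x ∧ zc p = z :=
  ⟨mkPt x z h, rfl, rfl⟩

/-- Near any point a model is isomorphic to the model of the face containing the exponent of that
point. -/
theorem locIso_face {P P₀ : Set (Fin m → ℝ)} {weak strict I : Finset (IntAffine m)}
    (hP : P = {x | (∀ q ∈ weak, 0 ≤ q.eval x) ∧ ∀ q ∈ strict, 0 < q.eval x})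
    (hP₀ : P₀ = {x | x ∈ P ∧ ∀ q ∈ I, q.eval x = 0}) (hI : I ⊆ weak)
    (p : model n P) (p₀ : model n P₀) (hx : xc p₀ = xc p) (hz : zc p₀ = zc p) :
    ∃ φ ψ, LocIso (model n P) (model n P₀) φ ψ p p₀ := by
  classical
  have hsub : P₀ ⊆ P := fun x h => (hP₀ ▸ h : x ∈ {x | x ∈ P ∧ ∀ q ∈ I, q.eval x = 0}).1
  have hmem : ∀ y, y ∈ P ↔ (∀ q ∈ weak, 0 ≤ q.eval y) ∧ ∀ q ∈ strict, 0 < q.eval y := by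
    simp [hP]
  have hmem₀ : ∀ y, y ∈ P₀ ↔ y ∈ P ∧ ∀ q ∈ I, q.eval y = 0 := by simp [hP₀]
  have htc : tc p₀ = tc p := by rw [tc, tc, hz]
  have hp₀ : ∀ q ∈ I, q.eval (tc p) = 0 := by
    rw [← htc]; exact ((hmem₀ _).1 (tc_mem p₀)).2
  let ψ : model n P₀ → model n P := fun e => mkPt (xc e) (zc e) (hsub (tc_mem e))
  let φ : model n P → model n P₀ := fun e =>
    if h : tropv (zc e) ∈ P₀ then mkPt (xc e) (zc e) h else p₀
  have hφ : ∀ e : model n P, tc e ∈ P₀ → xc (φ e) = xc e ∧ zc (φ e) = zc e := by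
    intro e he
    have he' : tropv (zc e) ∈ P₀ := he
    simp [φ, he']
  let S : IntAffine m := ∑ q ∈ I, q
  have hS : ∀ y ∈ P₀, S.eval y = 0 := fun y hy => by
    rw [IntAffine.eval_sum]; exact Finset.sum_eq_zero ((hmem₀ y).1 hy).2
  have hS' : ∀ y ∈ P, 0 ≤ S.eval y := fun y hy => by
    rw [IntAffine.eval_sum]
    exact Finset.sum_nonneg fun q hq => ((hmem y).1 hy).1 q (hI hq)
  -- For `q ∈ I` the smooth monomial of `q` is nonzero at `p`. Being nonzero is an open condition,
  -- and it forces the exponent `q` to be zero.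
  have hnear : ∀ᶠ e in 𝓝 p, tc e ∈ P₀ := by
    have h1 : ∀ q ∈ I, ∀ᶠ e in 𝓝 p, q.eval (tc e) = 0 := by
      intro q hq
      let r : NonnegMonomial P := ⟨q, fun y hy => ((hmem y).1 hy).1 q (hI hq)⟩
      have h2 : smon r p ≠ 0 := CStarT.smoothPart_ne_zero_iff.2 (by
        rw [trop_monomial_zc]; exact hp₀ q hq)
      filter_upwards [(continuous_smon r).continuousAt.eventually (isOpen_ne.mem_nhds h2)]
        with e he
      rw [← trop_monomial_zc]
      exact CStarT.smoothPart_ne_zero_iff.1 he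
    filter_upwards [(Finset.eventually_all I).2 h1] with e he
    exact (hmem₀ _).2 ⟨tc_mem e, he⟩
  have hψφ : ∀ e, tc e ∈ P₀ → ψ (φ e) = e := fun e he =>
    model_ext (hφ e he).1 (hφ e he).2
  have hφψ : ∀ e, φ (ψ e) = e := fun e =>
    model_ext (hφ (ψ e) (tc_mem e)).1 (hφ (ψ e) (tc_mem e)).2
  have hp : tc p ∈ P₀ := by rw [← htc]; exact tc_mem p₀
  refine ⟨φ, ψ, ?_, model_ext hx hz, ?_, Eventually.of_forall fun e => ?_,
    hnear.mono hψφ, Eventually.of_forall hφψ⟩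
  · exact model_ext ((hφ p hp).1.trans hx.symm) ((hφ p hp).2.trans hz.symm)
  · filter_upwards [eventually_eventually_nhds.2 hnear] with e he
    refine morAt_model_model ((smM_xc e).congr (he.mono fun a ha => (hφ a ha).1.symm))
      (fun r => ?_) fun i => (secAt_zc i e).congr (he.mono fun a ha => by
        dsimp only; rw [(hφ a ha).2])
    -- A smooth monomial `r` of the face need not be nonnegative on `P`, but `r + N • S` is. Since
    -- the smooth part of `S` is nonzero near `p`, division by its `N`th power expresses `r` by
    -- smooth monomials of `P`.
    obtain ⟨N, hN⟩ := exists_nonneg_add_nsmul (weak := weak) (strict := strict) (I := I)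
      (y₀ := tc p) ((hmem _).1 (tc_mem p)) hI hp₀ r.1 fun y h1 h2 h3 =>
        r.2 y ((hmem₀ y).2 ⟨(hmem y).2 ⟨h1, h2⟩, h3⟩)
    let r' : NonnegMonomial P := ⟨r.1 + N • S, fun y hy =>
      hN y ((hmem y).1 hy).1 ((hmem y).1 hy).2⟩
    let S' : NonnegMonomial P := ⟨S, hS'⟩
    have hS0 : ∀ a : model n P, tc a ∈ P₀ → smon S' a ≠ 0 := fun a ha =>
      CStarT.smoothPart_ne_zero_iff.2 (by rw [trop_monomial_zc]; exact hS _ ha)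
    have h1 := (smM_smon r' e).mul (((smM_smon S' e).pow N).inv
      (pow_ne_zero _ (hS0 e he.self_of_nhds)))
    refine h1.congr ?_
    filter_upwards [he] with a ha
    have h2 : smon r' a = smon r (φ a) * smon S' a ^ N := by
      rw [smon, smon, smon, (hφ a ha).2]
      have hr0 : 0 ≤ (monomial r.1 (zc a)).trop := by
        rw [trop_monomial_zc]; exact r.2 _ ha
      have hSt : (monomial S (zc a)).trop = 0 := by
        rw [trop_monomial_zc]; exact hS _ ha
      have hSN : (monomial S (zc a) ^ N).trop = 0 := by rw [CStarT.trop_pow, hSt, mul_zero]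
      rw [show r'.1 = r.1 + N • S from rfl, show S'.1 = S from rfl, monomial_add, monomial_nsmul,
        CStarT.smoothPart_mul hr0 hSN.ge, CStarT.smoothPart_of_eq hSN,
        CStarT.smoothPart_of_eq hSt]
      simp
    rw [h2, mul_assoc, mul_inv_cancel₀ (pow_ne_zero _ (hS0 a ha)), mul_one]
  · refine morAt_explicit (U := fun _ _ => 1) (M := fun i => IntAffine.coord i) (smM_xc e)
      (fun _ => smM_const 1 e) (fun _ => one_ne_zero) (Eventually.of_forall fun x j => ?_)
      fun y hy => ?_
    · rw [monomial_coord]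
      exact CStarT.ext' (by simp [ψ, toUnit]) (by simp [ψ])
    · have : IntAffine.aff (fun i : Fin m => IntAffine.coord i) y = y :=
        funext fun i => IntAffine.eval_coord _ _
      rw [this]
      exact hsub hy

/-- The product of a full dimensional model with coordinates of exponent zero. -/
theorem goodPt_of_prod {m₁ d : ℕ} {e : Fin m₁ ⊕ Fin d ≃ Fin m} {P : Set (Fin m → ℝ)}
    {P₁ : Set (Fin m₁ → ℝ)} (hP₁ : IsPoly P₁)
    (hP : ∀ y, y ∈ P ↔ (fun i => y (e (Sum.inl i))) ∈ P₁ ∧ ∀ j, y (e (Sum.inr j)) = 0)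
    (p : model n P) (hp : (fun i => tc p (e (Sum.inl i))) ∈ interior P₁) :
    GoodPt (model n P) p := by
  classical
  let e' : Fin n ⊕ (Fin d ⊕ Fin d) ≃ Fin (n + (d + d)) :=
    (Equiv.sumCongr (Equiv.refl _) finSumFinEquiv).trans finSumFinEquiv
  let s : Finset (NonnegMonomial P₁) := ∅
  let X : (Fin (n + (d + d)) → ℝ) × (s → ℂ) → Fin n → ℝ := fun y i => y.1 (e' (Sum.inl i))
  let ℓ : (Fin (n + (d + d)) → ℝ) × (s → ℂ) → Fin d → ℂ := fun y j =>
    y.1 (e' (Sum.inr (Sum.inl j))) + y.1 (e' (Sum.inr (Sum.inr j))) * Complex.I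
  -- A coordinate of exponent zero is a nonzero complex number, and locally its logarithm supplies
  -- two real coordinates.
  let k : (Fin (n + (d + d)) → ℝ) × (s → ℂ) → Fin d → ℂ := fun y j => Complex.exp (ℓ y j)
  have hX : ContDiff ℝ ∞ X := by fun_prop
  have hof : ContDiff ℝ ∞ (fun t : ℝ => (t : ℂ)) := Complex.ofRealCLM.contDiff
  have hℓj : ∀ j, ContDiff ℝ ∞ (fun y => ℓ y j) := fun j =>
    (hof.comp (f := fun y : (Fin (n + (d + d)) → ℝ) × (s → ℂ) => y.1 (e' (Sum.inr (Sum.inl j))))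
      (by fun_prop)).add ((hof.comp (f := fun y : (Fin (n + (d + d)) → ℝ) × (s → ℂ) =>
        y.1 (e' (Sum.inr (Sum.inr j)))) (by fun_prop)).mul contDiff_const)
  have hk : ContDiff ℝ ∞ k := contDiff_pi.2 fun j => (hℓj j).cexp
  obtain ⟨Φ, hΦx, hΦz⟩ := exists_map_model (P := P)
    (fun a : model (n + (d + d)) P₁ => X (coords s a))
    (fun a i => Sum.elim (fun l => zc a l) (fun j => CStarT.mk (toUnit (k (coords s a) j)) 0)
      (e.symm i)) fun a => by
        rw [hP]
        refine ⟨?_, fun j => by simp [tropv]⟩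
        have : (fun i => tropv (fun i => Sum.elim (fun l => zc a l)
            (fun j => CStarT.mk (toUnit (k (coords s a) j)) 0) (e.symm i)) (e (Sum.inl i))) =
            tc a := by
          funext i; simp [tropv, tc]
        rw [this]
        exact tc_mem a
  let c : Fin d → ℂ := fun j => (zc p (e (Sum.inr j))).1
  obtain ⟨p₁, hpx, hpz⟩ := exists_pt_model (P := P₁)
    (fun i => Sum.elim (xc p) (Sum.elim (fun j => (Complex.log (c j)).re)
      fun j => (Complex.log (c j)).im) (e'.symm i))
    (fun i => zc p (e (Sum.inl i))) ((hP _).1 (tc_mem p)).1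
  have hkp : ∀ j, k (coords s p₁) j = c j := by
    intro j
    have : ℓ (coords s p₁) j = Complex.log (c j) := by
      simp only [ℓ, coords, hpx, Equiv.symm_apply_apply, Sum.elim_inl, Sum.elim_inr,
        Complex.re_add_im]
    simp only [k, this]
    exact Complex.exp_log (Units.ne_zero _)
  have hΦp : Φ p₁ = p := by
    refine model_ext ?_ (funext fun i => ?_)
    · funext i
      simp only [hΦx, X, coords, hpx, Equiv.symm_apply_apply, Sum.elim_inl]
    · obtain ⟨i, rfl⟩ := e.surjective i
      cases i with
      | inl l => simp only [hΦz, hpz, Equiv.symm_apply_apply, Sum.elim_inl]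
      | inr j =>
        simp only [hΦz, Equiv.symm_apply_apply, Sum.elim_inr, hkp]
        refine CStarT.ext' (by simp [c]) ?_
        rw [CStarT.trop_mk]
        exact (((hP _).1 (tc_mem p)).2 j).symm
  obtain ⟨Θ, hΘ⟩ := exists_locIso_of_injective (e := e) (p := p₁) (s := s) (X := X)
    (h := fun _ _ => 1) (k := k) (Φ := Φ) hP (hX.smoothNear _) (contDiff_const.smoothNear _)
    (hk.smoothNear _) (fun _ => one_ne_zero) (fun _ => Complex.exp_ne_zero _) (by omega)
    (fun v h1 h2 _ => by
      have hXv : fderiv ℝ X (coords s p₁) v = X v := by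
        let A : ((Fin (n + (d + d)) → ℝ) × (s → ℂ)) →L[ℝ] (Fin n → ℝ) :=
          (ContinuousLinearMap.pi fun i => ContinuousLinearMap.proj (e' (Sum.inl i))).comp
            (ContinuousLinearMap.fst ℝ _ _)
        exact congrFun (congrArg DFunLike.coe A.hasFDerivAt.fderiv) v
      have hℓv : ∀ j, HasFDerivAt (fun y => ℓ y j)
          ((Complex.ofRealCLM.comp ((ContinuousLinearMap.proj (e' (Sum.inr (Sum.inl j)))).comp
            (ContinuousLinearMap.fst ℝ _ _))) +
          (Complex.I • Complex.ofRealCLM.comp ((ContinuousLinearMap.proj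
            (e' (Sum.inr (Sum.inr j)))).comp (ContinuousLinearMap.fst ℝ _ _)))) (coords s p₁) := by
        intro j
        refine (ContinuousLinearMap.hasFDerivAt _).congr_of_eventuallyEq
          (Eventually.of_forall fun y => ?_)
        simp [ℓ, mul_comm]
      have hkv : ∀ j, ℓ v j = 0 := by
        intro j
        have h3 := (hasFDerivAt_pi.2 fun j => (hℓv j).cexp)
        have h4 := congrFun (congrArg DFunLike.coe h3.fderiv) v
        have h5 : fderiv ℝ k (coords s p₁) v j = Complex.exp (ℓ (coords s p₁) j) * ℓ v j := by
          have := congrFun h4 j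
          refine this.trans ?_
          simp only [ContinuousLinearMap.coe_pi', ContinuousLinearMap.smul_apply,
            ContinuousLinearMap.add_apply, ContinuousLinearMap.comp_apply,
            ContinuousLinearMap.proj_apply, ContinuousLinearMap.coe_fst', Complex.ofRealCLM_apply,
            smul_eq_mul, ℓ]
          ring
        rw [h2] at h5
        exact (mul_eq_zero.1 h5.symm).resolve_left (Complex.exp_ne_zero _)
      refine Prod.ext (funext fun i => ?_) (funext fun i => absurd i.2 (Finset.notMem_empty _))
      obtain ⟨i, rfl⟩ := e'.surjective i
      rcases i with i | j | j
      · rw [hXv] at h1; exact congrFun h1 i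
      · have := congrArg Complex.re (hkv j); simpa [ℓ] using this
      · have := congrArg Complex.im (hkv j); simpa [ℓ] using this)
    (Eventually.of_forall fun a => ⟨hΦx a, fun l => by
      simp only [hΦz, Equiv.symm_apply_apply, Sum.elim_inl]
      exact CStarT.ext' (by simp [toUnit]) (by simp), fun j => by
      simp only [hΦz, Equiv.symm_apply_apply, Sum.elim_inr]⟩)
  rw [hΦp] at hΘ
  have hp₁ : tc p₁ ∈ interior P₁ := by
    rw [tc, hpz]
    exact hp
  exact ⟨_, _, P₁, p₁, Θ, Φ, ⟨⟨_, hp₁⟩, hP₁⟩, hp₁, hΘ.symm⟩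

/-- Models of arbitrary sets given by finitely many inequalities are exploded manifolds. -/
theorem goodPt_model {P : Set (Fin m → ℝ)} (hP : IsPoly P) (p : model n P) :
    GoodPt (model n P) p := by
  classical
  obtain ⟨weak, strict, hPe⟩ := id hP
  have hmem : ∀ y, y ∈ P ↔ (∀ q ∈ weak, 0 ≤ q.eval y) ∧ ∀ q ∈ strict, 0 < q.eval y := by
    simp [hPe]
  set y₀ := tc p with hy₀
  -- The weak inequalities that are equalities at `y₀` cut out the face containing `y₀` in its
  -- relative interior.
  let I := weak.filter fun q => q.eval y₀ = 0
  have hI : ∀ q ∈ I, q ∈ weak ∧ q.eval y₀ = 0 := fun q hq => Finset.mem_filter.1 hq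
  let P₀ : Set (Fin m → ℝ) := {x | x ∈ P ∧ ∀ q ∈ I, q.eval x = 0}
  have hy₀P : y₀ ∈ P := tc_mem p
  have hy₀P₀ : y₀ ∈ P₀ := ⟨tc_mem p, fun q hq => (hI q hq).2⟩
  let p₀ : model n P₀ := mkPt (xc p) (zc p) hy₀P₀
  obtain ⟨φ, ψ, hface⟩ := locIso_face (P₀ := P₀) hPe rfl (Finset.filter_subset _ _) p p₀ rfl rfl
  refine GoodPt.of_locIso hface ?_
  -- coordinates adapted to the lattice spanned by the equations of the face
  let Λ : Submodule ℤ (Fin m → ℤ) := Submodule.span ℤ ((fun q : IntAffine m => q.2) '' I)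
  obtain ⟨d, snf⟩ := Submodule.smithNormalForm (Pi.basisFun ℤ (Fin m)) Λ
  obtain ⟨bM, bN, f, a, hsnf⟩ := snf
  let m₁ := Fintype.card {i // ¬ i ∈ Set.range f}
  let e : Fin m₁ ⊕ Fin d ≃ Fin m := (Equiv.sumComm _ _).trans
    ((Equiv.sumCongr (Equiv.ofInjective f f.injective) (Fintype.equivFin _).symm).trans
      (Equiv.sumCompl (· ∈ Set.range f)))
  have he : ∀ j, e (Sum.inr j) = f j := fun j => by simp [e]
  let lin : (Fin m → ℝ) → (Fin m → ℤ) →ₗ[ℤ] ℝ := fun x =>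
    { toFun := fun v => ∑ i, x i * v i
      map_add' := fun v w => by simp [mul_add, Finset.sum_add_distrib]
      map_smul' := fun c v => by
        simp only [Pi.smul_apply, smul_eq_mul, Int.cast_mul, Finset.mul_sum, eq_intCast,
          zsmul_eq_mul]
        exact Finset.sum_congr rfl fun i _ => by rw [Int.cast_id]; ring }
  have hlin : ∀ (q : IntAffine m) x y, lin (x - y) q.2 = q.eval x - q.eval y := fun q x y =>
    IntAffine.lin_sub q x y
  -- Integral affine coordinates centred at `y₀`. Within `P`, the face `P₀` is where those indexed
  -- by the range of `f` vanish, as `hvan` and `hvan'` show.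
  let M : Fin m → IntAffine m := fun j => (-lin y₀ (bM j), bM j)
  have hMe : ∀ j x, (M j).eval x = lin (x - y₀) (bM j) := by
    intro j x
    have : lin (x - y₀) (bM j) = lin x (bM j) - lin y₀ (bM j) := by
      simp only [lin, LinearMap.coe_mk, AddHom.coe_mk, Pi.sub_apply, sub_mul,
        Finset.sum_sub_distrib]
    rw [this]
    simp only [M, IntAffine.eval, lin, LinearMap.coe_mk, AddHom.coe_mk]
    ring
  obtain ⟨N, hMN⟩ := exists_uniPair bM fun j => -lin y₀ (bM j)
  change UniPair M N at hMN
  have hvan : ∀ x, (∀ j, lin (x - y₀) (bM (f j)) = 0) → ∀ q ∈ I, q.eval x = 0 := by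
    intro x hx q hq
    have h1 : (lin (x - y₀)).domRestrict Λ = 0 := bN.ext fun j => by
      rw [LinearMap.domRestrict_apply, hsnf, map_smul, hx, smul_zero, LinearMap.zero_apply]
    have h2 := LinearMap.congr_fun h1 ⟨q.2, Submodule.subset_span ⟨q, hq, rfl⟩⟩
    simp only [LinearMap.domRestrict_apply, LinearMap.zero_apply] at h2
    rw [hlin, (hI q hq).2, sub_zero] at h2
    exact h2
  have hvan' : ∀ x ∈ P₀, ∀ j, lin (x - y₀) (bM (f j)) = 0 := by
    intro x hx j
    have h1 : ∀ v ∈ Λ, lin (x - y₀) v = 0 := by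
      intro v hv
      refine Submodule.span_induction (p := fun v _ => lin (x - y₀) v = 0) ?_ (map_zero _)
        (fun v w _ _ h1 h2 => by rw [map_add, h1, h2, add_zero])
        (fun c v _ h => by rw [map_smul, h, smul_zero]) hv
      rintro _ ⟨q, hq, rfl⟩
      simp only [hlin]
      rw [hx.2 q hq, (hI q hq).2, sub_zero]
    -- Smith normal form puts only the multiple `a j • bM (f j)` in `Λ`. The functional is real
    -- valued and `a j ≠ 0`, so the multiple can be divided out.
    have h2 := h1 _ (bN j).2
    rw [hsnf, map_smul, zsmul_eq_mul] at h2
    refine (mul_eq_zero.1 h2).resolve_left fun h0 => ?_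
    have ha : a j = 0 := by exact_mod_cast h0
    have := bN.ne_zero j
    apply this
    exact Subtype.ext (by rw [hsnf, ha, zero_smul]; rfl)
  let E₁ : Fin m → IntAffine m₁ := fun k => Sum.elim (fun l => IntAffine.coord l) (fun _ => 0) (e.symm k)
  have hE₁ : ∀ (y : Fin m₁ → ℝ), (fun l => IntAffine.aff E₁ y (e (Sum.inl l))) = y := fun y => by
    funext l; simp [E₁, IntAffine.aff]
  have hE₁' : ∀ (y : Fin m₁ → ℝ) j, IntAffine.aff E₁ y (e (Sum.inr j)) = 0 := fun y j => by
    simp [E₁, IntAffine.aff]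
  let P₁ : Set (Fin m₁ → ℝ) := IntAffine.aff E₁ ⁻¹' (IntAffine.aff N ⁻¹' P)
  have hmP₁ : ∀ y, y ∈ P₁ ↔ IntAffine.aff N (IntAffine.aff E₁ y) ∈ P := fun _ => Iff.rfl
  have hP₁ : IsPoly P₁ := (hP.preimage N).preimage E₁
  have hMN' : ∀ y j, lin (IntAffine.aff N y - y₀) (bM j) = y j := fun y j => by
    rw [← hMe]; exact congrFun (hMN.symm.aff_aff y) j
  have hprod : ∀ y, y ∈ IntAffine.aff N ⁻¹' P₀ ↔
      (fun i => y (e (Sum.inl i))) ∈ P₁ ∧ ∀ j, y (e (Sum.inr j)) = 0 := by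
    intro y
    have hy : (∀ j, y (e (Sum.inr j)) = 0) →
        IntAffine.aff E₁ (fun i => y (e (Sum.inl i))) = y := by
      intro h
      funext k
      obtain ⟨k, rfl⟩ := e.surjective k
      cases k with
      | inl l => simp [E₁, IntAffine.aff]
      | inr j => rw [hE₁', h]
    constructor
    · intro h
      have h1 : ∀ j, y (e (Sum.inr j)) = 0 := fun j => by
        rw [he, ← hMN' y]; exact hvan' _ h j
      refine ⟨?_, h1⟩
      rw [hmP₁, hy h1]
      exact h.1
    · rintro ⟨h1, h2⟩
      rw [hmP₁, hy h2] at h1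
      exact ⟨h1, hvan _ fun j => by rw [hMN', ← he]; exact h2 j⟩
  refine GoodPt.of_locIso (hMN.locIso p₀) (goodPt_of_prod hP₁ hprod _ ?_)
  have ht : tc (affMap M (hMN.mapsTo P₀) p₀) = 0 := by
    rw [tc_affMap]
    funext j
    rw [IntAffine.aff, hMe, show tc p₀ - y₀ = 0 from sub_self y₀]
    simp [lin]
  rw [ht]
  have hN0 : IntAffine.aff N 0 = y₀ := by
    have := hMN.aff_aff y₀
    rwa [show IntAffine.aff M y₀ = 0 from funext fun j => by
      rw [IntAffine.aff, hMe]; simp [lin]] at this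
  have hE0 : IntAffine.aff E₁ 0 = 0 := by
    funext k
    obtain ⟨k, rfl⟩ := e.surjective k
    cases k with
    | inl l => simp [E₁, IntAffine.aff]
    | inr j => rw [hE₁']; rfl
  have hcont : Continuous fun y => IntAffine.aff N (IntAffine.aff E₁ y) :=
    (IntAffine.continuous_aff N).comp (IntAffine.continuous_aff E₁)
  change (0 : Fin m₁ → ℝ) ∈ interior P₁
  rw [mem_interior_iff_mem_nhds]
  -- In the remaining coordinates the inequalities of `I` hold identically, and all others are
  -- strict at the origin, hence near it; so the origin is interior to `P₁`.
  have hpos : ∀ q : IntAffine m, 0 < q.eval y₀ →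
      ∀ᶠ y in 𝓝 (0 : Fin m₁ → ℝ), 0 < q.eval (IntAffine.aff N (IntAffine.aff E₁ y)) := by
    intro q hq
    refine ((IntAffine.continuous_eval q).comp hcont).continuousAt.eventually (lt_mem_nhds ?_)
    simpa [hE0, hN0] using hq
  have hw : ∀ q ∈ weak, ∀ᶠ y in 𝓝 (0 : Fin m₁ → ℝ),
      0 ≤ q.eval (IntAffine.aff N (IntAffine.aff E₁ y)) := by
    intro q hq
    by_cases h0 : q.eval y₀ = 0
    · refine Eventually.of_forall fun y => (hvan _ (fun j => ?_) q
        (Finset.mem_filter.2 ⟨hq, h0⟩)).ge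
      rw [hMN', ← he, hE₁']
    · exact (hpos q (lt_of_le_of_ne (((hmem y₀).1 hy₀P).1 q hq) (Ne.symm h0))).mono
        fun y hy => hy.le
  have hs : ∀ q ∈ strict, ∀ᶠ y in 𝓝 (0 : Fin m₁ → ℝ),
      0 < q.eval (IntAffine.aff N (IntAffine.aff E₁ y)) := fun q hq =>
    hpos q (((hmem y₀).1 hy₀P).2 q hq)
  filter_upwards [(Finset.eventually_all weak).2 hw, (Finset.eventually_all strict).2 hs]
    with y h1 h2
  exact (hmem _).2 ⟨h1, h2⟩

end Face

/-! ### Small neighbourhoods isomorphic to the whole model -/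

/-- Write `ρᵢ(c)` for the squares in the statement. The equation says that `c` is a critical point
of `|c|²/2 - ½ ∑ log (1 - ρᵢ(c))` on the open set where all `ρᵢ < 1`. This function has compact
sublevel sets, so it attains its minimum; the set is nonempty because moving far along `v` makes
every `ρᵢ` small. -/
theorem exists_balanced {ι : Type*} {m : ℕ} (s : Finset ι) (a : ι → Fin m → ℝ) (b : ι → ℝ)
    (v : Fin m → ℝ) (hv : ∀ i ∈ s, b i ≠ 0 → ∑ j, v j * a i j < 0) :
    ∃ c : Fin m → ℝ, (∀ i ∈ s, (b i * Real.exp (∑ j, c j * a i j)) ^ 2 < 1) ∧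
      ∀ l, c l + ∑ i ∈ s, (b i * Real.exp (∑ j, c j * a i j)) ^ 2 /
        (1 - (b i * Real.exp (∑ j, c j * a i j)) ^ 2) * a i l = 0 := by
  classical
  let ρ : ι → (Fin m → ℝ) → ℝ := fun i c => (b i * Real.exp (∑ j, c j * a i j)) ^ 2
  have hρ : ∀ i, Continuous (ρ i) := fun i => by fun_prop
  have hρ0 : ∀ i c, 0 ≤ ρ i c := fun i c => sq_nonneg _
  let D : Set (Fin m → ℝ) := {c | ∀ i ∈ s, ρ i c < 1}
  let G : (Fin m → ℝ) → ℝ := fun c => (∑ j, c j ^ 2) / 2 + ∑ i ∈ s, -(Real.log (1 - ρ i c) / 2)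
  have hΦ : ∀ c ∈ D, ∀ i ∈ s, 0 ≤ -(Real.log (1 - ρ i c) / 2) := fun c hc i hi => by
    have := Real.log_nonpos (by linarith [hc i hi]) (by linarith [hρ0 i c] : 1 - ρ i c ≤ 1)
    linarith
  -- a point of the domain
  obtain ⟨c₀, hc₀⟩ : ∃ c₀, c₀ ∈ D := by
    have h1 : ∀ i ∈ s, ∀ᶠ T : ℝ in atTop, ρ i (T • v) < 1 := by
      intro i hi
      by_cases h0 : b i = 0
      · simp [ρ, h0]
      have h2 := hv i hi h0
      have h3 : Tendsto (fun T : ℝ => (b i * Real.exp (T * ∑ j, v j * a i j)) ^ 2) atTop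
          (𝓝 ((b i * 0) ^ 2)) :=
        ((Real.tendsto_exp_atBot.comp (tendsto_id.atTop_mul_const_of_neg h2)).const_mul _).pow 2
      have h4 : (b i * 0) ^ 2 < (1 : ℝ) := by simp
      filter_upwards [h3.eventually (gt_mem_nhds h4)] with T hT
      have h5 : ∑ j, (T • v) j * a i j = T * ∑ j, v j * a i j := by
        simp [Finset.mul_sum, mul_assoc]
      simpa only [ρ, h5] using hT
    obtain ⟨T, hT⟩ := ((Finset.eventually_all s).2 h1).exists
    exact ⟨T • v, hT⟩
  set g₀ := G c₀ with hg₀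
  -- Both summands of `G` are nonnegative, so `G c ≤ g₀` bounds `c` and keeps every `ρ i c` away
  -- from `1`: the minimum is sought on a compact set inside the open domain.
  let S : Set (Fin m → ℝ) := {c | (∑ j, c j ^ 2) / 2 ≤ g₀ ∧
    ∀ i ∈ s, Real.exp (-(2 * g₀)) ≤ 1 - ρ i c}
  have hSD : S ⊆ D := fun c hc i hi => by
    have := hc.2 i hi
    have := Real.exp_pos (-(2 * g₀))
    linarith
  have hDS : ∀ c ∈ D, G c ≤ g₀ → c ∈ S := by
    intro c hc hG
    have h1 : 0 ≤ ∑ i ∈ s, -(Real.log (1 - ρ i c) / 2) := Finset.sum_nonneg (hΦ c hc)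
    have h2 : 0 ≤ (∑ j, c j ^ 2) / 2 := by positivity
    refine ⟨by simp only [G] at hG; linarith, fun i hi => ?_⟩
    have h3 := Finset.single_le_sum (hΦ c hc) hi
    rw [← Real.le_log_iff_exp_le (by linarith [hc i hi])]
    simp only [G] at hG
    linarith
  have hScl : IsClosed S := by
    have h1 : IsClosed {c : Fin m → ℝ | (∑ j, c j ^ 2) / 2 ≤ g₀} :=
      isClosed_le (by fun_prop) continuous_const
    have h2 : IsClosed (⋂ i ∈ s, {c : Fin m → ℝ | Real.exp (-(2 * g₀)) ≤ 1 - ρ i c}) :=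
      isClosed_biInter fun i _ => isClosed_le continuous_const (continuous_const.sub (hρ i))
    convert h1.inter h2 using 1
    ext c
    simp [S]
  have hScpt : IsCompact S := by
    refine (isCompact_Icc (a := fun _ : Fin m => -(2 * g₀ + 1))
      (b := fun _ : Fin m => 2 * g₀ + 1)).of_isClosed_subset hScl fun c hc => ?_
    have h1 : ∀ j, c j ^ 2 ≤ 2 * g₀ := fun j => by
      have := Finset.single_le_sum (f := fun j => c j ^ 2) (fun j _ => sq_nonneg _)
        (Finset.mem_univ j)
      have h2 := hc.1
      exact this.trans (by linarith)
    exact ⟨fun j => by have := h1 j; simp only; nlinarith, fun j => by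
      have := h1 j; simp only; nlinarith⟩
  have hGc : ContinuousOn G S := by
    refine ContinuousOn.add (by fun_prop) (continuousOn_finsetSum _ fun i hi => ?_)
    refine ((ContinuousOn.log (continuous_const.sub (hρ i)).continuousOn fun c hc => ?_).div_const
      _).neg
    have := hSD hc i hi
    exact (sub_pos.2 this).ne'
  obtain ⟨c, hcS, hmin⟩ := hScpt.exists_isMinOn ⟨c₀, hDS c₀ hc₀ le_rfl⟩ hGc
  have hmin' : ∀ c' ∈ D, G c ≤ G c' := fun c' hc' => by
    by_cases h : G c' ≤ g₀
    · exact hmin (hDS c' hc' h)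
    · exact (hmin (hDS c₀ hc₀ le_rfl)).trans (not_le.1 h).le
  have hcD := hSD hcS
  refine ⟨c, hcD, fun l => ?_⟩
  let w : Fin m → ℝ := Pi.single l 1
  have hline : ∀ i t, ρ i (c + t • w) =
      (b i * Real.exp (∑ j, c j * a i j + t * a i l)) ^ 2 := by
    intro i t
    have : ∑ j, (c + t • w) j * a i j = ∑ j, c j * a i j + t * a i l := by
      simp only [Pi.add_apply, Pi.smul_apply, smul_eq_mul, add_mul, Finset.sum_add_distrib]
      congr 1
      rw [Finset.sum_eq_single l]
      · simp [w]
      · intro j _ hj; simp [w, Pi.single_eq_of_ne hj]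
      · simp
    simp only [ρ, this]
  have hDo : IsOpen D := by
    have : D = ⋂ i ∈ s, {c | ρ i c < 1} := by ext c; simp [D]
    rw [this]
    exact isOpen_biInter_finset fun i _ => isOpen_lt (hρ i) continuous_const
  have hloc : IsLocalMin (fun t : ℝ => G (c + t • w)) 0 := by
    have : Tendsto (fun t : ℝ => c + t • w) (𝓝 0) (𝓝 c) := by
      have h : Continuous (fun t : ℝ => c + t • w) := by fun_prop
      simpa using h.tendsto 0
    filter_upwards [this.eventually (hDo.mem_nhds hcD)] with t ht
    simpa using hmin' _ ht
  have hder : HasDerivAt (fun t : ℝ => G (c + t • w))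
      (c l + ∑ i ∈ s, ρ i c / (1 - ρ i c) * a i l) 0 := by
    have h1 : HasDerivAt (fun t : ℝ => (∑ j, (c + t • w) j ^ 2) / 2) (c l) 0 := by
      have h2 : ∀ j, HasDerivAt (fun t : ℝ => (c + t • w) j ^ 2) (2 * c j * w j) 0 := by
        intro j
        have h3 : HasDerivAt (fun t : ℝ => c j + t * w j) (w j) 0 := by
          simpa using ((hasDerivAt_id (0 : ℝ)).mul_const (w j)).const_add (c j)
        refine (h3.fun_pow 2).congr_deriv ?_
        simp
      have h4 := (HasDerivAt.fun_sum fun j (_ : j ∈ Finset.univ) => h2 j).div_const 2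
      refine h4.congr_deriv ?_
      rw [Finset.sum_eq_single l]
      · simp [w]
      · intro j _ hj; simp [w, Pi.single_eq_of_ne hj]
      · simp
    refine h1.add (HasDerivAt.fun_sum fun i hi => ?_)
    simp only [hline]
    have h5 : HasDerivAt (fun t : ℝ => ∑ j, c j * a i j + t * a i l) (a i l) 0 := by
      simpa using ((hasDerivAt_id (0 : ℝ)).mul_const (a i l)).const_add (∑ j, c j * a i j)
    have h6 := ((h5.exp.const_mul (b i)).fun_pow 2).const_sub 1
    have h0 : 1 - (b i * Real.exp (∑ j, c j * a i j + 0 * a i l)) ^ 2 ≠ 0 := by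
      rw [← hline]; simpa using (sub_pos.2 (hcD i hi)).ne'
    have h7 := ((h6.log h0).div_const 2).neg
    refine h7.congr_deriv ?_
    simp only [zero_mul, add_zero, ρ] at h0 ⊢
    field_simp
    simp
    ring
  exact hloc.hasDerivAt_eq_zero hder

/-- The strictly increasing map of `(-ε, ε)` onto `ℝ`. -/
theorem stretch_bijOn {ε : ℝ} (hε : 0 < ε) :
    Set.InjOn (fun t : ℝ => t / (ε ^ 2 - t ^ 2)) (Set.Ioo (-ε) ε) ∧
    ∀ y : ℝ, ∃ t ∈ Set.Ioo (-ε) ε, t / (ε ^ 2 - t ^ 2) = y := by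
  have hpos : ∀ t ∈ Set.Ioo (-ε) ε, 0 < ε ^ 2 - t ^ 2 := fun t ht => by nlinarith [ht.1, ht.2]
  constructor
  · intro t ht t' ht' h
    have h1 := hpos t ht
    have h2 := hpos t' ht'
    simp only at h
    rw [div_eq_div_iff h1.ne' h2.ne'] at h
    have h3 : (t - t') * (ε ^ 2 + t * t') = 0 := by linear_combination h
    have h4 : 0 < ε ^ 2 + t * t' := by nlinarith [ht.1, ht.2, ht'.1, ht'.2, sq_nonneg (t + t')]
    exact sub_eq_zero.1 ((mul_eq_zero.1 h3).resolve_right h4.ne')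
  · intro y
    by_cases hy : y = 0
    · exact ⟨0, by simp [hε], by simp [hy]⟩
    -- solve `y (ε² - t²) = t` explicitly
    set r := Real.sqrt (1 + 4 * y ^ 2 * ε ^ 2) with hr
    have hr2 : r ^ 2 = 1 + 4 * y ^ 2 * ε ^ 2 := Real.sq_sqrt (by positivity)
    have hr0 : 0 ≤ r := Real.sqrt_nonneg _
    have hyε : 0 < y ^ 2 * ε ^ 2 := by positivity
    have hr1 : 1 < r := by nlinarith
    have hy2 : 0 < y ^ 2 := by positivity
    have hprod : (r - 1) * (r + 1) = 4 * y ^ 2 * ε ^ 2 := by linear_combination hr2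
    let t := (r - 1) / (2 * y)
    have ht1 : 2 * y * t = r - 1 := by simp only [t]; field_simp
    have ht2 : y * (ε ^ 2 - t ^ 2) = t := by
      have : 4 * y * (y * (ε ^ 2 - t ^ 2) - t) = 0 := by
        have : 4 * y ^ 2 * t ^ 2 = (r - 1) ^ 2 := by rw [← ht1]; ring
        linear_combination -this - hprod - 2 * ht1
      have h := (mul_eq_zero.1 this).resolve_left (by positivity)
      linarith
    have ht3 : t ^ 2 < ε ^ 2 := by
      have h1 : 4 * y ^ 2 * t ^ 2 = (r - 1) ^ 2 := by rw [← ht1]; ring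
      have h2 : 4 * y ^ 2 * t ^ 2 < 4 * y ^ 2 * ε ^ 2 := by
        rw [h1, ← hprod]; nlinarith
      exact lt_of_mul_lt_mul_left h2 (by positivity)
    have ht4 := abs_lt_of_sq_lt_sq' ht3 hε.le
    refine ⟨t, ⟨ht4.1, ht4.2⟩, ?_⟩
    rw [div_eq_iff (by linarith), ht2]

/-! ### The stretching map. -/

section Shrink

variable {n m : ℕ} {P : Set (Fin m → ℝ)}

/-- The point with given smooth coordinates and rescaled exploded coordinates. -/
def rescale (x : Fin n → ℝ) (c : Fin m → ℝ) (e : model n P) : model n P :=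
  mkPt x (fun l => CStarT.mk (toUnit (Real.exp (c l) : ℂ)) 0 * zc e l) (by
    have : tropv (fun l => CStarT.mk (toUnit (Real.exp (c l) : ℂ)) 0 * zc e l) = tc e := by
      funext l; simp [tropv, tc]
    rw [this]
    exact tc_mem e)

theorem xc_rescale (x : Fin n → ℝ) (c : Fin m → ℝ) (e : model n P) : xc (rescale x c e) = x := rfl

theorem zc_rescale (x : Fin n → ℝ) (c : Fin m → ℝ) (e : model n P) (l : Fin m) :
    zc (rescale x c e) l = CStarT.mk (toUnit (Real.exp (c l) : ℂ)) 0 * zc e l := rfl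

theorem rescale_rescale (x x' : Fin n → ℝ) (c c' : Fin m → ℝ) (e : model n P) :
    rescale x c (rescale x' c' e) = rescale x (c + c') e := by
  refine model_ext rfl (funext fun l => ?_)
  rw [zc_rescale, zc_rescale, zc_rescale, ← mul_assoc, ← CStarT.mk_mul_zero,
    ← toUnit_mul (by simp) (by simp), Pi.add_apply, Real.exp_add, Complex.ofReal_mul]

theorem rescale_zero (e : model n P) : rescale (xc e) 0 e = e := by
  refine model_ext rfl (funext fun l => ?_)
  rw [zc_rescale]
  exact CStarT.ext' (by simp [toUnit]) (by simp)

theorem smon_rescale (q : NonnegMonomial P) (x : Fin n → ℝ) (c : Fin m → ℝ) (e : model n P) :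
    smon q (rescale x c e) = Real.exp (q.1.lin c) * smon q e := by
  have := smoothPart_monomial_unit_mul q.1 (fun l => (Real.exp (c l) : ℂ)) (fun l => by simp) (zc e)
  refine this.trans ?_
  rw [smon, IntAffine.lin, Real.exp_sum, Complex.ofReal_prod]
  congr 1
  refine Finset.prod_congr rfl fun i _ => ?_
  rw [mul_comm, Complex.ofReal_exp, Complex.ofReal_exp, Complex.ofReal_mul,
    Complex.ofReal_intCast, Complex.exp_int_mul]

theorem norm_smon_rescale (q : NonnegMonomial P) (x : Fin n → ℝ) (c : Fin m → ℝ) (e : model n P) :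
    ‖smon q (rescale x c e)‖ = ‖smon q e‖ * Real.exp (q.1.lin c) := by
  rw [smon_rescale, norm_mul, Complex.norm_real, Real.norm_eq_abs, Real.abs_exp, mul_comm]

/-- The profile of the stretching map. -/
def profile (r : ℝ) : ℝ := r / (1 - r)

theorem profile_le {r r' : ℝ} (h : r ≤ r') (h' : r' < 1) : profile r ≤ profile r' := by
  rw [profile, profile, div_le_div_iff₀ (by linarith) (by linarith)]
  linarith

/-- The vector of exponents by which the stretching map rescales. -/
def stretchVec (s : Finset (NonnegMonomial P)) (ε : ℝ) (e : model n P) (l : Fin m) : ℝ :=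
  ∑ q ∈ s, profile ((ε⁻¹ * ‖smon q e‖) ^ 2) * (q.1.2 l : ℝ)

/-- The map stretching a neighbourhood given by `s` and `ε` to the whole model. -/
def stretch (s : Finset (NonnegMonomial P)) (ε : ℝ) (x₀ : Fin n → ℝ) (e : model n P) : model n P :=
  rescale (fun i => (xc e i - x₀ i) / (ε ^ 2 - (xc e i - x₀ i) ^ 2)) (stretchVec s ε e) e

/-- The neighbourhood stretched by `stretch`. -/
def stretchNhd (s : Finset (NonnegMonomial P)) (ε : ℝ) (x₀ : Fin n → ℝ) : Set (model n P) :=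
  {e | (∀ i, xc e i - x₀ i ∈ Set.Ioo (-ε) ε) ∧ ∀ q ∈ s, (ε⁻¹ * ‖smon q e‖) ^ 2 < 1}

theorem isOpen_stretchNhd (s : Finset (NonnegMonomial P)) (ε : ℝ) (x₀ : Fin n → ℝ) :
    IsOpen (stretchNhd s ε x₀) := by
  have h1 : IsOpen (⋂ i, {e : model n P | xc e i - x₀ i ∈ Set.Ioo (-ε) ε}) :=
    isOpen_iInter_of_finite fun i => isOpen_Ioo.preimage
      (((continuous_apply i).comp continuous_xc).sub continuous_const)
  have h2 : IsOpen (⋂ q ∈ s, {e : model n P | (ε⁻¹ * ‖smon q e‖) ^ 2 < 1}) :=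
    isOpen_biInter_finset fun q _ => isOpen_lt
      ((continuous_const.mul (continuous_smon q).norm).pow 2) continuous_const
  convert h1.inter h2 using 1
  ext e
  simp [stretchNhd]

/-- Points with the same image differ by rescaling with `c`, the difference of their stretching
vectors. Pairing `c` with itself gives a sum over `q` of the difference of profiles times `q.lin c`.
Since `|ζ_q|` changes by the factor `exp (q.lin c)` and the profile is increasing, no term is
positive, so `c = 0`. -/
theorem stretch_injOn (s : Finset (NonnegMonomial P)) {ε : ℝ} (hε : 0 < ε) (x₀ : Fin n → ℝ) :
    Set.InjOn (stretch s ε x₀) (stretchNhd s ε x₀) := by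
  intro e he e' he' h
  have hx : xc e = xc e' := by
    funext i
    have h1 := congrFun (congrArg xc h) i
    have := (stretch_bijOn hε).1 (he.1 i) (he'.1 i) h1
    linarith
  have hz : e' = rescale (xc e) (stretchVec s ε e - stretchVec s ε e') e := by
    have h2 := congrArg (rescale (xc e) (-stretchVec s ε e')) h
    rw [stretch, stretch, rescale_rescale, rescale_rescale, neg_add_cancel, hx, rescale_zero] at h2
    rw [sub_eq_neg_add, hx]
    exact h2.symm
  set c := stretchVec s ε e - stretchVec s ε e' with hc
  have hn : ∀ q, ‖smon q e'‖ = ‖smon q e‖ * Real.exp (q.1.lin c) := fun q => by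
    conv_lhs => rw [hz]
    exact norm_smon_rescale _ _ _ _
  have hcc : ∑ l, c l * c l = ∑ q ∈ s, (profile ((ε⁻¹ * ‖smon q e‖) ^ 2) -
      profile ((ε⁻¹ * ‖smon q e'‖) ^ 2)) * q.1.lin c := by
    simp only [IntAffine.lin, Finset.mul_sum]
    rw [Finset.sum_comm]
    refine Finset.sum_congr rfl fun l _ => ?_
    have h1 : c l = ∑ q ∈ s, (profile ((ε⁻¹ * ‖smon q e‖) ^ 2) -
      profile ((ε⁻¹ * ‖smon q e'‖) ^ 2)) * (q.1.2 l : ℝ) := by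
      simp only [hc, Pi.sub_apply, stretchVec, sub_mul, Finset.sum_sub_distrib]
    nth_rewrite 2 [h1]
    rw [Finset.mul_sum]
    exact Finset.sum_congr rfl fun q _ => by ring
  have hle : ∑ l, c l * c l ≤ 0 := by
    rw [hcc]
    refine Finset.sum_nonpos fun q hq => ?_
    have h0 : 0 ≤ ε⁻¹ := (inv_pos.2 hε).le
    rcases le_total 0 (q.1.lin c) with h1 | h1
    · refine mul_nonpos_of_nonpos_of_nonneg (sub_nonpos.2 (profile_le ?_ (he'.2 q hq))) h1
      rw [hn]
      gcongr
      exact le_mul_of_one_le_right (norm_nonneg _) (Real.one_le_exp h1)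
    · refine mul_nonpos_of_nonneg_of_nonpos (sub_nonneg.2 (profile_le ?_ (he.2 q hq))) h1
      rw [hn]
      gcongr
      exact mul_le_of_le_one_right (norm_nonneg _) (Real.exp_le_one_iff.2 h1)
  have hc0 : c = 0 := by
    funext l
    have h1 := (Finset.sum_eq_zero_iff_of_nonneg fun l _ => mul_self_nonneg (c l)).1
      (le_antisymm hle (Finset.sum_nonneg fun l _ => mul_self_nonneg (c l))) l (Finset.mem_univ l)
    exact mul_self_eq_zero.1 h1
  rw [hz, hc0, rescale_zero]

/-- The preimage is sought as a rescaling of `w` by some `c`, and the condition on `c` is the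
equation of `exists_balanced`. A monomial of `s` that is nonzero at `w` has exponent zero at `tc w`
and positive exponent at `y₀`, so it decreases in the direction `tc w - y₀`; this is the vector `v`
required there. -/
theorem stretch_surj (s : Finset (NonnegMonomial P)) {ε : ℝ} (hε : 0 < ε) (x₀ : Fin n → ℝ)
    {y₀ : Fin m → ℝ} (hs : ∀ q ∈ s, 0 < q.1.eval y₀) (w : model n P) :
    ∃ e ∈ stretchNhd s ε x₀, stretch s ε x₀ e = w := by
  obtain ⟨c, hc1, hc2⟩ := exists_balanced s (fun q l => (q.1.2 l : ℝ)) (fun q => ε⁻¹ * ‖smon q w‖)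
    (tc w - y₀) fun q hq h0 => by
      have h1 : smon q w ≠ 0 := by
        intro h; simp [h] at h0
      have h2 := CStarT.smoothPart_ne_zero_iff.1 h1
      rw [trop_monomial_zc] at h2
      have h3 := IntAffine.lin_sub q.1 (tc w) y₀
      rw [IntAffine.lin] at h3
      rw [h3, h2]
      linarith [hs q hq]
  choose t ht1 ht2 using fun i => (stretch_bijOn hε).2 (xc w i)
  have hn : ∀ q : NonnegMonomial P, ∀ x : Fin n → ℝ, ε⁻¹ * ‖smon q (rescale x c w)‖ =
      ε⁻¹ * ‖smon q w‖ * Real.exp (∑ j, c j * (q.1.2 j : ℝ)) := fun q x => by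
    rw [norm_smon_rescale, IntAffine.lin, mul_assoc]
  refine ⟨rescale (x₀ + t) c w, ⟨fun i => ?_, fun q hq => ?_⟩, ?_⟩
  · rw [xc_rescale, Pi.add_apply, add_sub_cancel_left]
    exact ht1 i
  · rw [hn]
    exact hc1 q hq
  · rw [stretch, rescale_rescale, xc_rescale]
    have h1 : stretchVec s ε (rescale (x₀ + t) c w) + c = 0 := by
      funext l
      rw [Pi.add_apply, stretchVec, add_comm]
      simp only [hn]
      exact hc2 l
    have h2 : (fun i => ((x₀ + t) i - x₀ i) / (ε ^ 2 - ((x₀ + t) i - x₀ i) ^ 2)) = xc w := by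
      funext i
      rw [Pi.add_apply, add_sub_cancel_left]
      exact ht2 i
    rw [h1, h2, rescale_zero]

/-- Infinitesimal form of the argument for injectivity of `stretch`. With `g i` the inner sum, `v i
= -y i g i`; pairing the equations shows that `∑ c i |y i|² (g i)²` equals minus a sum of squares,
so each `y i g i` vanishes. -/
theorem eq_zero_of_add_gram {σ : Type*} [Fintype σ] {m : ℕ} (a : σ → Fin m → ℝ) (c : σ → ℝ)
    (hc : ∀ i, 0 < c i) (y v : σ → ℂ)
    (h : ∀ i, v i + y i * ((∑ l, (∑ q, c q * ((y q).re * (v q).re + (y q).im * (v q).im) * a q l) *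
      a i l : ℝ) : ℂ) = 0) : v = 0 := by
  set g : σ → ℝ := fun i =>
    ∑ l, (∑ q, c q * ((y q).re * (v q).re + (y q).im * (v q).im) * a q l) * a i l with hg
  have hv : ∀ i, v i = -(y i * (g i : ℂ)) := fun i => eq_neg_of_add_eq_zero_left (h i)
  have hre : ∀ i, (v i).re = -((y i).re * g i) := fun i => by rw [hv]; simp
  have him : ∀ i, (v i).im = -((y i).im * g i) := fun i => by rw [hv]; simp
  have hw : ∀ i, (y i).re * (v i).re + (y i).im * (v i).im =
      -(((y i).re ^ 2 + (y i).im ^ 2) * g i) := fun i => by rw [hre, him]; ring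
  have h1 : ∑ i, c i * ((y i).re * (v i).re + (y i).im * (v i).im) * g i =
      ∑ l, (∑ q, c q * ((y q).re * (v q).re + (y q).im * (v q).im) * a q l) ^ 2 := by
    simp only [hg, Finset.mul_sum]
    rw [Finset.sum_comm]
    refine Finset.sum_congr rfl fun l _ => ?_
    rw [sq, Finset.sum_mul]
    exact Finset.sum_congr rfl fun i _ => by ring
  have h2 : ∑ i, c i * (((y i).re ^ 2 + (y i).im ^ 2) * g i ^ 2) ≤ 0 := by
    have h3 : ∑ i, c i * (((y i).re ^ 2 + (y i).im ^ 2) * g i ^ 2) =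
        -∑ i, c i * ((y i).re * (v i).re + (y i).im * (v i).im) * g i := by
      rw [← Finset.sum_neg_distrib]
      exact Finset.sum_congr rfl fun i _ => by rw [hw]; ring
    rw [h3, h1]
    exact neg_nonpos.2 (Finset.sum_nonneg fun l _ => sq_nonneg _)
  have hnn : ∀ i ∈ Finset.univ, 0 ≤ c i * (((y i).re ^ 2 + (y i).im ^ 2) * g i ^ 2) :=
    fun i _ => mul_nonneg (hc i).le (by positivity)
  funext i
  have h4 := (Finset.sum_eq_zero_iff_of_nonneg hnn).1 (le_antisymm h2 (Finset.sum_nonneg hnn)) i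
    (Finset.mem_univ i)
  have h5 := (mul_eq_zero.1 h4).resolve_left (hc i).ne'
  rw [hv]
  rcases mul_eq_zero.1 h5 with h6 | h6
  · have h7 : y i = 0 := Complex.ext
      (by simp only [Complex.zero_re]; nlinarith [sq_nonneg (y i).re, sq_nonneg (y i).im])
      (by simp only [Complex.zero_im]; nlinarith [sq_nonneg (y i).re, sq_nonneg (y i).im])
    simp [h7]
  · have h7 : g i = 0 := by simpa using h6
    simp [h7]

theorem sq_mul_norm (t : ℝ) (z : ℂ) : (t * ‖z‖) ^ 2 = t ^ 2 * (z.re ^ 2 + z.im ^ 2) := by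
  rw [mul_pow, Complex.sq_norm, Complex.normSq_apply]
  ring

/-- The derivative splits. On the real coordinates it is that of `t / (ε² - t²)`, which is positive;
on the smooth monomials it is, up to nonzero factors, the operator of `eq_zero_of_add_gram`. The
polytope does not change, so `d = 0` in `exists_locIso_of_injective`. -/
theorem stretch_locIso (s : Finset (NonnegMonomial P)) {ε : ℝ} (hε : 0 < ε) (x₀ : Fin n → ℝ)
    {e : model n P} (he : e ∈ stretchNhd s ε x₀) :
    ∃ Θ, LocIso (model n P) (model n P) (stretch s ε x₀) Θ e (stretch s ε x₀ e) := by
  classical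
  let X : ((Fin n → ℝ) × (s → ℂ)) → Fin n → ℝ := fun y i => (y.1 i - x₀ i) / (ε ^ 2 - (y.1 i - x₀ i) ^ 2)
  let κ : ((Fin n → ℝ) × (s → ℂ)) → s → ℝ := fun y q => ε⁻¹ ^ 2 * ((y.2 q).re ^ 2 + (y.2 q).im ^ 2)
  let g : ((Fin n → ℝ) × (s → ℂ)) → Fin m → ℝ := fun y l => ∑ q : s, profile (κ y q) * (q.1.1.2 l : ℝ)
  let h : ((Fin n → ℝ) × (s → ℂ)) → Fin m → ℂ := fun y l => (Real.exp (g y l) : ℂ)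
  have hre : ∀ q : s, ContDiff ℝ ∞ fun y : ((Fin n → ℝ) × (s → ℂ)) => (y.2 q).re := fun q =>
    Complex.reCLM.contDiff.comp (f := fun y : ((Fin n → ℝ) × (s → ℂ)) => y.2 q) (by fun_prop)
  have him : ∀ q : s, ContDiff ℝ ∞ fun y : ((Fin n → ℝ) × (s → ℂ)) => (y.2 q).im := fun q =>
    Complex.imCLM.contDiff.comp (f := fun y : ((Fin n → ℝ) × (s → ℂ)) => y.2 q) (by fun_prop)
  have hκ : ∀ q : s, ContDiff ℝ ∞ fun y : ((Fin n → ℝ) × (s → ℂ)) => κ y q := fun q =>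
    contDiff_const.mul (((hre q).pow 2).add ((him q).pow 2))
  let U : Set ((Fin n → ℝ) × (s → ℂ)) := {y | (∀ i, y.1 i - x₀ i ∈ Set.Ioo (-ε) ε) ∧ ∀ q, κ y q < 1}
  have hU : IsOpen U := by
    have h1 : IsOpen (⋂ i, {y : ((Fin n → ℝ) × (s → ℂ)) | y.1 i - x₀ i ∈ Set.Ioo (-ε) ε}) :=
      isOpen_iInter_of_finite fun i => isOpen_Ioo.preimage (by fun_prop)
    have h2 : IsOpen (⋂ q, {y : ((Fin n → ℝ) × (s → ℂ)) | κ y q < 1}) :=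
      isOpen_iInter_of_finite fun q => isOpen_lt (hκ q).continuous continuous_const
    convert h1.inter h2 using 1
    ext y
    simp [U]
  have hκe : ∀ q : s, κ (coords s e) q = (ε⁻¹ * ‖smon q.1 e‖) ^ 2 := fun q =>
    (sq_mul_norm _ _).symm
  have heU : coords s e ∈ U := ⟨he.1, fun q => by rw [hκe]; exact he.2 q.1 q.2⟩
  have hposX : ∀ y ∈ U, ∀ i, 0 < ε ^ 2 - (y.1 i - x₀ i) ^ 2 := fun y hy i => by
    nlinarith [(hy.1 i).1, (hy.1 i).2]
  have hXU : ∀ y ∈ U, ContDiffAt ℝ ∞ X y := fun y hy => contDiffAt_pi.2 fun i =>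
    ContDiffAt.div (by fun_prop) (by fun_prop) (hposX y hy i).ne'
  have hprofU : ∀ y ∈ U, ∀ q : s, ContDiffAt ℝ ∞ (fun y => profile (κ y q)) y := fun y hy q =>
    ContDiffAt.div (hκ q).contDiffAt (contDiffAt_const.sub (hκ q).contDiffAt)
      (sub_pos.2 (hy.2 q)).ne'
  have hgU : ∀ y ∈ U, ∀ l, ContDiffAt ℝ ∞ (fun y => g y l) y := fun y hy l =>
    ContDiffAt.sum fun q _ => (hprofU y hy q).mul contDiffAt_const
  have hhU : ∀ y ∈ U, ContDiffAt ℝ ∞ h y := fun y hy => contDiffAt_pi.2 fun l =>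
    Complex.ofRealCLM.contDiff.contDiffAt.comp y (hgU y hy l).exp
  have hnear : ∀ᶠ y in 𝓝 (coords s e), y ∈ U := hU.mem_nhds heU
  have hprod : ∀ (y : ((Fin n → ℝ) × (s → ℂ))) (i : s), ∏ l, h y l ^ i.1.1.2 l =
      ((Real.exp (∑ l, g y l * (i.1.1.2 l : ℝ)) : ℝ) : ℂ) := by
    intro y i
    rw [Real.exp_sum, Complex.ofReal_prod]
    refine Finset.prod_congr rfl fun l _ => ?_
    simp only [h]
    rw [mul_comm (g y l), Complex.ofReal_exp, Complex.ofReal_exp, Complex.ofReal_mul,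
      Complex.ofReal_intCast, Complex.exp_int_mul]
  refine exists_locIso_of_injective (e := Equiv.sumEmpty (Fin m) (Fin 0)) (s := s) (X := X) (h := h)
    (k := fun _ j => j.elim0) (fun y => ?_) (hnear.mono hXU) (hnear.mono hhU)
    (contDiff_const.smoothNear _) (fun l => by simp [h]) (fun j => j.elim0) rfl ?_ ?_
  · simp
  · intro v h1 _ h3
    have hline : ∀ t : ℝ, HasDerivAt (fun t : ℝ => coords s e + t • v) v t := fun t => by
      simpa using ((hasDerivAt_id t).smul_const v).const_add (coords s e)
    have hpt : coords s e + (0 : ℝ) • v = coords s e := by simp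
    have hdir : ∀ {F : Type} [NormedAddCommGroup F] [NormedSpace ℝ F] (f : ((Fin n → ℝ) × (s → ℂ)) → F),
        ContDiffAt ℝ ∞ f (coords s e) → HasDerivAt (fun t : ℝ => f (coords s e + t • v))
          (fderiv ℝ f (coords s e) v) 0 := by
      intro F _ _ f hf
      have := (hf.differentiableAt (by simp)).hasFDerivAt
      rw [← hpt] at this
      have h := this.comp_hasDerivAt (0 : ℝ) (hline 0)
      rwa [hpt] at h
    have hv1 : v.1 = 0 := by
      funext i
      have h4 := hasDerivAt_pi.1 (hdir X (hXU _ heU)) i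
      rw [h1] at h4
      have h5 : HasDerivAt (fun t : ℝ => (coords s e).1 i + t * v.1 i - x₀ i) (v.1 i) 0 := by
        simpa using (((hasDerivAt_id (0 : ℝ)).mul_const (v.1 i)).const_add ((coords s e).1 i)).sub_const (x₀ i)
      have hp := hposX _ heU i
      have h6 := h5.fun_div ((h5.fun_pow 2).const_sub (ε ^ 2)) (by simpa using hp.ne')
      have h7 := h4.unique h6
      simp only [Pi.zero_apply, zero_mul, add_zero] at h7
      rw [eq_comm, div_eq_zero_iff] at h7
      have h8 := h7.resolve_right (pow_ne_zero _ hp.ne')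
      have h9 : v.1 i * (ε ^ 2 + ((coords s e).1 i - x₀ i) ^ 2) = 0 := by
        rw [← h8]; push_cast; ring
      exact (mul_eq_zero.1 h9).resolve_right (by positivity)
    have hv2 : v.2 = 0 := by
      refine eq_zero_of_add_gram (fun q l => (q.1.1.2 l : ℝ))
        (fun q => 2 * ε⁻¹ ^ 2 / (1 - κ (coords s e) q) ^ 2) (fun q => ?_) (coords s e).2 v.2
        fun i => ?_
      · have := sub_pos.2 (heU.2 q); positivity
      have hκd : ∀ q : s, HasDerivAt (fun t : ℝ => κ (coords s e + t • v) q)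
          (ε⁻¹ ^ 2 * (2 * (((coords s e).2 q).re * (v.2 q).re +
            ((coords s e).2 q).im * (v.2 q).im))) 0 := by
        intro q
        have h5 : HasDerivAt (fun t : ℝ => ((coords s e).2 q).re + t * (v.2 q).re) (v.2 q).re 0 := by
          simpa using ((hasDerivAt_id (0 : ℝ)).mul_const (v.2 q).re).const_add
            ((coords s e).2 q).re
        have h6 : HasDerivAt (fun t : ℝ => ((coords s e).2 q).im + t * (v.2 q).im) (v.2 q).im 0 := by
          simpa using ((hasDerivAt_id (0 : ℝ)).mul_const (v.2 q).im).const_add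
            ((coords s e).2 q).im
        have h7 := (((h5.fun_pow 2).fun_add (h6.fun_pow 2)).const_mul (ε⁻¹ ^ 2))
        have h8 : (fun t : ℝ => κ (coords s e + t • v) q) = fun t : ℝ => ε⁻¹ ^ 2 *
            ((((coords s e).2 q).re + t * (v.2 q).re) ^ 2 +
              (((coords s e).2 q).im + t * (v.2 q).im) ^ 2) := by
          funext t; simp [κ]
        rw [h8]
        refine h7.congr_deriv ?_
        push_cast
        ring
      have hgd : ∀ l, HasDerivAt (fun t : ℝ => g (coords s e + t • v) l)
          (∑ q : s, 2 * ε⁻¹ ^ 2 / (1 - κ (coords s e) q) ^ 2 *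
            (((coords s e).2 q).re * (v.2 q).re + ((coords s e).2 q).im * (v.2 q).im) *
              (q.1.1.2 l : ℝ)) 0 := by
        intro l
        refine HasDerivAt.fun_sum fun q _ => HasDerivAt.mul_const ?_ _
        have hp := sub_pos.2 (heU.2 q)
        have h5 := (hκd q).fun_div ((hκd q).const_sub 1) (by rw [hpt]; exact hp.ne')
        refine h5.congr_deriv ?_
        rw [hpt]
        field_simp
        ring
      have hsum := HasDerivAt.fun_sum fun l (_ : l ∈ Finset.univ) =>
        (hgd l).mul_const (i.1.1.2 l : ℝ)
      have hexp := hsum.exp.ofReal_comp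
      have hy : HasDerivAt (fun t : ℝ => (coords s e).2 i + (t : ℂ) * v.2 i) (v.2 i) 0 := by
        simpa using (((hasDerivAt_id (0 : ℝ)).ofReal_comp).mul_const (v.2 i)).const_add
          ((coords s e).2 i)
      have h5 := hy.fun_mul hexp
      have h6 := hdir (fun y : ((Fin n → ℝ) × (s → ℂ)) => y.2 i * ∏ l, h y l ^ i.1.1.2 l) (by
        simp only [hprod]
        refine ContDiffAt.mul (by fun_prop) (Complex.ofRealCLM.contDiff.contDiffAt.comp _
          (ContDiffAt.exp (ContDiffAt.sum fun l _ => (hgU _ heU l).mul contDiffAt_const))))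
      rw [h3 i] at h6
      simp only [hprod] at h6
      have h7 := h6.unique (h5.congr_of_eventuallyEq (Eventually.of_forall fun t => by
        simp))
      simp only [hpt, Complex.ofReal_zero, zero_mul, add_zero] at h7
      have hne : ((Real.exp (∑ l, g (coords s e) l * (i.1.1.2 l : ℝ)) : ℝ) : ℂ) ≠ 0 := by simp
      refine mul_left_cancel₀ hne ?_
      rw [mul_zero, h7]
      push_cast
      ring
    exact Prod.ext hv1 hv2
  · refine Eventually.of_forall fun a => ⟨rfl, fun l => ?_, fun j => j.elim0⟩
    have h1 : stretchVec s ε a l = g (coords s a) l := by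
      simp only [stretchVec, g]
      rw [← Finset.sum_coe_sort s]
      exact Finset.sum_congr rfl fun q _ => by rw [sq_mul_norm]; rfl
    rw [stretch, Equiv.sumEmpty_apply_inl, zc_rescale, h1]

/-- Near a point with exponent in the interior of `P`, a smooth monomial either vanishes at the point
or is constant. -/
theorem smon_eq_of_eval_eq_zero {p : model n P} (hp : tc p ∈ interior P) {q : NonnegMonomial P}
    (hq : q.1.eval (tc p) = 0) (e : model n P) : smon q e = smon q p := by
  have h0 := relInt_of_mem_interior hp q.1 q.2 hq
  have h1 : ∀ l, q.1.2 l = 0 := by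
    intro l
    have h2 : ∀ᶠ t : ℝ in 𝓝 0, tc p + t • Pi.single l (1 : ℝ) ∈ P := by
      have hc : Continuous fun t : ℝ => tc p + t • (Pi.single l (1 : ℝ) : Fin m → ℝ) := by fun_prop
      exact (hc.tendsto' 0 (tc p) (by simp)).eventually (mem_interior_iff_mem_nhds.1 hp)
    obtain ⟨t, ht, ht0⟩ := (h2.filter_mono nhdsWithin_le_nhds |>.and
      (self_mem_nhdsWithin : {0}ᶜ ∈ 𝓝[≠] (0 : ℝ))).exists
    have h3 := h0 _ ht
    rw [IntAffine.eval_add_vec, hq, IntAffine.lin_smul, zero_add] at h3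
    have h4 := (mul_eq_zero.1 h3).resolve_left ht0
    rw [IntAffine.lin, Finset.sum_eq_single l] at h4
    · simpa using h4
    · intro j _ hj; simp [Pi.single_eq_of_ne hj]
    · simp
  rw [smon_eq_coeff h0, smon_eq_coeff h0, monomial_fst, monomial_fst]
  simp [h1]

/-- Every neighbourhood of a point of a model with exponent in the interior of the polytope contains
a neighbourhood isomorphic to the model. -/
theorem exists_openIso_of_mem_nhds {p : model n P} (hp : tc p ∈ interior P) {W : Set (model n P)}
    (hW : W ∈ 𝓝 p) : ∃ V φ ψ, p ∈ V ∧ V ⊆ W ∧ OpenIso (model n P) (model n P) V φ ψ := by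
  classical
  obtain ⟨s₀, ε, hε, hs₀⟩ := exists_coords_nhds hW
  -- Smooth monomials with exponent zero at `p` are constant because `tc p` is interior; they impose
  -- no condition and are discarded.
  let s := s₀.filter fun q => 0 < q.1.eval (tc p)
  have hs : ∀ q ∈ s, 0 < q.1.eval (tc p) := fun q hq => (Finset.mem_filter.1 hq).2
  have hsp : ∀ q ∈ s, smon q p = 0 := fun q hq =>
    CStarT.smoothPart_of_pos (by rw [trop_monomial_zc]; exact hs q hq)
  have hpV : p ∈ stretchNhd s ε (xc p) :=
    ⟨fun i => by simp [hε], fun q hq => by simp [hsp q hq]⟩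
  choose θ hθ1 hθ2 using stretch_surj s hε (xc p) hs
  refine ⟨stretchNhd s ε (xc p), stretch s ε (xc p), θ, hpV, fun e he => ?_, ?_⟩
  · refine hs₀ e (fun i => abs_lt.2 (he.1 i)) fun q hq => ?_
    by_cases h0 : 0 < q.1.eval (tc p)
    · have hqs : q ∈ s := Finset.mem_filter.2 ⟨hq, h0⟩
      rw [hsp q hqs, sub_zero]
      have h1 := he.2 q hqs
      have h2 := abs_lt_of_sq_lt_sq' (h1.trans_eq (one_pow 2).symm) zero_le_one
      have h3 := h2.2
      rwa [inv_mul_lt_iff₀ hε, mul_one] at h3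
    · rw [smon_eq_of_eval_eq_zero hp (le_antisymm (not_lt.1 h0) (q.2 _ (tc_mem p))) e, sub_self, norm_zero]
      exact hε
  · have hinv : ∀ e ∈ stretchNhd s ε (xc p), θ (stretch s ε (xc p) e) = e := fun e he =>
      stretch_injOn s hε _ (hθ1 _) he (hθ2 _)
    refine ⟨isOpen_stretchNhd _ _ _, fun e he => ?_, fun w => ?_, hθ1, hinv, hθ2⟩
    · obtain ⟨Θ, hΘ⟩ := stretch_locIso s hε (xc p) he
      exact hΘ.morAt.self_of_nhds
    · obtain ⟨Θ, hΘ⟩ := stretch_locIso s hε (xc p) (hθ1 w)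
      rw [hθ2] at hΘ
      -- By injectivity of the stretching map, the chosen inverse `θ` agrees near `w` with the
      -- smooth local inverse `Θ`.
      refine hΘ.morAt_symm.self_of_nhds.congr ?_
      have h1 := hΘ.symm.tendsto.eventually ((isOpen_stretchNhd s ε (xc p)).mem_nhds (hθ1 w))
      filter_upwards [h1, hΘ.right_inv] with w' hw1 hw2
      refine stretch_injOn s hε (xc p) hw1 (hθ1 w') ?_
      rw [hw2, hθ2]

end Shrink

/-- In the given chart the exponent of the point may lie on the boundary of the polytope;
`goodPt_model` replaces that chart by one where it is interior. -/
theorem IsExplodedManifold.goodPt {X : AbstractExplodedSpace.{u}} (hX : IsExplodedManifold X)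
    (x : X) : GoodPt X x := by
  obtain ⟨U, hU, n, m, P, hP, hiso⟩ := hX x
  obtain ⟨V, φ, ψ, hx, h⟩ := exists_isIsomorphic_iff.1 ⟨U, hU, hiso⟩
  exact GoodPt.of_locIso (h.locIso hx) (goodPt_model hP.2 _)

/-- Good points have arbitrarily small neighbourhoods isomorphic to a model. -/
theorem GoodPt.exists_openIso {X : AbstractExplodedSpace.{u}} {x : X} (h : GoodPt X x) {W : Set X}
    (hW : W ∈ 𝓝 x) : ∃ (n m : ℕ) (P : Set (Fin m → ℝ)) (V : Set X) (φ : X → model n P)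
      (ψ : model n P → X), IsIntegralAffinePolytope P ∧ x ∈ V ∧ V ⊆ W ∧
        OpenIso X (model n P) V φ ψ := by
  obtain ⟨n, m, P, p, φ, ψ, hP, hp, h⟩ := h
  -- `φ` and `ψ` are mutually inverse between an open `A` and an open `B`
  obtain ⟨A₀, hA₀, hA₀o, hxA₀⟩ := eventually_nhds_iff.1 (h.morAt.and (h.left_inv.and hW))
  obtain ⟨B₀, hB₀, hB₀o, hpB₀⟩ := eventually_nhds_iff.1 (h.morAt_symm.and (h.right_inv.and
    (h.symm.tendsto.eventually (hA₀o.mem_nhds hxA₀))))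
  obtain ⟨V, φ', ψ', hpV, hVB, hV⟩ := exists_openIso_of_mem_nhds hp (hB₀o.mem_nhds hpB₀)
  have hφc : ContinuousOn φ A₀ := fun a ha => (hA₀ a ha).1.1.continuousWithinAt
  refine ⟨n, m, P, A₀ ∩ φ ⁻¹' V, fun a => φ' (φ a), fun b => ψ (ψ' b), hP,
    ⟨hxA₀, by rw [Set.mem_preimage, h.map]; exact hpV⟩, fun a ha => (hA₀ a ha.1).2.2, ?_⟩
  refine ⟨hφc.isOpen_inter_preimage hA₀o hV.isOpen, fun a ha => ?_, fun b => ?_, fun b => ?_,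
    fun a ha => ?_, fun b => ?_⟩
  · exact (hV.morAt _ ha.2).comp (hA₀ a ha.1).1
  · exact (hB₀ _ (hVB (hV.mem b))).1.comp (hV.morAt_symm b)
  · have := hB₀ _ (hVB (hV.mem b))
    refine ⟨this.2.2, ?_⟩
    rw [Set.mem_preimage, this.2.1]
    exact hV.mem b
  · rw [hV.left_inv _ ha.2, (hA₀ a ha.1).2.1]
  · rw [(hB₀ _ (hVB (hV.mem b))).2.1, hV.right_inv]

theorem isExplodedManifold_of_goodPt {X : AbstractExplodedSpace.{u}} (h : ∀ x : X, GoodPt X x) :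
    IsExplodedManifold X := by
  intro x
  obtain ⟨n, m, P, V, φ, ψ, hP, hx, -, hV⟩ := (h x).exists_openIso univ_mem
  obtain ⟨U, hU, hiso⟩ := exists_isIsomorphic_iff.2 ⟨V, φ, ψ, hx, hV⟩
  exact ⟨U, hU, n, m, P, hP, hiso⟩

/-! ### Hadamard's lemma -/

section Hadamard

open MeasureTheory

variable {E : Type} [NormedAddCommGroup E] [NormedSpace ℝ E] [FiniteDimensional ℝ E]

/-- Differentiation under the integral sign. Each derivative produces another factor `t`, which is
why arbitrary powers of `t` are included. -/
theorem hasFDerivAt_ray_integral {F : Type} [NormedAddCommGroup F] [NormedSpace ℝ F]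
    [CompleteSpace F] {A : E → F} (hA : ContDiff ℝ 1 A) (k : ℕ) (y : E) :
    HasFDerivAt (fun y => ∫ t in (0 : ℝ)..1, t ^ k • A (t • y))
      (∫ t in (0 : ℝ)..1, t ^ (k + 1) • fderiv ℝ A (t • y)) y := by
  have hA' : Continuous (fderiv ℝ A) := hA.continuous_fderiv one_ne_zero
  have hAc := hA.continuous
  obtain ⟨C, hC⟩ := (isCompact_closedBall (0 : E) (‖y‖ + 1)).exists_bound_of_continuousOn
    hA'.continuousOn
  refine intervalIntegral.hasFDerivAt_integral_of_dominated_of_fderiv_le (bound := fun _ => C)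
    (F' := fun y t => t ^ (k + 1) • fderiv ℝ A (t • y)) (Metric.ball_mem_nhds y one_pos) ?_ ?_ ?_
    ?_ ?_ ?_
  · exact Eventually.of_forall fun y => (Continuous.aestronglyMeasurable (by fun_prop))
  · exact Continuous.intervalIntegrable (by fun_prop) _ _
  · exact Continuous.aestronglyMeasurable (by fun_prop)
  · refine Eventually.of_forall fun t ht x hx => ?_
    rw [Set.uIoc_of_le zero_le_one] at ht
    have hx' : ‖x‖ ≤ ‖y‖ + 1 := by
      have h1 := norm_le_norm_add_norm_sub' x y
      have h2 := mem_ball_iff_norm.1 hx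
      linarith
    have h3 := hC (t • x) (by
      rw [mem_closedBall_zero_iff, norm_smul, Real.norm_of_nonneg ht.1.le]
      exact (mul_le_of_le_one_left (norm_nonneg _) ht.2).trans hx')
    rw [norm_smul, norm_pow, Real.norm_of_nonneg ht.1.le]
    exact (mul_le_of_le_one_left (norm_nonneg _) (pow_le_one₀ ht.1.le ht.2)).trans h3
  · exact intervalIntegrable_const
  · refine Eventually.of_forall fun t _ x _ => ?_
    have h1 := (hA.differentiable one_ne_zero (t • x)).hasFDerivAt.comp x
      ((hasFDerivAt_id x).const_smul t)
    refine (h1.const_smul (t ^ k)).congr_fderiv ?_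
    ext v
    simp [pow_succ, mul_smul]

theorem contDiff_ray_integral (n : ℕ) {F : Type} [NormedAddCommGroup F] [NormedSpace ℝ F]
    [CompleteSpace F] {A : E → F} (hA : ContDiff ℝ ∞ A) (k : ℕ) :
    ContDiff ℝ n (fun y => ∫ t in (0 : ℝ)..1, t ^ k • A (t • y)) := by
  induction n generalizing F k with
  | zero =>
    rw [Nat.cast_zero, contDiff_zero]
    exact continuous_iff_continuousAt.2 fun y =>
      (hasFDerivAt_ray_integral (hA.of_le (by simp)) k y).continuousAt
  | succ n ih =>
    rw [Nat.cast_succ, contDiff_succ_iff_hasFDerivAt]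
    exact ⟨_, ih (contDiff_infty_iff_fderiv.1 hA).2 (k + 1),
      hasFDerivAt_ray_integral (hA.of_le (by simp)) k⟩

/-- After a cutoff making `H` globally smooth, integrate its derivative along the segment from `y₀`
to `y`. This turns a derivation on germs into a combination of partial derivatives. -/
theorem exists_hadamard {H : E → ℝ} {y₀ : E} (hH : SmoothNear H y₀) :
    ∃ D : E → E →L[ℝ] ℝ, ContDiff ℝ ∞ D ∧ ∀ᶠ y in 𝓝 y₀, H y = H y₀ + D y (y - y₀) := by
  obtain ⟨r, hr, hH⟩ := Metric.eventually_nhds_iff_ball.1 hH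
  let χ : ContDiffBump y₀ := ⟨r / 4, r / 2, by positivity, by linarith⟩
  let K : E → ℝ := fun y => χ y * H y
  have hK : ContDiff ℝ ∞ K := contDiff_iff_contDiffAt.2 fun y => by
    by_cases hy : y ∈ Metric.ball y₀ r
    · exact χ.contDiffAt.mul (hH y hy)
    · have h1 : y ∉ tsupport χ := by
        rw [χ.tsupport_eq]
        intro h
        refine hy (Metric.mem_ball.2 ((Metric.mem_closedBall.1 h).trans_lt ?_))
        change r / 2 < r
        linarith
      have h2 : K =ᶠ[𝓝 y] fun _ => 0 := by
        filter_upwards [notMem_tsupport_iff_eventuallyEq.1 h1] with x hx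
        simp only [K, hx, Pi.zero_apply, zero_mul]
      exact contDiffAt_const.congr_of_eventuallyEq h2
  have hKH : ∀ᶠ y in 𝓝 y₀, K y = H y := by
    filter_upwards [χ.eventuallyEq_one] with y hy
    simp only [K, hy, Pi.one_apply, one_mul]
  let A : E → E →L[ℝ] ℝ := fun y => fderiv ℝ K (y₀ + y)
  have hA : ContDiff ℝ ∞ A :=
    (contDiff_infty_iff_fderiv.1 hK).2.comp (contDiff_const.add contDiff_id)
  refine ⟨fun y => ∫ t in (0 : ℝ)..1, t ^ 0 • A (t • (y - y₀)), ?_, ?_⟩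
  · exact (contDiff_infty.2 fun n => contDiff_ray_integral n hA 0).comp
      (f := fun y => y - y₀) (by fun_prop)
  · filter_upwards [hKH] with y hy
    have hAc := hA.continuous
    rw [← hy, ← hKH.self_of_nhds, ContinuousLinearMap.intervalIntegral_apply
      (Continuous.intervalIntegrable (by fun_prop) _ _)]
    have h1 : ∀ t ∈ Set.uIcc (0 : ℝ) 1, HasDerivAt (fun t : ℝ => K (y₀ + t • (y - y₀)))
        ((t ^ 0 • A (t • (y - y₀))) (y - y₀)) t := by
      intro t _
      have h2 : HasDerivAt (fun t : ℝ => y₀ + t • (y - y₀)) (y - y₀) t := by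
        simpa using ((hasDerivAt_id t).smul_const (y - y₀)).const_add y₀
      have := ((contDiff_infty_iff_fderiv.1 hK).1 _).hasFDerivAt.comp_hasDerivAt t h2
      refine this.congr_deriv ?_
      simp [A]
    rw [intervalIntegral.integral_eq_sub_of_hasDerivAt h1
      (Continuous.intervalIntegrable (by fun_prop) _ _)]
    simp

end Hadamard

/-! ### Tangent vectors -/

section SmoothGerms

variable {X : AbstractExplodedSpace.{u}} {p : X}

/-- Real functions are treated as complex ones with zero imaginary part, so that `Nice.comp` applies
to the exponential of `H`. -/
theorem Nice.rSm_comp (hp : Nice X p) {κ : Type} [Fintype κ] {Y : X → κ → ℝ} {H : (κ → ℝ) → ℝ}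
    (hY : ∀ k, RSm X (fun x => Y x k) p) (hH : SmoothNear H (Y p)) :
    RSm X (fun x => H (Y x)) p := by
  have h0 : RSm X (fun _ => 0) p := secAt_const _ _
  refine hp.comp (n := 0) (fun _ i => i.elim0) (fun x k => (Y x k : ℂ))
    (fun y => (Real.exp (H fun k => (y.2 k).re) : ℂ)) (fun i => i.elim0)
    (fun k => ⟨by simpa using hY k, by simpa using h0⟩) ?_ (by simp)
  have h1 : SmoothNear (fun y : (Fin 0 → ℝ) × (κ → ℂ) => fun k => (y.2 k).re)
      (fun i => i.elim0, fun k => (Y p k : ℂ)) :=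
    SmoothNear.pi fun k => (Complex.reCLM.contDiff.comp
      (f := fun y : (Fin 0 → ℝ) × (κ → ℂ) => y.2 k) (by fun_prop)).smoothNear _
  have h2 := SmoothNear.comp (g := H) (f := fun y : (Fin 0 → ℝ) × (κ → ℂ) => fun k => (y.2 k).re)
    (x := (fun i => i.elim0, fun k => (Y p k : ℂ))) (by simpa using hH) h1
  exact SmoothNear.comp (g := fun t : ℝ => (Real.exp t : ℂ)) (smoothNear_exp _) h2

theorem Nice.rSm_add (hp : Nice X p) {f g : X → ℝ} (hf : RSm X f p) (hg : RSm X g p) :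
    RSm X (fun x => f x + g x) p :=
  hp.rSm_comp (Y := fun x => ![f x, g x]) (H := fun y => y 0 + y 1)
    (by intro k; fin_cases k <;> [exact hf; exact hg]) (ContDiff.smoothNear (by fun_prop) _)

theorem Nice.rSm_mul (hp : Nice X p) {f g : X → ℝ} (hf : RSm X f p) (hg : RSm X g p) :
    RSm X (fun x => f x * g x) p :=
  hp.rSm_comp (Y := fun x => ![f x, g x]) (H := fun y => y 0 * y 1)
    (by intro k; fin_cases k <;> [exact hf; exact hg]) (ContDiff.smoothNear (by fun_prop) _)

theorem rSm_const (c : ℝ) (p : X) : RSm X (fun _ => c) p := secAt_const _ _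

theorem rSm_realLine (t : ℝ) : RSm realLine (fun s : ℝ => s) t :=
  secAt_realLine_iff.2 ⟨fun s => (Real.exp s : ℂ), 0, smoothNear_exp t, by simp,
    Eventually.of_forall fun _ => rfl⟩

theorem Nice.morAt_realLine (hp : Nice X p) {f : X → ℝ} (hf : RSm X f p) :
    MorAt X realLine f p := by
  refine ⟨hp.continuousAt hf, fun F hF => ?_⟩
  obtain ⟨h, a, hh, h0, hF⟩ := secAt_realLine_iff.1 hF
  have h1 := hp.comp (n := 1) (ι := Empty) (fun x _ => f x) (fun _ i => i.elim)
    (fun y => h (y.1 0)) (fun _ => hf) (fun i => i.elim)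
    (SmoothNear.comp (g := h) (f := fun y : (Fin 1 → ℝ) × (Empty → ℂ) => y.1 0) hh
      (ContDiff.smoothNear (by fun_prop) _)) h0
  refine (h1.mul (secAt_const (CStarT.mk 1 a) p)).congr ?_
  have := (hp.continuousAt hf).eventually hF
  filter_upwards [this] with x hx
  rw [hx]
  exact CStarT.ext' (by simp) (by simp)

theorem isSmoothGerm_iff_morAt {f : X → ℝ} :
    IsSmoothGerm p (f : Germ (𝓝 p) ℝ) ↔ ∀ᶠ x in 𝓝 p, MorAt X realLine f x := by
  constructor
  · rintro ⟨φ, hφ, U, hp, h, hh⟩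
    have h1 := Germ.coe_eq.1 hφ
    filter_upwards [h1.eventuallyEq_nhds, U.isOpen.mem_nhds hp] with x hx hxU
    refine MorAt.congr (f := φ) ?_ hx
    refine (morAt_restrict_iff (Y := realLine) (f := φ) (U := U) hxU).1 ?_
    exact (h.morAt ⟨x, hxU⟩).congr (Eventually.of_forall fun x => hh x)
  · intro h
    obtain ⟨U, hU, hUo, hp⟩ := eventually_nhds_iff.1 h
    refine ⟨f, rfl, ⟨U, hUo⟩, hp, Hom.ofMorAt (X := X.restrict ⟨U, hUo⟩) (Y := realLine)
      (fun x : U => f x) ?_, fun _ => rfl⟩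
    rintro ⟨x, hx⟩
    exact (morAt_restrict_iff (U := ⟨U, hUo⟩) hx).2 (hU x hx)

theorem isSmoothGerm_iff (hX : ∀ x : X, GoodPt X x) {f : X → ℝ} :
    IsSmoothGerm p (f : Germ (𝓝 p) ℝ) ↔ RSm X f p := by
  rw [isSmoothGerm_iff_morAt]
  refine ⟨fun h => RSm.pull h.self_of_nhds (rSm_realLine _), fun h => ?_⟩
  exact h.eventually.mono fun x hx => (hX x).nice.morAt_realLine hx

theorem isSmoothGerm_const (c : ℝ) : IsSmoothGerm p ((fun _ : X => c : X → ℝ) : Germ (𝓝 p) ℝ) :=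
  isSmoothGerm_iff_morAt.2 (Eventually.of_forall fun x => ⟨continuousAt_const, fun _ _ =>
    secAt_const _ x⟩)

/-- The germ of an exploded function with values in `ℂ𝔱^ℝ`. -/
def secGerm (F : X → CStarT) (p : X) : Germ (𝓝 p) ExplodedC := ↑(fun x => (F x).toExplodedC)

theorem SecAt.isTropicalGerm {F : X → CStarT} (hF : SecAt X F p) :
    IsTropicalGerm p (secGerm F p) := by
  obtain ⟨U, hp, hF⟩ := hF
  exact AddSubsemigroup.subset_closure ⟨_, rfl, U, hp, _, hF, fun _ => rfl⟩

theorem IsExplodedGerm.exists_secAt {g : Germ (𝓝 p) ExplodedC} (hg : IsExplodedGerm p g) :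
    ∃ F, SecAt X F p ∧ g = secGerm F p := by
  obtain ⟨φ, rfl, U, hp, F, hF, h⟩ := hg
  refine ⟨extendOne (T := (U : Set X)) F, mem_sections_iff'.1 hF p hp, Germ.coe_eq.2 ?_⟩
  filter_upwards [U.isOpen.mem_nhds hp] with x hx
  rw [h ⟨x, hx⟩, ← extendOne_coe (T := (U : Set X)) F ⟨x, hx⟩]

theorem ExplodedC.add_of_eq {a b : ExplodedC} (h : a.order = b.order) :
    a + b = ⟨a.coeff + b.coeff, a.order⟩ := by
  change (if a.order < b.order then a else if b.order < a.order then b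
    else ⟨a.coeff + b.coeff, a.order⟩) = _
  rw [if_neg h.not_lt, if_neg h.not_gt]

theorem ExplodedC.add_of_lt {a b : ExplodedC} (h : a.order < b.order) : a + b = a := if_pos h

theorem ExplodedC.add_of_gt {a b : ExplodedC} (h : b.order < a.order) : a + b = b :=
  (if_neg h.not_gt).trans (if_pos h)

theorem ExplodedC.order_add (a b : ExplodedC) : (a + b).order = min a.order b.order := by
  rcases lt_trichotomy a.order b.order with h | h | h
  · rw [add_of_lt h, min_eq_left h.le]
  · rw [add_of_eq h, h, min_self]
  · rw [add_of_gt h, min_eq_right h.le]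

theorem ExplodedC.order_mul (a b : ExplodedC) : (a * b).order = a.order + b.order := rfl

theorem ExplodedC.coeff_mul (a b : ExplodedC) : (a * b).coeff = a.coeff * b.coeff := rfl

/-- A smooth function may vanish at `p`, so it need not be an exploded function. It is the sum of `f
+ K`, positive near `p`, and the constant `-K`, both of which are. -/
theorem isTropicalGerm_ofReal (hp : Nice X p) {f : X → ℝ} (hf : RSm X f p) :
    IsTropicalGerm p ((fun x => ExplodedC.ofReal (f x) : X → ExplodedC) : Germ (𝓝 p) ExplodedC) := by
  set K : ℝ := |f p| + 1 with hK
  have hK0 : 0 < K := by positivity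
  have hpos : 0 < f p + K := by have := neg_abs_le (f p); linarith
  have h1 : SecAt X (fun x => CStarT.mk (toUnit ((f x + K : ℝ) : ℂ)) 0) p := by
    have h0 : CSm X (fun x => ((f x + K : ℝ) : ℂ)) p :=
      ⟨by simpa using hp.rSm_add hf (rSm_const K p), by simpa using rSm_const 0 p⟩
    exact hp.comp (n := 0) (ι := Unit) (fun _ i => i.elim0) (fun x _ => ((f x + K : ℝ) : ℂ))
      (fun y => y.2 ()) (fun i => i.elim0) (fun _ => h0) (ContDiff.smoothNear (by fun_prop) _)
      (by simpa only using Complex.ofReal_ne_zero.2 hpos.ne')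
  have h2 := AddMemClass.add_mem h1.isTropicalGerm
    (secAt_const (X := X) (CStarT.mk (toUnit ((-K : ℝ) : ℂ)) 0) p).isTropicalGerm
  refine (congrArg (IsTropicalGerm p) (Germ.coe_eq.2 ?_)).mp h2
  have h3 : ∀ᶠ x in 𝓝 p, 0 < f x + K :=
    ((hp.continuousAt hf).add continuousAt_const).eventually (lt_mem_nhds hpos)
  filter_upwards [h3] with x hx
  have e1 : (toUnit ((f x + K : ℝ) : ℂ) : ℂ) = ((f x + K : ℝ) : ℂ) :=
    coe_toUnit (by exact_mod_cast hx.ne')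
  have e2 : (toUnit ((-K : ℝ) : ℂ) : ℂ) = ((-K : ℝ) : ℂ) :=
    coe_toUnit (by exact_mod_cast (neg_neg_of_pos hK0).ne)
  refine (ExplodedC.add_of_eq (by rfl)).trans ?_
  simp only [CStarT.toExplodedC, CStarT.mk_fst, e1, e2, CStarT.trop_mk, ExplodedC.ofReal]
  congr 1
  push_cast
  ring

end SmoothGerms

/-! ### Exponents of derivatives, and the zero vector. -/

namespace TangentVector

variable {X : AbstractExplodedSpace.{u}} {p : X}

theorem onTrop_one (v : TangentVector p) (h) :
    v.onTrop ⟨secGerm (fun _ => 1) p, h⟩ = ⟨0, 0⟩ := by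
  have h1 : IsSmoothGerm p ((fun _ : X => (1 : ℝ) : X → ℝ) : Germ (𝓝 p) ℝ) := isSmoothGerm_const 1
  have he : ((fun _ : X => (1 : ℝ) : X → ℝ) : Germ (𝓝 p) ℝ).map ExplodedC.ofReal =
      secGerm (fun _ => 1) p := by
    refine Germ.coe_eq.2 (Eventually.of_forall fun x => ?_)
    simp [ExplodedC.ofReal, CStarT.toExplodedC]
  have h2 := v.compat ⟨_, h1⟩ (he ▸ h)
  have h3 : v.onSmooth ⟨_, h1⟩ = 0 := by
    have := v.smooth_mul ⟨_, h1⟩ ⟨_, h1⟩ (by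
      refine (congrArg (IsSmoothGerm p) (Germ.coe_eq.2 (Eventually.of_forall fun x => ?_))).mp h1
      simp)
    have h4 : (⟨_, h1⟩ : {g : Germ (𝓝 p) ℝ // IsSmoothGerm p g}).1 * (⟨_, h1⟩ :
        {g : Germ (𝓝 p) ℝ // IsSmoothGerm p g}).1 =
        ((fun _ : X => (1 : ℝ) : X → ℝ) : Germ (𝓝 p) ℝ) :=
      Germ.coe_eq.2 (Eventually.of_forall fun x => by simp)
    simp only [h4, Germ.value_ofFun] at this
    linarith
  have h5 : (⟨_, h⟩ : {g : Germ (𝓝 p) ExplodedC // IsTropicalGerm p g}) = ⟨_, he ▸ h⟩ :=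
    Subtype.ext he.symm
  rw [h5, h2, h3]
  simp [ExplodedC.ofReal]

theorem secGerm_mul (F G : X → CStarT) :
    secGerm F p * secGerm G p = secGerm (fun x => F x * G x) p := by
  refine Germ.coe_eq.2 (Eventually.of_forall fun x => ?_)
  change ExplodedC.mk _ _ = ExplodedC.mk _ _
  simp [CStarT.toExplodedC]

theorem value_secGerm (F : X → CStarT) : (secGerm F p).value = (F p).toExplodedC := rfl

theorem onTrop_mul (v : TangentVector p) {F G : X → CStarT} (hF : SecAt X F p) (hG : SecAt X G p) :
    v.onTrop ⟨_, (hF.mul hG).isTropicalGerm⟩ =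
      v.onTrop ⟨_, hF.isTropicalGerm⟩ * (G p).toExplodedC +
        (F p).toExplodedC * v.onTrop ⟨_, hG.isTropicalGerm⟩ := by
  have := v.trop_mul ⟨_, hF.isTropicalGerm⟩ ⟨_, hG.isTropicalGerm⟩
    (secGerm_mul F G ▸ (hF.mul hG).isTropicalGerm)
  simp only [secGerm_mul, value_secGerm] at this
  exact this

/-- Compare exponents in the Leibniz rule, where a sum has the smaller exponent. The product `F · 1`
gives one inequality; the product `F · F⁻¹ = 1`, whose derivative is `0 𝔱⁰`, gives the other. -/
theorem order_onTrop_sec (v : TangentVector p) {F : X → CStarT} (hF : SecAt X F p) :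
    (v.onTrop ⟨_, hF.isTropicalGerm⟩).order = (F p).trop := by
  have key : ∀ {F : X → CStarT} (hF : SecAt X F p),
      (v.onTrop ⟨_, hF.isTropicalGerm⟩).order ≤ (F p).trop := by
    intro F hF
    have h1 := congrArg ExplodedC.order (v.onTrop_mul hF (secAt_const 1 p))
    rw [ExplodedC.order_add, ExplodedC.order_mul, ExplodedC.order_mul, onTrop_one] at h1
    have h2 : v.onTrop ⟨_, (hF.mul (secAt_const 1 p)).isTropicalGerm⟩ =
        v.onTrop ⟨_, hF.isTropicalGerm⟩ := by
      congr 1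
      exact Subtype.ext (by simp only [mul_one])
    rw [h2] at h1
    simp only [CStarT.toExplodedC, CStarT.trop_one, add_zero] at h1
    exact min_eq_left_iff.1 h1.symm
  refine le_antisymm (key hF) ?_
  have h1 := congrArg ExplodedC.order (v.onTrop_mul hF hF.inv)
  rw [ExplodedC.order_add, ExplodedC.order_mul, ExplodedC.order_mul] at h1
  have h2 : v.onTrop ⟨_, (hF.mul hF.inv).isTropicalGerm⟩ = ⟨0, 0⟩ := by
    rw [← v.onTrop_one (secAt_const 1 p).isTropicalGerm]
    congr 1
    exact Subtype.ext (by simp only [mul_inv_cancel])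
  rw [h2] at h1
  have h3 := h1.trans_le (min_le_left _ _)
  simp only [CStarT.toExplodedC, CStarT.trop_inv] at h3
  linarith

theorem order_onTrop (v : TangentVector p) (g : {g : Germ (𝓝 p) ExplodedC // IsTropicalGerm p g}) :
    (v.onTrop g).order = g.1.value.order := by
  obtain ⟨g, hg⟩ := g
  refine AddSubsemigroup.closure_induction
    (p := fun g hg => (v.onTrop ⟨g, hg⟩).order = g.value.order) ?_ ?_ hg
  · intro g hg
    obtain ⟨F, hF, rfl⟩ := IsExplodedGerm.exists_secAt hg
    exact v.order_onTrop_sec hF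
  · intro a b ha hb iha ihb
    refine (congrArg ExplodedC.order (v.trop_add ⟨a, ha⟩ ⟨b, hb⟩ (AddMemClass.add_mem ha hb))).trans ?_
    rw [ExplodedC.order_add, iha, ihb]
    induction a using Germ.inductionOn with | _ a => ?_
    induction b using Germ.inductionOn with | _ b => ?_
    exact (ExplodedC.order_add _ _).symm

/-- The zero tangent vector. -/
def zero (p : X) : TangentVector p where
  onSmooth _ := 0
  -- The exponent cannot be chosen freely: by `order_onTrop` every tangent vector gives `g` this
  -- exponent, and only then is the zero coefficient neutral for tropical addition.
  onTrop g := ⟨0, g.1.value.order⟩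
  smooth_add _ _ _ := by simp
  trop_add := by
    rintro ⟨a, ha⟩ ⟨b, hb⟩ _
    induction a using Germ.inductionOn with | _ a => ?_
    induction b using Germ.inductionOn with | _ b => ?_
    change (⟨0, (a p + b p).order⟩ : ExplodedC) = ⟨0, (a p).order⟩ + ⟨0, (b p).order⟩
    rcases lt_trichotomy (a p).order (b p).order with h | h | h
    · rw [ExplodedC.add_of_lt h, ExplodedC.add_of_lt (by exact h)]
    · rw [ExplodedC.add_of_eq h, ExplodedC.add_of_eq (by exact h)]; simp
    · rw [ExplodedC.add_of_gt h, ExplodedC.add_of_gt (by exact h)]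
  smooth_mul _ _ _ := by simp
  trop_mul := by
    rintro ⟨a, ha⟩ ⟨b, hb⟩ _
    induction a using Germ.inductionOn with | _ a => ?_
    induction b using Germ.inductionOn with | _ b => ?_
    change (⟨0, (a p * b p).order⟩ : ExplodedC) = ⟨0, (a p).order⟩ * b p + a p * ⟨0, (b p).order⟩
    refine Eq.trans ?_ (ExplodedC.add_of_eq (by rfl)).symm
    ext <;> simp [ExplodedC.coeff_mul, ExplodedC.order_mul]
  trop_const_mul := by
    rintro c ⟨a, ha⟩ _
    induction a using Germ.inductionOn with | _ a => ?_
    change (⟨0, (c * a p).order⟩ : ExplodedC) = c * ⟨0, (a p).order⟩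
    ext <;> simp [ExplodedC.coeff_mul, ExplodedC.order_mul]
  compat := by
    rintro ⟨a, ha⟩ _
    induction a using Germ.inductionOn with | _ a => ?_
    change (⟨0, (ExplodedC.ofReal (a p)).order⟩ : ExplodedC) = _
    simp [ExplodedC.ofReal]

end TangentVector

/-- The second vector can be taken to be zero. Its image is again the zero vector, and adding that
does not change `w`, since all exponents agree. -/
theorem isTransverse_of_surjective {A B C : AbstractExplodedSpace.{u}} (f : Hom A B) (g : Hom C B)
    (hf : ∀ a, Function.Surjective (f.deriv a)) : IsTransverse f g := by
  intro a c h w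
  obtain ⟨v, rfl⟩ := hf a w
  refine ⟨v, TangentVector.zero c, ?_⟩
  have h0 : ∀ {b : B} (h : g c = b), (h ▸ g.deriv c (TangentVector.zero c) : TangentVector b) =
      TangentVector.zero b := by
    rintro _ rfl
    refine TangentVector.ext rfl (funext ?_)
    rintro ⟨φ, hφ⟩
    exact congrArg (fun t : ExplodedC => (⟨0, t.order⟩ : ExplodedC)) (g.value_pullGerm c φ)
  rw [h0 h]
  refine ⟨fun φ => (add_zero _).symm, fun φ => ?_⟩
  have h1 := (f.deriv a v).order_onTrop φ
  rw [ExplodedC.add_of_eq (by exact h1)]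
  ext <;> simp [TangentVector.zero]

/-! ### Logarithmic derivatives and the chain rule. -/

namespace TangentVector

variable {X : AbstractExplodedSpace.{u}} {p : X}

open Classical in
/-- The derivative of a smooth function. -/
def sm (v : TangentVector p) (f : X → ℝ) : ℝ :=
  if h : IsSmoothGerm p (f : Germ (𝓝 p) ℝ) then v.onSmooth ⟨f, h⟩ else 0

open Classical in
/-- The logarithmic derivative of an exploded function. -/
def ld (v : TangentVector p) (F : X → CStarT) : ℂ :=
  if h : IsTropicalGerm p (secGerm F p) then (v.onTrop ⟨_, h⟩).coeff / (F p).1 else 0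

theorem sm_eq (v : TangentVector p) {f : X → ℝ} (h : IsSmoothGerm p (f : Germ (𝓝 p) ℝ)) :
    v.sm f = v.onSmooth ⟨f, h⟩ := dif_pos h

theorem ld_eq (v : TangentVector p) {F : X → CStarT} (h : IsTropicalGerm p (secGerm F p)) :
    v.ld F = (v.onTrop ⟨_, h⟩).coeff / (F p).1 := dif_pos h

open Classical in
theorem sm_congr (v : TangentVector p) {f g : X → ℝ} (h : f =ᶠ[𝓝 p] g) : v.sm f = v.sm g :=
  congrArg (fun g : Germ (𝓝 p) ℝ => if h : IsSmoothGerm p g then v.onSmooth ⟨g, h⟩ else 0)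
    (Germ.coe_eq.2 h)

open Classical in
theorem ld_congr (v : TangentVector p) {F G : X → CStarT} (h : F =ᶠ[𝓝 p] G) : v.ld F = v.ld G := by
  have : secGerm F p = secGerm G p := Germ.coe_eq.2 (h.fun_comp CStarT.toExplodedC)
  unfold ld
  rw [h.eq_of_nhds]
  exact congrArg (fun g : Germ (𝓝 p) ExplodedC =>
    if h : IsTropicalGerm p g then (v.onTrop ⟨g, h⟩).coeff / (G p).1 else 0) this

theorem onTrop_sec (v : TangentVector p) {F : X → CStarT} (hF : SecAt X F p) :
    v.onTrop ⟨_, hF.isTropicalGerm⟩ = ⟨v.ld F * (F p).1, (F p).trop⟩ := by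
  rw [v.ld_eq hF.isTropicalGerm, div_mul_cancel₀ _ (Units.ne_zero _)]
  exact ExplodedC.ext rfl (v.order_onTrop_sec hF)

/-- Division by the value turns the Leibniz rule into additivity, so a tangent vector acts on
monomials through its values on the coordinates. -/
theorem ld_mul (v : TangentVector p) {F G : X → CStarT} (hF : SecAt X F p) (hG : SecAt X G p) :
    v.ld (fun x => F x * G x) = v.ld F + v.ld G := by
  have h1 := congrArg ExplodedC.coeff (v.onTrop_mul hF hG)
  rw [v.onTrop_sec hF, v.onTrop_sec hG, v.onTrop_sec (hF.mul hG),
    ExplodedC.add_of_eq (by rfl)] at h1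
  simp only [ExplodedC.coeff_mul, CStarT.toExplodedC, Prod.fst_mul, Units.val_mul] at h1
  have h2 : ((F p).1 : ℂ) ≠ 0 := Units.ne_zero _
  have h3 : ((G p).1 : ℂ) ≠ 0 := Units.ne_zero _
  refine mul_right_cancel₀ (mul_ne_zero h2 h3) ?_
  rw [h1]
  ring

/-- The logarithmic derivative as a homomorphism. -/
def ldHom (v : TangentVector p) : secGroup p →* Multiplicative ℂ where
  toFun F := Multiplicative.ofAdd (v.ld F.1)
  map_one' := by
    have h := v.onTrop_one (secAt_const 1 p).isTropicalGerm
    have : v.ld (fun _ => 1) = 0 := by rw [v.ld_eq (secAt_const 1 p).isTropicalGerm, h]; simp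
    exact congrArg Multiplicative.ofAdd this
  map_mul' F G := congrArg Multiplicative.ofAdd (v.ld_mul F.2 G.2)

theorem ld_const (v : TangentVector p) (c : CStarT) : v.ld (fun _ => c) = 0 := by
  have h1 : (⟨(c.1 : ℂ), c.trop⟩ : ExplodedC) = c.toExplodedC := rfl
  have he : ((c.toExplodedC : ExplodedC) : Germ (𝓝 p) ExplodedC) * secGerm (fun _ => 1) p =
      secGerm (fun _ => c) p := by
    refine Germ.coe_eq.2 (Eventually.of_forall fun x => ?_)
    exact ExplodedC.ext (mul_one _) (add_zero _)
  have h2 := v.trop_const_mul c.toExplodedC ⟨_, (secAt_const 1 p).isTropicalGerm⟩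
    (he ▸ (secAt_const c p).isTropicalGerm)
  rw [v.onTrop_one] at h2
  have h3 : v.onTrop ⟨_, (secAt_const c p).isTropicalGerm⟩ = c.toExplodedC * ⟨0, 0⟩ := by
    rw [← h2]
    congr 1
    exact Subtype.ext he.symm
  rw [v.ld_eq (secAt_const c p).isTropicalGerm, h3, ExplodedC.coeff_mul, mul_zero, zero_div]

theorem ld_monomial (v : TangentVector p) {m : ℕ} (q : IntAffine m) {z : X → Fin m → CStarT}
    (hz : ∀ i, SecAt X (fun x => z x i) p) :
    v.ld (fun x => monomial q (z x)) = ∑ i, (q.2 i : ℂ) * v.ld (fun x => z x i) := by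
  let Z : Fin m → secGroup p := fun i => ⟨fun x => z x i, hz i⟩
  have h1 := v.ld_mul (secAt_const (CStarT.mk 1 q.1) p)
    (SecAt.prod Finset.univ fun i _ => (hz i).zpow (q.2 i))
  refine h1.trans ?_
  rw [ld_const, zero_add]
  have h2 := map_prod v.ldHom (fun i => Z i ^ q.2 i) Finset.univ
  have h3 : ((∏ i, Z i ^ q.2 i : secGroup p) : X → CStarT) = fun x => ∏ i, z x i ^ q.2 i := by
    funext x
    simp [Z, Finset.prod_apply]
  have h4 : v.ldHom (∏ i, Z i ^ q.2 i) = Multiplicative.ofAdd (v.ld fun x => ∏ i, z x i ^ q.2 i) :=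
    congrArg (fun F => Multiplicative.ofAdd (v.ld F)) h3
  rw [h4] at h2
  have h5 := congrArg Multiplicative.toAdd h2
  rw [toAdd_ofAdd] at h5
  rw [h5, toAdd_prod]
  refine Finset.sum_congr rfl fun i _ => ?_
  rw [map_zpow, toAdd_zpow, zsmul_eq_mul]
  rfl

section Good

variable (hX : ∀ x : X, GoodPt X x)
include hX

theorem sm_add (v : TangentVector p) {f g : X → ℝ} (hf : RSm X f p) (hg : RSm X g p) :
    v.sm (fun x => f x + g x) = v.sm f + v.sm g := by
  rw [v.sm_eq ((isSmoothGerm_iff hX).2 hf), v.sm_eq ((isSmoothGerm_iff hX).2 hg),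
    v.sm_eq ((isSmoothGerm_iff hX).2 ((hX p).nice.rSm_add hf hg))]
  exact v.smooth_add ⟨f, (isSmoothGerm_iff hX).2 hf⟩ ⟨g, (isSmoothGerm_iff hX).2 hg⟩
    ((isSmoothGerm_iff hX).2 ((hX p).nice.rSm_add hf hg))

theorem sm_mul (v : TangentVector p) {f g : X → ℝ} (hf : RSm X f p) (hg : RSm X g p) :
    v.sm (fun x => f x * g x) = v.sm f * g p + f p * v.sm g := by
  rw [v.sm_eq ((isSmoothGerm_iff hX).2 hf), v.sm_eq ((isSmoothGerm_iff hX).2 hg),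
    v.sm_eq ((isSmoothGerm_iff hX).2 ((hX p).nice.rSm_mul hf hg))]
  exact v.smooth_mul ⟨f, (isSmoothGerm_iff hX).2 hf⟩ ⟨g, (isSmoothGerm_iff hX).2 hg⟩
    ((isSmoothGerm_iff hX).2 ((hX p).nice.rSm_mul hf hg))

theorem onTrop_ofReal (v : TangentVector p) {f : X → ℝ} (hf : RSm X f p) :
    v.onTrop ⟨_, isTropicalGerm_ofReal (hX p).nice hf⟩ = ⟨(v.sm f : ℂ), 0⟩ := by
  rw [v.sm_eq ((isSmoothGerm_iff hX).2 hf)]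
  exact v.compat ⟨_, (isSmoothGerm_iff hX).2 hf⟩ _

/-- The logarithmic derivative of a smooth function with values in `ℂ^*`. -/
theorem ld_unit (v : TangentVector p) {f : X → ℂ} (hf : CSm X f p) (h0 : f p ≠ 0)
    (hs : SecAt X (fun x => CStarT.mk (toUnit (f x)) 0) p) :
    v.ld (fun x => CStarT.mk (toUnit (f x)) 0) =
      ((v.sm fun x => (f x).re) + (v.sm fun x => (f x).im) * Complex.I) / f p := by
  have h1 := isTropicalGerm_ofReal (hX p).nice hf.1
  have h2 := isTropicalGerm_ofReal (hX p).nice hf.2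
  have hI : IsTropicalGerm p (((⟨Complex.I, 0⟩ : ExplodedC) : Germ (𝓝 p) ExplodedC) *
      ((fun x => ExplodedC.ofReal (f x).im : X → ExplodedC) : Germ (𝓝 p) ExplodedC)) := by
    have hc : ∀ c : ExplodedC, c.coeff ≠ 0 → ∀ g, IsTropicalGerm p g →
        IsTropicalGerm p ((c : Germ (𝓝 p) ExplodedC) * g) := by
      intro c hc g hg
      have hcc : c = (CStarT.mk (toUnit c.coeff) c.order).toExplodedC :=
        ExplodedC.ext (by simp [CStarT.toExplodedC, coe_toUnit hc]) rfl
      refine AddSubsemigroup.closure_induction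
        (p := fun g _ => IsTropicalGerm p ((c : Germ (𝓝 p) ExplodedC) * g)) ?_ ?_ hg
      · intro g hg
        obtain ⟨F, hF, rfl⟩ := IsExplodedGerm.exists_secAt hg
        have h3 := ((secAt_const (CStarT.mk (toUnit c.coeff) c.order) p).mul hF).isTropicalGerm
        rw [← secGerm_mul] at h3
        rw [hcc]
        exact h3
      · intro a b _ _ ha hb
        have h3 := AddMemClass.add_mem ha hb
        refine (congrArg (IsTropicalGerm p) ?_).mp h3
        induction a using Germ.inductionOn with | _ a => ?_
        induction b using Germ.inductionOn with | _ b => ?_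
        refine Germ.coe_eq.2 (Eventually.of_forall fun x => ?_)
        change c * a x + c * b x = c * (a x + b x)
        rcases lt_trichotomy (a x).order (b x).order with h | h | h
        · rw [ExplodedC.add_of_lt h, ExplodedC.add_of_lt]
          exact add_lt_add_right h c.order
        · rw [ExplodedC.add_of_eq h, ExplodedC.add_of_eq]
          · exact ExplodedC.ext (mul_add _ _ _).symm rfl
          · exact congrArg (c.order + ·) h
        · rw [ExplodedC.add_of_gt h, ExplodedC.add_of_gt]
          exact add_lt_add_right h c.order
    exact hc _ Complex.I_ne_zero _ h2
  have hne : ∀ᶠ x in 𝓝 p, f x ≠ 0 :=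
    ((hX p).nice.continuousAt_complex hf).eventually (isOpen_ne.mem_nhds h0)
  have he : ((fun x => ExplodedC.ofReal (f x).re : X → ExplodedC) : Germ (𝓝 p) ExplodedC) +
      (((⟨Complex.I, 0⟩ : ExplodedC) : Germ (𝓝 p) ExplodedC) *
      ((fun x => ExplodedC.ofReal (f x).im : X → ExplodedC) : Germ (𝓝 p) ExplodedC)) =
      secGerm (fun x => CStarT.mk (toUnit (f x)) 0) p := by
    refine Germ.coe_eq.2 (hne.mono fun x hx => ?_)
    change ExplodedC.ofReal (f x).re + (⟨Complex.I, 0⟩ : ExplodedC) * ExplodedC.ofReal (f x).im = _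
    rw [ExplodedC.add_of_eq (by simp [ExplodedC.order_mul, ExplodedC.ofReal])]
    refine ExplodedC.ext ?_ rfl
    change ((f x).re : ℂ) + Complex.I * ((f x).im : ℂ) = (toUnit (f x) : ℂ)
    rw [coe_toUnit hx, mul_comm, Complex.re_add_im]
  have h3 := v.trop_add ⟨_, h1⟩ ⟨_, hI⟩ (he ▸ hs.isTropicalGerm)
  have h4 := v.trop_const_mul ⟨Complex.I, 0⟩ ⟨_, h2⟩ hI
  have h5 : v.onTrop ⟨_, hs.isTropicalGerm⟩ = ⟨(v.sm fun x => (f x).re) +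
      (v.sm fun x => (f x).im) * Complex.I, 0⟩ := by
    have h6 : (⟨_, hs.isTropicalGerm⟩ : {g : Germ (𝓝 p) ExplodedC // IsTropicalGerm p g}) =
        ⟨_, he ▸ hs.isTropicalGerm⟩ := Subtype.ext he.symm
    rw [h6]
    refine h3.trans ?_
    rw [h4, onTrop_ofReal hX v hf.1, onTrop_ofReal hX v hf.2]
    refine (ExplodedC.add_of_eq (by simp [ExplodedC.order_mul])).trans ?_
    refine ExplodedC.ext ?_ rfl
    simp [ExplodedC.coeff_mul, mul_comm]
  rw [v.ld_eq hs.isTropicalGerm, h5]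
  simp only [CStarT.mk_fst, coe_toUnit h0]

/-- Nonzero constants are exploded functions with zero logarithmic derivative, and `ld_unit`
transfers this to `sm`. The constant `0` is not a unit; it is handled as `1 + (-1)`. -/
theorem sm_const (v : TangentVector p) (c : ℝ) : v.sm (fun _ => c) = 0 := by
  have key : ∀ c : ℝ, c ≠ 0 → v.sm (fun _ => c) = 0 := by
    intro c hc
    have h := ld_unit hX v (f := fun _ => (c : ℂ)) ⟨by simpa using rSm_const c p,
      by simpa using rSm_const 0 p⟩ (by exact_mod_cast hc) (secAt_const _ p)
    rw [ld_const] at h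
    have h2 := (div_eq_zero_iff.1 h.symm).resolve_right (by exact_mod_cast hc)
    simpa using congrArg Complex.re h2
  have h1 := sm_add hX v (rSm_const 1 p) (rSm_const (c - 1) p)
  by_cases hc : c = 0
  · have h2 := sm_add hX v (rSm_const 1 p) (rSm_const (-1) p)
    rw [key 1 one_ne_zero, key (-1) (by simp)] at h2
    simpa [hc] using h2
  · exact key c hc

/-- Tropically, `1 + w` equals `1 + ⌈w⌉` near `p`. Its derivative `v(1) + v(w)` is `0 𝔱⁰`, since
`v(w)` has positive exponent and is absorbed. Hence smooth monomials of positive exponent contribute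
nothing to tangent vectors. -/
theorem sm_smoothPart (v : TangentVector p) {w : X → CStarT} (hw : SecAt X w p)
    (hpos : ∀ᶠ x in 𝓝 p, 0 ≤ (w x).trop) (hwp : 0 < (w p).trop) :
    v.sm (fun x => ((w x).smoothPart).re) = 0 ∧ v.sm (fun x => ((w x).smoothPart).im) = 0 := by
  have hC := (hX p).nice.smooth hw hpos
  have hc1 : CSm X (fun x => 1 + (w x).smoothPart) p :=
    ⟨by simpa using (hX p).nice.rSm_add (rSm_const 1 p) hC.1, by simpa using hC.2⟩
  have hwp0 : (w p).smoothPart = 0 := CStarT.smoothPart_of_pos hwp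
  have h0 : (1 : ℂ) + (w p).smoothPart ≠ 0 := by simp [hwp0]
  have hs : SecAt X (fun x => CStarT.mk (toUnit (1 + (w x).smoothPart)) 0) p :=
    (hX p).nice.comp (n := 0) (ι := Unit) (fun _ i => i.elim0) (fun x _ => 1 + (w x).smoothPart)
      (fun y => y.2 ()) (fun i => i.elim0) (fun _ => hc1) (ContDiff.smoothNear (by fun_prop) _) h0
  have hne : ∀ᶠ x in 𝓝 p, 1 + (w x).smoothPart ≠ 0 :=
    ((hX p).nice.continuousAt_complex hc1).eventually (isOpen_ne.mem_nhds h0)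
  have he : secGerm (fun _ => 1) p + secGerm w p =
      secGerm (fun x => CStarT.mk (toUnit (1 + (w x).smoothPart)) 0) p := by
    refine Germ.coe_eq.2 ?_
    filter_upwards [hpos, hne] with x hx hx0
    rcases hx.eq_or_lt with h | h
    · rw [ExplodedC.add_of_eq (by exact h)]
      refine ExplodedC.ext ?_ rfl
      change (1 : ℂ) + (w x).1 = (toUnit (1 + (w x).smoothPart) : ℂ)
      rw [coe_toUnit hx0, CStarT.smoothPart_of_eq h.symm]
    · rw [ExplodedC.add_of_lt (by exact h)]
      refine ExplodedC.ext ?_ rfl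
      change (1 : ℂ) = (toUnit (1 + (w x).smoothPart) : ℂ)
      rw [coe_toUnit hx0, CStarT.smoothPart_of_pos h, add_zero]
  have h1 := v.trop_add ⟨_, (secAt_const 1 p).isTropicalGerm⟩ ⟨_, hw.isTropicalGerm⟩
    (he ▸ hs.isTropicalGerm)
  rw [v.onTrop_one, ExplodedC.add_of_lt (by rw [v.order_onTrop_sec hw]; exact hwp)] at h1
  have h2 : v.ld (fun x => CStarT.mk (toUnit (1 + (w x).smoothPart)) 0) = 0 := by
    have h3 : (⟨_, hs.isTropicalGerm⟩ : {g : Germ (𝓝 p) ExplodedC // IsTropicalGerm p g}) =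
        ⟨_, he ▸ hs.isTropicalGerm⟩ := Subtype.ext he.symm
    rw [v.ld_eq hs.isTropicalGerm, h3]
    refine (div_eq_zero_iff.2 (Or.inl ?_))
    exact congrArg ExplodedC.coeff h1
  rw [ld_unit hX v hc1 h0 hs] at h2
  have h4 := (div_eq_zero_iff.1 h2).resolve_right h0
  have h5 := congrArg Complex.re h4
  have h6 := congrArg Complex.im h4
  simp only [Complex.add_re, Complex.add_im, Complex.one_re, Complex.one_im, zero_add,
    Complex.mul_re, Complex.mul_im, Complex.ofReal_re, Complex.ofReal_im, Complex.I_re,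
    Complex.I_im, mul_zero, mul_one, zero_mul, sub_zero, add_zero, Complex.zero_re,
    Complex.zero_im] at h5 h6
  rw [sm_add hX v (rSm_const 1 p) hC.1, sm_const hX, zero_add] at h5
  exact ⟨h5, h6⟩

theorem sm_sum (v : TangentVector p) {κ : Type*} (t : Finset κ) {f : κ → X → ℝ}
    (hf : ∀ k, RSm X (f k) p) :
    RSm X (fun x => ∑ k ∈ t, f k x) p ∧ v.sm (fun x => ∑ k ∈ t, f k x) = ∑ k ∈ t, v.sm (f k) := by
  classical
  induction t using Finset.induction_on with
  | empty => simpa using ⟨rSm_const 0 p, sm_const hX v 0⟩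
  | insert a t ha ih =>
    simp only [Finset.sum_insert ha]
    exact ⟨(hX p).nice.rSm_add (hf a) ih.1, by rw [sm_add hX v (hf a) ih.1, ih.2]⟩

/-- The chain rule: the derivative of a smooth function of smooth functions is determined by the
derivatives of these. -/
theorem sm_comp_eq (v v' : TangentVector p) {κ : Type} [Fintype κ] {Y : X → κ → ℝ}
    {H : (κ → ℝ) → ℝ} (hY : ∀ k, RSm X (fun x => Y x k) p) (hH : SmoothNear H (Y p))
    (hv : ∀ k, v.sm (fun x => Y x k) = v'.sm (fun x => Y x k)) :
    v.sm (fun x => H (Y x)) = v'.sm (fun x => H (Y x)) := by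
  classical
  -- Near `p` the function is a constant plus `∑ (Y k - Y p k) D k` with smooth `D k`; the Leibniz
  -- rule leaves only the derivatives of the `Y k`.
  obtain ⟨D, hD, hHD⟩ := exists_hadamard hH
  have hYc : ContinuousAt Y p := continuousAt_pi.2 fun k => (hX p).nice.continuousAt (hY k)
  have h1 : (fun x => H (Y x)) =ᶠ[𝓝 p] fun x =>
      H (Y p) + ∑ k, (Y x k + -Y p k) * D (Y x) (Pi.single k 1) := by
    filter_upwards [hYc.eventually hHD] with x hx
    rw [hx]
    congr 1
    conv_lhs => rw [pi_eq_sum_univ' (Y x - Y p), map_sum]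
    refine Finset.sum_congr rfl fun k _ => ?_
    have : (Pi.single k 1 : κ → ℝ) = fun j => if j = k then 1 else 0 := by
      funext j; simp [Pi.single_apply]
    rw [map_smul, smul_eq_mul, this, ← sub_eq_add_neg]
    simp only [Pi.sub_apply, eq_comm]
  have hYk : ∀ k, RSm X (fun x => Y x k + -Y p k) p := fun k =>
    (hX p).nice.rSm_add (hY k) (rSm_const _ p)
  have hDk : ∀ k, RSm X (fun x => D (Y x) (Pi.single k 1)) p := fun k =>
    (hX p).nice.rSm_comp (H := fun y => D y (Pi.single k 1)) hY
      (ContDiff.smoothNear (hD.clm_apply contDiff_const) _)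
  have key : ∀ v : TangentVector p, v.sm (fun x => H (Y x)) =
      ∑ k, v.sm (fun x => Y x k) * D (Y p) (Pi.single k 1) := by
    intro v
    have h2 := sm_sum hX v Finset.univ fun k => (hX p).nice.rSm_mul (hYk k) (hDk k)
    rw [v.sm_congr h1, sm_add hX v (rSm_const _ p) h2.1, sm_const hX, zero_add, h2.2]
    refine Finset.sum_congr rfl fun k _ => ?_
    rw [sm_mul hX v (hYk k) (hDk k), sm_add hX v (hY k) (rSm_const _ p), sm_const hX]
    ring
  rw [key, key]
  exact Finset.sum_congr rfl fun k _ => by rw [hv]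

theorem ext_of_sm_ld {v v' : TangentVector p} (h1 : ∀ f, RSm X f p → v.sm f = v'.sm f)
    (h2 : ∀ F, SecAt X F p → v.ld F = v'.ld F) : v = v' := by
  refine TangentVector.ext (funext ?_) (funext ?_)
  · rintro ⟨g, hg⟩
    induction g using Germ.inductionOn with | _ f => ?_
    rw [← v.sm_eq hg, ← v'.sm_eq hg]
    exact h1 f ((isSmoothGerm_iff hX).1 hg)
  · rintro ⟨g, hg⟩
    refine AddSubsemigroup.closure_induction
      (p := fun g hg => v.onTrop ⟨g, hg⟩ = v'.onTrop ⟨g, hg⟩) ?_ ?_ hg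
    · intro g hg
      obtain ⟨F, hF, rfl⟩ := IsExplodedGerm.exists_secAt hg
      exact (v.onTrop_sec hF).trans ((h2 F hF ▸ (v'.onTrop_sec hF).symm))
    · intro a b ha hb iha ihb
      refine (v.trop_add ⟨a, ha⟩ ⟨b, hb⟩ (AddMemClass.add_mem ha hb)).trans ?_
      rw [iha, ihb]
      exact (v'.trop_add ⟨a, ha⟩ ⟨b, hb⟩ (AddMemClass.add_mem ha hb)).symm

/-- Tangent vectors are determined by the derivatives of the coordinates of a chart. -/
theorem ext_of_chart {n m : ℕ} {P : Set (Fin m → ℝ)} {φ : X → model n P} {ψ : model n P → X}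
    {e : model n P} (h : LocIso X (model n P) φ ψ p e) (he : tc e ∈ interior P)
    {v v' : TangentVector p} (h1 : ∀ j, v.sm (fun x => xc (φ x) j) = v'.sm (fun x => xc (φ x) j))
    (h2 : ∀ i, v.ld (fun x => zc (φ x) i) = v'.ld (fun x => zc (φ x) i)) : v = v' := by
  classical
  have hri := relInt_of_mem_interior he
  have hφ : MorAt X (model n P) φ p := h.morAt.self_of_nhds
  have hψ : MorAt (model n P) X ψ e := h.morAt_symm.self_of_nhds
  have hz : ∀ i, SecAt X (fun x => zc (φ x) i) p := fun i => hφ.2 _ (secAt_zc i _)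
  have hx : ∀ j, RSm X (fun x => xc (φ x) j) p := fun j => RSm.pull hφ (rSm_xc j _)
  have hsm : ∀ q : NonnegMonomial P, CSm X (fun x => smon q (φ x)) p := fun q =>
    CSm.pull hφ (smM_smon q _).cSm
  have hsv : ∀ q : NonnegMonomial P, v.sm (fun x => (smon q (φ x)).re) =
      v'.sm (fun x => (smon q (φ x)).re) ∧ v.sm (fun x => (smon q (φ x)).im) =
      v'.sm (fun x => (smon q (φ x)).im) := by
    intro q
    -- A smooth monomial of exponent zero at `e` is constant, since `tc e` is interior; one of
    -- positive exponent has zero derivative by `sm_smoothPart`. So smooth functions are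
    -- differentiated through the real coordinates only.
    by_cases h0 : q.1.eval (tc e) = 0
    · simp only [smon_eq_of_eval_eq_zero he h0, sm_const hX, and_self]
    · have hpos : 0 < q.1.eval (tc e) := lt_of_le_of_ne (q.2 _ (tc_mem e)) (Ne.symm h0)
      have key : ∀ v : TangentVector p, v.sm (fun x => (smon q (φ x)).re) = 0 ∧
          v.sm (fun x => (smon q (φ x)).im) = 0 := fun v =>
        sm_smoothPart hX v (SecAt.monomial q.1 hz)
          (Eventually.of_forall fun x => by rw [trop_monomial_zc]; exact q.2 _ (tc_mem _))
          (by rw [trop_monomial_zc, h.map]; exact hpos)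
      rw [(key v).1, (key v).2, (key v').1, (key v').2]
      exact ⟨rfl, rfl⟩
  have hSm : ∀ g : model n P → ℝ, SmM g e → v.sm (fun x => g (φ x)) = v'.sm (fun x => g (φ x)) := by
    rintro g ⟨s, k, hk, hg⟩
    let Y : X → Fin n ⊕ (s ⊕ s) → ℝ := fun x => Sum.elim (xc (φ x))
      (Sum.elim (fun i => (smon i.1 (φ x)).re) fun i => (smon i.1 (φ x)).im)
    let R : (Fin n ⊕ (s ⊕ s) → ℝ) → (Fin n → ℝ) × (s → ℂ) := fun y =>
      (fun j => y (Sum.inl j),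
        fun i => (y (Sum.inr (Sum.inl i)) : ℂ) + (y (Sum.inr (Sum.inr i)) : ℂ) * Complex.I)
    have hR : ContDiff ℝ ∞ R := by
      refine ContDiff.prodMk (by fun_prop) (contDiff_pi.2 fun i => ContDiff.add ?_
        (ContDiff.mul ?_ contDiff_const))
      · exact Complex.ofRealCLM.contDiff.comp
          (f := fun y : Fin n ⊕ (s ⊕ s) → ℝ => y (Sum.inr (Sum.inl i))) (by fun_prop)
      · exact Complex.ofRealCLM.contDiff.comp
          (f := fun y : Fin n ⊕ (s ⊕ s) → ℝ => y (Sum.inr (Sum.inr i))) (by fun_prop)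
    have hRY : ∀ x, R (Y x) = coords s (φ x) := fun x =>
      Prod.ext rfl (funext fun i => Complex.re_add_im _)
    have hgY : (fun x => g (φ x)) =ᶠ[𝓝 p] fun x => k (R (Y x)) := by
      filter_upwards [h.tendsto.eventually hg] with x hx
      rw [hx, hRY]
    rw [v.sm_congr hgY, v'.sm_congr hgY]
    refine sm_comp_eq hX v v' (H := fun y => k (R y)) (fun κ => ?_) ?_ fun κ => ?_
    · rcases κ with j | i | i
      · exact hx j
      · exact (hsm i.1).1
      · exact (hsm i.1).2
    · refine SmoothNear.comp (g := k) ?_ (hR.smoothNear _)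
      rw [hRY, h.map]
      exact hk
    · rcases κ with j | i | i
      · exact h1 j
      · exact (hsv i.1).1
      · exact (hsv i.1).2
  have hback : ∀ {T : Type} (f : X → T), f =ᶠ[𝓝 p] fun x => f (ψ (φ x)) := fun f =>
    h.left_inv.mono fun x hx => congrArg f hx.symm
  refine ext_of_sm_ld hX (fun f hf => ?_) fun F hF => ?_
  · have h3 : RSm (model n P) (fun y => f (ψ y)) e := RSm.pull hψ (by rwa [h.map_symm])
    rw [v.sm_congr (hback f), v'.sm_congr (hback f)]
    exact hSm _ (h3.smM hri)
  · have h3 : SecAt (model n P) (fun y => F (ψ y)) e := hψ.2 F (by rwa [h.map_symm])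
    obtain ⟨K, q, hK, hK0, hFK⟩ := secAt_model_iff.1 h3
    have h4 : F =ᶠ[𝓝 p] fun x => CStarT.mk (toUnit (K (φ x))) 0 * monomial q (zc (φ x)) :=
      (hback F).trans (h.tendsto.eventually hFK)
    have hKp : CSm X (fun x => K (φ x)) p := CSm.pull hφ (by rw [h.map]; exact hK.cSm)
    have hKs : SecAt X (fun x => CStarT.mk (toUnit (K (φ x))) 0) p :=
      hφ.2 (fun y => CStarT.mk (toUnit (K y)) 0) (by rw [h.map]; exact secAt_unit hK hK0)
    have hK0' : K (φ p) ≠ 0 := by rwa [h.map]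
    have key : ∀ v : TangentVector p, v.ld F =
        ((v.sm fun x => (K (φ x)).re) + (v.sm fun x => (K (φ x)).im) * Complex.I) / K (φ p) +
          ∑ i, (q.2 i : ℂ) * v.ld (fun x => zc (φ x) i) := fun v => by
      rw [v.ld_congr h4, v.ld_mul hKs (SecAt.monomial q hz), ld_unit hX v hKp hK0' hKs,
        v.ld_monomial q hz]
    rw [key v, key v']
    congr 2
    · rw [hSm (fun y => (K y).re) (SmM.comp (g := Complex.re)
        (ContDiff.smoothNear Complex.reCLM.contDiff _) hK), hSm (fun y => (K y).im)
        (SmM.comp (g := Complex.im) (ContDiff.smoothNear Complex.imCLM.contDiff _) hK)]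
    · exact funext fun i => by rw [h2]

end Good

end TangentVector

/-! ### Tangent vectors of paths -/

section Paths

variable {X : AbstractExplodedSpace.{u}} {p : X}

/-- The derivative at `0` of a germ of a function of a real variable. -/
def germDeriv {F : Type*} [NormedAddCommGroup F] [NormedSpace ℝ F] (g : Germ (𝓝 (0 : ℝ)) F) : F :=
  Quotient.liftOn' g (fun f => deriv f 0) fun _ _ h => Filter.EventuallyEq.deriv_eq h

theorem RSm.differentiableAt {f : ℝ → ℝ} {t : ℝ} (h : RSm realLine f t) : DifferentiableAt ℝ f t := by
  obtain ⟨k, a, hk, hk0, hf⟩ := secAt_realLine_iff.1 h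
  have h1 : ∀ᶠ s in 𝓝 t, (k s).re = Real.exp (f s) := by
    filter_upwards [hf, hk.continuousAt.eventually (isOpen_ne.mem_nhds hk0)] with s hs h0
    have := congrArg (fun c : CStarT => ((c.1 : ℂ)).re) hs
    simp only [CStarT.mk_fst, coe_toUnit h0] at this
    rw [← this, coe_toUnit (by simp), Complex.ofReal_re]
  have h2 : DifferentiableAt ℝ (fun s => Real.log (k s).re) t := by
    refine DifferentiableAt.log ?_ (by rw [h1.self_of_nhds]; exact (Real.exp_pos _).ne')
    exact (Complex.reCLM.contDiff.contDiffAt.comp t hk.contDiffAt).differentiableAt (by simp)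
  exact h2.congr_of_eventuallyEq (h1.mono fun s hs => by simp only [hs, Real.log_exp])

theorem tendsto_path {γ : ℝ → X} (hγ : MorAt realLine X γ (0 : ℝ)) (h0 : γ 0 = p) :
    Tendsto γ (𝓝 (0 : ℝ)) (𝓝 p) := by
  have h : Tendsto γ (𝓝 (0 : ℝ)) (𝓝 (γ 0)) := hγ.1
  rwa [h0] at h

theorem IsSmoothGerm.differentiableAt_path {γ : ℝ → X} (hγ : MorAt realLine X γ (0 : ℝ))
    (h0 : γ 0 = p) {f : X → ℝ} (hf : IsSmoothGerm p (f : Germ (𝓝 p) ℝ)) :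
    DifferentiableAt ℝ (fun t => f (γ t)) 0 := by
  subst h0
  have h1 := (isSmoothGerm_iff_morAt.1 hf).self_of_nhds
  exact RSm.differentiableAt (RSm.pull (h1.comp hγ) (rSm_realLine _))

/-- Exponents of exploded functions on the real line are locally constant, so along a path each sum
either loses one summand or adds coefficients. This makes the coefficient differentiable and lets a
path define a tangent vector. -/
theorem IsTropicalGerm.path {γ : ℝ → X} (hγ : MorAt realLine X γ (0 : ℝ)) (h0 : γ 0 = p)
    {f : X → ExplodedC} (hf : IsTropicalGerm p (f : Germ (𝓝 p) ExplodedC)) :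
    ∃ (h : ℝ → ℂ) (a : ℝ), DifferentiableAt ℝ h 0 ∧ ∀ᶠ t in 𝓝 (0 : ℝ), f (γ t) = ⟨h t, a⟩ := by
  subst h0
  have key : ∀ g, IsTropicalGerm (γ 0) g → ∃ (h : ℝ → ℂ) (a : ℝ), DifferentiableAt ℝ h 0 ∧
      g.compTendsto γ (tendsto_path hγ rfl) = ((fun t => ⟨h t, a⟩ : ℝ → ExplodedC) :
        Germ (𝓝 (0 : ℝ)) ExplodedC) := by
    intro g hg
    refine AddSubsemigroup.closure_induction
      (p := fun g _ => ∃ (h : ℝ → ℂ) (a : ℝ), DifferentiableAt ℝ h 0 ∧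
      g.compTendsto γ (tendsto_path hγ rfl) = ((fun t => ⟨h t, a⟩ : ℝ → ExplodedC) :
        Germ (𝓝 (0 : ℝ)) ExplodedC)) ?_ ?_ hg
    · intro g hg
      obtain ⟨F, hF, rfl⟩ := IsExplodedGerm.exists_secAt hg
      obtain ⟨h, a, hh, hne, hFh⟩ := secAt_realLine_iff.1 (hγ.2 F hF)
      refine ⟨h, a, hh.contDiffAt.differentiableAt (by simp), Germ.coe_eq.2 ?_⟩
      filter_upwards [hFh, hh.continuousAt.eventually (isOpen_ne.mem_nhds hne)] with t ht h0
      change (F (γ t)).toExplodedC = _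
      rw [ht]
      exact ExplodedC.ext (coe_toUnit h0) rfl
    · rintro a b _ _ ⟨h₁, a₁, hd₁, e₁⟩ ⟨h₂, a₂, hd₂, e₂⟩
      have hab : (a + b).compTendsto γ (tendsto_path hγ rfl) =
          a.compTendsto γ (tendsto_path hγ rfl) + b.compTendsto γ (tendsto_path hγ rfl) := by
        induction a using Germ.inductionOn with | _ a => ?_
        induction b using Germ.inductionOn with | _ b => rfl
      rw [hab, e₁, e₂]
      rcases lt_trichotomy a₁ a₂ with h | h | h
      · exact ⟨h₁, a₁, hd₁, Germ.coe_eq.2 (Eventually.of_forall fun t =>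
          ExplodedC.add_of_lt (by exact h))⟩
      · exact ⟨fun t => h₁ t + h₂ t, a₁, hd₁.add hd₂, Germ.coe_eq.2 (Eventually.of_forall fun t =>
          ExplodedC.add_of_eq (by exact h))⟩
      · exact ⟨h₂, a₂, hd₂, Germ.coe_eq.2 (Eventually.of_forall fun t =>
          ExplodedC.add_of_gt (by exact h))⟩
  obtain ⟨h, a, hd, e⟩ := key _ hf
  exact ⟨h, a, hd, Germ.coe_eq.1 e⟩

/-- The values of the tangent vector of a path on tropical functions. -/
def pathTrop (γ : ℝ → X) (ht : Tendsto γ (𝓝 (0 : ℝ)) (𝓝 p)) (g : Germ (𝓝 p) ExplodedC) : ExplodedC :=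
  ⟨germDeriv ((g.compTendsto γ ht).map ExplodedC.coeff), g.value.order⟩

theorem pathTrop_coe {γ : ℝ → X} (ht : Tendsto γ (𝓝 (0 : ℝ)) (𝓝 p)) (h0 : γ 0 = p)
    {f : X → ExplodedC} {h : ℝ → ℂ} {h' : ℂ} {a : ℝ} (hd : HasDerivAt h h' 0)
    (he : ∀ᶠ t in 𝓝 (0 : ℝ), f (γ t) = ⟨h t, a⟩) :
    pathTrop γ ht (f : Germ (𝓝 p) ExplodedC) = ⟨h', a⟩ := by
  subst h0
  refine ExplodedC.ext ?_ ?_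
  · change deriv (fun t => (f (γ t)).coeff) 0 = h'
    refine (hd.congr_of_eventuallyEq (he.mono fun t ht => ?_)).deriv
    rw [ht]
  · change (f (γ 0)).order = a
    rw [he.self_of_nhds]

/-- The tangent vector of a path. -/
def pathVec (γ : ℝ → X) (hγ : MorAt realLine X γ (0 : ℝ)) (h0 : γ 0 = p) : TangentVector p where
  onSmooth g := germDeriv (g.1.compTendsto γ (tendsto_path hγ h0))
  onTrop g := pathTrop γ (tendsto_path hγ h0) g.1
  smooth_add := by
    rintro ⟨a, ha⟩ ⟨b, hb⟩ _
    induction a using Germ.inductionOn with | _ a => ?_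
    induction b using Germ.inductionOn with | _ b => ?_
    exact ((ha.differentiableAt_path hγ h0).hasDerivAt.fun_add
      (hb.differentiableAt_path hγ h0).hasDerivAt).deriv
  trop_add := by
    rintro ⟨a, ha⟩ ⟨b, hb⟩ _
    induction a using Germ.inductionOn with | _ a => ?_
    induction b using Germ.inductionOn with | _ b => ?_
    obtain ⟨h₁, a₁, hd₁, e₁⟩ := ha.path hγ h0
    obtain ⟨h₂, a₂, hd₂, e₂⟩ := hb.path hγ h0
    have ht := tendsto_path hγ h0
    have hs : ∀ᶠ t in 𝓝 (0 : ℝ), (a + b) (γ t) = ⟨h₁ t, a₁⟩ + ⟨h₂ t, a₂⟩ := by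
      filter_upwards [e₁, e₂] with t t1 t2
      rw [Pi.add_apply, t1, t2]
    change pathTrop γ ht ((a + b : X → ExplodedC) : Germ (𝓝 p) ExplodedC) =
      pathTrop γ ht (a : Germ (𝓝 p) ExplodedC) + pathTrop γ ht (b : Germ (𝓝 p) ExplodedC)
    rw [pathTrop_coe ht h0 hd₁.hasDerivAt e₁, pathTrop_coe ht h0 hd₂.hasDerivAt e₂]
    rcases lt_trichotomy a₁ a₂ with h | h | h
    · rw [ExplodedC.add_of_lt (by exact h)]
      exact pathTrop_coe ht h0 hd₁.hasDerivAt
        (hs.mono fun t ht => ht.trans (ExplodedC.add_of_lt (by exact h)))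
    · rw [ExplodedC.add_of_eq (by exact h)]
      exact pathTrop_coe ht h0 (hd₁.hasDerivAt.fun_add hd₂.hasDerivAt)
        (hs.mono fun t ht => ht.trans (ExplodedC.add_of_eq (by exact h)))
    · rw [ExplodedC.add_of_gt (by exact h)]
      exact pathTrop_coe ht h0 hd₂.hasDerivAt
        (hs.mono fun t ht => ht.trans (ExplodedC.add_of_gt (by exact h)))
  smooth_mul := by
    rintro ⟨a, ha⟩ ⟨b, hb⟩ _
    induction a using Germ.inductionOn with | _ a => ?_
    induction b using Germ.inductionOn with | _ b => ?_
    have := ((ha.differentiableAt_path hγ h0).hasDerivAt.fun_mul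
      (hb.differentiableAt_path hγ h0).hasDerivAt).deriv
    rw [h0] at this
    exact this
  trop_mul := by
    rintro ⟨a, ha⟩ ⟨b, hb⟩ _
    induction a using Germ.inductionOn with | _ a => ?_
    induction b using Germ.inductionOn with | _ b => ?_
    obtain ⟨h₁, a₁, hd₁, e₁⟩ := ha.path hγ h0
    obtain ⟨h₂, a₂, hd₂, e₂⟩ := hb.path hγ h0
    have ht := tendsto_path hγ h0
    have hs : ∀ᶠ t in 𝓝 (0 : ℝ), (a * b) (γ t) = ⟨h₁ t * h₂ t, a₁ + a₂⟩ := by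
      filter_upwards [e₁, e₂] with t t1 t2
      rw [Pi.mul_apply, t1, t2]
      rfl
    change pathTrop γ ht ((a * b : X → ExplodedC) : Germ (𝓝 p) ExplodedC) =
      pathTrop γ ht (a : Germ (𝓝 p) ExplodedC) * b p +
        a p * pathTrop γ ht (b : Germ (𝓝 p) ExplodedC)
    rw [pathTrop_coe ht h0 hd₁.hasDerivAt e₁, pathTrop_coe ht h0 hd₂.hasDerivAt e₂,
      pathTrop_coe ht h0 (hd₁.hasDerivAt.fun_mul hd₂.hasDerivAt) hs]
    have e₁' := e₁.self_of_nhds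
    have e₂' := e₂.self_of_nhds
    rw [h0] at e₁' e₂'
    rw [e₁', e₂']
    exact (ExplodedC.add_of_eq (a := ⟨deriv h₁ 0, a₁⟩ * ⟨h₂ 0, a₂⟩)
      (b := ⟨h₁ 0, a₁⟩ * ⟨deriv h₂ 0, a₂⟩) rfl).symm
  trop_const_mul := by
    rintro c ⟨a, ha⟩ _
    induction a using Germ.inductionOn with | _ a => ?_
    obtain ⟨h₁, a₁, hd₁, e₁⟩ := ha.path hγ h0
    have ht := tendsto_path hγ h0
    have hs : ∀ᶠ t in 𝓝 (0 : ℝ), ((fun x => c * a x : X → ExplodedC)) (γ t) =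
        ⟨c.coeff * h₁ t, c.order + a₁⟩ := by
      filter_upwards [e₁] with t t1
      rw [t1]
      rfl
    change pathTrop γ ht ((fun x => c * a x : X → ExplodedC) : Germ (𝓝 p) ExplodedC) =
      c * pathTrop γ ht (a : Germ (𝓝 p) ExplodedC)
    rw [pathTrop_coe ht h0 hd₁.hasDerivAt e₁, pathTrop_coe ht h0 (hd₁.hasDerivAt.const_mul _) hs]
    rfl
  compat := by
    rintro ⟨a, ha⟩ _
    induction a using Germ.inductionOn with | _ a => ?_
    exact pathTrop_coe (tendsto_path hγ h0) h0
      (ha.differentiableAt_path hγ h0).hasDerivAt.ofReal_comp (Eventually.of_forall fun t => rfl)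

theorem sm_pathVec {γ : ℝ → X} (hγ : MorAt realLine X γ (0 : ℝ)) (h0 : γ 0 = p) {f : X → ℝ}
    (hf : IsSmoothGerm p (f : Germ (𝓝 p) ℝ)) :
    (pathVec γ hγ h0).sm f = deriv (fun t => f (γ t)) 0 :=
  TangentVector.sm_eq _ hf

theorem ld_pathVec {γ : ℝ → X} (hγ : MorAt realLine X γ (0 : ℝ)) (h0 : γ 0 = p) {F : X → CStarT}
    (hF : SecAt X F p) :
    (pathVec γ hγ h0).ld F = deriv (fun t => ((F (γ t)).1 : ℂ)) 0 / (F p).1 :=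
  TangentVector.ld_eq _ hF.isTropicalGerm

end Paths

/-! ### Derivatives of morphisms and velocities of paths in charts. -/

section Deriv

variable {X Y : AbstractExplodedSpace.{u}}

theorem sm_deriv (f : Hom X Y) {p : X} (v : TangentVector p) {g : Y → ℝ}
    (hg : IsSmoothGerm (f p) (g : Germ (𝓝 (f p)) ℝ)) :
    (f.deriv p v).sm g = v.sm (fun x => g (f x)) :=
  (TangentVector.sm_eq _ hg).trans (TangentVector.sm_eq v (hg.pull f)).symm

theorem ld_deriv (f : Hom X Y) {p : X} (v : TangentVector p) {F : Y → CStarT}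
    (hF : SecAt Y F (f p)) : (f.deriv p v).ld F = v.ld (fun x => F (f x)) :=
  (TangentVector.ld_eq _ hF.isTropicalGerm).trans
    (TangentVector.ld_eq v (hF.isTropicalGerm.pull f)).symm

variable {n m : ℕ} {P : Set (Fin m → ℝ)}

/-- The path through a point of a model with given logarithmic velocity. -/
def linePath (e : model n P) (a : Fin n → ℝ) (c : Fin m → ℂ) (t : ℝ) : model n P :=
  mkPt (fun j => xc e j + t * a j) (fun i => CStarT.mk (toUnit (Complex.exp (t * c i))) 0 * zc e i) (by
    have : tropv (fun i => CStarT.mk (toUnit (Complex.exp (t * c i))) 0 * zc e i) = tc e := by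
      funext l; simp [tropv, tc]
    rw [this]
    exact tc_mem e)

theorem xc_linePath (e : model n P) (a : Fin n → ℝ) (c : Fin m → ℂ) (t : ℝ) (j : Fin n) :
    xc (linePath e a c t) j = xc e j + t * a j := rfl

theorem zc_linePath (e : model n P) (a : Fin n → ℝ) (c : Fin m → ℂ) (t : ℝ) (i : Fin m) :
    zc (linePath e a c t) i = CStarT.mk (toUnit (Complex.exp (t * c i))) 0 * zc e i := rfl

theorem linePath_zero (e : model n P) (a : Fin n → ℝ) (c : Fin m → ℂ) : linePath e a c 0 = e := by
  refine model_ext (funext fun j => ?_) (funext fun i => ?_)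
  · rw [xc_linePath, zero_mul, add_zero]
  · rw [zc_linePath]
    exact CStarT.ext' (by simp [toUnit]) (by simp)

theorem contDiff_cexp_mul (c : ℂ) : ContDiff ℝ ∞ fun t : ℝ => Complex.exp (t * c) :=
  (ContDiff.mul Complex.ofRealCLM.contDiff contDiff_const).cexp

theorem hasDerivAt_cexp_mul (c : ℂ) (t : ℝ) :
    HasDerivAt (fun t : ℝ => Complex.exp (t * c)) (c * Complex.exp (t * c)) t := by
  have h := (((hasDerivAt_id t).ofReal_comp).mul_const c).cexp
  refine h.congr_deriv ?_
  simp [mul_comm]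

theorem morAt_linePath (e : model n P) (a : Fin n → ℝ) (c : Fin m → ℂ) (t : ℝ) :
    MorAt realLine (model n P) (linePath e a c) t := by
  refine (goodPt_realLine t).nice.morAt (fun j => ?_) fun i => ?_
  · exact (goodPt_realLine t).nice.rSm_comp (κ := Unit) (Y := fun s _ => s)
      (H := fun y => xc e j + y () * a j) (fun _ => rSm_realLine t)
      (ContDiff.smoothNear (by fun_prop) _)
  · refine secAt_realLine_iff.2 ⟨fun t => Complex.exp (t * c i) * (zc e i).1, (zc e i).trop,
      ((contDiff_cexp_mul (c i)).mul contDiff_const).smoothNear t,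
      mul_ne_zero (Complex.exp_ne_zero _) (Units.ne_zero _), Eventually.of_forall fun (s : ℝ) => ?_⟩
    refine (zc_linePath e a c s i).trans ?_
    rw [toUnit_mul (Complex.exp_ne_zero _) (Units.ne_zero _), toUnit_coe]
    exact CStarT.ext' (by simp) (by simp)

theorem deriv_xc_linePath (e : model n P) (a : Fin n → ℝ) (c : Fin m → ℂ) (j : Fin n) :
    deriv (fun t => xc (linePath e a c t) j) 0 = a j := by
  have : HasDerivAt (fun t : ℝ => xc e j + t * a j) (a j) 0 := by
    simpa using ((hasDerivAt_id (0 : ℝ)).mul_const (a j)).const_add (xc e j)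
  exact this.deriv

theorem deriv_zc_linePath (e : model n P) (a : Fin n → ℝ) (c : Fin m → ℂ) (i : Fin m) :
    deriv (fun t => ((zc (linePath e a c t) i).1 : ℂ)) 0 = c i * (zc e i).1 := by
  have h1 : (fun t => ((zc (linePath e a c t) i).1 : ℂ)) =
      fun t : ℝ => Complex.exp (t * c i) * (zc e i).1 := by
    funext t
    rw [zc_linePath, Prod.fst_mul, Units.val_mul, CStarT.mk_fst, coe_toUnit (Complex.exp_ne_zero _)]
  rw [h1]
  have := ((hasDerivAt_cexp_mul (c i) 0).mul_const ((zc e i).1 : ℂ)).deriv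
  simpa using this

section Chart

variable {φ : X → model n P} {ψ : model n P → X} {p : X} {e : model n P}

/-- The path given by `linePath` in a chart. -/
def chartPath (ψ : model n P → X) (e : model n P) (a : Fin n → ℝ) (c : Fin m → ℂ) (t : ℝ) : X :=
  ψ (linePath e a c t)

theorem LocIso.morAt_path (h : LocIso X (model n P) φ ψ p e) (a : Fin n → ℝ) (c : Fin m → ℂ) :
    MorAt realLine X (chartPath ψ e a c) (0 : ℝ) := by
  have h1 : MorAt (model n P) X ψ (linePath e a c 0) := by
    rw [linePath_zero]; exact h.morAt_symm.self_of_nhds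
  exact MorAt.comp (X := realLine) (f := linePath e a c) (g := ψ) h1 (morAt_linePath e a c 0)

theorem LocIso.path_zero (h : LocIso X (model n P) φ ψ p e) (a : Fin n → ℝ) (c : Fin m → ℂ) :
    chartPath ψ e a c 0 = p := by rw [chartPath, linePath_zero, h.map_symm]

theorem LocIso.eventually_path (h : LocIso X (model n P) φ ψ p e) (a : Fin n → ℝ) (c : Fin m → ℂ) :
    ∀ᶠ t in 𝓝 (0 : ℝ), φ (chartPath ψ e a c t) = linePath e a c t :=
  (tendsto_path (morAt_linePath e a c 0) (linePath_zero e a c)).eventually h.right_inv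

variable (hX : ∀ x : X, GoodPt X x)
include hX

theorem sm_xc_path (h : LocIso X (model n P) φ ψ p e) (a : Fin n → ℝ) (c : Fin m → ℂ) (j : Fin n) :
    (pathVec _ (h.morAt_path a c) (h.path_zero a c)).sm (fun x => xc (φ x) j) = a j := by
  rw [sm_pathVec _ _ ((isSmoothGerm_iff hX).2 (RSm.pull h.morAt.self_of_nhds (rSm_xc j _))),
    ← deriv_xc_linePath e a c j]
  exact Filter.EventuallyEq.deriv_eq ((h.eventually_path a c).mono fun t ht => by simp only [ht])

omit hX in
theorem ld_zc_path (h : LocIso X (model n P) φ ψ p e) (a : Fin n → ℝ) (c : Fin m → ℂ) (i : Fin m) :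
    (pathVec _ (h.morAt_path a c) (h.path_zero a c)).ld (fun x => zc (φ x) i) = c i := by
  rw [ld_pathVec _ _ (h.morAt.self_of_nhds.2 _ (secAt_zc i _)), h.map]
  have h1 : deriv (fun t => ((zc (φ (chartPath ψ e a c t)) i).1 : ℂ)) 0 = c i * (zc e i).1 := by
    rw [← deriv_zc_linePath e a c i]
    exact Filter.EventuallyEq.deriv_eq ((h.eventually_path a c).mono fun t ht => by simp only [ht])
  rw [h1, mul_div_cancel_right₀ _ (Units.ne_zero _)]

theorem exists_eq_pathVec (h : LocIso X (model n P) φ ψ p e) (he : tc e ∈ interior P)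
    (v : TangentVector p) : ∃ a c, v = pathVec _ (h.morAt_path a c) (h.path_zero a c) := by
  refine ⟨fun j => v.sm fun x => xc (φ x) j, fun i => v.ld fun x => zc (φ x) i,
    TangentVector.ext_of_chart hX h he (fun j => ?_) fun i => ?_⟩
  · rw [sm_xc_path hX h]
  · rw [ld_zc_path h]

-- By `exists_eq_pathVec` every tangent vector is the velocity of a path that is straight in
-- logarithmic coordinates, so surjectivity of `df` becomes a statement about derivatives of real
-- functions, usable with ordinary calculus.
omit hX in
theorem exists_path_of_surjective (hX : ∀ x : X, GoodPt X x) (hY : ∀ y : Y, GoodPt Y y) (f : Hom X Y)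
    {p : X} (hf : Function.Surjective (f.deriv p)) {n' m' : ℕ} {P' : Set (Fin m' → ℝ)}
    {φ' : X → model n' P'} {ψ' : model n' P' → X} {e' : model n' P'}
    (h' : LocIso X (model n' P') φ' ψ' p e') (he' : tc e' ∈ interior P')
    {φ : Y → model n P} {ψ : model n P → Y} {e : model n P}
    (h : LocIso Y (model n P) φ ψ (f p) e) (a : Fin n → ℝ) (c : Fin m → ℂ) :
    ∃ (a' : Fin n' → ℝ) (c' : Fin m' → ℂ),
      (∀ j, deriv (fun t => xc (φ (f (chartPath ψ' e' a' c' t))) j) 0 = a j) ∧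
      ∀ i, deriv (fun t => ((zc (φ (f (chartPath ψ' e' a' c' t))) i).1 : ℂ)) 0 =
        c i * (zc e i).1 := by
  obtain ⟨v, hv⟩ := hf (pathVec _ (h.morAt_path a c) (h.path_zero a c))
  obtain ⟨a', c', h1⟩ := exists_eq_pathVec hX h' he' v
  refine ⟨a', c', fun j => ?_, fun i => ?_⟩
  · have h2 := sm_xc_path hY h a c j
    have hs : IsSmoothGerm (f p) ((fun y => xc (φ y) j : Y → ℝ) : Germ (𝓝 (f p)) ℝ) :=
      (isSmoothGerm_iff hY).2 (RSm.pull h.morAt.self_of_nhds (rSm_xc j _))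
    have hs' : IsSmoothGerm p ((fun x => xc (φ (f x)) j : X → ℝ) : Germ (𝓝 p) ℝ) := hs.pull f
    rw [← hv, sm_deriv f v hs, h1, sm_pathVec _ _ hs'] at h2
    exact h2
  · have h2 := ld_zc_path h a c i
    have hs : SecAt Y (fun y => zc (φ y) i) (f p) := h.morAt.self_of_nhds.2 _ (secAt_zc i _)
    rw [← hv, ld_deriv f v hs, h1, ld_pathVec _ _ ((f.morAt p).2 _ hs), h.map,
      div_eq_iff (Units.ne_zero _)] at h2
    exact h2

-- A tangent vector of the target is determined by its values on the coordinates of a chart, so it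
-- is enough to realise these values by the image of a path.
omit hX in
theorem surjective_of_exists_path (hY : ∀ y : Y, GoodPt Y y) (f : Hom X Y) {p : X}
    {φ : Y → model n P} {ψ : model n P → Y} {e : model n P}
    (h : LocIso Y (model n P) φ ψ (f p) e) (he : tc e ∈ interior P)
    (hp : ∀ (a : Fin n → ℝ) (c : Fin m → ℂ), ∃ γ : ℝ → X, MorAt realLine X γ (0 : ℝ) ∧ γ 0 = p ∧
      (∀ j, deriv (fun t => xc (φ (f (γ t))) j) 0 = a j) ∧
      ∀ i, deriv (fun t => ((zc (φ (f (γ t))) i).1 : ℂ)) 0 = c i * (zc e i).1) :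
    Function.Surjective (f.deriv p) := by
  intro w
  obtain ⟨γ, hγ, h0, h1, h2⟩ := hp (fun j => w.sm fun x => xc (φ x) j)
    fun i => w.ld fun x => zc (φ x) i
  refine ⟨pathVec γ hγ h0, TangentVector.ext_of_chart hY h he (fun j => ?_) fun i => ?_⟩
  · have hs : IsSmoothGerm (f p) ((fun y => xc (φ y) j : Y → ℝ) : Germ (𝓝 (f p)) ℝ) :=
      (isSmoothGerm_iff hY).2 (RSm.pull h.morAt.self_of_nhds (rSm_xc j _))
    have hs' : IsSmoothGerm p ((fun x => xc (φ (f x)) j : X → ℝ) : Germ (𝓝 p) ℝ) := hs.pull f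
    rw [sm_deriv f _ hs, sm_pathVec _ _ hs']
    exact h1 j
  · have hs : SecAt Y (fun y => zc (φ y) i) (f p) := h.morAt.self_of_nhds.2 _ (secAt_zc i _)
    rw [ld_deriv f _ hs, ld_pathVec _ _ ((f.morAt p).2 _ hs), h.map, div_eq_iff (Units.ne_zero _)]
    exact h2 i

end Chart

end Deriv

/-! ### Characters, adapted bases, and injective submersions -/

/-- A proper sublattice is annihilated by a nontrivial point of the torus. -/
theorem exists_torus_point {m : ℕ} {Λ : Submodule ℤ (Fin m → ℤ)} (hΛ : Λ ≠ ⊤) :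
    ∃ θ : Fin m → ℂˣ, θ ≠ 1 ∧ ∀ α ∈ Λ, ∏ i, θ i ^ α i = 1 := by
  classical
  obtain ⟨x, hx⟩ : ∃ x, x ∉ Λ := by
    by_contra h
    push Not at h
    exact hΛ (eq_top_iff.2 fun x _ => h x)
  have hx0 : (Submodule.Quotient.mk x : (Fin m → ℤ) ⧸ Λ) ≠ 0 := by
    rwa [Ne, Submodule.Quotient.mk_eq_zero]
  obtain ⟨c, hc⟩ := CharacterModule.exists_character_apply_ne_zero_of_ne_zero hx0
  -- The character found on the quotient takes values in `ℚ/ℤ`, which `t ↦ exp (2πit)` embeds in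
  -- `ℂ^*`.
  let E₀ : ℚ →+ Additive ℂˣ :=
    { toFun := fun t => Additive.ofMul (toUnit (Complex.exp (2 * Real.pi * Complex.I * t)))
      map_zero' := by
        refine congrArg Additive.ofMul (Units.ext ?_)
        rw [coe_toUnit (Complex.exp_ne_zero _)]; simp
      map_add' := fun s t => by
        refine congrArg Additive.ofMul (Units.ext ?_)
        change (toUnit _ : ℂ) = (toUnit _ : ℂ) * (toUnit _ : ℂ)
        rw [coe_toUnit (Complex.exp_ne_zero _), coe_toUnit (Complex.exp_ne_zero _),
          coe_toUnit (Complex.exp_ne_zero _), ← Complex.exp_add]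
        push_cast
        ring_nf }
  have hE₀ : ∀ t, E₀ t = 0 ↔ t ∈ AddSubgroup.zmultiples (1 : ℚ) := by
    intro t
    have h1 : E₀ t = 0 ↔ Complex.exp (2 * Real.pi * Complex.I * t) = 1 := by
      rw [← coe_toUnit (Complex.exp_ne_zero (2 * Real.pi * Complex.I * t))]
      exact ⟨fun h => congrArg Units.val (congrArg Additive.toMul h), fun h =>
        congrArg Additive.ofMul (Units.ext h)⟩
    rw [h1, Complex.exp_eq_one_iff, AddSubgroup.mem_zmultiples_iff]
    refine exists_congr fun k => ?_
    rw [mul_comm, zsmul_eq_mul, mul_one]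
    constructor
    · intro h
      have := mul_right_cancel₀ Complex.two_pi_I_ne_zero h
      exact_mod_cast this.symm
    · intro h
      rw [← h]
      push_cast
      ring
  let E₁ : AddCircle (1 : ℚ) →+ Additive ℂˣ :=
    QuotientAddGroup.lift (AddSubgroup.zmultiples (1 : ℚ)) E₀ fun t ht => (hE₀ t).2 ht
  have hE₁ : ∀ y, E₁ y = 0 → y = 0 := by
    intro y hy
    obtain ⟨t, rfl⟩ := QuotientAddGroup.mk_surjective y
    exact (QuotientAddGroup.eq_zero_iff t).2 ((hE₀ t).1 hy)
  let χ : (Fin m → ℤ) →+ Additive ℂˣ := (E₁.comp c).comp Λ.mkQ.toAddMonoidHom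
  let θ : Fin m → ℂˣ := fun i => Additive.toMul (χ (Pi.single i 1))
  have hθ : ∀ α : Fin m → ℤ, ∏ i, θ i ^ α i = Additive.toMul (χ α) := by
    intro α
    have h1 : α = ∑ i, α i • (Pi.single i 1 : Fin m → ℤ) := by
      conv_lhs => rw [pi_eq_sum_univ α]
      refine Finset.sum_congr rfl fun i _ => ?_
      congr 1
      funext j
      simp [Pi.single_apply, eq_comm]
    conv_rhs => rw [h1, map_sum]
    rw [toMul_sum]
    refine Finset.prod_congr rfl fun i _ => ?_
    rw [map_zsmul, toMul_zsmul]
  refine ⟨θ, fun h => hc (hE₁ _ ?_), fun α hα => ?_⟩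
  · have h2 := hθ x
    simp only [h, Pi.one_apply, one_zpow, Finset.prod_const_one] at h2
    exact congrArg Additive.ofMul h2.symm
  · rw [hθ]
    have : Λ.mkQ α = 0 := by simpa using hα
    change Additive.toMul (E₁ (c (Λ.mkQ α))) = 1
    rw [this, map_zero, map_zero]
    rfl

/-- A basis adapted to a surjection of lattices. -/
theorem exists_adapted_basis {m m' : ℕ} (α : (Fin m → ℤ) →ₗ[ℤ] (Fin m' → ℤ))
    (hα : Function.Surjective α) :
    ∃ (d : ℕ) (e : Fin m' ⊕ Fin d ≃ Fin m) (b : Module.Basis (Fin m) ℤ (Fin m → ℤ)),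
      (∀ k, α (b (e (Sum.inl k))) = Pi.single k 1) ∧ ∀ j, α (b (e (Sum.inr j))) = 0 := by
  classical
  -- A surjection onto a free module splits. The section applied to the standard basis, together
  -- with a basis of the kernel, gives the adapted basis.
  obtain ⟨s, hs⟩ := Module.projective_lifting_property α LinearMap.id hα
  have hs' : ∀ y, α (s y) = y := fun y => LinearMap.congr_fun hs y
  let bk := Module.finBasis ℤ (LinearMap.ker α)
  let E : ((Fin m' → ℤ) × LinearMap.ker α) ≃ₗ[ℤ] (Fin m → ℤ) :=
    { toFun := fun y => s y.1 + y.2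
      map_add' := fun y y' => by
        change s (y.1 + y'.1) + ((y.2 + y'.2 : LinearMap.ker α) : Fin m → ℤ) = _
        rw [map_add, Submodule.coe_add]
        abel
      map_smul' := fun c y => by
        change s (c • y.1) + ((c • y.2 : LinearMap.ker α) : Fin m → ℤ) = c • (s y.1 + y.2)
        rw [map_smul, smul_add]
        rfl
      invFun := fun x => (α x, ⟨x - s (α x), by simp [hs']⟩)
      left_inv := fun y => by
        have h1 : α (s y.1 + y.2) = y.1 := by
          rw [map_add, hs', LinearMap.mem_ker.1 y.2.2, add_zero]
        refine Prod.ext h1 (Subtype.ext ?_)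
        simp only [h1, add_sub_cancel_left]
      right_inv := fun x => by simp }
  let b₀ := ((Pi.basisFun ℤ (Fin m')).prod bk).map E
  have hcard : Fintype.card (Fin m' ⊕ Fin (Module.finrank ℤ (LinearMap.ker α))) =
      Fintype.card (Fin m) := by
    rw [← Module.finrank_eq_card_basis b₀, Module.finrank_fintype_fun_eq_card]
  let e := Fintype.equivOfCardEq hcard
  refine ⟨_, e, b₀.reindex e, fun k => ?_, fun j => ?_⟩
  · rw [Module.Basis.reindex_apply, Equiv.symm_apply_apply]
    have : b₀ (Sum.inl k) = s (Pi.single k 1) := by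
      simp [b₀, E]
    rw [this, hs']
  · rw [Module.Basis.reindex_apply, Equiv.symm_apply_apply]
    have : b₀ (Sum.inr j) = bk j := by
      simp [b₀, E]
    rw [this]
    exact (bk j).2

/-- An injective map with surjective derivative has injective derivative. -/
theorem injective_fderiv_of_injOn {E F : Type*} [NormedAddCommGroup E] [NormedSpace ℝ E]
    [FiniteDimensional ℝ E] [NormedAddCommGroup F] [NormedSpace ℝ F] [FiniteDimensional ℝ F]
    {g : E → F} {x₀ : E} (hg : ContDiffAt ℝ ∞ g x₀)
    (hsurj : Function.Surjective (fderiv ℝ g x₀)) {U : Set E} (hU : U ∈ 𝓝 x₀) (hinj : Set.InjOn g U) :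
    Function.Injective (fderiv ℝ g x₀) := by
  have : CompleteSpace E := FiniteDimensional.complete ℝ E
  have : CompleteSpace F := FiniteDimensional.complete ℝ F
  have hs : HasStrictFDerivAt g (fderiv ℝ g x₀) x₀ := hg.hasStrictFDerivAt (by simp)
  have hr : (fderiv ℝ g x₀).range = ⊤ := LinearMap.range_eq_top.2 hsurj
  -- By the implicit function theorem the fiber of `g` through `x₀` is locally parametrised by the
  -- kernel of the derivative. A nonzero kernel vector would give further points of the fiber
  -- arbitrarily close to `x₀`.
  let T := hs.implicitToOpenPartialHomeomorph g _ hr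
  have hx₀ : x₀ ∈ T.source := hs.mem_implicitToOpenPartialHomeomorph_source hr
  have hT0 : T x₀ = (g x₀, 0) := hs.implicitToOpenPartialHomeomorph_self hr
  have hT1 : ∀ x, (T x).1 = g x := fun x => hs.implicitToOpenPartialHomeomorph_fst hr x
  refine (injective_iff_map_eq_zero _).2 fun v hv => ?_
  let w : LinearMap.ker (fderiv ℝ g x₀ : E →ₗ[ℝ] F) := ⟨v, hv⟩
  have htgt : (g x₀, (0 : LinearMap.ker (fderiv ℝ g x₀ : E →ₗ[ℝ] F))) ∈ T.target := by
    rw [← hT0]; exact T.map_source hx₀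
  have hc : Tendsto (fun t : ℝ => (g x₀, t • w)) (𝓝 0) (𝓝 (g x₀, 0)) := by
    have : Continuous fun t : ℝ => (g x₀, t • w) := by fun_prop
    exact this.tendsto' _ _ (by simp)
  have hsymm : T.symm (g x₀, 0) = x₀ := by rw [← hT0, T.left_inv hx₀]
  have hc2 : ∀ᶠ t : ℝ in 𝓝 0, T.symm (g x₀, t • w) ∈ U := by
    have h1 := (T.continuousAt_symm htgt).tendsto.comp hc
    rw [hsymm] at h1
    exact h1.eventually hU
  have hc3 : ∀ᶠ t : ℝ in 𝓝 0, (g x₀, t • w) ∈ T.target :=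
    hc.eventually (T.open_target.mem_nhds htgt)
  obtain ⟨t, ⟨ht1, ht2⟩, ht0⟩ := (((hc2.and hc3).filter_mono nhdsWithin_le_nhds).and
    (self_mem_nhdsWithin : {0}ᶜ ∈ 𝓝[≠] (0 : ℝ))).exists
  have h2 : g (T.symm (g x₀, t • w)) = g x₀ := by rw [← hT1, T.right_inv ht2]
  have h3 := hinj ht1 (mem_of_mem_nhds hU) h2
  have h4 := T.right_inv ht2
  rw [h3, hT0] at h4
  have h5 : t • w = 0 := (congrArg Prod.snd h4).symm
  have h6 := (smul_eq_zero.1 h5).resolve_left ht0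
  exact congrArg Subtype.val h6

/-! ### Points with the same exponent as an interior point. -/

section Interior

variable {n m : ℕ} {P : Set (Fin m → ℝ)}

/-- At an interior exponent a nonnegative monomial is either constant or positive. Hence among
points with this exponent only the real coordinates are visible to smooth functions and to the
topology. -/
theorem smon_eq_of_tc_eq {p e : model n P} (hp : tc p ∈ interior P) (he : tc e = tc p)
    (q : NonnegMonomial P) : smon q e = smon q p := by
  by_cases h0 : q.1.eval (tc p) = 0
  · exact smon_eq_of_eval_eq_zero hp h0 e
  · have hpos : 0 < q.1.eval (tc p) := lt_of_le_of_ne (q.2 _ (tc_mem p)) (Ne.symm h0)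
    rw [smon, smon, CStarT.smoothPart_of_pos, CStarT.smoothPart_of_pos]
    · rwa [trop_monomial_zc]
    · rwa [trop_monomial_zc, he]

theorem eventually_xc_mem {p : model n P} (hp : tc p ∈ interior P) {W : Set (model n P)}
    (hW : W ∈ 𝓝 p) : ∀ᶠ x in 𝓝 (xc p), ∀ e : model n P, xc e = x → tc e = tc p → e ∈ W := by
  obtain ⟨s, ε, hε, h⟩ := exists_coords_nhds hW
  have h1 : ∀ᶠ x in 𝓝 (xc p), ∀ i, |x i - xc p i| < ε := by
    refine eventually_all.2 fun i => ?_
    have : ContinuousAt (fun x : Fin n → ℝ => |x i - xc p i|) (xc p) :=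
      ((continuous_apply i).sub continuous_const).abs.continuousAt
    exact this.eventually (gt_mem_nhds (by simpa using hε))
  filter_upwards [h1] with x hx e hex het
  refine h e (fun i => by rw [hex]; exact hx i) fun q _ => ?_
  rw [smon_eq_of_tc_eq hp het, sub_self, norm_zero]
  exact hε

theorem mem_of_tc_eq {p e : model n P} (hp : tc p ∈ interior P) {W : Set (model n P)}
    (hW : W ∈ 𝓝 p) (hx : xc e = xc p) (ht : tc e = tc p) : e ∈ W :=
  (eventually_xc_mem hp hW).self_of_nhds e hx ht

/-- Smooth functions near a point with exponent in the interior are functions of smooth monomials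
vanishing at this point. -/
theorem SmM.exists_pos {V : Type*} [NormedAddCommGroup V] [NormedSpace ℝ V] {f : model n P → V}
    {p : model n P} (hf : SmM f p) (hp : tc p ∈ interior P) :
    ∃ (s : Finset (NonnegMonomial P)) (h : (Fin n → ℝ) × (s → ℂ) → V),
      (∀ q ∈ s, 0 < q.1.eval (tc p)) ∧ SmoothNear h (coords s p) ∧
      f =ᶠ[𝓝 p] fun e => h (coords s e) := by
  classical
  obtain ⟨s, h, hh, hfh⟩ := hf
  let s' := s.filter fun q => 0 < q.1.eval (tc p)
  let R : (Fin n → ℝ) × (s' → ℂ) → (Fin n → ℝ) × (s → ℂ) := fun y =>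
    (y.1, fun i => if hi : i.1 ∈ s' then y.2 ⟨i.1, hi⟩ else smon i.1 p)
  have hR : ContDiff ℝ ∞ R := by
    refine contDiff_fst.prodMk (contDiff_pi.2 fun i => ?_)
    by_cases hi : i.1 ∈ s'
    · simp only [hi, dif_pos]; fun_prop
    · simp only [hi, dif_neg, not_false_eq_true]; fun_prop
  have hRc : ∀ e : model n P, R (coords s' e) = coords s e := by
    intro e
    refine Prod.ext rfl (funext fun i => ?_)
    by_cases hi : i.1 ∈ s'
    · simp only [R, coords, hi, dif_pos]
    · have h0 : i.1.1.eval (tc p) = 0 := by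
        have h1 : ¬ 0 < i.1.1.eval (tc p) := fun h1 => hi (Finset.mem_filter.2 ⟨i.2, h1⟩)
        exact le_antisymm (not_lt.1 h1) (i.1.2 _ (tc_mem p))
      simp only [R, coords, hi, dif_neg, not_false_eq_true]
      exact (smon_eq_of_eval_eq_zero hp h0 e).symm
  refine ⟨s', fun y => h (R y), fun q hq => (Finset.mem_filter.1 hq).2, ?_, ?_⟩
  · refine SmoothNear.comp (g := h) ?_ (hR.smoothNear _)
    rwa [hRc]
  · simpa only [hRc] using hfh

end Interior

/-! ### The local structure of injective submersions -/

theorem prod_mk_toUnit_zpow {ι : Type*} (t : Finset ι) {u : ι → ℂ} (hu : ∀ i ∈ t, u i ≠ 0)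
    (k : ι → ℤ) :
    ∏ i ∈ t, CStarT.mk (toUnit (u i)) 0 ^ k i = CStarT.mk (toUnit (∏ i ∈ t, u i ^ k i)) 0 := by
  have h0 : ∏ i ∈ t, u i ^ k i ≠ 0 := Finset.prod_ne_zero_iff.2 fun i hi => zpow_ne_zero _ (hu i hi)
  refine CStarT.ext' (Units.ext ?_) ?_
  · rw [CStarT.mk_fst, coe_toUnit h0, Prod.fst_prod, Units.coe_prod]
    refine Finset.prod_congr rfl fun i hi => ?_
    change ((toUnit (u i) ^ k i : ℂˣ) : ℂ) = _
    rw [Units.val_zpow_eq_zpow_val, coe_toUnit (hu i hi)]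
  · rw [CStarT.trop_prod, CStarT.trop_mk]
    refine Finset.sum_eq_zero fun i _ => ?_
    simp

section ModelMap

variable {n' m' n m d : ℕ} {P' : Set (Fin m' → ℝ)} {P : Set (Fin m → ℝ)}

theorem SmM.eq_of_tc_eq {V : Type*} [NormedAddCommGroup V] [NormedSpace ℝ V] {f : model n P → V}
    {p e : model n P} (hf : SmM f p) (hp : tc p ∈ interior P) (hx : xc e = xc p)
    (ht : tc e = tc p) : f e = f p := by
  obtain ⟨s, h, -, hfh⟩ := hf
  have h1 : e ∈ {e | f e = h (coords s e)} := mem_of_tc_eq hp hfh hx ht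
  have h2 : coords s e = coords s p :=
    Prod.ext hx (funext fun i => smon_eq_of_tc_eq hp ht i.1)
  exact h1.trans (h2 ▸ hfh.self_of_nhds.symm)

/-- Coordinates on the target adapted to an injective map. -/
theorem exists_adapted_coordinates {p' : model n' P'} (hp' : tc p' ∈ interior P')
    {F : model n' P' → model n P} (hF : MorAt (model n' P') (model n P) F p')
    {W : Set (model n' P')} (hW : W ∈ 𝓝 p') (hinj : Set.InjOn F W) :
    ∃ (d : ℕ) (e : Fin m' ⊕ Fin d ≃ Fin m) (M N : Fin m → IntAffine m)
      (H : Fin m' → model n' P' → ℂ) (K : Fin d → model n' P' → ℂ), UniPair M N ∧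
      (∀ l, SmM (H l) p' ∧ H l p' ≠ 0) ∧ (∀ j, SmM (K j) p' ∧ K j p' ≠ 0) ∧
      ∀ᶠ x in 𝓝 p', (∀ l, monomial (M (e (Sum.inl l))) (zc (F x)) =
          CStarT.mk (toUnit (H l x)) 0 * zc x l) ∧
        ∀ j, monomial (M (e (Sum.inr j))) (zc (F x)) = CStarT.mk (toUnit (K j x)) 0 := by
  classical
  have hr := relInt_of_mem_interior hp'
  have hz : ∀ j, ∃ (H : model n' P' → ℂ) (q : IntAffine m'), SmM H p' ∧ H p' ≠ 0 ∧
      ∀ᶠ e in 𝓝 p', zc (F e) j = CStarT.mk (toUnit (H e)) 0 * monomial q (zc e) := fun j =>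
    secAt_model_iff.1 (hF.2 _ (secAt_zc j _))
  choose H q hH hH0 hHq using hz
  -- The map `α` is the pullback of monomials by `F`, up to units and constants.
  let α : (Fin m → ℤ) →ₗ[ℤ] (Fin m' → ℤ) := Fintype.linearCombination ℤ fun j => (q j).2
  have hα : ∀ v, α v = ∑ j, v j • (q j).2 := fun v => Fintype.linearCombination_apply ..
  have hsurj : Function.Surjective α := by
    rw [← LinearMap.range_eq_top]
    by_contra hne
    -- Multiplication by `θ` keeps the exponent and the real coordinates of `p'`, hence also the
    -- values there of the smooth functions in `F`, and it fixes every monomial in the image of `α`.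
    -- So it moves `p'` to a nearby point with the same image, against injectivity.
    obtain ⟨θ, hθ, hθΛ⟩ := exists_torus_point hne
    have htrop : tropv (fun i => zc p' i * CStarT.mk (θ i) 0) = tc p' := by
      funext i; simp [tropv, tc]
    obtain ⟨e, hex, hez⟩ := exists_pt_model (P := P') (xc p')
      (fun i => zc p' i * CStarT.mk (θ i) 0) (htrop ▸ tc_mem p')
    have het : tc e = tc p' := by rw [tc, hez, htrop]
    have hmem : ∀ {W : Set (model n' P')}, W ∈ 𝓝 p' → e ∈ W := fun hW => mem_of_tc_eq hp' hW hex het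
    have heq : F e = F p' := by
      refine model_ext ?_ (funext fun j => ?_)
      · funext i
        have h1 : SmM (fun x => xc (F x) i) p' := (RSm.pull hF (rSm_xc i _)).smM hr
        exact h1.eq_of_tc_eq hp' hex het
      · have h1 : zc (F e) j = _ := hmem (hHq j)
        rw [h1, (hHq j).self_of_nhds, (hH j).eq_of_tc_eq hp' hex het, hez, monomial_mul]
        congr 1
        have h2 := hθΛ (q j).2 ⟨Pi.single j 1, by rw [hα]; simp [Pi.single_apply]⟩
        have h3 : ∏ i, CStarT.mk (θ i) 0 ^ (q j).2 i = 1 := by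
          refine CStarT.ext' ?_ ?_
          · rw [Prod.fst_prod]
            simpa using h2
          · rw [CStarT.trop_prod]
            refine Finset.sum_eq_zero fun i _ => by simp
        rw [h3, mul_one]
    have := hinj (hmem hW) (mem_of_mem_nhds hW) heq
    refine hθ (funext fun i => ?_)
    have h4 := congrFun hez i
    rw [this] at h4
    have h5 := congrArg Prod.fst (left_eq_mul.1 h4)
    exact h5
  obtain ⟨d, e, b, hb1, hb2⟩ := exists_adapted_basis α hsurj
  -- The constants are chosen so that the pulled back monomials carry no factor `𝔱^a`.
  obtain ⟨N, hMN⟩ := exists_uniPair b fun k => -∑ j, (q j).1 * (b k j : ℝ)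
  let M : Fin m → IntAffine m := fun k => (-∑ j, (q j).1 * (b k j : ℝ), b k)
  have hM : ∀ k, (M k).comp q = (0, α (b k)) := by
    intro k
    rw [hα]
    refine Prod.ext ?_ ?_
    · simp [M, IntAffine.comp, Prod.fst_sum, mul_comm]
    · simp [M, IntAffine.comp, Prod.snd_sum]
  let L : Fin m → model n' P' → ℂ := fun k x => ∏ j, H j x ^ b k j
  have hL : ∀ k, SmM (L k) p' ∧ L k p' ≠ 0 := fun k =>
    ⟨SmM.prod _ fun j _ => (hH j).zpow (hH0 j) _,
      Finset.prod_ne_zero_iff.2 fun j _ => zpow_ne_zero _ (hH0 j)⟩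
  have hev : ∀ᶠ x in 𝓝 p', ∀ k, monomial (M k) (zc (F x)) =
      CStarT.mk (toUnit (L k x)) 0 * monomial (0, α (b k)) (zc x) := by
    filter_upwards [eventually_all.2 hHq,
      eventually_all.2 fun j => (hH j).continuousAt.eventually_ne (hH0 j)] with x hx hx0 k
    have h1 : zc (F x) = fun j => monMap q (zc x) j * CStarT.mk (toUnit (H j x)) 0 := by
      funext j; rw [hx j, mul_comm]; rfl
    rw [h1, monomial_mul, ← monomial_comp, hM, mul_comm, prod_mk_toUnit_zpow _ fun j _ => hx0 j]
  refine ⟨d, e, M, N, fun l => L (e (Sum.inl l)), fun j => L (e (Sum.inr j)), hMN,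
    fun l => hL _, fun j => hL _, hev.mono fun x hx => ⟨fun l => ?_, fun j => ?_⟩⟩
  · rw [hx, hb1]
    congr 1
    exact monomial_coord l _
  · rw [hx, hb2]
    rw [monomial_const (0 : ℝ)]
    exact mul_one _

/-- In adapted coordinates, an injective submersion is locally the inclusion of a subpolytope. -/
theorem exists_locIso_of_adapted {p' : model n' P'} (hp' : tc p' ∈ interior P')
    {F : model n' P' → model n P} (hF : MorAt (model n' P') (model n P) F p')
    {W : Set (model n' P')} (hW : W ∈ 𝓝 p') (hinj : Set.InjOn F W)
    (hd : ∀ (a : Fin n → ℝ) (c : Fin m → ℂ), ∃ (a' : Fin n' → ℝ) (c' : Fin m' → ℂ),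
      (∀ j, deriv (fun t => xc (F (linePath p' a' c' t)) j) 0 = a j) ∧
      ∀ i, deriv (fun t => ((zc (F (linePath p' a' c' t)) i).1 : ℂ)) 0 = c i * (zc (F p') i).1)
    {e : Fin m' ⊕ Fin d ≃ Fin m} {H : Fin m' → model n' P' → ℂ} {K : Fin d → model n' P' → ℂ}
    (hH : ∀ l, SmM (H l) p') (hH0 : ∀ l, H l p' ≠ 0) (hK : ∀ j, SmM (K j) p')
    (hK0 : ∀ j, K j p' ≠ 0)
    (hz : ∀ᶠ x in 𝓝 p', (∀ l, zc (F x) (e (Sum.inl l)) = CStarT.mk (toUnit (H l x)) 0 * zc x l) ∧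
        ∀ j, zc (F x) (e (Sum.inr j)) = CStarT.mk (toUnit (K j x)) 0)
    {P₂ : Set (Fin m → ℝ)}
    (hP₂ : ∀ y, y ∈ P₂ ↔ (fun i => y (e (Sum.inl i))) ∈ P' ∧ ∀ j, y (e (Sum.inr j)) = 0) :
    ∃ (Φ : model n' P' → model n P₂) (Θ : model n P₂ → model n' P'),
      LocIso (model n' P') (model n P₂) Φ Θ p' (Φ p') ∧
      ∀ᶠ x in 𝓝 p', xc (F x) = xc (Φ x) ∧ zc (F x) = zc (Φ x) := by
  classical
  have hr := relInt_of_mem_interior hp'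
  -- the map in coordinates
  have hX : SmM (fun x => xc (F x)) p' := SmM.pi fun i => (RSm.pull hF (rSm_xc i _)).smM hr
  have hHK : SmM (fun x => (xc (F x), fun l => H l x, fun j => K j x)) p' :=
    hX.prodMk ((SmM.pi hH).prodMk (SmM.pi hK))
  obtain ⟨s, G, hs, hG, hFG⟩ := hHK.exists_pos hp'
  have hs0 : ∀ x : model n' P', tc x = tc p' → coords s x = (xc x, 0) := fun x hx =>
    Prod.ext rfl (funext fun i => by
      change smon i.1 x = 0
      rw [smon, CStarT.smoothPart_of_pos]
      · rw [trop_monomial_zc, hx]; exact hs _ i.2)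
  have hG0 := hFG.self_of_nhds
  simp only at hG0
  have hy₀ := hs0 p' rfl
  have hGd : HasFDerivAt G (fderiv ℝ G (coords s p')) (coords s p') :=
    (hG.contDiffAt.differentiableAt (by simp)).hasFDerivAt
  have hGX : SmoothNear (fun y => (G y).1) (coords s p') :=
    SmoothNear.comp (g := Prod.fst) (contDiff_fst.smoothNear _) hG
  have hGH : SmoothNear (fun y => (G y).2.1) (coords s p') :=
    SmoothNear.comp (g := fun y : (Fin n → ℝ) × (Fin m' → ℂ) × (Fin d → ℂ) => y.2.1)
      ((contDiff_fst.comp contDiff_snd).smoothNear _) hG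
  have hGK : SmoothNear (fun y => (G y).2.2) (coords s p') :=
    SmoothNear.comp (g := fun y : (Fin n → ℝ) × (Fin m' → ℂ) × (Fin d → ℂ) => y.2.2)
      ((contDiff_snd.comp contDiff_snd).smoothNear _) hG
  -- The restriction to the stratum where the smooth monomials of `s` vanish: it records the real
  -- coordinates of the image and those exploded coordinates whose exponent is zero.
  let g : (Fin n' → ℝ) → (Fin n → ℝ) × (Fin d → ℂ) := fun x => ((G (x, 0)).1, (G (x, 0)).2.2)
  let g' : (Fin n' → ℝ) →L[ℝ] (Fin n → ℝ) × (Fin d → ℂ) :=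
    ((fderiv ℝ (fun y => (G y).1) (coords s p')).prod
      (fderiv ℝ (fun y => (G y).2.2) (coords s p'))).comp
      (ContinuousLinearMap.inl ℝ (Fin n' → ℝ) (s → ℂ))
  have hι : ContDiff ℝ ∞ fun x : Fin n' → ℝ => (x, (0 : s → ℂ)) := by fun_prop
  have hgs : SmoothNear g (xc p') := by
    refine SmoothNear.comp (g := fun y => ((G y).1, (G y).2.2)) ?_ (hι.smoothNear _)
    rw [← hy₀]
    exact hGX.prodMk hGK
  have hgd : HasFDerivAt g g' (xc p') := by
    have h1 : HasFDerivAt (fun x : Fin n' → ℝ => (x, (0 : s → ℂ)))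
        (ContinuousLinearMap.inl ℝ (Fin n' → ℝ) (s → ℂ)) (xc p') :=
      hasFDerivAt_prodMk_left (xc p') (0 : s → ℂ)
    have h2 : HasFDerivAt (fun y => ((G y).1, (G y).2.2))
        ((fderiv ℝ (fun y => (G y).1) (coords s p')).prod
          (fderiv ℝ (fun y => (G y).2.2) (coords s p'))) ((xc p', (0 : s → ℂ))) := by
      rw [← hy₀]
      exact (hGX.contDiffAt.differentiableAt (by simp)).hasFDerivAt.prodMk
        (hGK.contDiffAt.differentiableAt (by simp)).hasFDerivAt
    exact h2.comp (xc p') h1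
  -- injectivity
  have hginj : ∃ U ∈ 𝓝 (xc p'), Set.InjOn g U := by
    have hev := eventually_xc_mem hp' (inter_mem hW (inter_mem hz hFG))
    have hne : ∀ᶠ x in 𝓝 (xc p'), ∀ l, (G (x, 0)).2.1 l ≠ 0 := by
      refine eventually_all.2 fun l => ?_
      have : SmoothNear (fun x => (G (x, 0)).2.1) (xc p') := by
        refine SmoothNear.comp (g := fun y => (G y).2.1) ?_ (hι.smoothNear _)
        rw [← hy₀]; exact hGH
      refine ((continuousAt_pi.1 this.continuousAt l)).eventually_ne ?_
      rw [← hy₀, ← hG0]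
      exact hH0 l
    refine ⟨_, hev.and hne, ?_⟩
    rintro x₁ ⟨h1, h1'⟩ x₂ ⟨h2, h2'⟩ h12
    obtain ⟨e₁, he₁x, he₁z⟩ := exists_pt_model (P := P') x₁ (zc p') (tc_mem p')
    -- The exploded coordinates of `e₂` are chosen to compensate for the change of the units `H`
    -- between `x₁` and `x₂`. With this choice equality of `g` implies equality of `F`.
    have htrop : tropv (fun l => CStarT.mk (toUnit ((G (x₁, 0)).2.1 l / (G (x₂, 0)).2.1 l)) 0 *
        zc p' l) = tc p' := by
      funext l; simp [tropv, tc]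
    obtain ⟨e₂, he₂x, he₂z⟩ := exists_pt_model (P := P') x₂ _ (htrop ▸ tc_mem p')
    have he₁t : tc e₁ = tc p' := by rw [tc, he₁z]; rfl
    have he₂t : tc e₂ = tc p' := by rw [tc, he₂z, htrop]
    obtain ⟨hw₁, ⟨hl₁, hj₁⟩, hg₁⟩ := h1 e₁ he₁x he₁t
    obtain ⟨hw₂, ⟨hl₂, hj₂⟩, hg₂⟩ := h2 e₂ he₂x he₂t
    simp only [Set.mem_ofPred_eq] at hg₁ hg₂
    rw [hs0 _ he₁t, he₁x] at hg₁
    rw [hs0 _ he₂t, he₂x] at hg₂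
    have hFe : F e₁ = F e₂ := by
      refine model_ext ?_ (funext fun k => ?_)
      · exact (congrArg Prod.fst hg₁).trans ((congrArg Prod.fst h12).trans
          (congrArg Prod.fst hg₂).symm)
      · obtain ⟨k, rfl⟩ := e.surjective k
        cases k with
        | inl l =>
          have e1 : H l e₁ = (G (x₁, 0)).2.1 l := congrFun (congrArg (fun y => y.2.1) hg₁) l
          have e2 : H l e₂ = (G (x₂, 0)).2.1 l := congrFun (congrArg (fun y => y.2.1) hg₂) l
          rw [hl₁, hl₂, he₁z, he₂z, e1, e2, ← mul_assoc, ← CStarT.mk_mul_zero,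
            ← toUnit_mul (h2' l) (div_ne_zero (h1' l) (h2' l)), mul_div_cancel₀ _ (h2' l)]
        | inr j =>
          have e1 : K j e₁ = (G (x₁, 0)).2.2 j := congrFun (congrArg (fun y => y.2.2) hg₁) j
          have e2 : K j e₂ = (G (x₂, 0)).2.2 j := congrFun (congrArg (fun y => y.2.2) hg₂) j
          have e3 : (G (x₁, 0)).2.2 j = (G (x₂, 0)).2.2 j := congrFun (congrArg Prod.snd h12) j
          rw [hj₁, hj₂, e1, e2, e3]
    have := hinj hw₁ hw₂ hFe
    rw [← he₁x, ← he₂x, this]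
  obtain ⟨U, hU, hgU⟩ := hginj
  -- surjectivity of the derivative
  have hgsurj : Function.Surjective g' := by
    rintro ⟨a, k⟩
    -- The hypothesis prescribes logarithmic velocities. Dividing `k j` by the value `K j p'` yields
    -- the ordinary velocity `k j`; the velocity of the other exploded coordinates is immaterial.
    obtain ⟨a', c', h1, h2⟩ := hd a fun i => Sum.elim (fun _ => 0) (fun j => k j / K j p') (e.symm i)
    refine ⟨a', ?_⟩
    have ht : ∀ t, tc (linePath p' a' c' t) = tc p' := fun t => by
      funext i
      simp [tc, tropv, zc_linePath]
    have hx : ∀ t, xc (linePath p' a' c' t) = xc p' + t • a' := fun t => by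
      funext j; simp [xc_linePath]
    have hlt : Tendsto (linePath p' a' c') (𝓝 (0 : ℝ)) (𝓝 p') :=
      tendsto_path (morAt_linePath p' a' c' 0) (linePath_zero p' a' c')
    have hev := hlt.eventually (hz.and hFG)
    have hγ : HasDerivAt (fun t : ℝ => xc p' + t • a') a' 0 := by
      have := ((hasDerivAt_id (0 : ℝ)).smul_const a').const_add (xc p')
      simpa using this
    have hgγ : HasDerivAt (fun t : ℝ => g (xc p' + t • a')) (g' a') 0 := by
      have hgd' : HasFDerivAt g g' (xc p' + (0 : ℝ) • a') := by simpa using hgd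
      exact hgd'.comp_hasDerivAt (0 : ℝ) hγ
    refine Prod.ext (funext fun j => ?_) (funext fun j => ?_)
    · have h3 := (hasDerivAt_pi.1 hgγ.fst j).deriv
      change (g' a').1 j = a j
      rw [← h1 j, ← h3]
      refine EventuallyEq.deriv_eq (hev.mono fun t ht' => ?_)
      have h4 := congrArg (fun y => y.1 j) ht'.2
      simp only [hs0 _ (ht t), hx] at h4
      exact h4.symm
    · have h3 := (hasDerivAt_pi.1 hgγ.snd j).deriv
      have h5 := h2 (e (Sum.inr j))
      rw [e.symm_apply_apply, hz.self_of_nhds.2 j, CStarT.mk_fst, coe_toUnit (hK0 j)] at h5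
      simp only [Sum.elim_inr] at h5
      rw [div_mul_cancel₀ _ (hK0 j)] at h5
      change (g' a').2 j = k j
      rw [← h5, ← h3]
      have hne := hlt.eventually ((hK j).continuousAt.eventually_ne (hK0 j))
      refine EventuallyEq.deriv_eq ((hev.and hne).mono fun t ht' => ?_)
      have h4 := congrArg (fun y => y.2.2 j) ht'.1.2
      simp only [hs0 _ (ht t), hx] at h4
      simp only
      rw [ht'.1.1.2 j, CStarT.mk_fst, coe_toUnit ht'.2]
      exact h4.symm
  have hginj' : Function.Injective g' := by
    have := injective_fderiv_of_injOn hgs.contDiffAt (by rw [hgd.fderiv]; exact hgsurj) hU hgU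
    rwa [hgd.fderiv] at this
  -- The derivative of `g` is bijective, so its source and target have equal real dimension.
  have hn : n' = n + 2 * d := by
    have h := (LinearEquiv.ofBijective g'.toLinearMap ⟨hginj', hgsurj⟩).finrank_eq
    simp only [Module.finrank_prod, Module.finrank_pi_fintype, Complex.finrank_real_complex,
      Module.finrank_self, Finset.sum_const, Finset.card_univ, Fintype.card_fin, smul_eq_mul] at h
    omega
  -- the chart
  have htrop : ∀ x, ((∀ l, zc (F x) (e (Sum.inl l)) = CStarT.mk (toUnit (H l x)) 0 * zc x l) ∧
        ∀ j, zc (F x) (e (Sum.inr j)) = CStarT.mk (toUnit (K j x)) 0) → tropv (zc (F x)) ∈ P₂ := by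
    rintro x ⟨hl, hj⟩
    rw [hP₂]
    refine ⟨?_, fun j => by simp [tropv, hj j]⟩
    have : (fun i => tropv (zc (F x)) (e (Sum.inl i))) = tc x := by
      funext i; simp [tropv, tc, hl i]
    rw [this]
    exact tc_mem x
  have h0 := htrop p' hz.self_of_nhds
  obtain ⟨Φ, hΦx, hΦz⟩ := exists_map_model (P := P₂) (fun x => xc (F x))
    (fun x => if tropv (zc (F x)) ∈ P₂ then zc (F x) else zc (F p')) fun x => by
      by_cases h : tropv (zc (F x)) ∈ P₂
      · simp only [h, if_true]
      · simpa only [h, if_false] using h0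
  have hΦF : ∀ᶠ x in 𝓝 p', xc (F x) = xc (Φ x) ∧ zc (F x) = zc (Φ x) := hz.mono fun x hx =>
    ⟨(hΦx x).symm, by rw [hΦz, if_pos (htrop x hx)]⟩
  have hloc := exists_locIso_of_injective hP₂ (p := p') hGX hGH hGK (Φ := Φ)
    (fun l => by rw [← hG0]; exact hH0 l) (fun j => by rw [← hG0]; exact hK0 j) hn ?_ ?_
  · obtain ⟨Θ, hΘ⟩ := hloc
    exact ⟨Φ, Θ, hΘ, hΦF⟩
  · rintro ⟨vx, vζ⟩ hv1 hv2 hv3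
    -- At `p'` the monomials of `s` are zero, so the derivative of `ζᵢ` times a unit is that unit's
    -- value times the derivative of `ζᵢ`.
    have hvζ : vζ = 0 := by
      funext i
      have h1 : HasFDerivAt (fun y : (Fin n' → ℝ) × (s → ℂ) => y.2 i)
          ((ContinuousLinearMap.proj (R := ℝ) (φ := fun _ : s => ℂ) i).comp
            (ContinuousLinearMap.snd ℝ (Fin n' → ℝ) (s → ℂ))) (coords s p') :=
        ((ContinuousLinearMap.proj (R := ℝ) (φ := fun _ : s => ℂ) i).comp
            (ContinuousLinearMap.snd ℝ (Fin n' → ℝ) (s → ℂ))).hasFDerivAt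
      have h2 : ContDiffAt ℝ ∞ (fun y => ∏ l, (G y).2.1 l ^ i.1.1.2 l) (coords s p') := by
        refine contDiffAt_prod fun l _ => ?_
        have h3 : ContDiffAt ℝ ∞ (fun y => (G y).2.1 l) (coords s p') :=
          contDiffAt_pi.1 hGH.contDiffAt l
        have h4 : (G (coords s p')).2.1 l ≠ 0 := by rw [← hG0]; exact hH0 l
        cases i.1.1.2 l with
        | ofNat k => simpa using h3.pow k
        | negSucc k =>
          simp only [zpow_negSucc]
          exact (h3.pow (k + 1)).fun_inv (pow_ne_zero _ h4)
      have h5 := (h1.fun_mul (h2.differentiableAt (by simp)).hasFDerivAt).fderiv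
      have h6 := hv3 i
      rw [h5] at h6
      have h7 : (coords s p').2 i = 0 := by rw [hy₀]; rfl
      simp only [h7, ContinuousLinearMap.add_apply, zero_mul, zero_add, ContinuousLinearMap.smul_apply,
        ContinuousLinearMap.comp_apply, ContinuousLinearMap.coe_snd',
        ContinuousLinearMap.proj_apply, smul_eq_mul] at h6
      refine (mul_eq_zero.1 h6).resolve_left (Finset.prod_ne_zero_iff.2 fun l _ =>
        zpow_ne_zero _ ?_)
      rw [← hG0]; exact hH0 l
    subst hvζ
    have : vx = 0 := hginj' (by
      rw [map_zero]
      exact Prod.ext hv1 hv2)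
    rw [this]; rfl
  · filter_upwards [hz, hFG] with x hx hgx
    refine ⟨(hΦx x).trans (congrArg Prod.fst hgx), fun l => ?_, fun j => ?_⟩
    · rw [hΦz, if_pos (htrop x hx), hx.1 l]
      have : H l x = (G (coords s x)).2.1 l := congrFun (congrArg (fun y => y.2.1) hgx) l
      rw [this]
    · rw [hΦz, if_pos (htrop x hx), hx.2 j]
      have : K j x = (G (coords s x)).2.2 j := congrFun (congrArg (fun y => y.2.2) hgx) j
      rw [this]

end ModelMap

/-- Locally, an injective submersion is the inclusion of a model in a model of a larger polytope. -/
theorem exists_subpolytope_charts {X Y : AbstractExplodedSpace.{u}} (hX : ∀ x : X, GoodPt X x)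
    (hY : ∀ y : Y, GoodPt Y y) {f : Hom X Y} (hinj : Function.Injective f) {p : X}
    (hf : Function.Surjective (f.deriv p)) :
    ∃ (n m : ℕ) (P₁ P₂ : Set (Fin m → ℝ)) (φ : Y → model n P₁) (ψ : model n P₁ → Y)
      (e : model n P₁) (φ' : X → model n P₂) (ψ' : model n P₂ → X) (e' : model n P₂),
      IsPoly P₁ ∧ tc e ∈ interior P₁ ∧ LocIso Y (model n P₁) φ ψ (f p) e ∧
      IsPoly P₂ ∧ P₂ ⊆ P₁ ∧ RelInt P₂ (tc e') ∧ LocIso X (model n P₂) φ' ψ' p e' ∧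
      ∀ᶠ x in 𝓝 p, xc (φ (f x)) = xc (φ' x) ∧ zc (φ (f x)) = zc (φ' x) := by
  classical
  obtain ⟨n', m', P', p', φ', ψ', hP', hp', h'⟩ := hX p
  obtain ⟨n, m, P, q, φ, ψ, hP, hq, h⟩ := hY (f p)
  have hF : MorAt (model n' P') (model n P) (fun x => φ (f (ψ' x))) p' := by
    refine MorAt.comp (g := φ) ?_ (MorAt.comp (f.morAt _) h'.morAt_symm.self_of_nhds)
    rw [h'.map_symm]
    exact h.morAt.self_of_nhds
  have hfψ : Tendsto (fun x => f (ψ' x)) (𝓝 p') (𝓝 (f p)) :=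
    (f.continuous'.tendsto p).comp h'.symm.tendsto
  have hW : {x | ψ (φ (f (ψ' x))) = f (ψ' x) ∧ φ' (ψ' x) = x} ∈ 𝓝 p' :=
    (hfψ.eventually h.left_inv).and h'.right_inv
  have hWinj : Set.InjOn (fun x => φ (f (ψ' x)))
      {x | ψ (φ (f (ψ' x))) = f (ψ' x) ∧ φ' (ψ' x) = x} := by
    rintro x ⟨hx1, hx2⟩ y ⟨hy1, hy2⟩ hxy
    simp only at hxy
    rw [← hx2, ← hy2, hinj (hx1.symm.trans ((congrArg ψ hxy).trans hy1))]
  obtain ⟨d, e, M, N, H, K, hMN, hH, hK, hHK⟩ := exists_adapted_coordinates hp' hF hW hWinj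
  have hA := hMN.locIso q
  have hφA := h.trans hA
  have hq₁ : tc (affMap M (hMN.mapsTo P) q) ∈ interior (IntAffine.aff N ⁻¹' P) := by
    rw [tc_affMap]
    refine preimage_interior_subset_interior_preimage (IntAffine.continuous_aff N) ?_
    rw [Set.mem_preimage, hMN.aff_aff]
    exact hq
  let P₂ : Set (Fin m → ℝ) := {y | (fun i => y (e (Sum.inl i))) ∈ P' ∧ ∀ j, y (e (Sum.inr j)) = 0}
  have hP₂ : ∀ y, y ∈ P₂ ↔ (fun i => y (e (Sum.inl i))) ∈ P' ∧ ∀ j, y (e (Sum.inr j)) = 0 :=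
    fun _ => Iff.rfl
  have hF₁ : MorAt (model n' P') (model n (IntAffine.aff N ⁻¹' P))
      (fun x => affMap M (hMN.mapsTo P) (φ (f (ψ' x)))) p' :=
    MorAt.comp (g := affMap M (hMN.mapsTo P)) (morAt_affMap _ _ _) hF
  have hinj₁ : Set.InjOn (fun x => affMap M (hMN.mapsTo P) (φ (f (ψ' x))))
      {x | ψ (φ (f (ψ' x))) = f (ψ' x) ∧ φ' (ψ' x) = x} := by
    intro x hx y hy hxy
    have hxc := congrArg xc hxy
    refine hWinj hx hy (model_ext hxc ?_)
    have h1 := congrArg (monMap N) (congrArg zc hxy)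
    change monMap N (monMap M _) = monMap N (monMap M _) at h1
    rwa [hMN.monMap_monMap, hMN.monMap_monMap] at h1
  have hp₁ : affMap M (hMN.mapsTo P) (φ (f (ψ' p'))) = affMap M (hMN.mapsTo P) q := by
    rw [h'.map_symm, h.map]
  have hd := fun a c => exists_path_of_surjective hX hY f hf h' hp' hφA a c
  simp only [chartPath] at hd
  rw [← hp₁] at hd
  obtain ⟨Φ, Θ, hΘ, hΦ⟩ := exists_locIso_of_adapted hp' hF₁ hW hinj₁ hd (fun l => (hH l).1)
    (fun l => (hH l).2) (fun j => (hK j).1) (fun j => (hK j).2) hHK hP₂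
  let E : Fin m → IntAffine m' := fun k => Sum.elim (fun l => IntAffine.coord l) (fun _ => 0) (e.symm k)
  have hE : ∀ y ∈ P', IntAffine.aff E y ∈ P₂ := fun y hy => by
    have : (fun i => IntAffine.aff E y (e (Sum.inl i))) = y := by
      funext i; simp [E, IntAffine.aff]
    exact (hP₂ _).2 ⟨by rwa [this], fun j => by simp [E, IntAffine.aff]⟩
  have hE' : ∀ y ∈ P₂, IntAffine.aff E (fun i => y (e (Sum.inl i))) = y := fun y hy => by
    funext k
    obtain ⟨k, rfl⟩ := e.surjective k
    cases k with
    | inl l => simp [E, IntAffine.aff]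
    | inr j => simp [E, IntAffine.aff, ((hP₂ y).1 hy).2 j]
  have htΦ : ∀ᶠ x in 𝓝 p', tc (affMap M (hMN.mapsTo P) (φ (f (ψ' x)))) =
      IntAffine.aff E (tc x) := by
    filter_upwards [hHK] with x hx
    funext k
    obtain ⟨k, rfl⟩ := e.surjective k
    cases k with
    | inl l =>
      have := congrArg CStarT.trop (hx.1 l)
      change (monomial (M (e (Sum.inl l))) (zc (φ (f (ψ' x))))).trop = _
      rw [this]
      simp [E, IntAffine.aff, tc, tropv]
    | inr j =>
      have := congrArg CStarT.trop (hx.2 j)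
      change (monomial (M (e (Sum.inr j))) (zc (φ (f (ψ' x))))).trop = _
      rw [this]
      simp [E, IntAffine.aff]
  have hpoly : IsPoly P₂ := by
    have h1 : IsPoly {y : Fin m → ℝ | ∀ j, y (e (Sum.inr j)) = 0} := by
      refine ⟨Finset.univ.image (fun j : Fin d => IntAffine.coord (e (Sum.inr j))) ∪
        Finset.univ.image (fun j : Fin d => -IntAffine.coord (e (Sum.inr j))), ∅, ?_⟩
      ext y
      simp only [Set.mem_ofPred_eq, Finset.mem_union, or_imp, forall_and, Finset.forall_mem_image,
        Finset.mem_univ, forall_const, Finset.notMem_empty, IsEmpty.forall_iff, and_true,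
        IntAffine.eval_neg, IntAffine.eval_coord, Left.nonneg_neg_iff]
      exact ⟨fun h => ⟨fun j => (h j).ge, fun j => (h j).le⟩, fun h j => le_antisymm (h.2 (x := j)) (h.1 (x := j))⟩
    have h2 : IsPoly P' := hP'.2
    have h3 := (h2.preimage fun l => IntAffine.coord (e (Sum.inl l))).inter h1
    convert h3 using 1
    ext y
    simp only [Set.mem_inter_iff, Set.mem_preimage, Set.mem_ofPred_eq, hP₂]
    have : IntAffine.aff (fun l => IntAffine.coord (e (Sum.inl l))) y =
      fun i => y (e (Sum.inl i)) := by funext l; simp [IntAffine.aff]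
    rw [this]
  -- Points arbitrarily near `p'` have any prescribed exponent in `P'`, and their images lie in the
  -- target model; so the whole of `P₂` consists of exponents allowed there.
  have hsub : P₂ ⊆ IntAffine.aff N ⁻¹' P := by
    intro y hy
    obtain ⟨x, hx, hxt, -⟩ := exists_near_of_relInt (relInt_of_mem_interior hp') htΦ
      (y := fun i => y (e (Sum.inl i))) ((hP₂ y).1 hy).1
    have h1 : tc _ = _ := hx
    rw [hxt, hE' y hy] at h1
    rw [← h1]
    exact tc_mem _
  have hΦt : tc (Φ p') = IntAffine.aff E (tc p') := by
    rw [← htΦ.self_of_nhds, tc, tc, ← hΦ.self_of_nhds.2]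
  have hrel : RelInt P₂ (tc (Φ p')) := by
    intro r hr hr0 y hy
    have h1 := relInt_of_mem_interior hp' (r.comp E)
      (fun z hz => by rw [IntAffine.eval_comp]; exact hr _ (hE z hz))
      (by rwa [IntAffine.eval_comp, ← hΦt]) _ ((hP₂ y).1 hy).1
    rwa [IntAffine.eval_comp, hE' y hy] at h1
  refine ⟨n, m, IntAffine.aff N ⁻¹' P, P₂, _, _, _, _, _, Φ p', IsPoly.preimage hP.2 N, hq₁, hφA,
    hpoly, hsub, hrel, h'.trans hΘ, ?_⟩
  filter_upwards [h'.tendsto.eventually hΦ, h'.left_inv] with x hx hx'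
  rw [hx'] at hx
  exact hx

/-! ### The fiber product -/

section Pullback

variable {X Y Z : AbstractExplodedSpace.{u}}

/-- The points of the fiber product. -/
def PullbackPt (f : Hom X Y) (g : Hom Z Y) : Type u := {s : X × Z // f s.1 = g s.2}

variable {f : Hom X Y} {g : Hom Z Y}

/-- The first projection. -/
def PullbackPt.fst (s : PullbackPt f g) : X := s.1.1

/-- The second projection. -/
def PullbackPt.snd (s : PullbackPt f g) : Z := s.1.2

theorem PullbackPt.comm (s : PullbackPt f g) : f s.fst = g s.snd := s.2

theorem PullbackPt.ext' {s t : PullbackPt f g} (h1 : s.fst = t.fst) (h2 : s.snd = t.snd) : s = t :=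
  Subtype.ext (Prod.ext h1 h2)

/-- Maps of a chart to the fiber product whose components are morphisms. -/
structure IsPlot {n m : ℕ} {P : Set (Fin m → ℝ)} (v : model n P → PullbackPt f g) : Prop where
  poly : IsIntegralAffinePolytope P
  fst : ∀ e, MorAt (model n P) X (fun e => (v e).fst) e
  snd : ∀ e, MorAt (model n P) Z (fun e => (v e).snd) e

/-- The finest topology making all plots continuous. -/
instance pullbackTopology (f : Hom X Y) (g : Hom Z Y) : TopologicalSpace (PullbackPt f g) where
  IsOpen U := ∀ ⦃n m : ℕ⦄ ⦃P : Set (Fin m → ℝ)⦄ ⦃v : model n P → PullbackPt f g⦄, IsPlot v →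
    IsOpen (v ⁻¹' U)
  isOpen_univ _ _ _ _ _ := isOpen_univ
  isOpen_inter _ _ hU hV _ _ _ _ hv := (hU hv).inter (hV hv)
  isOpen_sUnion _ h _ _ _ v hv := by
    rw [Set.preimage_sUnion]
    exact isOpen_biUnion fun U hU => h U hU hv

theorem IsPlot.continuous {n m : ℕ} {P : Set (Fin m → ℝ)} {v : model n P → PullbackPt f g}
    (hv : IsPlot v) : Continuous v := ⟨fun _ hU => hU hv⟩

/-- The final structure of an abstract exploded space on the fiber product. -/
def pullbackSpace (f : Hom X Y) (g : Hom Z Y) : AbstractExplodedSpace.{u} where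
  carrier := PullbackPt f g
  sections U :=
    { carrier := {F | ∀ ⦃n m : ℕ⦄ ⦃P : Set (Fin m → ℝ)⦄ ⦃v : model n P → PullbackPt f g⦄, IsPlot v →
        ∀ e, v e ∈ U → SecAt (model n P) (fun e => extendOne (T := (U : Set _)) F (v e)) e}
      mul_mem' := fun {F G} hF hG n m P v hv e he => by
        refine ((hF hv e he).mul (hG hv e he)).congr (Eventually.of_forall fun x => ?_)
        simp only [extendOne]
        split_ifs <;> simp
      one_mem' := fun n m P v hv e he => by
        refine (secAt_const 1 e).congr (Eventually.of_forall fun x => ?_)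
        simp [extendOne]
      inv_mem' := fun {F} hF n m P v hv e he => by
        refine (hF hv e he).inv.congr (Eventually.of_forall fun x => ?_)
        simp only [extendOne]
        split_ifs <;> simp }
  const_mem U c n m P v hv e he := by
    refine (secAt_const c e).congr ?_
    filter_upwards [(U.isOpen.preimage hv.continuous).mem_nhds he] with x hx
    exact (extendOne_coe (T := (U : Set (PullbackPt f g))) (fun _ => c) ⟨v x, hx⟩).symm
  restrict_mem {U V} h F hF n m P v hv e he := by
    refine (hF hv e (h he)).congr ?_
    filter_upwards [(V.isOpen.preimage hv.continuous).mem_nhds he] with x hx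
    rw [extendOne_coe (T := (V : Set (PullbackPt f g))) _ ⟨v x, hx⟩]
    exact extendOne_coe (T := (U : Set (PullbackPt f g))) F ⟨v x, h hx⟩
  glue {U F} hF n m P v hv e he := by
    obtain ⟨V, heV, hVU, hV⟩ := hF ⟨v e, he⟩
    refine (hV hv e heV).congr ?_
    filter_upwards [(V.isOpen.preimage hv.continuous).mem_nhds heV] with x hx
    rw [extendOne_coe (T := (V : Set (PullbackPt f g))) _ ⟨v x, hx⟩]
    exact (extendOne_coe (T := (U : Set (PullbackPt f g))) F ⟨v x, hVU hx⟩).symm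

/-- A point of the fiber product. -/
def pullbackMk (x : X) (z : Z) (h : f x = g z) : pullbackSpace f g := ⟨(x, z), h⟩

theorem IsPlot.morAt {n m : ℕ} {P : Set (Fin m → ℝ)} {v : model n P → PullbackPt f g}
    (hv : IsPlot v) (e : model n P) : MorAt (model n P) (pullbackSpace f g) v e := by
  refine ⟨hv.continuous.continuousAt, fun F hF => ?_⟩
  obtain ⟨U, hU, hF⟩ := hF
  refine (hF hv e hU).congr ?_
  filter_upwards [(U.isOpen.preimage hv.continuous).mem_nhds hU] with x hx
  exact extendOne_coe (T := (U : Set (pullbackSpace f g))) (fun y => F y) ⟨v x, hx⟩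

/-- A map from the fiber product which is a morphism along all plots is a morphism. -/
theorem morAt_of_plots {W : AbstractExplodedSpace.{u₁}} {h : pullbackSpace f g → W}
    {O : Set (pullbackSpace f g)} (hO : IsOpen O)
    (hh : ∀ ⦃n m : ℕ⦄ ⦃P : Set (Fin m → ℝ)⦄ ⦃v : model n P → pullbackSpace f g⦄, IsPlot v →
      ∀ e, v e ∈ O → MorAt (model n P) W (fun e => h (v e)) e) {s : pullbackSpace f g}
    (hs : s ∈ O) : MorAt (pullbackSpace f g) W h s := by
  have hopen : ∀ V : Set W, IsOpen V → IsOpen (O ∩ h ⁻¹' V) := by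
    intro V hV n m P v hv
    refine isOpen_iff_mem_nhds.2 fun e he => ?_
    exact inter_mem ((hO.preimage hv.continuous).mem_nhds he.1)
      ((hh hv e he.1).1.preimage_mem_nhds (hV.mem_nhds he.2))
  refine ⟨fun V hV => ?_, fun F hF => ?_⟩
  · obtain ⟨V', hV'V, hV'o, hsV'⟩ := mem_nhds_iff.1 hV
    rw [mem_map]
    exact mem_of_superset ((hopen V' hV'o).mem_nhds ⟨hs, hsV'⟩) fun x hx => hV'V hx.2
  · obtain ⟨V, hVF, hVo, hsV⟩ := eventually_nhds_iff.1 hF.eventually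
    refine ⟨⟨O ∩ h ⁻¹' V, hopen V hVo⟩, ⟨hs, hsV⟩, fun n m P v hv e he => ?_⟩
    refine ((hh hv e he.1).2 F (hVF _ he.2)).congr ?_
    filter_upwards [((hopen V hVo).preimage hv.continuous).mem_nhds he] with x hx
    exact (extendOne_coe (T := O ∩ h ⁻¹' V) (fun y => F (h y)) ⟨v x, hx⟩).symm

/-- The first projection of the fiber product. -/
def pullbackFst (f : Hom X Y) (g : Hom Z Y) : Hom (pullbackSpace f g) X :=
  Hom.ofMorAt PullbackPt.fst fun _ =>
    morAt_of_plots isOpen_univ (fun _ _ _ _ hv e _ => hv.fst e) trivial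

/-- The second projection of the fiber product. -/
def pullbackSnd (f : Hom X Y) (g : Hom Z Y) : Hom (pullbackSpace f g) Z :=
  Hom.ofMorAt PullbackPt.snd fun _ =>
    morAt_of_plots isOpen_univ (fun _ _ _ _ hv e _ => hv.snd e) trivial

theorem pullback_comm (s : pullbackSpace f g) : f (pullbackFst f g s) = g (pullbackSnd f g s) :=
  PullbackPt.comm s

theorem pullback_ext {s t : pullbackSpace f g} (h1 : pullbackFst f g s = pullbackFst f g t)
    (h2 : pullbackSnd f g s = pullbackSnd f g t) : s = t := PullbackPt.ext' h1 h2

/-- A map to the fiber product is a morphism if its components are. -/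
theorem morAt_pullback {E : AbstractExplodedSpace.{u₁}} {e : E} (he : GoodPt E e)
    {v : E → pullbackSpace f g} (h1 : ∀ᶠ x in 𝓝 e, MorAt E X (fun x => pullbackFst f g (v x)) x)
    (h2 : ∀ᶠ x in 𝓝 e, MorAt E Z (fun x => pullbackSnd f g (v x)) x) :
    MorAt E (pullbackSpace f g) v e := by
  -- Plots are defined on whole models, while the components are morphisms only near `e`. A
  -- neighbourhood inside this set that is isomorphic to a full model is needed.
  obtain ⟨n, m, P, V, φ, ψ, hP, heV, hVW, hV⟩ := he.exists_openIso (h1.and h2)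
  have hplot : IsPlot (f := f) (g := g) fun x : model n P => v (ψ x) :=
    ⟨hP, fun x => MorAt.comp (g := fun x => pullbackFst f g (v x)) (hVW (hV.mem x)).1 (hV.morAt_symm x),
      fun x => MorAt.comp (g := fun x => pullbackSnd f g (v x)) (hVW (hV.mem x)).2 (hV.morAt_symm x)⟩
  have h3 : MorAt E (pullbackSpace f g) (fun x => v (ψ (φ x))) e :=
    MorAt.comp (g := fun x : model n P => v (ψ x)) (hplot.morAt _) (hV.morAt e heV)
  exact h3.congr (mem_of_superset (hV.isOpen.mem_nhds heV) fun x hx =>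
    congrArg v (hV.left_inv x hx))

theorem Hom.ext_fun {f₁ f₂ : Hom X Y} (h : ∀ x, f₁ x = f₂ x) : f₁ = f₂ :=
  Hom.ext (funext h)

/-- The lift is forced on points. It is a morphism by `morAt_pullback`, since the structure makes
every plot a morphism; the only substantial input is the existence of charts, taken as a hypothesis.
-/
theorem isFiberProduct_pullback (h : ∀ s : pullbackSpace f g, GoodPt (pullbackSpace f g) s) :
    IsFiberProduct f g (pullbackFst f g) (pullbackSnd f g) where
  isExplodedManifold := isExplodedManifold_of_goodPt h
  comm := Hom.ext_fun pullback_comm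
  existsUnique_lift E hE h₁ h₂ h12 := by
    have hc : ∀ x, f (h₁ x) = g (h₂ x) := fun x => congrArg (fun k : Hom E Y => k x) h12
    refine ⟨Hom.ofMorAt (fun x => pullbackMk (h₁ x) (h₂ x) (hc x)) fun x =>
      morAt_pullback (hE.goodPt x) (Eventually.of_forall fun y => h₁.morAt y)
        (Eventually.of_forall fun y => h₂.morAt y), ⟨rfl, rfl⟩, fun l hl => ?_⟩
    refine Hom.ext_fun fun x => pullback_ext ?_ ?_
    · exact congrArg (fun k : Hom E X => k x) hl.1
    · exact congrArg (fun k : Hom E Z => k x) hl.2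

end Pullback

/-! ### Charts of the fiber product -/

/-- `φ` is an isomorphism of the open set `U` onto the open set `V`, with inverse `ψ`. -/
structure SubIso (X : AbstractExplodedSpace.{u₁}) (Y : AbstractExplodedSpace.{u₂}) (U : Set X)
    (V : Set Y) (φ : X → Y) (ψ : Y → X) : Prop where
  isOpen_source : IsOpen U
  isOpen_target : IsOpen V
  morAt : ∀ x ∈ U, MorAt X Y φ x
  morAt_symm : ∀ y ∈ V, MorAt Y X ψ y
  mapsTo : ∀ x ∈ U, φ x ∈ V
  mapsTo_symm : ∀ y ∈ V, ψ y ∈ U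
  left_inv : ∀ x ∈ U, ψ (φ x) = x
  right_inv : ∀ y ∈ V, φ (ψ y) = y

theorem LocIso.exists_subIso {X : AbstractExplodedSpace.{u₁}} {Y : AbstractExplodedSpace.{u₂}}
    {φ : X → Y} {ψ : Y → X} {x : X} {y : Y} (h : LocIso X Y φ ψ x y) {S : Set X} (hS : S ∈ 𝓝 x) :
    ∃ U V, x ∈ U ∧ U ⊆ S ∧ SubIso X Y U V φ ψ := by
  obtain ⟨A, hA, hAo, hxA⟩ := eventually_nhds_iff.1 ((h.morAt.and h.left_inv).and hS)
  obtain ⟨B, hB, hBo, hyB⟩ := eventually_nhds_iff.1 (h.morAt_symm.and h.right_inv)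
  have hφ : ContinuousOn φ A := fun a ha => (hA a ha).1.1.1.continuousWithinAt
  have hψ : ContinuousOn ψ B := fun b hb => (hB b hb).1.1.continuousWithinAt
  refine ⟨A ∩ φ ⁻¹' B, B ∩ ψ ⁻¹' A, ⟨hxA, by rw [Set.mem_preimage, h.map]; exact hyB⟩,
    fun a ha => (hA a ha.1).2, hφ.isOpen_inter_preimage hAo hBo, hψ.isOpen_inter_preimage hBo hAo,
    fun a ha => (hA a ha.1).1.1, fun b hb => (hB b hb.1).1, fun a ha => ⟨ha.2, ?_⟩,
    fun b hb => ⟨hb.2, ?_⟩, fun a ha => (hA a ha.1).1.2, fun b hb => (hB b hb.1).2⟩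
  · rw [Set.mem_preimage, (hA a ha.1).1.2]; exact ha.1
  · rw [Set.mem_preimage, (hB b hb.1).2]; exact hb.1

/-! ### Inclusions of models. -/

section Inclusion

variable {n m : ℕ} {P Q : Set (Fin m → ℝ)}

/-- The inclusion of models given by an inclusion of polytopes. -/
def incl (h : P ⊆ Q) (p : model n P) : model n Q := mkPt (xc p) (zc p) (h (tc_mem p))

@[simp] theorem xc_incl (h : P ⊆ Q) (p : model n P) : xc (incl h p) = xc p := rfl

@[simp] theorem zc_incl (h : P ⊆ Q) (p : model n P) : zc (incl h p) = zc p := rfl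

theorem incl_injective (h : P ⊆ Q) : Function.Injective (incl (n := n) h) := fun a b hab => by
  have h1 := congrArg xc hab
  have h2 := congrArg zc hab
  exact model_ext h1 h2

theorem morAt_incl (hP : IsPoly P) (h : P ⊆ Q) (p : model n P) :
    MorAt (model n P) (model n Q) (incl h) p :=
  (goodPt_model hP p).nice.morAt (fun i => rSm_xc i p) fun i => secAt_zc i p

end Inclusion

/-! ### Charts of the fiber product from compatible charts. -/

section Charts

variable {X Y Z : AbstractExplodedSpace.{u}} {f : Hom X Y} {g : Hom Z Y} {n m l k : ℕ}
  {P₁ P₂ : Set (Fin m → ℝ)} {Q : Set (Fin k → ℝ)} {φ : Y → model n P₁} {ψ : model n P₁ → Y}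
  {φ' : X → model n P₂} {ψ' : model n P₂ → X} {χ : Z → model l Q} {χ' : model l Q → Z}
  {A : Fin m → IntAffine k} {H : Fin m → model l Q → ℂ} {NX : Set X} {OP : Set (model n P₂)}
  {NZ : Set Z} {OQ : Set (model l Q)}

/-- Compatible charts, in which `f` is the inclusion of a subpolytope and `g` is monomial. -/
structure ChartData (f : Hom X Y) (g : Hom Z Y) (φ : Y → model n P₁) (ψ : model n P₁ → Y)
    (φ' : X → model n P₂) (ψ' : model n P₂ → X) (χ : Z → model l Q) (χ' : model l Q → Z)
    (A : Fin m → IntAffine k) (H : Fin m → model l Q → ℂ) (NX : Set X) (OP : Set (model n P₂))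
    (NZ : Set Z) (OQ : Set (model l Q)) : Prop where
  isoX : SubIso X (model n P₂) NX OP φ' ψ'
  isoZ : SubIso Z (model l Q) NZ OQ χ χ'
  agree : ∀ x ∈ NX, xc (φ (f x)) = xc (φ' x) ∧ zc (φ (f x)) = zc (φ' x)
  baseX : ∀ x ∈ NX, ψ (φ (f x)) = f x
  baseZ : ∀ z ∈ NZ, ψ (φ (g z)) = g z
  morAt : ∀ z ∈ NZ, MorAt Y (model n P₁) φ (g z)
  mon : ∀ z ∈ NZ, ∀ j, zc (φ (g z)) j = CStarT.mk (toUnit (H j (χ z))) 0 * monomial (A j) (zc (χ z))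

/-- The part of `Q` which the affine map `A` maps to `P₂`. -/
def cut (Q : Set (Fin k → ℝ)) (A : Fin m → IntAffine k) (P₂ : Set (Fin m → ℝ)) :
    Set (Fin k → ℝ) := Q ∩ IntAffine.aff A ⁻¹' P₂

theorem cut_subset : cut Q A P₂ ⊆ Q := Set.inter_subset_left

theorem isPoly_cut (hQ : IsPoly Q) (hP₂ : IsPoly P₂) : IsPoly (cut Q A P₂) :=
  hQ.inter (hP₂.preimage A)

namespace ChartData

variable (D : ChartData f g φ ψ φ' ψ' χ χ' A H NX OP NZ OQ)

include D

theorem tropv_eq {z : Z} (hz : z ∈ NZ) :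
    tropv (zc (φ (g z))) = IntAffine.aff A (tc (χ z)) := by
  funext j
  simp only [tropv, D.mon z hz j, CStarT.trop_mul, CStarT.trop_mk, zero_add]
  exact trop_monomial _ _

/-- On `cut Q A P₂` the exponent of `g` in the chart of `Y` lies in `P₂`, so the coordinate
expression of `g` can be regarded as a map `G` into the model of `P₂`, that is, into the chart of
`X`. The point `e₀` only supplies values away from `OQ`. -/
theorem exists_transition (hQ : IsPoly Q) (hP₂ : IsPoly P₂) (e₀ : model n P₂) :
    ∃ G : model l (cut Q A P₂) → model n P₂, ∀ w, incl cut_subset w ∈ OQ →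
      xc (G w) = xc (φ (g (χ' (incl cut_subset w)))) ∧
      zc (G w) = zc (φ (g (χ' (incl cut_subset w)))) ∧
      MorAt (model l (cut Q A P₂)) (model n P₂) G w := by
  classical
  obtain ⟨G, hGx, hGz⟩ := exists_map_model (P := P₂)
    (fun w : model l (cut Q A P₂) => xc (φ (g (χ' (incl cut_subset w)))))
    (fun w => if tropv (zc (φ (g (χ' (incl cut_subset w))))) ∈ P₂ then
      zc (φ (g (χ' (incl cut_subset w)))) else zc e₀) fun w => by
        by_cases h : tropv (zc (φ (g (χ' (incl cut_subset w))))) ∈ P₂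
        · simp only [h, if_true]
        · simp only [h, if_false]
          exact tc_mem e₀
  have hmem : ∀ w : model l (cut Q A P₂), incl cut_subset w ∈ OQ →
      tropv (zc (φ (g (χ' (incl cut_subset w))))) ∈ P₂ := by
    intro w hw
    rw [D.tropv_eq (D.isoZ.mapsTo_symm _ hw), D.isoZ.right_inv _ hw]
    exact (tc_mem w).2
  have hG : ∀ w, incl cut_subset w ∈ OQ → zc (G w) = zc (φ (g (χ' (incl cut_subset w)))) :=
    fun w hw => by rw [hGz, if_pos (hmem w hw)]
  refine ⟨G, fun w hw => ⟨hGx w, hG w hw, ?_⟩⟩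
  have hpoly := isPoly_cut (A := A) hQ hP₂
  have hι := morAt_incl (n := l) hpoly (cut_subset (Q := Q)) w
  have hm : MorAt (model l (cut Q A P₂)) (model n P₁)
      (fun w => φ (g (χ' (incl cut_subset w)))) w :=
    MorAt.comp (g := φ) (D.morAt _ (D.isoZ.mapsTo_symm _ hw))
      (MorAt.comp (g.morAt _) (MorAt.comp (D.isoZ.morAt_symm _ hw) hι))
  have hev : ∀ᶠ w' in 𝓝 w, incl cut_subset w' ∈ OQ :=
    hι.1.eventually (D.isoZ.isOpen_target.mem_nhds hw)
  refine (goodPt_model hpoly w).nice.morAt (fun i => ?_) fun i => ?_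
  · refine (RSm.pull hm (rSm_xc i _)).congr (Eventually.of_forall fun w' => ?_)
    simp only [hGx]
  · refine (hm.2 _ (secAt_zc i _)).congr (hev.mono fun w' hw' => ?_)
    simp only [hG w' hw']

/-- A point of the fiber product is read off from its `Z` component, whose exponent lies in the cut
because `f` is an inclusion of models. Conversely a point `w` of the cut gives the pair `(ψ' (G w),
χ' w)`. The base point `s₀` supplies default values. -/
theorem exists_chart (hQ : IsPoly Q) (hP₂ : IsPoly P₂) {G : model l (cut Q A P₂) → model n P₂}
    (hG : ∀ w, incl cut_subset w ∈ OQ → xc (G w) = xc (φ (g (χ' (incl cut_subset w)))) ∧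
      zc (G w) = zc (φ (g (χ' (incl cut_subset w)))) ∧
      MorAt (model l (cut Q A P₂)) (model n P₂) G w)
    {s₀ : pullbackSpace f g} (h₁ : pullbackFst f g s₀ ∈ NX) (h₂ : pullbackSnd f g s₀ ∈ NZ) :
    ∃ (Φ : pullbackSpace f g → model l (cut Q A P₂)) (Ω : model l (cut Q A P₂) → pullbackSpace f g),
      (∀ s, pullbackFst f g s ∈ NX → pullbackSnd f g s ∈ NZ →
        incl cut_subset (Φ s) = χ (pullbackSnd f g s) ∧ G (Φ s) = φ' (pullbackFst f g s) ∧
        MorAt (pullbackSpace f g) (model l (cut Q A P₂)) Φ s ∧ Ω (Φ s) = s) ∧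
      ∀ w, incl cut_subset w ∈ OQ → G w ∈ OP →
        MorAt (model l (cut Q A P₂)) (pullbackSpace f g) Ω w ∧ pullbackFst f g (Ω w) ∈ NX ∧
        pullbackSnd f g (Ω w) = χ' (incl cut_subset w) ∧ Φ (Ω w) = w := by
  classical
  have hpoly := isPoly_cut (A := A) hQ hP₂
  have hcut : ∀ s, pullbackFst f g s ∈ NX → pullbackSnd f g s ∈ NZ →
      tropv (zc (χ (pullbackSnd f g s))) ∈ cut Q A P₂ := by
    intro s hs₁ hs₂
    refine ⟨tc_mem _, ?_⟩
    have h := D.tropv_eq hs₂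
    rw [← pullback_comm, (D.agree _ hs₁).2] at h
    change IntAffine.aff A (tc _) ∈ P₂
    rw [← h]
    exact tc_mem (φ' (pullbackFst f g s))
  obtain ⟨Φ, hΦx, hΦz⟩ := exists_map_model (P := cut Q A P₂)
    (fun s : pullbackSpace f g => xc (χ (pullbackSnd f g s)))
    (fun s => if tropv (zc (χ (pullbackSnd f g s))) ∈ cut Q A P₂ then zc (χ (pullbackSnd f g s))
      else zc (χ (pullbackSnd f g s₀))) fun s => by
        by_cases h : tropv (zc (χ (pullbackSnd f g s))) ∈ cut Q A P₂
        · simp only [h, if_true]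
        · simpa only [h, if_false] using hcut s₀ h₁ h₂
  have hΦz' : ∀ s, pullbackFst f g s ∈ NX → pullbackSnd f g s ∈ NZ →
      zc (Φ s) = zc (χ (pullbackSnd f g s)) := fun s hs₁ hs₂ => by
    rw [hΦz, if_pos (hcut s hs₁ hs₂)]
  have hιΦ : ∀ s, pullbackFst f g s ∈ NX → pullbackSnd f g s ∈ NZ →
      incl cut_subset (Φ s) = χ (pullbackSnd f g s) := fun s hs₁ hs₂ =>
    model_ext (hΦx s) (hΦz' s hs₁ hs₂)
  have hGΦ : ∀ s, pullbackFst f g s ∈ NX → pullbackSnd f g s ∈ NZ →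
      G (Φ s) = φ' (pullbackFst f g s) := by
    intro s hs₁ hs₂
    have hι := hιΦ s hs₁ hs₂
    have hO : incl cut_subset (Φ s) ∈ OQ := hι ▸ D.isoZ.mapsTo _ hs₂
    obtain ⟨hx, hz, -⟩ := hG _ hO
    rw [hι, D.isoZ.left_inv _ hs₂, ← pullback_comm] at hx hz
    exact model_ext (hx.trans (D.agree _ hs₁).1) (hz.trans (D.agree _ hs₁).2)
  have hopen : IsOpen {s : pullbackSpace f g | pullbackFst f g s ∈ NX ∧ pullbackSnd f g s ∈ NZ} :=
    (D.isoX.isOpen_source.preimage (pullbackFst f g).continuous').inter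
      (D.isoZ.isOpen_source.preimage (pullbackSnd f g).continuous')
  have hΦm : ∀ s, pullbackFst f g s ∈ NX → pullbackSnd f g s ∈ NZ →
      MorAt (pullbackSpace f g) (model l (cut Q A P₂)) Φ s := by
    intro s hs₁ hs₂
    refine morAt_of_plots hopen (fun a b R v hv e he => ?_) ⟨hs₁, hs₂⟩
    have hm : MorAt (model a R) (model l Q) (fun e => χ (pullbackSnd f g (v e))) e :=
      MorAt.comp (g := χ) (D.isoZ.morAt _ he.2) (hv.snd e)
    have hev : ∀ᶠ e' in 𝓝 e, v e' ∈ {s : pullbackSpace f g |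
        pullbackFst f g s ∈ NX ∧ pullbackSnd f g s ∈ NZ} :=
      (hv.morAt e).1.eventually (hopen.mem_nhds he)
    refine (goodPt_model hv.poly.2 e).nice.morAt (fun i => ?_) fun i => ?_
    · refine (RSm.pull hm (rSm_xc i _)).congr (Eventually.of_forall fun e' => ?_)
      simp only [hΦx]
    · refine (hm.2 _ (secAt_zc i _)).congr (hev.mono fun e' he' => ?_)
      simp only [hΦz' _ he'.1 he'.2]
  have hcomp : ∀ w, incl cut_subset w ∈ OQ → G w ∈ OP →
      f (ψ' (G w)) = g (χ' (incl cut_subset w)) := by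
    intro w hw hw'
    obtain ⟨hx, hz, -⟩ := hG w hw
    have hN := D.isoX.mapsTo_symm _ hw'
    -- Both points of `Y` are recovered by `ψ` from their coordinates, and these agree by the
    -- construction of `G`.
    rw [← D.baseX _ hN, ← D.baseZ _ (D.isoZ.mapsTo_symm _ hw)]
    congr 1
    obtain ⟨h1, h2⟩ := D.agree _ hN
    rw [D.isoX.right_inv _ hw'] at h1 h2
    exact model_ext (h1.trans hx) (h2.trans hz)
  let Ω : model l (cut Q A P₂) → pullbackSpace f g := fun w =>
    if h : f (ψ' (G w)) = g (χ' (incl cut_subset w)) then pullbackMk _ _ h else s₀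
  have hΩ : ∀ w, incl cut_subset w ∈ OQ → G w ∈ OP → pullbackFst f g (Ω w) = ψ' (G w) ∧
      pullbackSnd f g (Ω w) = χ' (incl cut_subset w) := by
    intro w hw hw'
    simp only [Ω, hcomp w hw hw', dif_pos]
    exact ⟨rfl, rfl⟩
  refine ⟨Φ, Ω, fun s hs₁ hs₂ => ⟨hιΦ s hs₁ hs₂, hGΦ s hs₁ hs₂, hΦm s hs₁ hs₂, ?_⟩,
    fun w hw hw' => ?_⟩
  · have hι := hιΦ s hs₁ hs₂
    have hO : incl cut_subset (Φ s) ∈ OQ := hι ▸ D.isoZ.mapsTo _ hs₂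
    have hO' : G (Φ s) ∈ OP := hGΦ s hs₁ hs₂ ▸ D.isoX.mapsTo _ hs₁
    obtain ⟨h1, h2⟩ := hΩ _ hO hO'
    refine pullback_ext ?_ ?_
    · rw [h1, hGΦ s hs₁ hs₂, D.isoX.left_inv _ hs₁]
    · rw [h2, hι, D.isoZ.left_inv _ hs₂]
  · have hι := morAt_incl (n := l) hpoly (cut_subset (Q := Q)) w
    have hev : ∀ᶠ w' in 𝓝 w, incl cut_subset w' ∈ OQ ∧ G w' ∈ OP :=
      (hι.1.eventually (D.isoZ.isOpen_target.mem_nhds hw)).and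
        ((hG w hw).2.2.1.eventually (D.isoX.isOpen_target.mem_nhds hw'))
    have h1 := hΩ w hw hw'
    have hN : pullbackFst f g (Ω w) ∈ NX := h1.1 ▸ D.isoX.mapsTo_symm _ hw'
    have hN' : pullbackSnd f g (Ω w) ∈ NZ := h1.2 ▸ D.isoZ.mapsTo_symm _ hw
    refine ⟨morAt_pullback (goodPt_model hpoly w) ?_ ?_, hN, h1.2, ?_⟩
    · filter_upwards [hev, hev.eventually_nhds] with w' hw'' hw'''
      exact (MorAt.comp (D.isoX.morAt_symm _ hw''.2) (hG w' hw''.1).2.2).congr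
        (hw'''.mono fun a ha => (hΩ a ha.1 ha.2).1.symm)
    · filter_upwards [hev, hev.eventually_nhds] with w' hw'' hw'''
      exact (MorAt.comp (D.isoZ.morAt_symm _ hw''.1)
        (morAt_incl (n := l) hpoly (cut_subset (Q := Q)) w')).congr
        (hw'''.mono fun a ha => (hΩ a ha.1 ha.2).2.symm)
    · refine incl_injective cut_subset ?_
      rw [hιΦ _ hN hN', h1.2, D.isoZ.right_inv _ hw]

end ChartData

end Charts

/-! ### Limits of ultrafilters in models -/

theorem exists_combination {m : ℕ} {P : Set (Fin m → ℝ)} {weak strict : Finset (IntAffine m)}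
    (hP : ∀ y, y ∈ P ↔ (∀ q ∈ weak, 0 ≤ q.eval y) ∧ ∀ q ∈ strict, 0 < q.eval y) (hne : P.Nonempty)
    {r : IntAffine m} (hr : ∀ y ∈ P, 0 ≤ r.eval y) :
    ∃ (c : IntAffine m → ℝ) (c₀ : ℝ), (∀ q, 0 ≤ c q) ∧ 0 ≤ c₀ ∧
      ∀ y, r.eval y = ∑ q ∈ weak ∪ strict, c q * q.eval y + c₀ := by
  classical
  obtain ⟨y₀, hy₀⟩ := hne
  obtain ⟨c, c', c₀, hc, -, hc₀, h⟩ := exists_nonneg_combination (I := ∅) ((hP y₀).1 hy₀)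
    (Finset.empty_subset _) (by simp) r fun y h1 h2 _ => hr y ((hP y).2 ⟨h1, h2⟩)
  refine ⟨c, c₀, hc, hc₀, fun y => ?_⟩
  rw [h y, Finset.sum_empty, sub_zero]

theorem eval_midpoint {m : ℕ} (q : IntAffine m) (x y : Fin m → ℝ) :
    q.eval ((2⁻¹ : ℝ) • (x + y)) = (q.eval x + q.eval y) / 2 := by
  have h : ∀ z, q.eval z = q.1 + q.lin z := fun _ => rfl
  rw [h, h, h, IntAffine.lin_smul, IntAffine.lin_add]
  ring

/-- A nonempty polytope has a point which lies in no proper face. -/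
theorem exists_relInt {m : ℕ} {P : Set (Fin m → ℝ)} (hP : IsPoly P) (hne : P.Nonempty) :
    ∃ v ∈ P, RelInt P v := by
  classical
  obtain ⟨weak, strict, hPe⟩ := hP
  have hP : ∀ y, y ∈ P ↔ (∀ q ∈ weak, 0 ≤ q.eval y) ∧ ∀ q ∈ strict, 0 < q.eval y := by
    simp [hPe]
  have hpos : ∀ q ∈ weak ∪ strict, ∀ y ∈ P, 0 ≤ q.eval y := fun q hq y hy => by
    rcases Finset.mem_union.1 hq with h | h
    · exact ((hP y).1 hy).1 q h
    · exact (((hP y).1 hy).2 q h).le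
  have hmid : ∀ x ∈ P, ∀ y ∈ P, (2⁻¹ : ℝ) • (x + y) ∈ P := fun x hx y hy => by
    rw [hP]
    refine ⟨fun q hq => ?_, fun q hq => ?_⟩
    · rw [eval_midpoint]
      linarith [((hP x).1 hx).1 q hq, ((hP y).1 hy).1 q hq]
    · rw [eval_midpoint]
      linarith [((hP x).1 hx).2 q hq, ((hP y).1 hy).2 q hq]
  -- Midpoints keep all strict positivity already achieved and add the next one, so successive
  -- averaging makes every defining function that is not identically zero on `P` nonzero at one
  -- point.
  have key : ∀ t ⊆ weak ∪ strict, ∃ v ∈ P, ∀ q ∈ t, (∃ y ∈ P, q.eval y ≠ 0) → q.eval v ≠ 0 := by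
    intro t
    induction t using Finset.induction_on with
    | empty => exact fun _ => ⟨hne.some, hne.some_mem, by simp⟩
    | insert q t hq ih =>
      intro ht
      obtain ⟨v, hv, hvt⟩ := ih ((Finset.subset_insert _ _).trans ht)
      by_cases h : ∃ y ∈ P, q.eval y ≠ 0
      · obtain ⟨y, hy, hqy⟩ := h
        refine ⟨_, hmid v hv y hy, fun q' hq' hq'' => ?_⟩
        have h1 := hpos q' (ht hq') v hv
        have h2 := hpos q' (ht hq') y hy
        rw [eval_midpoint]
        rcases Finset.mem_insert.1 hq' with rfl | h3
        · have := lt_of_le_of_ne h2 (Ne.symm hqy)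
          exact ne_of_gt (by linarith)
        · have := lt_of_le_of_ne h1 (Ne.symm (hvt q' h3 hq''))
          exact ne_of_gt (by linarith)
      · refine ⟨v, hv, fun q' hq' hq'' => ?_⟩
        rcases Finset.mem_insert.1 hq' with rfl | h3
        · exact absurd hq'' h
        · exact hvt q' h3 hq''
  obtain ⟨v, hv, hvt⟩ := key _ le_rfl
  refine ⟨v, hv, fun r hr hr0 x hx => ?_⟩
  obtain ⟨c, c₀, hc, hc₀, h⟩ := exists_combination hP hne hr
  have h1 : ∀ q ∈ weak ∪ strict, 0 ≤ c q * q.eval v := fun q hq =>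
    mul_nonneg (hc q) (hpos q hq v hv)
  have h2 := h v
  rw [hr0] at h2
  have h3 := Finset.sum_nonneg h1
  have h4 : ∑ q ∈ weak ∪ strict, c q * q.eval v = 0 := by linarith
  have h5 := (Finset.sum_eq_zero_iff_of_nonneg h1).1 h4
  rw [h x, show c₀ = 0 by linarith, add_zero]
  refine Finset.sum_eq_zero fun q hq => ?_
  rcases mul_eq_zero.1 (h5 q hq) with h6 | h6
  · rw [h6, zero_mul]
  · by_contra h7
    exact hvt q hq ⟨x, hx, fun h8 => h7 (by rw [h8, mul_zero])⟩ h6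

section Limits

variable {n m : ℕ} {P : Set (Fin m → ℝ)}

/-- The absolute value of the smooth part of a monomial. -/
def mabs (q : IntAffine m) (e : model n P) : ℝ := ‖(monomial q (zc e)).smoothPart‖

theorem mabs_nonneg (q : IntAffine m) (e : model n P) : 0 ≤ mabs q e := norm_nonneg _

theorem mabs_of_ne {q : IntAffine m} {e : model n P} (h : q.eval (tc e) ≠ 0) : mabs q e = 0 := by
  rw [mabs, CStarT.smoothPart, if_neg (by rwa [trop_monomial_zc]), norm_zero]

theorem norm_monomial_fst (q : IntAffine m) (e : model n P) :
    ‖((monomial q (zc e)).1 : ℂ)‖ = Real.exp (-q.lin fun i => -Real.log ‖((zc e i).1 : ℂ)‖) := by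
  rw [monomial_fst, Units.coe_prod, norm_prod, IntAffine.lin, ← Finset.sum_neg_distrib, Real.exp_sum]
  refine Finset.prod_congr rfl fun i _ => ?_
  rw [Units.val_zpow_eq_zpow_val, norm_zpow, neg_mul, neg_neg, mul_comm, ← Real.log_zpow,
    Real.exp_log (zpow_pos (norm_pos_iff.2 (Units.ne_zero _)) _)]

theorem mabs_of_eq {q : IntAffine m} {e : model n P} (h : q.eval (tc e) = 0) :
    mabs q e = Real.exp (-q.lin fun i => -Real.log ‖((zc e i).1 : ℂ)‖) := by
  rw [mabs, CStarT.smoothPart_of_eq (by rwa [trop_monomial_zc]), norm_monomial_fst]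

/-- The multiplicative form of Farkas' lemma. If `r` vanishes at the exponent of `e`, so does every
`q` with `c q > 0`, and the two sides are equal; otherwise the left side is zero. -/
theorem mabs_le_prod {t : Finset (IntAffine m)} (ht : ∀ q ∈ t, ∀ y ∈ P, 0 ≤ q.eval y)
    {r : IntAffine m} {c : IntAffine m → ℝ} {c₀ : ℝ} (hc : ∀ q, 0 ≤ c q) (hc₀ : 0 ≤ c₀)
    (h : ∀ y, r.eval y = ∑ q ∈ t, c q * q.eval y + c₀) (e : model n P) :
    mabs r e ≤ ∏ q ∈ t, mabs q e ^ c q := by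
  have h0 : 0 ≤ ∏ q ∈ t, mabs q e ^ c q :=
    Finset.prod_nonneg fun q _ => Real.rpow_nonneg (mabs_nonneg q e) _
  by_cases hr : r.eval (tc e) = 0
  · have h1 : ∀ q ∈ t, 0 ≤ c q * q.eval (tc e) := fun q hq =>
      mul_nonneg (hc q) (ht q hq _ (tc_mem e))
    have h2 := h (tc e)
    rw [hr] at h2
    have h3 := (Finset.sum_eq_zero_iff_of_nonneg h1).1 (by linarith [Finset.sum_nonneg h1])
    have h4 : ∀ y, r.lin y = ∑ q ∈ t, c q * q.lin y := by
      intro y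
      have h5 : ∀ q : IntAffine m, q.lin y = q.eval y - q.eval 0 := fun q => by
        rw [← IntAffine.lin_sub, sub_zero]
      simp only [h5, h, mul_sub, Finset.sum_sub_distrib]
      ring
    rw [mabs_of_eq hr, h4, ← Finset.sum_neg_distrib, Real.exp_sum]
    refine (Finset.prod_congr rfl fun q hq => ?_).le
    rcases eq_or_ne (c q) 0 with h5 | h5
    · rw [h5, zero_mul, neg_zero, Real.exp_zero, Real.rpow_zero]
    · rw [mabs_of_eq ((mul_eq_zero.1 (h3 q hq)).resolve_left h5), ← Real.exp_mul]
      ring_nf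
  · rwa [mabs_of_ne hr]

/-- The lattice of slopes of integral affine functions vanishing on `P` is a direct summand. -/
theorem exists_vanishing_projection (P : Set (Fin m → ℝ)) :
    ∃ R : Fin m → IntAffine m, (∀ i, ∀ y ∈ P, (R i).eval y = 0) ∧
      ∀ q : IntAffine m, (∀ y ∈ P, q.eval y = 0) → q.2 = ∑ i, q.2 i • (R i).2 := by
  classical
  let Γ : Submodule ℤ (Fin m → ℤ) :=
    { carrier := {α | ∃ a : ℝ, ∀ y ∈ P, IntAffine.eval (a, α) y = 0}
      zero_mem' := ⟨0, fun y _ => by simp [IntAffine.eval]⟩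
      add_mem' := by
        rintro α β ⟨a, ha⟩ ⟨b, hb⟩
        refine ⟨a + b, fun y hy => ?_⟩
        have := IntAffine.eval_add (a, α) (b, β) y
        rw [ha y hy, hb y hy, add_zero] at this
        exact this
      smul_mem' := by
        rintro k α ⟨a, ha⟩
        refine ⟨k * a, fun y hy => ?_⟩
        have h1 := ha y hy
        simp only [IntAffine.eval] at h1 ⊢
        have h2 : ∑ i, y i * (((k • α) i : ℤ) : ℝ) = k * ∑ i, y i * (α i : ℝ) := by
          rw [Finset.mul_sum]
          refine Finset.sum_congr rfl fun i _ => ?_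
          rw [Pi.smul_apply, smul_eq_mul, Int.cast_mul]; ring
        rw [h2, ← mul_add, h1, mul_zero] }
  -- Saturation makes the quotient by `Γ` torsion free, hence free, so the quotient map splits and
  -- projects the lattice onto `Γ`.
  have hsat : ∀ (k : ℤ) (α : Fin m → ℤ), k ≠ 0 → k • α ∈ Γ → α ∈ Γ := by
    rintro k α hk ⟨a, ha⟩
    refine ⟨a / k, fun y hy => ?_⟩
    have hk' : (k : ℝ) ≠ 0 := by exact_mod_cast hk
    have h1 := ha y hy
    simp only [IntAffine.eval] at h1 ⊢
    have h2 : ∑ i, y i * (((k • α) i : ℤ) : ℝ) = k * ∑ i, y i * (α i : ℝ) := by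
      rw [Finset.mul_sum]
      refine Finset.sum_congr rfl fun i _ => ?_
      rw [Pi.smul_apply, smul_eq_mul, Int.cast_mul]; ring
    rw [h2] at h1
    field_simp
    linarith
  have htf : Module.IsTorsionFree ℤ ((Fin m → ℤ) ⧸ Γ) := by
    refine ⟨fun k hk => ?_⟩
    have hk0 : k ≠ 0 := hk.ne_zero
    intro x y hxy
    obtain ⟨x, rfl⟩ := Submodule.Quotient.mk_surjective _ x
    obtain ⟨y, rfl⟩ := Submodule.Quotient.mk_surjective _ y
    simp only [← Submodule.Quotient.mk_smul] at hxy
    rw [Submodule.Quotient.eq, ← smul_sub] at hxy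
    exact (Submodule.Quotient.eq _).2 (hsat k _ hk0 hxy)
  obtain ⟨s, hs⟩ := Module.projective_lifting_property Γ.mkQ LinearMap.id Γ.mkQ_surjective
  have hs' : ∀ y, Γ.mkQ (s y) = y := fun y => LinearMap.congr_fun hs y
  let ρ : (Fin m → ℤ) →ₗ[ℤ] (Fin m → ℤ) := LinearMap.id - s.comp Γ.mkQ
  have hρ : ∀ α, ρ α ∈ Γ := fun α => by
    have h : Γ.mkQ (α - s (Γ.mkQ α)) = 0 := by rw [map_sub, hs', sub_self]
    rw [← LinearMap.mem_ker, Submodule.ker_mkQ] at h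
    exact h
  choose a ha using fun i => hρ (Pi.single i 1)
  refine ⟨fun i => (a i, ρ (Pi.single i 1)), ha, fun q hq => ?_⟩
  have h1 : Γ.mkQ q.2 = 0 := by
    rw [← LinearMap.mem_ker, Submodule.ker_mkQ]; exact ⟨q.1, hq⟩
  have h2 : ρ q.2 = q.2 := by
    change q.2 - s (Γ.mkQ q.2) = q.2
    rw [h1, map_zero, sub_zero]
  have h3 : q.2 = ∑ i, q.2 i • (Pi.single i 1 : Fin m → ℤ) := by
    conv_lhs => rw [pi_eq_sum_univ q.2]
    refine Finset.sum_congr rfl fun i _ => ?_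
    congr 1
    funext j
    simp [Pi.single_apply, eq_comm]
  conv_lhs => rw [← h2, h3, map_sum]
  exact Finset.sum_congr rfl fun i _ => map_smul _ _ _

/-- An ultrafilter converges in a model if its real coordinates converge and the absolute values of
the defining monomials are bounded, and converge to zero for those not vanishing identically. -/
theorem exists_le_nhds_of_bounded {weak strict : Finset (IntAffine m)}
    (hP : P = {y | (∀ q ∈ weak, 0 ≤ q.eval y) ∧ ∀ q ∈ strict, 0 < q.eval y})
    (𝓥 : Ultrafilter (model n P)) {x₀ : Fin n → ℝ} (hx : Tendsto (fun e : model n P => xc e) 𝓥 (𝓝 x₀))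
    (hb : ∀ q ∈ weak ∪ strict, ∃ K, ∀ᶠ e : model n P in 𝓥, mabs q e ≤ K)
    (h0 : ∀ q ∈ weak ∪ strict, (∃ y ∈ P, q.eval y ≠ 0) → Tendsto (fun e : model n P => mabs q e) 𝓥 (𝓝 0)) :
    ∃ d : model n P, (𝓥 : Filter (model n P)) ≤ 𝓝 d := by
  classical
  have hP' : ∀ y, y ∈ P ↔ (∀ q ∈ weak, 0 ≤ q.eval y) ∧ ∀ q ∈ strict, 0 < q.eval y := by simp [hP]
  have hne : P.Nonempty := by
    obtain ⟨e, -⟩ := (univ_mem : Set.univ ∈ (𝓥 : Filter (model n P))) |> nonempty_of_mem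
    exact ⟨_, tc_mem e⟩
  have hpos : ∀ q ∈ weak ∪ strict, ∀ y ∈ P, 0 ≤ q.eval y := fun q hq y hy => by
    rcases Finset.mem_union.1 hq with h | h
    · exact ((hP' y).1 hy).1 q h
    · exact (((hP' y).1 hy).2 q h).le
  choose! K hK using hb
  -- nonnegative functions have bounded monomials
  have hbd : ∀ r : IntAffine m, (∀ y ∈ P, 0 ≤ r.eval y) → ∃ K, ∀ᶠ e : model n P in 𝓥, mabs r e ≤ K := by
    intro r hr
    obtain ⟨c, c₀, hc, hc₀, h⟩ := exists_combination hP' hne hr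
    refine ⟨∏ q ∈ weak ∪ strict, K q ^ c q, ?_⟩
    filter_upwards [(Finset.eventually_all _).2 hK] with e he
    refine (mabs_le_prod hpos hc hc₀ h e).trans ?_
    exact Finset.prod_le_prod (fun q _ => Real.rpow_nonneg (mabs_nonneg q e) _) fun q hq =>
      Real.rpow_le_rpow (mabs_nonneg q e) (he q hq) (hc q)
  have hzero : ∀ r : IntAffine m, (∀ y ∈ P, 0 ≤ r.eval y) → (∃ y ∈ P, r.eval y ≠ 0) →
      Tendsto (fun e : model n P => mabs r e) 𝓥 (𝓝 0) := by
    rintro r hr ⟨y, hy, hry⟩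
    obtain ⟨c, c₀, hc, hc₀, h⟩ := exists_combination hP' hne hr
    rcases hc₀.eq_or_lt' with hc₀' | hc₀'
    · obtain ⟨q, hq, hqy⟩ : ∃ q ∈ weak ∪ strict, c q * q.eval y ≠ 0 := by
        refine Finset.exists_ne_zero_of_sum_ne_zero ?_
        have := h y
        rw [hc₀', add_zero] at this
        rwa [← this]
      have hcq : 0 < c q := lt_of_le_of_ne (hc q) (left_ne_zero_of_mul hqy).symm
      have h1 := h0 q hq ⟨y, hy, right_ne_zero_of_mul hqy⟩
      have h2 : Tendsto (fun e : model n P => mabs q e ^ c q * ∏ q' ∈ (weak ∪ strict).erase q, K q' ^ c q') 𝓥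
          (𝓝 0) := by
        have h3 := (h1.rpow_const (p := c q) (Or.inr hcq.le)).mul_const
          (∏ q' ∈ (weak ∪ strict).erase q, K q' ^ c q')
        rwa [Real.zero_rpow hcq.ne', zero_mul] at h3
      refine squeeze_zero' (Eventually.of_forall fun e => mabs_nonneg r e) ?_ h2
      filter_upwards [(Finset.eventually_all _).2 hK] with e he
      refine (mabs_le_prod hpos hc hc₀ h e).trans ?_
      rw [← Finset.mul_prod_erase _ _ hq]
      refine mul_le_mul_of_nonneg_left ?_ (Real.rpow_nonneg (mabs_nonneg q e) _)
      exact Finset.prod_le_prod (fun q _ => Real.rpow_nonneg (mabs_nonneg q e) _) fun q hq =>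
        Real.rpow_le_rpow (mabs_nonneg q e) (he q (Finset.mem_of_mem_erase hq)) (hc q)
    · refine tendsto_const_nhds.congr' (Eventually.of_forall fun e => (mabs_of_ne ?_).symm)
      rw [h]
      have := Finset.sum_nonneg fun q hq => mul_nonneg (hc q) (hpos q hq _ (tc_mem e))
      exact ne_of_gt (by linarith)
  obtain ⟨v, hv, hrel⟩ := exists_relInt ⟨weak, strict, hP⟩ hne
  obtain ⟨R, hR0, hR⟩ := exists_vanishing_projection P
  -- limits of the coefficients
  have hζ : ∀ i, ∃ ζ : ℂ, ζ ≠ 0 ∧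
      Tendsto (fun e : model n P => ((monomial (R i) (zc e)).1 : ℂ)) 𝓥 (𝓝 ζ) := by
    intro i
    have hR0' : ∀ y ∈ P, (-R i).eval y = 0 := fun y hy => by
      rw [IntAffine.eval_neg, hR0 i y hy, neg_zero]
    obtain ⟨K₁, hK₁⟩ := hbd (R i) fun y hy => (hR0 i y hy).ge
    obtain ⟨K₂, hK₂⟩ := hbd (-R i) fun y hy => (hR0' y hy).ge
    have e1 : ∀ e : model n P, mabs (R i) e = ‖((monomial (R i) (zc e)).1 : ℂ)‖ := fun e => by
      rw [mabs, CStarT.smoothPart_of_eq (by rw [trop_monomial_zc]; exact hR0 i _ (tc_mem e))]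
    have e2 : ∀ e : model n P, mabs (-R i) e = ‖((monomial (R i) (zc e)).1 : ℂ)‖⁻¹ := fun e => by
      rw [mabs, CStarT.smoothPart_of_eq (by rw [trop_monomial_zc]; exact hR0' _ (tc_mem e)),
        monomial_neg, Prod.fst_inv, Units.val_inv_eq_inv_val, norm_inv]
    have hcpt : IsCompact (Metric.closedBall (0 : ℂ) K₁) := isCompact_closedBall _ _
    obtain ⟨ζ, -, hζ⟩ := hcpt.ultrafilter_le_nhds
      (𝓥.map fun e : model n P => ((monomial (R i) (zc e)).1 : ℂ)) (by
        rw [le_principal_iff]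
        exact hK₁.mono fun e he => by simpa [e1] using he)
    -- The inverse monomial also vanishes identically on `P`, so it is bounded as well, and the
    -- limit cannot be zero.
    refine ⟨ζ, fun h => ?_, hζ⟩
    have h1 : Tendsto (fun e : model n P => ‖((monomial (R i) (zc e)).1 : ℂ)‖ * K₂) 𝓥
        (𝓝 (‖ζ‖ * K₂)) := (Tendsto.norm hζ).mul_const _
    rw [h, norm_zero, zero_mul] at h1
    have h2 : ∀ᶠ e in (𝓥 : Filter (model n P)), 1 ≤ ‖((monomial (R i) (zc e)).1 : ℂ)‖ * K₂ := by
      filter_upwards [hK₂] with e he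
      rw [e2] at he
      have hpos' : 0 < ‖((monomial (R i) (zc e)).1 : ℂ)‖ := norm_pos_iff.2 (Units.ne_zero _)
      rw [← mul_inv_cancel₀ hpos'.ne']
      exact mul_le_mul_of_nonneg_left he hpos'.le
    exact absurd (ge_of_tendsto h1 h2) (by norm_num)
  choose ζ hζ0 hζ using hζ
  -- The limit point gets a relatively interior exponent, so at it every smooth monomial is zero
  -- unless its exponent vanishes on all of `P`; the latter ones are determined by the limits `ζ`
  -- through the projection `R`.
  obtain ⟨d, hdx, hdz⟩ := exists_pt_model (P := P) x₀ (fun i => CStarT.mk (toUnit (ζ i)) (v i))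
    (by rw [show tropv (fun i => CStarT.mk (toUnit (ζ i)) (v i)) = v from rfl]; exact hv)
  have hdt : tc d = v := by rw [tc, hdz]; rfl
  refine ⟨d, ?_⟩
  change Tendsto (fun e => e) (𝓥 : Filter (model n P)) (𝓝 d)
  refine tendsto_model_iff.2 ⟨hdx ▸ hx, fun q => ?_⟩
  by_cases h : ∃ y ∈ P, q.1.eval y ≠ 0
  · have h1 : q.1.eval v ≠ 0 := fun h1 => by
      obtain ⟨y, hy, hqy⟩ := h
      exact hqy (hrel q.1 q.2 h1 y hy)
    have h2 : smon q d = 0 := by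
      rw [smon, CStarT.smoothPart, if_neg (by rwa [trop_monomial_zc, hdt])]
    rw [h2]
    exact tendsto_zero_iff_norm_tendsto_zero.2 (hzero q.1 q.2 h)
  · push Not at h
    have h1 : ∀ e : model n P, smon q e = (monomial q.1 (zc e)).1 := smon_eq_coeff h
    have h2 := hR q.1 h
    have h3 : ∀ e : model n P, smon q e =
        ∏ i, ((monomial (R i) (zc e)).1 : ℂ) ^ q.1.2 i := by
      intro e
      rw [h1]
      have : (monomial q.1 (zc e)).1 = ∏ i, (monomial (R i) (zc e)).1 ^ q.1.2 i := by
        have h5 : (∑ i, q.1.2 i • R i).2 = q.1.2 := by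
          rw [Prod.snd_sum]; exact h2.symm
        rw [monomial_fst, ← h5, ← monomial_fst, monomial_sum, Prod.fst_prod]
        simp only [monomial_zsmul]
        rw [h5]
        rfl
      rw [this, Units.coe_prod]
      simp only [Units.val_zpow_eq_zpow_val]
    have h4 : smon q d = ∏ i, ζ i ^ q.1.2 i := by
      rw [h1, monomial_fst, Units.coe_prod]
      refine Finset.prod_congr rfl fun i _ => ?_
      rw [Units.val_zpow_eq_zpow_val, hdz, CStarT.mk_fst, coe_toUnit (hζ0 i)]
    simp only [h3]
    rw [← h3, h4]
    exact tendsto_finsetProd _ fun i _ => (hζ i).zpow₀ _ (Or.inl (hζ0 i))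

end Limits

/-! ### Properties of the fiber product -/

theorem Inseparable.map_of_continuousAt {S T : Type*} [TopologicalSpace S] [TopologicalSpace T]
    {h : S → T} {a b : S} (hab : Inseparable a b) (ha : ContinuousAt h a) (hb : ContinuousAt h b) :
    Inseparable (h a) (h b) := by
  have key : ∀ {a b : S}, Inseparable a b → ContinuousAt h b → h a ⤳ h b := fun {a b} hab hb => by
    rw [specializes_iff_pure, ← map_pure]
    exact (map_mono ((pure_le_nhds a).trans hab.nhds_eq.le)).trans hb
  exact inseparable_iff_specializes_and.2 ⟨key hab hb, key hab.symm ha⟩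

instance {n m : ℕ} {P : Set (Fin m → ℝ)} : R1Space (model n P) :=
  IsInducing.r1Space (f := fun p : model n P => (xc p, fun q : NonnegMonomial P => smon q p))
    (isInducing_iff_nhds.2 nhds_model)

/-- Properness of the map of smooth parts, expressed on the spaces themselves: limits exist, but are
mapped to the prescribed limit only up to topological indistinguishability. -/
theorem Hom.isProper_iff {X Y : AbstractExplodedSpace.{u}} (f : Hom X Y) :
    f.IsProper ↔ ∀ (𝓤 : Ultrafilter X) (y : Y), Tendsto f 𝓤 (𝓝 y) →
      ∃ x, Inseparable (f x) y ∧ (𝓤 : Filter X) ≤ 𝓝 x := by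
  constructor
  · intro h 𝓤 y hy
    have h1 : Tendsto f.smoothPartMap (𝓤.map SeparationQuotient.mk)
        (𝓝 (SeparationQuotient.mk y)) :=
      (SeparationQuotient.continuous_mk.tendsto y).comp hy
    obtain ⟨x, hx, hx'⟩ := IsProperMap.ultrafilter_le_nhds_of_tendsto h h1
    obtain ⟨x, rfl⟩ := SeparationQuotient.surjective_mk x
    refine ⟨x, SeparationQuotient.mk_eq_mk.1 hx, ?_⟩
    rw [← SeparationQuotient.comap_mk_nhds_mk, ← map_le_iff_le_comap]
    exact hx'
  · intro h
    refine isProperMap_iff_ultrafilter.2 ⟨SeparationQuotient.continuous_lift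
      (SeparationQuotient.continuous_mk.comp f.continuous'), fun 𝒰 y hy => ?_⟩
    obtain ⟨y, rfl⟩ := SeparationQuotient.surjective_mk y
    let o : SmoothPart X → X := Function.surjInv SeparationQuotient.surjective_mk
    have ho : ∀ x, SeparationQuotient.mk (o x) = x :=
      Function.surjInv_eq SeparationQuotient.surjective_mk
    obtain ⟨x, hx, hx'⟩ := h (𝒰.map o) y (by
      rw [SeparationQuotient.isInducing_mk.tendsto_nhds_iff]
      change Tendsto (fun x => SeparationQuotient.mk (f (o x))) 𝒰 _
      refine hy.congr fun x => ?_
      conv_lhs => rw [← ho x]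
      rfl)
    refine ⟨SeparationQuotient.mk x, SeparationQuotient.mk_eq_mk.2 hx, ?_⟩
    have h2 : Tendsto (fun x => SeparationQuotient.mk (o x)) 𝒰 (𝓝 (SeparationQuotient.mk x)) :=
      (SeparationQuotient.continuous_mk.tendsto x).comp hx'
    simp only [ho] at h2
    exact h2

section Global

variable {X Y Z : AbstractExplodedSpace.{u}} {f : Hom X Y} {g : Hom Z Y}

/-- The images of `p` and `q` are only required to be inseparable. In the proof of properness the
limits produced in `X` and `Z` need not lie over the same point of `Y`. -/
theorem exists_chartData (hX : ∀ x : X, GoodPt X x) (hY : ∀ y : Y, GoodPt Y y)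
    (hZ : ∀ z : Z, GoodPt Z z) (hinj : Function.Injective f)
    (hf : ∀ x, Function.Surjective (f.deriv x)) {p : X} {q : Z} (hpq : Inseparable (f p) (g q)) :
    ∃ (n m l k : ℕ) (P₁ P₂ : Set (Fin m → ℝ)) (Q : Set (Fin k → ℝ)) (φ : Y → model n P₁)
      (ψ : model n P₁ → Y) (φ' : X → model n P₂) (ψ' : model n P₂ → X) (χ : Z → model l Q)
      (χ' : model l Q → Z) (A : Fin m → IntAffine k) (H : Fin m → model l Q → ℂ) (NX : Set X)
      (OP : Set (model n P₂)) (NZ : Set Z) (OQ : Set (model l Q)),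
      ChartData f g φ ψ φ' ψ' χ χ' A H NX OP NZ OQ ∧ p ∈ NX ∧ q ∈ NZ ∧ IsPoly P₂ ∧ IsPoly Q ∧
      RelInt P₂ (tc (φ' p)) ∧ tc (χ q) ∈ interior Q ∧ LocIso Z (model l Q) χ χ' q (χ q) ∧
      ∀ j, ContinuousAt (H j) (χ q) ∧ H j (χ q) ≠ 0 := by
  obtain ⟨n, m, P₁, P₂, φ, ψ, e, φ', ψ', e', -, -, hφ, hP₂, -, he', hφ', hagree⟩ :=
    exists_subpolytope_charts hX hY hinj (hf p)
  obtain ⟨l, k, Q, c, χ, χ', hQ, hc, hχ⟩ := hZ q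
  obtain rfl := hφ'.map
  obtain rfl := hχ.map
  -- Inseparable points have the same neighbourhoods, so the chart of `Y` at `f p` also serves at `g
  -- q`.
  have hYq := hpq.nhds_eq ▸ hφ.morAt.and hφ.left_inv
  have hG : MorAt (model l Q) (model n P₁) (fun w => φ (g (χ' w))) (χ q) := by
    refine MorAt.comp (g := φ) ?_ (MorAt.comp (g.morAt _) hχ.morAt_symm.self_of_nhds)
    rw [hχ.map_symm]
    exact hYq.self_of_nhds.1
  have hz : ∀ j, ∃ (H : model l Q → ℂ) (r : IntAffine k), SmM H (χ q) ∧ H (χ q) ≠ 0 ∧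
      ∀ᶠ w in 𝓝 (χ q), zc (φ (g (χ' w))) j = CStarT.mk (toUnit (H w)) 0 * monomial r (zc w) :=
    fun j => secAt_model_iff.1 (hG.2 _ (secAt_zc j _))
  choose H A hH hH0 hHA using hz
  obtain ⟨NX, OP, hpNX, hNX, hisoX⟩ := hφ'.exists_subIso
    (hagree.and ((f.continuous'.tendsto p).eventually hφ.left_inv))
  obtain ⟨NZ, OQ, hqNZ, hNZ, hisoZ⟩ := hχ.exists_subIso
    (((g.continuous'.tendsto q).eventually hYq).and
      ((hχ.tendsto.eventually (eventually_all.2 hHA)).and hχ.left_inv))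
  refine ⟨n, m, l, k, P₁, P₂, Q, φ, ψ, φ', ψ', χ, χ', A, H, NX, OP, NZ, OQ,
    ⟨hisoX, hisoZ, fun x hx => (hNX hx).1, fun x hx => (hNX hx).2, fun z hz => (hNZ hz).1.2,
      fun z hz => (hNZ hz).1.1, fun z hz j => ?_⟩, hpNX, hqNZ, hP₂, hQ.2, he', hc, hχ,
    fun j => ⟨(hH j).continuousAt, hH0 j⟩⟩
  have h1 := (hNZ hz).2.1 j
  rwa [(hNZ hz).2.2] at h1

/-- Charts of the fiber product. -/
theorem exists_chart_pullback (hX : ∀ x : X, GoodPt X x) (hY : ∀ y : Y, GoodPt Y y)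
    (hZ : ∀ z : Z, GoodPt Z z) (hinj : Function.Injective f)
    (hf : ∀ x, Function.Surjective (f.deriv x)) (s : pullbackSpace f g) :
    ∃ (l k : ℕ) (Q R : Set (Fin k → ℝ)) (hRQ : R ⊆ Q) (χ : Z → model l Q) (χ' : model l Q → Z)
      (Φ : pullbackSpace f g → model l R) (Ω : model l R → pullbackSpace f g),
      IsPoly R ∧ tc (χ (pullbackSnd f g s)) ∈ interior Q ∧
      LocIso Z (model l Q) χ χ' (pullbackSnd f g s) (χ (pullbackSnd f g s)) ∧
      LocIso (pullbackSpace f g) (model l R) Φ Ω s (Φ s) ∧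
      ∀ᶠ t in 𝓝 s, incl hRQ (Φ t) = χ (pullbackSnd f g t) := by
  have hs : Inseparable (f (pullbackFst f g s)) (g (pullbackSnd f g s)) := by
    rw [pullback_comm]
  obtain ⟨n, m, l, k, P₁, P₂, Q, φ, ψ, φ', ψ', χ, χ', A, H, NX, OP, NZ, OQ, D, hpX, hqZ, hP₂, hQ,
    -, hc, hχ, -⟩ := exists_chartData hX hY hZ hinj hf hs
  obtain ⟨G, hG⟩ := D.exists_transition hQ hP₂ (φ' (pullbackFst f g s))
  obtain ⟨Φ, Ω, h1, h2⟩ := D.exists_chart hQ hP₂ hG hpX hqZ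
  have hev : ∀ᶠ t in 𝓝 s, pullbackFst f g t ∈ NX ∧ pullbackSnd f g t ∈ NZ :=
    (((pullbackFst f g).continuous'.tendsto s).eventually (D.isoX.isOpen_source.mem_nhds hpX)).and
      (((pullbackSnd f g).continuous'.tendsto s).eventually (D.isoZ.isOpen_source.mem_nhds hqZ))
  have hs := h1 s hpX hqZ
  have hO : incl cut_subset (Φ s) ∈ OQ := by rw [hs.1]; exact D.isoZ.mapsTo _ hqZ
  have hO' : G (Φ s) ∈ OP := by rw [hs.2.1]; exact D.isoX.mapsTo _ hpX
  have hevD : ∀ᶠ w in 𝓝 (Φ s), incl cut_subset w ∈ OQ ∧ G w ∈ OP :=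
    ((morAt_incl (n := l) (isPoly_cut hQ hP₂) (cut_subset (Q := Q)) (Φ s)).1.eventually
      (D.isoZ.isOpen_target.mem_nhds hO)).and
      ((hG _ hO).2.2.1.eventually (D.isoX.isOpen_target.mem_nhds hO'))
  exact ⟨l, k, Q, cut Q A P₂, cut_subset, χ, χ', Φ, Ω, isPoly_cut hQ hP₂, hc, hχ,
    ⟨rfl, hs.2.2.2, hev.mono fun t ht => (h1 t ht.1 ht.2).2.2.1,
      hevD.mono fun w hw => (h2 w hw.1 hw.2).1, hev.mono fun t ht => (h1 t ht.1 ht.2).2.2.2,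
      hevD.mono fun w hw => (h2 w hw.1 hw.2).2.2.2⟩,
    hev.mono fun t ht => (h1 t ht.1 ht.2).1⟩

theorem goodPt_pullback (hX : ∀ x : X, GoodPt X x) (hY : ∀ y : Y, GoodPt Y y)
    (hZ : ∀ z : Z, GoodPt Z z) (hinj : Function.Injective f)
    (hf : ∀ x, Function.Surjective (f.deriv x)) (s : pullbackSpace f g) :
    GoodPt (pullbackSpace f g) s := by
  obtain ⟨l, k, Q, R, -, -, -, Φ, Ω, hR, -, -, h, -⟩ := exists_chart_pullback hX hY hZ hinj hf s
  exact GoodPt.of_locIso h (goodPt_model hR _)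

/-- All velocities in `Z` are realised by paths in the fiber product. -/
theorem exists_path_pullback (hX : ∀ x : X, GoodPt X x) (hY : ∀ y : Y, GoodPt Y y)
    (hZ : ∀ z : Z, GoodPt Z z) (hinj : Function.Injective f)
    (hf : ∀ x, Function.Surjective (f.deriv x)) (s : pullbackSpace f g) :
    ∃ (l k : ℕ) (Q : Set (Fin k → ℝ)) (χ : Z → model l Q) (χ' : model l Q → Z),
      tc (χ (pullbackSnd f g s)) ∈ interior Q ∧
      LocIso Z (model l Q) χ χ' (pullbackSnd f g s) (χ (pullbackSnd f g s)) ∧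
      ∀ (a : Fin l → ℝ) (c : Fin k → ℂ), ∃ γ : ℝ → pullbackSpace f g,
        MorAt realLine (pullbackSpace f g) γ (0 : ℝ) ∧ γ 0 = s ∧
        (∀ j, deriv (fun t => xc (χ (pullbackSnd f g (γ t))) j) 0 = a j) ∧
        ∀ i, deriv (fun t => ((zc (χ (pullbackSnd f g (γ t))) i).1 : ℂ)) 0 =
          c i * (zc (χ (pullbackSnd f g s)) i).1 := by
  obtain ⟨l, k, Q, R, hRQ, χ, χ', Φ, Ω, hR, hc, hχ, h, hΦ⟩ :=
    exists_chart_pullback hX hY hZ hinj hf s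
  refine ⟨l, k, Q, χ, χ', hc, hχ, fun a c => ⟨chartPath Ω (Φ s) a c, h.morAt_path a c,
    h.path_zero a c, ?_⟩⟩
  have hev : ∀ᶠ t in 𝓝 (0 : ℝ), χ (pullbackSnd f g (chartPath Ω (Φ s) a c t)) =
      incl hRQ (linePath (Φ s) a c t) := by
    filter_upwards [h.eventually_path a c,
      (tendsto_path (h.morAt_path a c) (h.path_zero a c)).eventually hΦ] with t h1 h2
    rw [← h2, h1]
  refine ⟨fun j => ?_, fun i => ?_⟩
  · rw [← deriv_xc_linePath (Φ s) a c j]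
    refine EventuallyEq.deriv_eq (hev.mono fun t ht => ?_)
    simp only [ht, xc_incl]
  · rw [← hΦ.self_of_nhds, zc_incl, ← deriv_zc_linePath (Φ s) a c i]
    refine EventuallyEq.deriv_eq (hev.mono fun t ht => ?_)
    simp only [ht, zc_incl]

/-- Points whose components are not both inseparable are separated by a projection. Otherwise both
points lie in the domain of one chart, and models are `R1Space`. -/
theorem r1Space_pullback (hX : ∀ x : X, GoodPt X x) (hY : ∀ y : Y, GoodPt Y y)
    (hZ : ∀ z : Z, GoodPt Z z) (hinj : Function.Injective f)
    (hf : ∀ x, Function.Surjective (f.deriv x)) (h₁ : R1Space X) (h₂ : R1Space Z) :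
    R1Space (pullbackSpace f g) := by
  rw [r1Space_iff_inseparable_or_disjoint_nhds] at h₁ h₂ ⊢
  intro s t
  rcases h₁ (pullbackFst f g s) (pullbackFst f g t) with hst₁ | hst₁
  swap
  · exact Or.inr (((pullbackFst f g).continuous'.tendsto s).disjoint hst₁
      ((pullbackFst f g).continuous'.tendsto t))
  rcases h₂ (pullbackSnd f g s) (pullbackSnd f g t) with hst₂ | hst₂
  swap
  · exact Or.inr (((pullbackSnd f g).continuous'.tendsto s).disjoint hst₂
      ((pullbackSnd f g).continuous'.tendsto t))
  have hs : Inseparable (f (pullbackFst f g s)) (g (pullbackSnd f g s)) := by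
    rw [pullback_comm]
  obtain ⟨n, m, l, k, P₁, P₂, Q, φ, ψ, φ', ψ', χ, χ', A, H, NX, OP, NZ, OQ, D, hpX, hqZ, hP₂, hQ,
    -⟩ := exists_chartData hX hY hZ hinj hf hs
  obtain ⟨G, hG⟩ := D.exists_transition hQ hP₂ (φ' (pullbackFst f g s))
  obtain ⟨Φ, Ω, h1, h2⟩ := D.exists_chart hQ hP₂ hG hpX hqZ
  have hpX' := (hst₁.mem_open_iff D.isoX.isOpen_source).1 hpX
  have hqZ' := (hst₂.mem_open_iff D.isoZ.isOpen_source).1 hqZ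
  have hΩ : ∀ s, pullbackFst f g s ∈ NX → pullbackSnd f g s ∈ NZ → ContinuousAt Ω (Φ s) := by
    intro s hpX hqZ
    have hs := h1 s hpX hqZ
    refine (h2 _ ?_ ?_).1.1
    · rw [hs.1]; exact D.isoZ.mapsTo _ hqZ
    · rw [hs.2.1]; exact D.isoX.mapsTo _ hpX
  rcases r1Space_iff_inseparable_or_disjoint_nhds.1 inferInstance (Φ s) (Φ t) with h | h
  · left
    have h3 := Inseparable.map_of_continuousAt h (hΩ s hpX hqZ) (hΩ t hpX' hqZ')
    rwa [(h1 s hpX hqZ).2.2.2, (h1 t hpX' hqZ').2.2.2] at h3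
  · right
    have hc₁ := (h1 s hpX hqZ).2.2.1.1
    have hc₂ := (h1 t hpX' hqZ').2.2.1.1
    exact Tendsto.disjoint hc₁ h hc₂

/-- Properness of `f` gives a limit `p` for the first components. In charts at `p` and `q`, the
monomials defining `Q` converge through the second components and those defining `P₂` through the
first; `exists_le_nhds_of_bounded` then gives a limit in the model of the cut. -/
theorem isProper_pullbackSnd (hX : ∀ x : X, GoodPt X x) (hY : ∀ y : Y, GoodPt Y y)
    (hZ : ∀ z : Z, GoodPt Z z) (hinj : Function.Injective f)
    (hf : ∀ x, Function.Surjective (f.deriv x)) (hprop : f.IsProper) :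
    (pullbackSnd f g).IsProper := by
  classical
  rw [Hom.isProper_iff] at hprop ⊢
  intro 𝓤 q hq
  obtain ⟨p, hpq, hp⟩ := hprop (𝓤.map (pullbackFst f g)) (g q) (by
    have h : Tendsto (fun s => f (pullbackFst f g s)) 𝓤 (𝓝 (g q)) :=
      ((g.continuous'.tendsto q).comp hq).congr fun s => (pullback_comm s).symm
    exact h)
  have hp : Tendsto (pullbackFst f g) 𝓤 (𝓝 p) := hp
  obtain ⟨n, m, l, k, P₁, P₂, Q, φ, ψ, φ', ψ', χ, χ', A, H, NX, OP, NZ, OQ, D, hpX, hqZ, hP₂, hQ,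
    hrel, hc, hχ, hH⟩ := exists_chartData hX hY hZ hinj hf hpq
  obtain ⟨G, hG⟩ := D.exists_transition hQ hP₂ (φ' p)
  have hev : ∀ᶠ s in (𝓤 : Filter (pullbackSpace f g)),
      pullbackFst f g s ∈ NX ∧ pullbackSnd f g s ∈ NZ :=
    (hp.eventually (D.isoX.isOpen_source.mem_nhds hpX)).and
      (hq.eventually (D.isoZ.isOpen_source.mem_nhds hqZ))
  -- No point of the fiber product over `p` and `q` is available yet, so a member of a set in the
  -- ultrafilter serves as base point of the chart.
  obtain ⟨s₀, hs₀, hs₀'⟩ := hev.exists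
  obtain ⟨Φ, Ω, h1, h2⟩ := D.exists_chart hQ hP₂ hG hs₀ hs₀'
  have hχq : Tendsto (fun s => χ (pullbackSnd f g s)) 𝓤 (𝓝 (χ q)) :=
    Tendsto.comp (D.isoZ.morAt q hqZ).1 hq
  have hφp : Tendsto (fun s => φ' (pullbackFst f g s)) 𝓤 (𝓝 (φ' p)) :=
    Tendsto.comp (D.isoX.morAt p hpX).1 hp
  have hι : Tendsto (fun s => incl cut_subset (Φ s)) 𝓤 (𝓝 (χ q)) :=
    hχq.congr' (hev.mono fun s hs => (h1 s hs.1 hs.2).1.symm)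
  have hGp : Tendsto (fun s => G (Φ s)) 𝓤 (𝓝 (φ' p)) :=
    hφp.congr' (hev.mono fun s hs => (h1 s hs.1 hs.2).2.1.symm)
  -- the absolute values of the monomials defining the polytope
  have hlimQ : ∀ r : IntAffine k, (∀ y ∈ Q, 0 ≤ r.eval y) →
      ∃ L, Tendsto (fun s => mabs r (Φ s)) 𝓤 (𝓝 L) ∧
        ((∃ y ∈ cut Q A P₂, r.eval y ≠ 0) → L = 0) := by
    intro r hr
    refine ⟨‖smon ⟨r, hr⟩ (χ q)‖, (((continuous_smon ⟨r, hr⟩).tendsto _).comp hι).norm, ?_⟩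
    rintro ⟨y, hy, hry⟩
    rw [norm_eq_zero, smon, CStarT.smoothPart, if_neg]
    rw [trop_monomial_zc]
    exact fun h => hry (relInt_of_mem_interior hc r hr h y hy.1)
  have hlimP : ∀ r : IntAffine m, (∀ y ∈ P₂, 0 ≤ r.eval y) →
      ∃ L, Tendsto (fun s => mabs (r.comp A) (Φ s)) 𝓤 (𝓝 L) ∧
        ((∃ y ∈ cut Q A P₂, (r.comp A).eval y ≠ 0) → L = 0) := by
    intro r hr
    have hH1 : ∀ j, Tendsto (fun s => H j (incl cut_subset (Φ s))) 𝓤 (𝓝 (H j (χ q))) := fun j =>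
      (hH j).1.tendsto.comp hι
    -- The monomial `r ∘ A` on the cut is the monomial `r` of `G` divided by a product of the units
    -- `H`, which have nonzero limits.
    have hT : Tendsto (fun s => ‖∏ j, H j (incl cut_subset (Φ s)) ^ r.2 j‖⁻¹) 𝓤
        (𝓝 ‖∏ j, H j (χ q) ^ r.2 j‖⁻¹) := by
      refine (Tendsto.norm (tendsto_finsetProd _ fun j _ =>
        (hH1 j).zpow₀ _ (Or.inl (hH j).2))).inv₀ ?_
      exact norm_ne_zero_iff.2 (Finset.prod_ne_zero_iff.2 fun j _ => zpow_ne_zero _ (hH j).2)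
    refine ⟨‖∏ j, H j (χ q) ^ r.2 j‖⁻¹ * ‖smon ⟨r, hr⟩ (φ' p)‖, ?_, ?_⟩
    · refine (hT.mul (((continuous_smon ⟨r, hr⟩).tendsto _).comp hGp).norm).congr' ?_
      filter_upwards [hev, eventually_all.2 fun j => (hH1 j).eventually_ne (hH j).2] with s hs hH0
      have hs' := h1 s hs.1 hs.2
      have hO : incl cut_subset (Φ s) ∈ OQ := by rw [hs'.1]; exact D.isoZ.mapsTo _ hs.2
      have hz : zc (G (Φ s)) = fun j => CStarT.mk (toUnit (H j (incl cut_subset (Φ s)))) 0 *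
          monMap A (zc (Φ s)) j := by
        funext j
        rw [(hG _ hO).2.1, D.mon _ (D.isoZ.mapsTo_symm _ hO), D.isoZ.right_inv _ hO]
        rfl
      have h0 : ‖∏ j, H j (incl cut_subset (Φ s)) ^ r.2 j‖ ≠ 0 :=
        norm_ne_zero_iff.2 (Finset.prod_ne_zero_iff.2 fun j _ => zpow_ne_zero _ (hH0 j))
      rw [Function.comp_apply, smon, hz, smoothPart_monomial_unit_mul r _ hH0, norm_mul,
        inv_mul_cancel_left₀ h0, mabs, monomial_comp]
    · rintro ⟨y, hy, hry⟩
      rw [mul_eq_zero, norm_eq_zero]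
      right
      rw [smon, CStarT.smoothPart, if_neg]
      rw [trop_monomial_zc]
      refine fun h => hry ?_
      rw [IntAffine.eval_comp]
      exact hrel r hr h _ hy.2
  -- the limit
  obtain ⟨wQ, sQ, hQe⟩ := hQ
  obtain ⟨wP, sP, hPe⟩ := hP₂
  have hlim : ∀ r ∈ (wQ ∪ wP.image (·.comp A)) ∪ (sQ ∪ sP.image (·.comp A)),
      ∃ L, Tendsto (fun s => mabs r (Φ s)) 𝓤 (𝓝 L) ∧
        ((∃ y ∈ cut Q A P₂, r.eval y ≠ 0) → L = 0) := by
    intro r hr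
    simp only [Finset.mem_union, Finset.mem_image] at hr
    rcases hr with (hr | ⟨r, hr, rfl⟩) | (hr | ⟨r, hr, rfl⟩)
    · exact hlimQ r fun y hy => by rw [hQe] at hy; exact hy.1 r hr
    · exact hlimP r fun y hy => by rw [hPe] at hy; exact hy.1 r hr
    · exact hlimQ r fun y hy => by rw [hQe] at hy; exact (hy.2 r hr).le
    · exact hlimP r fun y hy => by rw [hPe] at hy; exact (hy.2 r hr).le
  have hcut : cut Q A P₂ = {y | (∀ r ∈ wQ ∪ wP.image (·.comp A), 0 ≤ r.eval y) ∧
      ∀ r ∈ sQ ∪ sP.image (·.comp A), 0 < r.eval y} := by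
    ext y
    simp only [cut, hQe, hPe, Set.mem_inter_iff, Set.mem_preimage, Set.mem_ofPred_eq,
      Finset.mem_union, or_imp, forall_and, Finset.forall_mem_image, IntAffine.eval_comp]
    tauto
  obtain ⟨d, hd⟩ := exists_le_nhds_of_bounded hcut (𝓤.map Φ) (x₀ := xc (χ q))
    ((continuous_xc.tendsto _).comp hι) (fun r hr => by
      obtain ⟨L, hL, -⟩ := hlim r hr
      exact ⟨L + 1, (hL.eventually (gt_mem_nhds (lt_add_one L))).mono fun _ h => h.le⟩)
    fun r hr h => by
      obtain ⟨L, hL, hL0⟩ := hlim r hr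
      rw [hL0 h] at hL
      exact hL
  have hΦd : Tendsto Φ 𝓤 (𝓝 d) := hd
  have hpoly : IsPoly (cut Q A P₂) := isPoly_cut ⟨wQ, sQ, hQe⟩ ⟨wP, sP, hPe⟩
  -- Both are limits of the same ultrafilter in an `R1Space`. Inseparable points lie in the same
  -- open sets, so `d` is in the domain of the inverse chart `Ω`.
  have hιd : Inseparable (incl cut_subset d) (χ q) := tendsto_nhds_unique_inseparable
    (Tendsto.comp (morAt_incl (n := l) hpoly (cut_subset (Q := Q)) d).1 hΦd) hι
  have hO : incl cut_subset d ∈ OQ :=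
    (hιd.mem_open_iff D.isoZ.isOpen_target).2 (D.isoZ.mapsTo _ hqZ)
  have hGd : Inseparable (G d) (φ' p) := tendsto_nhds_unique_inseparable
    (Tendsto.comp (hG d hO).2.2.1 hΦd) hGp
  have hO' : G d ∈ OP := (hGd.mem_open_iff D.isoX.isOpen_target).2 (D.isoX.mapsTo _ hpX)
  obtain ⟨hΩ, -, hΩd, -⟩ := h2 d hO hO'
  refine ⟨Ω d, ?_, ?_⟩
  · rw [hΩd]
    have h3 := Inseparable.map_of_continuousAt hιd (D.isoZ.morAt_symm _ hO).1
      (D.isoZ.morAt_symm _ (D.isoZ.mapsTo _ hqZ)).1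
    rwa [D.isoZ.left_inv _ hqZ] at h3
  · have h3 : Tendsto (fun s => Ω (Φ s)) 𝓤 (𝓝 (Ω d)) := Tendsto.comp hΩ.1 hΦd
    exact h3.congr' (hev.mono fun s hs => (h1 s hs.1 hs.2).2.2.2)

end Global

/-! ### Arbitrary fiber products with a refinement. -/

section FiberProduct

variable {X Y Z W : AbstractExplodedSpace.{u}} {f : Hom X Y} {g : Hom Z Y}

/-- Any fiber product is identified with the explicit one. -/
theorem IsFiberProduct.exists_inverse {π₁ : Hom W X} {π₂ : Hom W Z}
    (h : IsFiberProduct f g π₁ π₂)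
    (hS : IsFiberProduct f g (pullbackFst f g) (pullbackSnd f g)) :
    ∃ (l : Hom W (pullbackSpace f g)) (k : Hom (pullbackSpace f g) W),
      (∀ w, k (l w) = w) ∧ (∀ s, l (k s) = s) ∧
      (∀ w, pullbackFst f g (l w) = π₁ w) ∧ ∀ w, pullbackSnd f g (l w) = π₂ w := by
  obtain ⟨l, ⟨hl₁, hl₂⟩, -⟩ := hS.existsUnique_lift W h.isExplodedManifold π₁ π₂ h.comm
  obtain ⟨k, ⟨hk₁, hk₂⟩, -⟩ := h.existsUnique_lift _ hS.isExplodedManifold _ _ hS.comm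
  have hl₁ w : pullbackFst f g (l w) = π₁ w := congrArg (fun e : Hom W X => e w) hl₁
  have hl₂ w : pullbackSnd f g (l w) = π₂ w := congrArg (fun e : Hom W Z => e w) hl₂
  have hk₁ s : π₁ (k s) = pullbackFst f g s :=
    congrArg (fun e : Hom (pullbackSpace f g) X => e s) hk₁
  have hk₂ s : π₂ (k s) = pullbackSnd f g s :=
    congrArg (fun e : Hom (pullbackSpace f g) Z => e s) hk₂
  refine ⟨l, k, fun w => ?_, fun s => pullback_ext ((hl₁ _).trans (hk₁ s))
    ((hl₂ _).trans (hk₂ s)), hl₁, hl₂⟩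
  obtain ⟨i, -, hi⟩ := h.existsUnique_lift W h.isExplodedManifold π₁ π₂ h.comm
  let idW : Hom W W := ⟨fun w => w, continuous_id, fun U F hF => hF⟩
  have h1 : k.comp l = i := hi _ ⟨Hom.ext_fun fun w => (hk₁ _).trans (hl₁ w),
    Hom.ext_fun fun w => (hk₂ _).trans (hl₂ w)⟩
  have h2 : idW = i := hi _ ⟨Hom.ext_fun fun w => rfl, Hom.ext_fun fun w => rfl⟩
  exact congrArg (fun e : Hom W W => e w) (h1.trans h2.symm)

/-- The projection of a fiber product with a refinement is a refinement. -/
theorem IsRefinement.of_isFiberProduct (hf : IsRefinement f) (hY : IsExplodedManifold Y)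
    (hZ : IsExplodedManifold Z) {π₁ : Hom W X} {π₂ : Hom W Z} (h : IsFiberProduct f g π₁ π₂) :
    IsRefinement π₂ := by
  have gX := hf.isExplodedManifold.goodPt
  have gY := hY.goodPt
  have gZ := hZ.goodPt
  have hinj := hf.bijective.1
  have hd := hf.deriv_surjective
  obtain ⟨l, k, hkl, hlk, -, hl₂⟩ := h.exists_inverse
    (isFiberProduct_pullback (goodPt_pullback gX gY gZ hinj hd))
  refine ⟨h.isExplodedManifold, ?_, ⟨fun w w' hw => ?_, fun z => ?_⟩, fun w => ?_⟩
  · have hp := isProper_pullbackSnd (g := g) gX gY gZ hinj hd hf.isProper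
    rw [Hom.isProper_iff] at hp ⊢
    intro 𝓤 q hq
    obtain ⟨s, hs, hs'⟩ := hp (𝓤.map l) q (by
      have h1 : Tendsto (fun w => pullbackSnd f g (l w)) 𝓤 (𝓝 q) :=
        hq.congr fun w => (hl₂ w).symm
      exact h1)
    refine ⟨k s, by rwa [← hl₂, hlk], ?_⟩
    have h2 : Tendsto (fun w => k (l w)) 𝓤 (𝓝 (k s)) := (k.continuous'.tendsto s).comp hs'
    have h3 : Tendsto (fun w => w) 𝓤 (𝓝 (k s)) := h2.congr hkl
    exact h3
  · rw [← hl₂, ← hl₂] at hw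
    rw [← hkl w, ← hkl w']
    refine congrArg k (pullback_ext (hinj ?_) hw)
    rw [pullback_comm, pullback_comm, hw]
  · obtain ⟨x, hx⟩ := hf.bijective.2 (g z)
    refine ⟨k (pullbackMk x z hx), ?_⟩
    rw [← hl₂, hlk]
    rfl
  · obtain ⟨n, m, Q, χ, χ', hc, hχ, hp⟩ := exists_path_pullback gX gY gZ hinj hd (l w)
    have hk s : π₂ (k s) = pullbackSnd f g s := by rw [← hl₂, hlk]
    rw [hl₂] at hc hχ
    refine surjective_of_exists_path gZ π₂ hχ hc fun a c => ?_
    obtain ⟨γ, hγ, h0, h1, h2⟩ := hp a c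
    refine ⟨fun t => k (γ t), (MorAt.comp (X := realLine) (p := (0 : ℝ)) (g := k) (f := γ) (k.morAt (γ 0)) hγ :), ?_, ?_, ?_⟩
    · change k (γ 0) = w
      rw [h0, hkl]
    · simpa only [hk] using h1
    · simpa only [hk, hl₂] using h2

/-- The separation quotient of a space is Hausdorff exactly when the space is `R1Space`, a property
that passes along the homeomorphism with the explicit fiber product. -/
theorem t2Space_smoothPart_of_isFiberProduct (hf : IsRefinement f) (hY : IsExplodedManifold Y)
    (hZ : IsExplodedManifold Z) {π₁ : Hom W X} {π₂ : Hom W Z} (h : IsFiberProduct f g π₁ π₂)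
    (h₁ : T2Space (SmoothPart X)) (h₂ : T2Space (SmoothPart Z)) : T2Space (SmoothPart W) := by
  have gX := hf.isExplodedManifold.goodPt
  have gY := hY.goodPt
  have gZ := hZ.goodPt
  have hinj := hf.bijective.1
  have hd := hf.deriv_surjective
  obtain ⟨l, k, hkl, hlk, -, -⟩ := h.exists_inverse
    (isFiberProduct_pullback (goodPt_pullback gX gY gZ hinj hd))
  have := r1Space_pullback (g := g) gX gY gZ hinj hd (SeparationQuotient.t2Space_iff.1 h₁)
    (SeparationQuotient.t2Space_iff.1 h₂)
  let e : W ≃ₜ pullbackSpace f g := ⟨⟨l, k, hkl, hlk⟩, l.continuous', k.continuous'⟩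
  exact SeparationQuotient.t2Space_iff.2 e.isInducing.r1Space

end FiberProduct

end Exploded
end

/-! ### Base change of refinements. -/

theorem mainTheorem10 {B' B C : Exploded.AbstractExplodedSpace.{u}}
    (hB : Exploded.IsExplodedManifold B) (hC : Exploded.IsExplodedManifold C)
    (f : Exploded.Hom B' B) (hf : Exploded.IsRefinement f) (g : Exploded.Hom C B) :
    Exploded.IsTransverse f g ∧
    (∃ (C' : Exploded.AbstractExplodedSpace.{u}) (g' : Exploded.Hom C' B')
      (f' : Exploded.Hom C' C), Exploded.IsFiberProduct f g g' f') ∧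
    (∀ (C' : Exploded.AbstractExplodedSpace.{u}) (g' : Exploded.Hom C' B')
      (f' : Exploded.Hom C' C), Exploded.IsFiberProduct f g g' f' →
        Exploded.IsRefinement f' ∧
        (T2Space (Exploded.SmoothPart B') → T2Space (Exploded.SmoothPart C) →
          T2Space (Exploded.SmoothPart C'))) := by
  have gX := hf.isExplodedManifold.goodPt
  refine ⟨Exploded.isTransverse_of_surjective f g hf.deriv_surjective,
    ⟨_, _, _, Exploded.isFiberProduct_pullback (Exploded.goodPt_pullback gX hB.goodPt hC.goodPt
      hf.bijective.1 hf.deriv_surjective)⟩, fun C' g' f' h => ⟨hf.of_isFiberProduct hB hC h,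
      Exploded.t2Space_smoothPart_of_isFiberProduct hf hB hC h⟩⟩
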